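/- **Setting.** Let $\mathcal X$ be a compact connected Riemannian manifold of dimension $d\ge 1$ (a boundary is allowed), with Riemannian distance $\mathrm{dist}$ and Riemannian volume $\mathrm{Leb}=|\cdot|$, let $T:\mathcal X\to\mathcal X$ be measurable and let $\mu=h\,\mathrm{Leb}$ be a $T$-invariant probability measure with density $h:\mathcal X\to[0,\infty)$. *Decay of correlations.* There are a Banach space $\mathcal C_1$ of measurable functions and a summable sequence $(\rho_n)$ with $$\Big|\int\phi\,(\psi\circ T^n)\,d\mu-\int\phi\,d\mu\int\psi\,d\mu\Big|\le \rho_n\,\|\phi\|_{\mathcal C_1}\|\psi\|_{L^1(\mu)}\qquad(\phi\in\mathcal C_1,\ \psi\in L^1(\mu),\ n\ge1),$$ and for every $K\in\mathbb N$ there is $C>0$ such that $\mathbf 1_B\in\mathcal C_1$ and $\|\mathbf 1_B\|_{\mathcal C_1}\le C$ for every Borel set $B$ that has at most $K$ connected components and whose boundary is covered by $K$ images of $[0,1]^{d-1}$ under $K$-Lipschitz maps. *The point $\zeta$.* Let $\zeta$ be an interior point of $\mathcal X$ such that $T$ is continuous at $T^j\zeta$ for all $j\ge0$, $h(\zeta)>0$,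 and $\mu(B_\varepsilon(\zeta))/|B_\varepsilon(\zeta)|\to h(\zeta)$ as $\varepsilon\to0$. *Observable and levels.* Let $X_j=\varphi\circ T^j$, where $\varphi(x)=g(\mathrm{dist}(x,\zeta))$ is measurable, $g:[0,\infty)\to\mathbb R\cup\{+\infty\}$ has a global maximum at $0$, is continuous and strictly decreasing on some $[0,\delta)$, and satisfies $\sup_{r\ge\delta}g(r)<g(0)$; $g^{-1}$ denotes the inverse of $g|_{[0,\delta)}$. For each $n$ let $u_n:(0,\infty)\to\mathbb R$ be continuous and strictly decreasing, with $n\,\mu(X_0>u_n(\tau))\to\tau$ for every $\tau>0$; $u_n^{-1}$ is its inverse, set to $0$ above and to $+\infty$ below the range of $u_n$. *Empirical processes.* Let $\Phi_\zeta$ be a $C^1$ diffeomorphism from an open ball around $0$ in $T_\zeta\mathcal X$ (identified with $\mathbb R^d$ by a linear isometry) onto a neighbourhood $W$ of $\zeta$, with $\Phi_\zeta(0)=\zeta$ and $D\Phi_\zeta(0)=\mathrm{id}$. Put $$N_n=\sum_{j\ge0}\delta_{(j/n,\;u_n^{-1}(X_j))}\ \text{ on }[0,\infty)^2,\qquad N_n^*(x)=\sum_{j\ge0,\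 T^jx\in W}\delta_{\left(j/n,\;\Phi_\zeta^{-1}(T^jx)/(g^{-1}(u_n(1))\,|B_1|^{1/d})\right)}\ \text{ on }[0,\infty)\times T_\zeta\mathcal X,$$ where points with $u_n^{-1}(X_j)=+\infty$ are omitted, $B_r$ is the open ball of radius $r$ around $0$ in $T_\zeta\mathcal X$ and $|B_1|$ is its Lebesgue measure for $r=1$. Convergence $\Rightarrow$ is weak convergence of point processes, with respect to the vague topology on the space of Radon point measures. *Limits.* For sets $S_1,S_2,\dots$ and $\theta>0$ let $\bar T_{i,j}\sim\mathrm{Exp}(\theta|S_i|)$ and $U_{i,j}$ uniform on $S_i$ ($i,j\ge1$) be independent, and $T_{i,j}=\sum_{\ell=1}^j\bar T_{i,\ell}$. **Theorem.** 1. Let $\zeta$ be non-periodic. With $S_i=(i-1,i]$ and $\theta=1$, $N_n\Rightarrow\sum_{i,j}\delta_{(T_{i,j},U_{i,j})}$, the Poisson process on $[0,\infty)^2$ with Lebesgue intensity. If $\zeta$ is a Lebesgue point of $h$, i.e. $|B_\varepsilon(\zeta)|^{-1}\int_{B_\varepsilon(\zeta)}|h-h(\zeta)|\,d\mathrm{Leb}\to0$,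 then, with $S_i=B_i\setminus B_{i-1}\subset T_\zeta\mathcal X$ and $\theta=1$, $N_n^*\Rightarrow\sum_{i,j}\delta_{(T_{i,j},U_{i,j})}$, the Poisson process on $[0,\infty)\times T_\zeta\mathcal X$ with Lebesgue intensity. 2. Let $\zeta$ be periodic of prime period $p$, with $T^p$ differentiable at $\zeta$. * If all eigenvalues of $DT^p_\zeta$ have modulus $>1$ and $\zeta$ is a Lebesgue point of $h$, then, with $S_i=B_i\setminus B_{i-1}$ and $\theta=1-|\det DT^p_\zeta|^{-1}$, $$N_n^*\Rightarrow N^*_\theta=\sum_{i,j\ge1}\sum_{\ell\ge0}\delta_{(T_{i,j},\,DT_\zeta^{\ell p}U_{i,j})}.$$ * If $\|DT^p_\zeta v\|=\alpha\|v\|$ for all $v\in T_\zeta\mathcal X$, for some $\alpha>1$, then, with $S_i=(i-1,i]$ and $\theta=1-\alpha^{-d}$, $$N_n\Rightarrow\tilde N=\sum_{i,j\ge1}\sum_{\ell\ge0}\delta_{(T_{i,j},\,\alpha^{\ell d}U_{i,j})}.$$ -/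

import Mathlib

open MeasureTheory ProbabilityTheory Filter Topology Set Bundle Manifold
open scoped NNReal ENNReal CompactlySupported

noncomputable section

/-! ### Point measures, the vague topology, weak convergence of point processes -/

/-- `m` is a (finite or countable) sum of Dirac masses. -/
def IsPointMeasure {E : Type*} [MeasurableSpace E] (m : Measure E) : Prop :=
  ∃ (s : Set ℕ) (x : s → E), m = Measure.sum fun i : s => Measure.dirac (x i)

/-- The space `M_p(E)` of Radon point measures on `E`. -/
def PointMeasure (E : Type*) [TopologicalSpace E] [MeasurableSpace E] : Type _ :=
  {m : Measure E // IsPointMeasure m ∧ ∀ K : Set E, IsCompact K → m K < ∞}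

/-- The `σ`-algebra on `M_p(E)` generated by the maps `m ↦ m F`, `F` measurable. -/
instance PointMeasure.instMeasurableSpace (E : Type*) [TopologicalSpace E] [MeasurableSpace E] :
    MeasurableSpace (PointMeasure E) :=
  ⨆ (F : Set E) (_ : MeasurableSet F),
    MeasurableSpace.comap (fun m : PointMeasure E => m.1 F) inferInstance

/-- The vague topology on `M_p(E)`: the coarsest one making `m ↦ ∫ f dm` continuous for every
continuous compactly supported `f`. -/
instance PointMeasure.instTopologicalSpace (E : Type*) [TopologicalSpace E] [MeasurableSpace E] :
    TopologicalSpace (PointMeasure E) :=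
  TopologicalSpace.induced (fun (m : PointMeasure E) (f : C_c(E, ℝ)) => ∫ x, f x ∂m.1)
    inferInstance

/-- The zero measure as a point measure. -/
def PointMeasure.zero (E : Type*) [TopologicalSpace E] [MeasurableSpace E] : PointMeasure E :=
  ⟨0, ⟨∅, fun i => i.2.elim, by simp⟩, fun K _ => by simp⟩

open Classical in
/-- A measure seen as a Radon point measure. The value `0` is given to a measure that is not one;
this concerns only a null set of realisations of the limiting processes below. -/
def toPointMeasure {E : Type*} [TopologicalSpace E] [MeasurableSpace E] (m : Measure E) :
    PointMeasure E :=
  if hm : IsPointMeasure m ∧ ∀ K : Set E, IsCompact K → m K < ∞ then ⟨m, hm⟩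
  else PointMeasure.zero E

/-- Weak convergence `N_n ⇒ N` of point processes on `E`: the `N_n` and `N` are point processes,
and `𝔼 f(N_n) → 𝔼 f(N)` for every bounded vaguely continuous `f : M_p(E) → ℝ`. -/
def ConvergesWeakly {X Ω E : Type*} [MeasurableSpace X] [MeasurableSpace Ω]
    [TopologicalSpace E] [MeasurableSpace E] (μ : Measure X) (N : ℕ → X → PointMeasure E)
    (P : Measure Ω) (N₀ : Ω → PointMeasure E) : Prop :=
  (∀ n, 1 ≤ n → Measurable (N n)) ∧ AEMeasurable N₀ P ∧
    ∀ f : BoundedContinuousFunction (PointMeasure E) ℝ,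
      Tendsto (fun n => ∫ x, f (N n x) ∂μ) atTop (𝓝 (∫ ω, f (N₀ ω) ∂P))

/-! ### The limiting processes -/

/-- The arrays `(T̄_{i,j})` and `(U_{i,j})` used to build the limiting processes: `T̄_{i,j}` has law
`Exp(θ |S_i|)`, `U_{i,j}` is uniformly distributed on `S_i`, and everything is independent.
Both indices start at `0`. -/
structure IsPoissonArray {Ω S : Type*} [MeasurableSpace Ω] [MeasureSpace S] (P : Measure Ω)
    (shell : ℕ → Set S) (θ : ℝ) (Tbar : ℕ → ℕ → Ω → ℝ) (U : ℕ → ℕ → Ω → S) : Prop where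
  law_Tbar : ∀ i j, HasLaw (Tbar i j) (expMeasure (θ * volume.real (shell i))) P
  law_U : ∀ i j, HasLaw (U i j) (ProbabilityTheory.cond volume (shell i)) P
  indep_Tbar : iIndepFun (fun (k : ℕ × ℕ) => Tbar k.1 k.2) P
  indep_U : iIndepFun (fun (k : ℕ × ℕ) => U k.1 k.2) P
  indep : IndepFun (fun ω (k : ℕ × ℕ) => Tbar k.1 k.2 ω) (fun ω (k : ℕ × ℕ) => U k.1 k.2 ω) P

/-- The intervals `(i, i+1]`. -/
def unitInterval2d (i : ℕ) : Set ℝ := Ioc (i : ℝ) (i + 1)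

/-- The shells `B_{i+1} \ B_i` in `ℝ^d`. -/
def unitShell (d : ℕ) (i : ℕ) : Set (EuclideanSpace ℝ (Fin d)) :=
  Metric.ball 0 ((i : ℝ) + 1) \ Metric.ball 0 (i : ℝ)

/-- `T_{i,j} = T̄_{i,0} + ⋯ + T̄_{i,j}`, as a point of `[0, ∞)`. -/
def arrivalTime {Ω : Type*} (Tbar : ℕ → ℕ → Ω → ℝ) (i j : ℕ) (ω : Ω) : ℝ≥0 :=
  (∑ l ∈ Finset.range (j + 1), Tbar i l ω).toNNReal

/-- `N = ∑_{i,j} δ_{(T_{i,j}, U_{i,j})}` on `[0, ∞)²`. -/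
def poisson2d {Ω : Type*} (Tbar U : ℕ → ℕ → Ω → ℝ) (ω : Ω) : PointMeasure (ℝ≥0 × ℝ≥0) :=
  toPointMeasure (Measure.sum fun k : ℕ × ℕ =>
    Measure.dirac (arrivalTime Tbar k.1 k.2 ω, (U k.1 k.2 ω).toNNReal))

/-- `Ñ = ∑_{i,j} ∑_ℓ δ_{(T_{i,j}, α^{ℓ d} U_{i,j})}` on `[0, ∞)²`. -/
def cluster2d {Ω : Type*} (d : ℕ) (α : ℝ) (Tbar U : ℕ → ℕ → Ω → ℝ) (ω : Ω) :
    PointMeasure (ℝ≥0 × ℝ≥0) :=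
  toPointMeasure (Measure.sum fun k : ℕ × ℕ × ℕ =>
    Measure.dirac (arrivalTime Tbar k.1 k.2.1 ω,
      (α ^ (k.2.2 * d) * U k.1 k.2.1 ω).toNNReal))

/-- `N^* = ∑_{i,j} δ_{(T_{i,j}, U_{i,j})}` on `[0, ∞) × ℝ^d`. -/
def poissonMulti {Ω : Type*} {d : ℕ} (Tbar : ℕ → ℕ → Ω → ℝ)
    (U : ℕ → ℕ → Ω → EuclideanSpace ℝ (Fin d)) (ω : Ω) :
    PointMeasure (ℝ≥0 × EuclideanSpace ℝ (Fin d)) :=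
  toPointMeasure (Measure.sum fun k : ℕ × ℕ =>
    Measure.dirac (arrivalTime Tbar k.1 k.2 ω, U k.1 k.2 ω))

/-- `N^*_θ = ∑_{i,j} ∑_ℓ δ_{(T_{i,j}, L^ℓ U_{i,j})}` on `[0, ∞) × ℝ^d`. -/
def clusterMulti {Ω : Type*} {d : ℕ}
    (L : EuclideanSpace ℝ (Fin d) →L[ℝ] EuclideanSpace ℝ (Fin d)) (Tbar : ℕ → ℕ → Ω → ℝ)
    (U : ℕ → ℕ → Ω → EuclideanSpace ℝ (Fin d)) (ω : Ω) :
    PointMeasure (ℝ≥0 × EuclideanSpace ℝ (Fin d)) :=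
  toPointMeasure (Measure.sum fun k : ℕ × ℕ × ℕ =>
    Measure.dirac (arrivalTime Tbar k.1 k.2.1 ω, (L ^ k.2.2) (U k.1 k.2.1 ω)))

/-! ### Observables, levels and empirical processes -/

/-- The profile `g : [0, ∞) → ℝ ∪ {+∞}` of the observable `x ↦ g (dist x ζ)`: `0` is a global
maximum, `g` is a strictly decreasing bijection from `[0, δ)` onto an interval (equivalently, it is
strictly decreasing and continuous there), and away from `[0, δ)` it stays below a level
`c < g 0`, so that the sets `{g (dist x ζ) > u}` with `u` close to `g 0` are balls around `ζ`. -/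
structure IsProfile (g : ℝ → EReal) (δ : ℝ) : Prop where
  pos : 0 < δ
  ne_bot : ∀ r, 0 ≤ r → g r ≠ ⊥
  le_max : ∀ r, 0 ≤ r → g r ≤ g 0
  strictAnti : StrictAntiOn g (Ico 0 δ)
  continuousOn : ContinuousOn g (Ico 0 δ)
  separated : ∃ c, c < g 0 ∧ ∀ r, δ ≤ r → g r ≤ c

/-- `g⁻¹`, the inverse of the restriction of `g` to `[0, δ)`. -/
def profileInv (g : ℝ → EReal) (δ : ℝ) (z : EReal) : ℝ :=
  Function.invFunOn g (Ico 0 δ) z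

/-- The frequencies `τ > 0` whose level lies below `z`. -/
def freqSet (v : ℝ → ℝ) (z : EReal) : Set ℝ := {τ | 0 < τ ∧ (v τ : EReal) < z}

/-- The inverse of a strictly decreasing level function `v : (0, ∞) → ℝ`: it is `τ` at `z = v τ`.
It is `0` at values `z` above the range of `v`; for `z` below the range of `v`, the
inverse is `+∞`, which is encoded by `freqSet v z = ∅`. -/
def levelInv (v : ℝ → ℝ) (z : EReal) : ℝ≥0 := (sInf (freqSet v z)).toNNReal

/-- The level functions `u n : (0, ∞) → ℝ` are continuous and strictly decreasing, and
`n μ(X₀ > u_n(τ)) → τ` for every `τ > 0`. -/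
structure IsNormalising {X : Type*} [MeasurableSpace X] (μ : Measure X) (X₀ : X → EReal)
    (u : ℕ → ℝ → ℝ) : Prop where
  continuousOn : ∀ n, ContinuousOn (u n) (Ioi 0)
  strictAnti : ∀ n, StrictAntiOn (u n) (Ioi 0)
  tendsto : ∀ τ, 0 < τ →
    Tendsto (fun n : ℕ => (n : ℝ) * μ.real {x | (u n τ : EReal) < X₀ x}) atTop (𝓝 τ)

/-- The two-dimensional empirical process `N_n = ∑_j δ_{(j/n, u_n⁻¹(X_j))}`, `X_j = X₀ ∘ T^j`
(indices `j` with `u_n⁻¹(X_j) = +∞` give no point of `[0, ∞)²`). -/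
def empirical2d {X : Type*} (T : X → X) (X₀ : X → EReal) (u : ℕ → ℝ → ℝ) (n : ℕ) (x : X) :
    PointMeasure (ℝ≥0 × ℝ≥0) :=
  toPointMeasure (Measure.sum fun j : {j : ℕ // (freqSet (u n) (X₀ (T^[j] x))).Nonempty} =>
    Measure.dirac ((j.1 : ℝ≥0) / (n : ℝ≥0), levelInv (u n) (X₀ (T^[j.1] x))))

/-- The multi-dimensional empirical process
`N_n^* = ∑_j δ_{(j/n, Φ⁻¹(T^j x) / (r_n |B_1|^{1/d}))}`, the sum being over the `j` for which
`T^j x` lies in the range of the coordinates `Φ`. -/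
def empiricalMulti {X : Type*} [TopologicalSpace X] {d : ℕ} (T : X → X)
    (Φ : OpenPartialHomeomorph (EuclideanSpace ℝ (Fin d)) X) (r : ℕ → ℝ) (n : ℕ) (x : X) :
    PointMeasure (ℝ≥0 × EuclideanSpace ℝ (Fin d)) :=
  toPointMeasure (Measure.sum fun j : {j : ℕ // T^[j] x ∈ Φ.target} =>
    Measure.dirac ((j.1 : ℝ≥0) / (n : ℝ≥0),
      (r n * volume.real (Metric.ball (0 : EuclideanSpace ℝ (Fin d)) 1) ^ (1 / (d : ℝ)))⁻¹ •
        Φ.symm (T^[j.1] x)))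

/-! ### Decay of correlations -/

/-- The correlation `Cor_μ(φ, ψ, n)` of `φ ∈ 𝒞₁` and `ψ ∈ L¹(μ)`. The Banach space `𝒞₁` of
functions is given by the linear map `ι` sending its elements to measurable functions (taken up to
null sets). -/
def correlation {X C₁ : Type*} [MeasurableSpace X] [NormedAddCommGroup C₁] [NormedSpace ℝ C₁]
    (μ : Measure X) (T : X → X) (ι : C₁ →ₗ[ℝ] (X →ₘ[μ] ℝ)) (φ : C₁) (ψ : X → ℝ) (n : ℕ) : ℝ :=
  1 / (‖φ‖ * ∫ x, |ψ x| ∂μ) *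
    |∫ x, ι φ x * ψ (T^[n] x) ∂μ - (∫ x, ι φ x ∂μ) * ∫ x, ψ x ∂μ|

/-- `B` has at most `K` connected components, and its boundary is covered by `K` sets that are
images of the cube `[0,1]^{d-1}` under `K`-Lipschitz maps. For `d = 1` the second condition says that
the boundary has at most `K` points. -/
def IsTameSet {X : Type*} [MetricSpace X] (d K : ℕ) (B : Set X) : Prop :=
  ENat.card (ConnectedComponents B) ≤ K ∧
    ∃ f : Fin K → (Fin (d - 1) → ℝ) → X,
      (∀ i, LipschitzOnWith (K : ℝ≥0) (f i) (Icc 0 1)) ∧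
        frontier B ⊆ ⋃ i, f i '' Icc 0 1

/-- Summable decay of correlations of observables in `𝒞₁` against `L¹(μ)`, where `𝒞₁` contains the
indicators of the tame sets, with norms that are bounded uniformly for each `K`. -/
structure SummableDecayAgainstL1 {X C₁ : Type*} [MetricSpace X] [MeasurableSpace X]
    [NormedAddCommGroup C₁] [NormedSpace ℝ C₁] (d : ℕ) (μ : Measure X) (T : X → X)
    (ι : C₁ →ₗ[ℝ] (X →ₘ[μ] ℝ)) : Prop where
  decay : ∃ ρ : ℕ → ℝ, Summable ρ ∧
    ∀ (φ : C₁) (ψ : X → ℝ), Integrable ψ μ → ∀ n, 1 ≤ n → correlation μ T ι φ ψ n ≤ ρ n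
  indicator : ∀ K : ℕ, ∃ C : ℝ, ∀ B : Set X, MeasurableSet B → IsTameSet d K B →
    ∃ φ : C₁, (ι φ =ᵐ[μ] B.indicator fun _ => (1 : ℝ)) ∧ ‖φ‖ ≤ C

/-! ### Lebesgue measure and derivatives on a Riemannian manifold -/

/-- Lebesgue (Riemannian volume) measure on a `d`-dimensional Riemannian manifold: the
`d`-dimensional Hausdorff measure of the Riemannian distance, normalised so that on `ℝ^d` it is
Lebesgue measure. -/
def riemannianLeb (d : ℕ) (X : Type*) [MetricSpace X] [MeasurableSpace X] [BorelSpace X] :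
    Measure X :=
  (volume (Metric.ball (0 : EuclideanSpace ℝ (Fin d)) 1) /
    μH[(d : ℝ)] (Metric.ball (0 : EuclideanSpace ℝ (Fin d)) 1)) • μH[(d : ℝ)]

/-- `ζ` is a Lebesgue point of the density `h`: the mean of `|h - h ζ|` over the balls `B_ε(ζ)` tends
to `0`. -/
def IsLebesguePoint (d : ℕ) {X : Type*} [MetricSpace X] [MeasurableSpace X] [BorelSpace X]
    (h : X → ℝ≥0) (ζ : X) : Prop :=
  Tendsto (fun ε : ℝ => ⨍ x in Metric.ball ζ ε, |(h x : ℝ) - h ζ| ∂(riemannianLeb d X))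
    (𝓝[>] 0) (𝓝 0)

section Manifold

variable {d : ℕ} {H : Type*} [TopologicalSpace H]
  (I : ModelWithCorners ℝ (EuclideanSpace ℝ (Fin d)) H)
  {X : Type*} [TopologicalSpace X] [ChartedSpace H X]
  [RiemannianBundle (fun x : X => TangentSpace I x)]

/-- The coordinates `Φ_ζ` around `ζ`: a `C¹` diffeomorphism from an open ball around `0` in
`T_ζ X` onto a neighbourhood of `ζ`, with `Φ_ζ(0) = ζ` and derivative the identity at `0`.
The tangent space `T_ζ X` is identified with `ℝ^d` by the linear isometry `e`. -/
structure IsTangentChart (ζ : X)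
    (e : EuclideanSpace ℝ (Fin d) ≃ₗᵢ[ℝ] TangentSpace I ζ)
    (Φ : OpenPartialHomeomorph (EuclideanSpace ℝ (Fin d)) X) : Prop where
  source : ∃ R : ℝ, 0 < R ∧ Φ.source = Metric.ball 0 R
  map_zero : Φ 0 = ζ
  contMDiffOn : ContMDiffOn 𝓘(ℝ, EuclideanSpace ℝ (Fin d)) I 1 Φ Φ.source
  contMDiffOn_symm : ContMDiffOn I 𝓘(ℝ, EuclideanSpace ℝ (Fin d)) 1 Φ.symm Φ.target
  mfderiv_zero : ∀ v : EuclideanSpace ℝ (Fin d),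
    (mfderiv 𝓘(ℝ, EuclideanSpace ℝ (Fin d)) I Φ 0 v : EuclideanSpace ℝ (Fin d)) = e v

/-- The derivative `DT^p_ζ : T_ζ X → T_ζ X` at a point with `T^p ζ = ζ`, in the orthonormal
coordinates `e` of `T_ζ X`. -/
def periodDeriv (T : X → X) (p : ℕ) (ζ : X)
    (e : EuclideanSpace ℝ (Fin d) ≃ₗᵢ[ℝ] TangentSpace I ζ) :
    EuclideanSpace ℝ (Fin d) →L[ℝ] EuclideanSpace ℝ (Fin d) :=
  let D : TangentSpace I ζ →L[ℝ] TangentSpace I ζ := mfderiv I I T^[p] ζ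
  (e.symm.toContinuousLinearEquiv : TangentSpace I ζ →L[ℝ] EuclideanSpace ℝ (Fin d)).comp
    (D.comp (e.toContinuousLinearEquiv : EuclideanSpace ℝ (Fin d) →L[ℝ] TangentSpace I ζ))

end Manifold

/-- All complex eigenvalues of `L` have modulus larger than one. -/
def IsRepelling {d : ℕ} (L : EuclideanSpace ℝ (Fin d) →L[ℝ] EuclideanSpace ℝ (Fin d)) : Prop :=
  ∀ z : ℂ, Polynomial.aeval z (LinearMap.charpoly L.toLinearMap) = 0 → 1 < ‖z‖

end

set_option linter.unusedSectionVars false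

noncomputable section

/-! ### Weak convergence of point processes via characteristic functionals -/

section Vague

variable {E : Type*} [MetricSpace E] [ProperSpace E] [MeasurableSpace E] [BorelSpace E]

/-! Weak convergence of point processes follows from convergence of the characteristic functionals 𝔼
exp(i ∫ F dN) for continuous compactly supported F: countably many test functions induce the vague
topology, and Lévy's theorem handles finitely many of them at a time
(`convergesWeakly_of_tendsto_charFunctional`).

Both empirical processes record marks Y_n of the visits of an orbit to some domain. The interface
`RareMarks` collects what is needed of them: n μ(Y_n ∈ Q) tends to ν(Q) for small cells Q that are
approximated by sets with decay of correlations, and a mark y in a compact set returns after a fixed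
time j either outside that compact set, or, for j ∈ R, close to g_j(y). Put f_j = F(j/n, Y_n) and
let w_k be the integral of exp(i Σ_j f_{k+j} ∘ T^j). Invariance gives w_k - w_{k+1} = ∫ (e^{i f_k} -
1) exp(i Σ_{j≥1} f_{k+j} ∘ T^j) dμ, whose first factor lives on a set A of measure O(1/n). On A the
returns up to a fixed time Q are explicit. Returns between Q and a gap time t are negligible,
because decay against L¹ gives μ(A ∩ T^{-j}A) ≤ (μ(D) + Cρ_j) μ(A) for a set D ⊇ A that is not much
larger. After t, which is a small multiple of n with nρ_t small, the future decouples. Hence w_k =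
exp(c(k/n)/n) w_{k+1} + o(1/n) uniformly in k (`RareMarks.step_estimate`), where c(s) is the limit,
as Q grows, of the ν-integral of `returnFun`. Iteration and Riemann sums give w_0 → exp ∫ c(s) ds
(`RareMarks.tendsto_charFunctional`).

If there are no short returns, c(s) = ∫ (e^{iF(s,y)} - 1) dν(y) is the Poisson exponent. At a
periodic point the mark y reappears as L^l y at time pl. With G(y) = exp(i Σ_{l≥0} F(s, L^l y)) the
integrand becomes G - G∘L, and since L pushes ν forward to (1-θ)ν, its integral is θ ∫ (G-1) dν
(`ExpandingMap.returnFun_lim`): a Poisson process of clusters, thinned by θ. The arrays T_{i,j},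
U_{i,j} have the same exponent by a renewal equation for exponential waiting times
(`ClusterMaps.integral_cis_clusterMeasure`).

It remains to verify `RareMarks`. The chart is almost isometric near the origin
(`IsTangentChart.exists_biLipschitz`), so volume, balls and tameness can be compared with their
Euclidean counterparts. For the rescaled coordinates ν is Lebesgue measure on ℝ^d and the cells are
small boxes, which is why ζ has to be a Lebesgue point of h. For the frequencies ν is Lebesgue
measure on the half-line and the cells come from balls around ζ, so the density along balls
suffices. The frequency of x is close to nκ dist(x,ζ)^d, and a conformal T^p therefore multiplies it
by α^d (`level_step`). -/

lemma PointMeasure.isFiniteMeasureOnCompacts (m : PointMeasure E) :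
    IsFiniteMeasureOnCompacts m.1 := ⟨fun _ hK => m.2.2 _ hK⟩

lemma PointMeasure.integrable (m : PointMeasure E) (f : C_c(E, ℝ)) : Integrable (fun x => f x) m.1 := by
  have := m.isFiniteMeasureOnCompacts
  exact f.continuous.integrable_of_hasCompactSupport f.hasCompactSupport

lemma PointMeasure.continuous_integral (f : C_c(E, ℝ)) :
    Continuous fun m : PointMeasure E => ∫ x, f x ∂m.1 := by
  have h : Continuous fun (m : PointMeasure E) (f : C_c(E, ℝ)) => ∫ x, f x ∂m.1 :=
    continuous_induced_dom
  exact (continuous_apply f).comp h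

/-- A compactly supported function that is at least `1` on the ball of radius `k` around `x₀`. -/
def bump (x₀ : E) (k : ℕ) : C_c(E, ℝ) where
  toFun x := max 0 (k + 1 - dist x x₀)
  continuous_toFun := by fun_prop
  hasCompactSupport' := by
    refine HasCompactSupport.of_support_subset_isCompact
      (isCompact_closedBall x₀ ((k : ℝ) + 1)) fun x hx => ?_
    rw [Metric.mem_closedBall]
    by_contra! h
    exact hx (max_eq_left (by linarith))

/-- Continuous functions supported in a closed ball. -/
def supportedIn (x₀ : E) (k : ℕ) : Set C(E, ℝ) :=
  {f | tsupport f ⊆ Metric.closedBall x₀ k}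

lemma zero_mem_supportedIn (x₀ : E) (k : ℕ) : (0 : C(E, ℝ)) ∈ supportedIn x₀ k := by
  simp [supportedIn, tsupport]

instance (x₀ : E) (k : ℕ) : Nonempty (supportedIn x₀ k) := ⟨⟨0, zero_mem_supportedIn x₀ k⟩⟩

/-- A countable family of test functions that determines the vague topology. -/
def testFamily (x₀ : E) : ℕ ⊕ ℕ × ℕ → C_c(E, ℝ)
  | .inl k => bump x₀ k
  | .inr (k, l) =>
    ⟨(TopologicalSpace.denseSeq (supportedIn x₀ k) l).1, by
      refine HasCompactSupport.of_support_subset_isCompact (isCompact_closedBall x₀ (k : ℝ)) ?_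
      exact (subset_tsupport _).trans (TopologicalSpace.denseSeq (supportedIn x₀ k) l).2⟩

/-- Both f and its approximant vanish off the ball of radius k, where the bump is at least one. A
uniform error ε on that ball is therefore dominated by ε times the bump, simultaneously for all
measures m. -/
lemma exists_testFamily_approx (x₀ : E) (f : C_c(E, ℝ)) : ∃ k : ℕ, ∀ ε : ℝ, 0 < ε →
    ∃ i, ∀ m : PointMeasure E,
      |∫ x, f x ∂m.1 - ∫ x, testFamily x₀ i x ∂m.1| ≤ ε * ∫ x, bump x₀ k x ∂m.1 := by
  obtain ⟨r, hr⟩ := f.hasCompactSupport.isCompact.isBounded.subset_closedBall x₀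
  obtain ⟨k, hk⟩ := exists_nat_ge r
  have hf : tsupport f ⊆ Metric.closedBall x₀ k := hr.trans (Metric.closedBall_subset_closedBall hk)
  refine ⟨k, fun ε hε => ?_⟩
  let f' : supportedIn x₀ k := ⟨f.toContinuousMap, hf⟩
  have hU : {g : supportedIn x₀ k | ∀ x ∈ Metric.closedBall x₀ (k : ℝ), |f x - g.1 x| < ε} ∈ 𝓝 f' := by
    have h1 : {p : ℝ × ℝ | |p.1 - p.2| < ε} ∈ uniformity ℝ := Metric.dist_mem_uniformity hε
    have h2 := (ContinuousMap.tendsto_iff_forall_isCompact_tendstoUniformlyOn.1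
      (continuous_subtype_val.tendsto f')) _ (isCompact_closedBall x₀ (k : ℝ)) _ h1
    exact h2
  obtain ⟨l, hl⟩ := (TopologicalSpace.denseRange_denseSeq (supportedIn x₀ k)).exists_mem_open
    isOpen_interior ⟨f', mem_interior_iff_mem_nhds.2 hU⟩
  have hl := interior_subset hl
  refine ⟨.inr (k, l), fun m => ?_⟩
  rw [← integral_sub (m.integrable _) (m.integrable _), ← integral_const_mul]
  refine (abs_integral_le_integral_abs).trans (integral_mono_of_nonneg
    (Eventually.of_forall fun x => abs_nonneg _) ((m.integrable _).const_mul ε)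
    (Eventually.of_forall fun x => ?_))
  simp only
  have hb : (0 : ℝ) ≤ bump x₀ k x := le_max_left _ _
  by_cases hx : x ∈ Metric.closedBall x₀ (k : ℝ)
  · have h3 : (1 : ℝ) ≤ bump x₀ k x := by
      refine le_trans ?_ (le_max_right _ _)
      rw [Metric.mem_closedBall] at hx; linarith
    have h4 := (hl x hx).le
    calc _ ≤ ε := h4
      _ ≤ _ := by nlinarith
  · have h5 : f x = 0 := image_eq_zero_of_notMem_tsupport fun h => hx (hf h)
    have h6 : testFamily x₀ (.inr (k, l)) x = 0 :=
      image_eq_zero_of_notMem_tsupport (f := ((TopologicalSpace.denseSeq (supportedIn x₀ k) l).1 : E → ℝ))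
        fun h => hx ((TopologicalSpace.denseSeq (supportedIn x₀ k) l).2 h)
    rw [h5, h6]; simp; positivity

/-- The integrals of the test functions. -/
def testIntegrals (x₀ : E) (m : PointMeasure E) (i : ℕ ⊕ ℕ × ℕ) : ℝ := ∫ x, testFamily x₀ i x ∂m.1

/-- The error of approximating ∫ f dm by a test integral is proportional to ∫ bump dm, which is
itself one of the test integrals and hence locally bounded in the induced topology. -/
lemma isInducing_testIntegrals (x₀ : E) : IsInducing (testIntegrals x₀) := by
  refine ⟨le_antisymm ?_ ?_⟩
  · exact continuous_iff_le_induced.1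
      (continuous_pi fun i => PointMeasure.continuous_integral _)
  · let t' : TopologicalSpace (PointMeasure E) := TopologicalSpace.induced (testIntegrals x₀) inferInstance
    refine continuous_iff_le_induced.1 (?_ : @Continuous _ _ t' _ _)
    refine @continuous_pi _ _ _ t' _ _ fun f => ?_
    have hc : ∀ i, @Continuous _ _ t' _ fun m : PointMeasure E => ∫ x, testFamily x₀ i x ∂m.1 :=
      fun i => by
        have h : @Continuous _ _ t' _ (testIntegrals x₀ : PointMeasure E → _) :=
          continuous_induced_dom
        exact (continuous_apply i).comp h
    rw [@continuous_iff_continuousAt _ _ t']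
    intro m₀
    unfold ContinuousAt
    rw [Metric.tendsto_nhds]
    intro ε hε
    obtain ⟨k, hk⟩ := exists_testFamily_approx x₀ f
    set B : PointMeasure E → ℝ := fun m => ∫ x, bump x₀ k x ∂m.1
    have hB0 : ∀ m, 0 ≤ B m := fun m => integral_nonneg fun x => le_max_left _ _
    have hBm : 0 < 2 * B m₀ + 1 := by linarith [hB0 m₀]
    -- Once `B m < B m₀ + 1`, the approximation errors at `m` and at `m₀` add up to at most ε/2.
    obtain ⟨i, hi⟩ := hk (ε / 2 / (2 * B m₀ + 1)) (by positivity)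
    have h1 : ∀ᶠ m in @nhds _ t' m₀, B m < B m₀ + 1 :=
      (hc (.inl k)).continuousAt.eventually (gt_mem_nhds (lt_add_one (B m₀)))
    have h2 := (Metric.tendsto_nhds.1 ((hc i).continuousAt (x := m₀))) (ε / 2) (by positivity)
    filter_upwards [h1, h2] with m hm1 hm2
    have e1 := hi m
    have e2 := hi m₀
    rw [Real.dist_eq] at hm2 ⊢
    have e3 : ε / 2 / (2 * B m₀ + 1) * B m + ε / 2 / (2 * B m₀ + 1) * B m₀ ≤ ε / 2 := by
      rw [← mul_add, div_mul_eq_mul_div, div_le_iff₀ hBm]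
      have : 0 < ε / 2 := by positivity
      nlinarith
    rw [abs_le] at e1 e2
    rw [abs_lt] at hm2 ⊢
    constructor <;> linarith [e1.1, e1.2, e2.1, e2.2, hm2.1, hm2.2]

lemma PointMeasure.instMeasurableSpace_eq_comap :
    PointMeasure.instMeasurableSpace E =
      MeasurableSpace.comap (fun m : PointMeasure E => m.1) inferInstance := by
  unfold PointMeasure.instMeasurableSpace
  change _ = MeasurableSpace.comap _ (⨆ (s : Set E) (_ : MeasurableSet s), _)
  simp_rw [MeasurableSpace.comap_iSup, MeasurableSpace.comap_comp]
  rfl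

lemma PointMeasure.measurable_val : Measurable fun m : PointMeasure E => m.1 := by
  rw [PointMeasure.instMeasurableSpace_eq_comap]
  exact comap_measurable _

lemma PointMeasure.measurable_iff {Ω : Type*} [MeasurableSpace Ω] {N : Ω → PointMeasure E} :
    Measurable N ↔ Measurable fun ω => (N ω).1 := by
  refine ⟨fun h => PointMeasure.measurable_val.comp h, fun h => ?_⟩
  rw [PointMeasure.instMeasurableSpace_eq_comap]
  exact measurable_comap_iff.2 h

lemma PointMeasure.measurable_integral (f : C_c(E, ℝ)) :
    Measurable fun m : PointMeasure E => ∫ x, f x ∂m.1 := by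
  have hf : Measurable (fun x => f x) := f.continuous.measurable
  have h : (fun m : PointMeasure E => ∫ x, f x ∂m.1) = fun m =>
      (∫⁻ x, ENNReal.ofReal (f x) ∂m.1).toReal - (∫⁻ x, ENNReal.ofReal (-f x) ∂m.1).toReal := by
    ext m
    exact integral_eq_lintegral_pos_part_sub_lintegral_neg_part (m.integrable f)
  rw [h]
  exact ((Measure.measurable_lintegral (hf.ennreal_ofReal)).comp measurable_val).ennreal_toReal.sub
    ((Measure.measurable_lintegral (hf.neg.ennreal_ofReal)).comp measurable_val).ennreal_toReal

/-- Open sets are preimages of open sets of a countable product of lines, and these are measurable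
for the product σ-algebra. The countability of the test family is essential here; the portmanteau
theorem needs this instance. -/
instance [Nonempty E] : OpensMeasurableSpace (PointMeasure E) := by
  constructor
  refine MeasurableSpace.generateFrom_le fun s hs => ?_
  obtain ⟨t, ht, rfl⟩ := (isInducing_testIntegrals (Classical.arbitrary E)).isOpen_iff.1 hs
  exact (measurable_pi_iff.2 fun i => PointMeasure.measurable_integral _) ht.measurableSet

/-- Finite-dimensional convergence for countably many test functions, by Lévy's theorem. -/
lemma tendsto_law_finite {ι X Ω : Type*} [Fintype ι] [MeasurableSpace X] [MeasurableSpace Ω]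
    {μ : Measure X} [IsProbabilityMeasure μ] {P : Measure Ω} [IsProbabilityMeasure P]
    {N : ℕ → X → PointMeasure E} {N₀ : Ω → PointMeasure E} (hN : ∀ n, Measurable (N n))
    (hN₀ : AEMeasurable N₀ P)
    (hchar : ∀ f : C_c(E, ℝ), Tendsto
      (fun n => ∫ x, Complex.exp (Complex.I * (∫ y, f y ∂(N n x).1 : ℝ)) ∂μ) atTop
      (𝓝 (∫ ω, Complex.exp (Complex.I * (∫ y, f y ∂(N₀ ω).1 : ℝ)) ∂P)))
    (D : ι → C_c(E, ℝ)) {O : Set (EuclideanSpace ℝ ι)} (hO : IsOpen O) :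
    P.map N₀ {m | WithLp.toLp 2 (fun i => ∫ y, D i y ∂m.1) ∈ O} ≤
      liminf (fun n => μ.map (N n) {m | WithLp.toLp 2 (fun i => ∫ y, D i y ∂m.1) ∈ O}) atTop := by
  let pr : PointMeasure E → EuclideanSpace ℝ ι := fun m => WithLp.toLp 2 (fun i => ∫ y, D i y ∂m.1)
  have hpr : Measurable pr := by
    refine (WithLp.measurable_toLp 2 _).comp (measurable_pi_iff.2 fun i => PointMeasure.measurable_integral _)
  have hprN : ∀ n, Measurable (fun x => pr (N n x)) := fun n => hpr.comp (hN n)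
  have hprN₀ : AEMeasurable (fun ω => pr (N₀ ω)) P := hpr.comp_aemeasurable hN₀
  let νs : ℕ → ProbabilityMeasure (EuclideanSpace ℝ ι) := fun n =>
    ⟨μ.map (fun x => pr (N n x)), Measure.isProbabilityMeasure_map (hprN n).aemeasurable⟩
  let ν₀ : ProbabilityMeasure (EuclideanSpace ℝ ι) :=
    ⟨P.map (fun ω => pr (N₀ ω)), Measure.isProbabilityMeasure_map hprN₀⟩
  have hkey : ∀ (t : EuclideanSpace ℝ ι) (m : PointMeasure E),
      ((inner ℝ (pr m) t : ℝ) : ℂ) = ((∫ y, (∑ i, t i • D i : C_c(E, ℝ)) y ∂m.1 : ℝ) : ℂ) := by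
    intro t m
    congr 1
    have : (fun y => (∑ i, t i • D i : C_c(E, ℝ)) y) = fun y => ∑ i, t i * D i y := by
      ext y; simp [CompactlySupportedContinuousMap.sum_apply]
    rw [this, integral_finsetSum _ (fun i _ => (m.integrable (D i)).const_mul _)]
    simp only [integral_const_mul, PiLp.inner_apply]
    rfl
  have hconv : Tendsto νs atTop (𝓝 ν₀) := by
    refine ProbabilityMeasure.tendsto_of_tendsto_charFun fun t => ?_
    have e1 : ∀ n, charFun (νs n : Measure (EuclideanSpace ℝ ι)) t = ∫ x, Complex.exp (Complex.I *
        (∫ y, (∑ i, t i • D i : C_c(E, ℝ)) y ∂(N n x).1 : ℝ)) ∂μ := by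
      intro n
      rw [charFun_apply]
      change ∫ x, _ ∂(μ.map _) = _
      rw [integral_map (hprN n).aemeasurable (by fun_prop)]
      simp_rw [hkey, mul_comm]
    have e2 : charFun (ν₀ : Measure (EuclideanSpace ℝ ι)) t = ∫ x, Complex.exp (Complex.I *
        (∫ y, (∑ i, t i • D i : C_c(E, ℝ)) y ∂(N₀ x).1 : ℝ)) ∂P := by
      rw [charFun_apply]
      change ∫ x, _ ∂(P.map _) = _
      rw [integral_map hprN₀ (by fun_prop)]
      simp_rw [hkey, mul_comm]
    simp_rw [e1, e2]
    exact hchar _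
  have h := ProbabilityMeasure.le_liminf_measure_open_of_tendsto hconv hO
  have hmeas : MeasurableSet {m | pr m ∈ O} := hpr hO.measurableSet
  have f1 : (ν₀ : Measure _) O = P.map N₀ {m | pr m ∈ O} := by
    change P.map _ O = _
    rw [Measure.map_apply_of_aemeasurable hprN₀ hO.measurableSet,
      Measure.map_apply_of_aemeasurable hN₀ hmeas]
    rfl
  have f2 : ∀ n, (νs n : Measure _) O = μ.map (N n) {m | pr m ∈ O} := by
    intro n
    change μ.map _ O = _
    rw [Measure.map_apply (hprN n) hO.measurableSet, Measure.map_apply (hN n) hmeas]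
    rfl
  rw [f1] at h
  simp_rw [f2] at h
  exact h

/-- Convergence of the characteristic functionals on compactly supported functions implies weak
convergence of point processes. -/
theorem convergesWeakly_of_tendsto_charFunctional [Nonempty E] {X Ω : Type*} [MeasurableSpace X]
    [MeasurableSpace Ω] {μ : Measure X} [IsProbabilityMeasure μ] {P : Measure Ω}
    [IsProbabilityMeasure P] {N : ℕ → X → PointMeasure E} {N₀ : Ω → PointMeasure E}
    (hN : ∀ n, 1 ≤ n → Measurable (N n)) (hN₀ : AEMeasurable N₀ P)
    (hchar : ∀ f : C_c(E, ℝ), Tendsto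
      (fun n => ∫ x, Complex.exp (Complex.I * (∫ y, f y ∂(N n x).1 : ℝ)) ∂μ) atTop
      (𝓝 (∫ ω, Complex.exp (Complex.I * (∫ y, f y ∂(N₀ ω).1 : ℝ)) ∂P))) :
    ConvergesWeakly μ N P N₀ := by
  refine ⟨hN, hN₀, fun f => ?_⟩
  let x₀ := Classical.arbitrary E
  -- Measurability is assumed only for n ≥ 1, so the sequence is shifted by one.
  have hN' : ∀ n, Measurable (N (n + 1)) := fun n => hN _ (by omega)
  let νs : ℕ → ProbabilityMeasure (PointMeasure E) := fun n =>
    ⟨μ.map (N (n + 1)), Measure.isProbabilityMeasure_map (hN' n).aemeasurable⟩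
  let ν₀ : ProbabilityMeasure (PointMeasure E) :=
    ⟨P.map N₀, Measure.isProbabilityMeasure_map hN₀⟩
  have hconv : Tendsto νs atTop (𝓝 ν₀) := by
    refine tendsto_of_forall_isOpen_le_liminf_nat' fun G hG => ?_
    obtain ⟨O, hO, rfl⟩ := (isInducing_testIntegrals x₀).isOpen_iff.1 hG
    let ι := ℕ ⊕ ℕ × ℕ
    let r : (S : Finset ι) → (ι → ℝ) → EuclideanSpace ℝ S := fun S y => WithLp.toLp 2 fun i => y i
    have hr : ∀ S, Continuous (r S) := fun S => by fun_prop
    -- `V S` is the largest open set of ℝ^S whose cylinder lies in `O`. These cylinders increase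
    -- with `S` and exhaust `O`, so the portmanteau inequality on each of them passes to `O` by
    -- continuity of the limit law from below.
    let V : (S : Finset ι) → Set (EuclideanSpace ℝ S) := fun S =>
      ⋃₀ {V : Set (EuclideanSpace ℝ S) | IsOpen V ∧ r S ⁻¹' V ⊆ O}
    have hV : ∀ S, IsOpen (V S) := fun S => isOpen_sUnion fun V h => h.1
    have hVO : ∀ S, r S ⁻¹' V S ⊆ O := fun S y hy => by
      obtain ⟨V, hV1, hV2⟩ := hy
      exact hV1.2 hV2
    have hmono : Monotone fun S => testIntegrals x₀ ⁻¹' (r S ⁻¹' V S) := by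
      intro S S' hSS m hm
      obtain ⟨V, hV1, hV2⟩ := hm
      let q : EuclideanSpace ℝ S' → EuclideanSpace ℝ S := fun y => WithLp.toLp 2 fun i => y ⟨i, hSS i.2⟩
      have hq : Continuous q := by fun_prop
      exact ⟨q ⁻¹' V, ⟨hV1.1.preimage hq, hV1.2⟩, hV2⟩
    have hU : testIntegrals x₀ ⁻¹' O = ⋃ S, testIntegrals x₀ ⁻¹' (r S ⁻¹' V S) := by
      refine Subset.antisymm (fun m hm => ?_) (iUnion_subset fun S m hm => hVO S hm)
      obtain ⟨S, u, hu, hS⟩ := isOpen_pi_iff.1 hO _ hm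
      refine mem_iUnion.2 ⟨S, (⋂ i : S, {y : EuclideanSpace ℝ S | y i ∈ u i}), ⟨?_, ?_⟩, ?_⟩
      · exact isOpen_iInter_of_finite fun i => (hu i i.2).1.preimage (by fun_prop)
      · intro y hy
        refine hS fun i hi => ?_
        exact mem_iInter.1 hy ⟨i, hi⟩
      · exact mem_iInter.2 fun i => (hu i i.2).2
    have hlim := tendsto_measure_iUnion_atTop (μ := P.map N₀) hmono
    rw [← hU] at hlim
    refine le_of_tendsto' hlim fun S => ?_
    refine (tendsto_law_finite (ι := S) hN' hN₀ (fun f => (hchar f).comp (tendsto_add_atTop_nat 1))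
      (fun i => testFamily x₀ i) (hV S)).trans ?_
    refine liminf_le_liminf (Eventually.of_forall fun n => ?_)
    exact measure_mono fun m hm => hVO S hm
  have h := ProbabilityMeasure.tendsto_iff_forall_integral_tendsto.1 hconv f
  refine (tendsto_add_atTop_iff_nat 1).1 ?_
  have e1 : ∀ n, ∫ m, f m ∂(νs n : Measure _) = ∫ x, f (N (n + 1) x) ∂μ := fun n =>
    integral_map (hN' n).aemeasurable f.continuous.measurable.aestronglyMeasurable
  have e2 : ∫ m, f m ∂(ν₀ : Measure _) = ∫ x, f (N₀ x) ∂P :=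
    integral_map hN₀ f.continuous.measurable.aestronglyMeasurable
  simp_rw [e1, e2] at h
  exact h

end Vague

/-! ### Sums of Dirac masses -/

section PointSums

/-- `IsPointMeasure` only admits index sets contained in ℕ; an injection into ℕ transports any
countable index set there. -/
lemma isPointMeasure_sum_dirac {E ι : Type*} [MeasurableSpace E] [Countable ι] (x : ι → E) :
    IsPointMeasure (Measure.sum fun i => Measure.dirac (x i)) := by
  obtain ⟨e, he⟩ := exists_injective_nat ι
  let q := Equiv.ofInjective e he
  refine ⟨range e, fun i => x (q.symm i), ?_⟩
  ext s hs
  rw [Measure.sum_apply _ hs, Measure.sum_apply _ hs]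
  exact (q.symm.tsum_eq (fun i => Measure.dirac (x i) s)).symm

variable {E : Type*} [MetricSpace E] [ProperSpace E] [MeasurableSpace E] [BorelSpace E]

lemma toPointMeasure_val {m : Measure E}
    (hm : IsPointMeasure m ∧ ∀ K : Set E, IsCompact K → m K < ∞) : (toPointMeasure m).1 = m := by
  exact congrArg Subtype.val (dif_pos hm)

lemma sum_dirac_lt_top {ι : Type*} {x : ι → E}
    (hx : ∀ K : Set E, IsCompact K → {i | x i ∈ K}.Finite) (K : Set E) (hK : IsCompact K) :
    (Measure.sum fun i => Measure.dirac (x i)) K < ∞ := by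
  rw [Measure.sum_apply _ hK.measurableSet,
    tsum_eq_sum (s := (hx K hK).toFinset) (fun i hi => ?_)]
  · exact ENNReal.sum_lt_top.2 fun i _ => measure_lt_top _ _
  · rw [Measure.dirac_apply' _ hK.measurableSet]
    simp only [Finite.mem_toFinset, mem_ofPred_eq] at hi
    simp [hi]

lemma toPointMeasure_sum_dirac {ι : Type*} [Countable ι] {x : ι → E}
    (hx : ∀ K : Set E, IsCompact K → {i | x i ∈ K}.Finite) :
    (toPointMeasure (Measure.sum fun i => Measure.dirac (x i))).1 =
      Measure.sum fun i => Measure.dirac (x i) :=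
  toPointMeasure_val ⟨isPointMeasure_sum_dirac x, sum_dirac_lt_top hx⟩

lemma hasSum_integral_toPointMeasure {ι : Type*} [Countable ι] {x : ι → E}
    (hx : ∀ K : Set E, IsCompact K → {i | x i ∈ K}.Finite) (f : C_c(E, ℝ)) :
    HasSum (fun i => f (x i))
      (∫ y, f y ∂(toPointMeasure (Measure.sum fun i => Measure.dirac (x i))).1) := by
  have h := (toPointMeasure (Measure.sum fun i => Measure.dirac (x i))).integrable f
  rw [toPointMeasure_sum_dirac hx] at h ⊢
  simpa using hasSum_integral_measure h

lemma measurable_sum_measure {Ω ι : Type*} [MeasurableSpace Ω] [Countable ι]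
    {m : ι → Ω → Measure E} (hm : ∀ i, Measurable (m i)) :
    Measurable fun ω => Measure.sum fun i => m i ω := by
  refine Measure.measurable_of_measurable_coe _ fun s hs => ?_
  simp_rw [Measure.sum_apply _ hs]
  exact Measurable.tsum fun i => (Measure.measurable_coe hs).comp (hm i)

end PointSums

/-! ### Empirical point processes -/

section Empirical

variable {X S : Type*} [MeasurableSpace X] [MetricSpace S] [ProperSpace S] [MeasurableSpace S]
  [BorelSpace S]

/-- The empirical process of the marks `Y` at the times at which the orbit visits `dom`. -/
def empiricalMarks (T : X → X) (dom : Set X) (Y : X → S) (n : ℕ) (x : X) :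
    PointMeasure (ℝ≥0 × S) :=
  toPointMeasure (Measure.sum fun j : {j : ℕ // T^[j] x ∈ dom} =>
    Measure.dirac ((j.1 : ℝ≥0) / (n : ℝ≥0), Y (T^[j.1] x)))

lemma finite_empirical_points (T : X → X) (dom : Set X) (Y : X → S) {n : ℕ} (hn : 1 ≤ n) (x : X)
    (K : Set (ℝ≥0 × S)) (hK : IsCompact K) :
    {j : {j : ℕ // T^[j] x ∈ dom} | ((j.1 : ℝ≥0) / (n : ℝ≥0), Y (T^[j.1] x)) ∈ K}.Finite := by
  obtain ⟨M, hM⟩ := (hK.image continuous_fst).bddAbove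
  refine Set.Finite.of_finite_image (f := Subtype.val) ?_ Subtype.val_injective.injOn
  refine (Set.finite_Iic ⌈M * n⌉₊).subset ?_
  rintro _ ⟨j, hj, rfl⟩
  have h := hM ⟨_, hj, rfl⟩
  have hn' : (0 : ℝ≥0) < n := by exact_mod_cast hn
  simp only at h
  rw [div_le_iff₀ hn'] at h
  exact_mod_cast h.trans (Nat.le_ceil _)

/-- The mark is meaningful only on `dom`, so measurability is required only of the sets `dom ∩ Y ⁻¹'
B`; nothing is asked of `Y` elsewhere. -/
lemma measurable_ite_comp {Z : Type*} [MeasurableSpace Z] {dom : Set X} {Y : X → S}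
    (hY : ∀ B, MeasurableSet B → MeasurableSet (dom ∩ Y ⁻¹' B)) {ψ : S → Z} (hψ : Measurable ψ)
    (z : Z) [DecidablePred (· ∈ dom)] : Measurable fun x => if x ∈ dom then ψ (Y x) else z := by
  intro B hB
  have h : (fun x => if x ∈ dom then ψ (Y x) else z) ⁻¹' B =
      (dom ∩ Y ⁻¹' (ψ ⁻¹' B)) ∪ (domᶜ ∩ {x | z ∈ B}) := by
    ext x
    by_cases hx : x ∈ dom <;> simp [hx]
  have hd : MeasurableSet dom := by simpa using hY univ MeasurableSet.univ
  rw [h]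
  exact (hY _ (hψ hB)).union (hd.compl.inter (MeasurableSet.const _))

lemma measurable_empiricalMarks {T : X → X} (hT : Measurable T) {dom : Set X} {Y : X → S}
    (hY : ∀ B, MeasurableSet B → MeasurableSet (dom ∩ Y ⁻¹' B)) {n : ℕ} (hn : 1 ≤ n) :
    Measurable (empiricalMarks T dom Y n) := by
  classical
  rw [PointMeasure.measurable_iff]
  have h : (fun x => (empiricalMarks T dom Y n x).1) = fun x => Measure.sum fun j : ℕ =>
      if T^[j] x ∈ dom then
        Measure.dirac ((j : ℝ≥0) / (n : ℝ≥0), Y (T^[j] x)) else 0 := by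
    ext x : 1
    unfold empiricalMarks
    rw [toPointMeasure_sum_dirac (finite_empirical_points T dom Y hn x)]
    ext s hs
    rw [Measure.sum_apply _ hs, Measure.sum_apply _ hs]
    refine (tsum_subtype {j : ℕ | T^[j] x ∈ dom}
      (fun j => Measure.dirac ((j : ℝ≥0) / (n : ℝ≥0), Y (T^[j] x)) s)).trans ?_
    refine tsum_congr fun j => ?_
    by_cases hj : T^[j] x ∈ dom <;> simp [hj, indicator]
  rw [h]
  refine measurable_sum_measure fun j => ?_
  have h2 : Measurable fun y : S => Measure.dirac ((j : ℝ≥0) / (n : ℝ≥0), y) :=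
    Measure.measurable_dirac.comp measurable_prodMk_left
  exact (measurable_ite_comp hY h2 0).comp (hT.iterate j)

open Classical in
lemma integral_empiricalMarks (T : X → X) (dom : Set X) (Y : X → S) {n : ℕ} (hn : 1 ≤ n)
    (F : C_c(ℝ≥0 × S, ℝ)) {M : ℕ} (hM : ∀ (t : ℝ≥0) y, (M : ℝ≥0) ≤ t → F (t, y) = 0) (x : X) :
    ∫ y, F y ∂(empiricalMarks T dom Y n x).1 = ∑ j ∈ Finset.range (M * n),
      if T^[j] x ∈ dom then F ((j : ℝ≥0) / (n : ℝ≥0), Y (T^[j] x)) else 0 := by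
  have h := hasSum_integral_toPointMeasure (finite_empirical_points T dom Y hn x) F
  have h2 : HasSum ({j : ℕ | T^[j] x ∈ dom}.indicator
      (fun j => F ((j : ℝ≥0) / (n : ℝ≥0), Y (T^[j] x)))) _ := hasSum_subtype_iff_indicator.1 h
  have h3 : ∀ j ∉ Finset.range (M * n), {j : ℕ | T^[j] x ∈ dom}.indicator
      (fun j => F ((j : ℝ≥0) / (n : ℝ≥0), Y (T^[j] x))) j = 0 := by
    intro j hj
    rw [indicator_apply]
    split_ifs
    · refine hM _ _ ?_
      have hn' : (0 : ℝ≥0) < n := by exact_mod_cast hn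
      rw [le_div_iff₀ hn']
      rw [Finset.mem_range, not_lt] at hj
      exact_mod_cast hj
    · rfl
  refine (h2.unique (hasSum_sum_of_ne_finset_zero h3)).trans ?_
  refine Finset.sum_congr rfl fun j _ => ?_
  rw [indicator_apply]
  rfl

end Empirical

/-! ### The unit circle -/

/-- `e^{ia}`. -/
def cis (a : ℝ) : ℂ := Complex.exp (Complex.I * a)

lemma norm_cis (a : ℝ) : ‖cis a‖ = 1 := Complex.norm_exp_I_mul_ofReal a

lemma cis_zero : cis 0 = 1 := by simp [cis]

lemma cis_add (a b : ℝ) : cis (a + b) = cis a * cis b := by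
  simp [cis, mul_add, Complex.exp_add]

lemma continuous_cis : Continuous cis := by unfold cis; fun_prop

lemma norm_cis_sub_cis_le (a b : ℝ) : ‖cis a - cis b‖ ≤ |a - b| := by
  have h : cis a - cis b = cis b * (cis (a - b) - 1) := by
    rw [mul_sub, ← cis_add]; ring_nf
  rw [h, norm_mul, norm_cis, one_mul]
  exact Real.norm_exp_I_mul_ofReal_sub_one_le

lemma norm_cis_sub_one_le (a : ℝ) : ‖cis a - 1‖ ≤ 2 := by
  refine (norm_sub_le _ _).trans ?_
  rw [norm_cis, norm_one]; norm_num

/-! ### Elementary estimates -/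

/-- The approximate recursion w_k ≈ exp(c_k) w_{k+1} can be iterated without amplifying the errors,
because Re c_k ≤ 0 makes every multiplier at most one in modulus. -/
lemma norm_sub_exp_sum_le {w c : ℕ → ℂ} {N : ℕ} {ε : ℝ} (hN : w N = 1)
    (hc : ∀ k, (c k).re ≤ 0) (h : ∀ k < N, ‖w k - Complex.exp (c k) * w (k + 1)‖ ≤ ε) :
    ‖w 0 - Complex.exp (∑ k ∈ Finset.range N, c k)‖ ≤ N * ε := by
  have key : ∀ m ≤ N, ‖w 0 - Complex.exp (∑ k ∈ Finset.range m, c k) * w m‖ ≤ m * ε := by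
    intro m
    induction m with
    | zero => simp
    | succ m ih =>
      intro hm
      have ih := ih (by omega)
      have e : w 0 - Complex.exp (∑ k ∈ Finset.range (m + 1), c k) * w (m + 1) =
          (w 0 - Complex.exp (∑ k ∈ Finset.range m, c k) * w m) +
          Complex.exp (∑ k ∈ Finset.range m, c k) * (w m - Complex.exp (c m) * w (m + 1)) := by
        rw [Finset.sum_range_succ, Complex.exp_add]; ring
      rw [e]
      refine (norm_add_le _ _).trans ?_
      rw [norm_mul, Complex.norm_exp]
      have h1 : Real.exp (∑ k ∈ Finset.range m, c k).re ≤ 1 := by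
        rw [Real.exp_le_one_iff, Complex.re_sum]
        exact Finset.sum_nonpos fun k _ => hc k
      have h2 := h m (by omega)
      push_cast
      have := mul_le_mul h1 h2 (norm_nonneg _) zero_le_one
      linarith
  simpa [hN] using key N le_rfl

/-- Riemann sums of a continuous function. -/
lemma tendsto_riemann_sum {c : ℝ → ℂ} (hc : Continuous c) (M : ℕ) :
    Tendsto (fun n : ℕ => ∑ k ∈ Finset.range (M * n), c (k / n) / n) atTop
      (𝓝 (∫ s in (0 : ℝ)..M, c s)) := by
  have hu : UniformContinuousOn c (Icc 0 M) :=
    isCompact_Icc.uniformContinuousOn_of_continuous hc.continuousOn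
  rw [Metric.tendsto_atTop]
  intro ε hε
  obtain ⟨δ, hδ, hδ'⟩ := Metric.uniformContinuousOn_iff.1 hu (ε / (M + 1)) (by positivity)
  obtain ⟨n₀, hn₀⟩ := exists_nat_gt (1 / δ)
  refine ⟨n₀ + 1, fun n hn => ?_⟩
  have hn1 : (0 : ℝ) < n := by exact_mod_cast (by omega : 0 < n)
  have hnδ : 1 / (n : ℝ) < δ := by
    rw [div_lt_iff₀ hn1]
    rw [div_lt_iff₀ hδ] at hn₀
    have : (n₀ : ℝ) ≤ n := by exact_mod_cast (by omega : n₀ ≤ n)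
    nlinarith
  have hsplit : ∫ s in (0 : ℝ)..M, c s = ∑ k ∈ Finset.range (M * n),
      ∫ s in ((k : ℝ) / n)..((k + 1 : ℕ) : ℝ) / n, c s := by
    rw [intervalIntegral.sum_integral_adjacent_intervals (a := fun k : ℕ => (k : ℝ) / n)
      (fun k _ => hc.intervalIntegrable _ _)]
    simp only [Nat.cast_zero, zero_div, Nat.cast_mul]
    rw [mul_div_cancel_right₀ _ hn1.ne']
  rw [dist_eq_norm, hsplit, ← Finset.sum_sub_distrib]
  have hterm : ∀ k ∈ Finset.range (M * n),
      ‖c (k / n) / n - ∫ s in ((k : ℝ) / n)..((k + 1 : ℕ) : ℝ) / n, c s‖ ≤ ε / (M + 1) / n := by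
    intro k hk
    rw [Finset.mem_range] at hk
    have hle : (k : ℝ) / n ≤ ((k + 1 : ℕ) : ℝ) / n := by gcongr; simp
    have hlen : ((k + 1 : ℕ) : ℝ) / n - (k : ℝ) / n = 1 / n := by push_cast; ring
    have hM : ((k + 1 : ℕ) : ℝ) / n ≤ M := by
      rw [div_le_iff₀ hn1]; exact_mod_cast hk
    have e : c (k / n) / n = ∫ s in ((k : ℝ) / n)..((k + 1 : ℕ) : ℝ) / n, c (k / n) := by
      rw [intervalIntegral.integral_const, hlen]
      simp [div_eq_inv_mul]
    rw [e, ← intervalIntegral.integral_sub (by simp) (hc.intervalIntegrable _ _)]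
    refine (intervalIntegral.norm_integral_le_of_norm_le_const (C := ε / (M + 1)) ?_).trans ?_
    · intro s hs
      rw [uIoc_of_le hle] at hs
      have hk0 : 0 ≤ (k : ℝ) / n := by positivity
      rw [← dist_eq_norm]
      refine (hδ' _ ⟨hk0, hle.trans hM⟩ s ⟨hk0.trans hs.1.le, hs.2.trans hM⟩ ?_).le
      rw [Real.dist_eq, abs_sub_comm, abs_of_nonneg (by linarith [hs.1])]
      linarith [hs.2]
    · rw [hlen, abs_of_nonneg (by positivity)]
      rw [mul_one_div]
  refine (norm_sum_le_of_le _ hterm).trans_lt ?_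
  rw [Finset.sum_const, Finset.card_range, nsmul_eq_mul]
  push_cast
  have : (M : ℝ) * n * (ε / (M + 1) / n) = ε * (M / (M + 1)) := by field_simp
  rw [this]
  have h1 : (M : ℝ) / (M + 1) < 1 := by rw [div_lt_one (by positivity)]; linarith
  nlinarith

/-- For a summable sequence there are times in `[m, 2m)` at which it is `o(1/m)`. -/
lemma exists_gap {ρ : ℕ → ℝ} (hρ : Summable ρ) (h0 : ∀ n, 0 ≤ ρ n) :
    ∃ t : ℕ → ℕ, (∀ m, 1 ≤ m → m ≤ t m ∧ t m < 2 * m) ∧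
      Tendsto (fun m : ℕ => (m : ℝ) * ρ (t m)) atTop (𝓝 0) := by
  -- The minimum of ρ over the m integers in [m, 2m) is at most their average, so m ρ_t is bounded
  -- by a block of the convergent series.
  have hex : ∀ m : ℕ, ∃ t, 1 ≤ m → (m ≤ t ∧ t < 2 * m) ∧
      (m : ℝ) * ρ t ≤ ∑ j ∈ Finset.Ico m (2 * m), ρ j := by
    intro m
    by_cases hm : 1 ≤ m
    · obtain ⟨t, ht, hmin⟩ := Finset.exists_min_image (Finset.Ico m (2 * m)) ρ
        ⟨m, by simp; omega⟩
      refine ⟨t, fun _ => ⟨by simpa using ht, ?_⟩⟩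
      have := Finset.card_nsmul_le_sum _ ρ (ρ t) hmin
      simpa [two_mul] using this
    · exact ⟨0, fun h => absurd h hm⟩
  choose t ht using hex
  refine ⟨t, fun m hm => (ht m hm).1, ?_⟩
  have htail : Tendsto (fun m : ℕ => ∑ j ∈ Finset.Ico m (2 * m), ρ j) atTop (𝓝 0) := by
    have h1 := hρ.hasSum.tendsto_sum_nat
    have h2 : Tendsto (fun m : ℕ => 2 * m) atTop atTop :=
      tendsto_atTop_mono (fun m => by simp only [id]; omega) tendsto_id
    have := (h1.comp h2).sub h1
    rw [sub_self] at this
    refine this.congr fun m => ?_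
    rw [Finset.sum_Ico_eq_sub _ (by omega)]
    rfl
  refine squeeze_zero' (Eventually.of_forall fun m => mul_nonneg (by positivity) (h0 _)) ?_ htail
  filter_upwards [eventually_ge_atTop 1] with m hm using (ht m hm).2

/-! ### Rare marks along the orbits of a rapidly mixing system -/

/-- A function that vanishes off the cells and varies by at most η around a constant on each may be
replaced by a step function. The error is uniform over all weights W of modulus at most one; W will
be the future of the orbit. -/
lemma norm_integral_mul_sub_sum_le {Z : Type*} [MeasurableSpace Z] {m : Measure Z} {N : ℕ}
    {E : Fin N → Set Z} (hE : ∀ i, MeasurableSet (E i)) (hfin : ∀ i, m (E i) ≠ ∞)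
    (hdisj : Pairwise (Function.onFun Disjoint E)) {f W : Z → ℂ} (hf : Measurable f) (hW : Measurable W)
    (hW1 : ∀ x, ‖W x‖ ≤ 1) {B η : ℝ} (hB : ∀ x, ‖f x‖ ≤ B) (a : Fin N → ℂ)
    (ha : ∀ i, ∀ x ∈ E i, ‖f x - a i‖ ≤ η) (hf0 : ∀ x, (∀ i, x ∉ E i) → f x = 0) :
    ‖∫ x, f x * W x ∂m - ∑ i, a i * ∫ x in E i, W x ∂m‖ ≤ η * ∑ i, m.real (E i) := by
  have hWi : ∀ i, IntegrableOn W (E i) m := fun i =>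
    Measure.integrableOn_of_bounded (hfin i) hW.aestronglyMeasurable
      (Eventually.of_forall fun x => hW1 x)
  have hfi : ∀ i, IntegrableOn (fun x => f x * W x) (E i) m := fun i =>
    Measure.integrableOn_of_bounded (M := B) (hfin i) (hf.mul hW).aestronglyMeasurable
      (Eventually.of_forall fun x => by
        rw [norm_mul]
        calc ‖f x‖ * ‖W x‖ ≤ ‖f x‖ * 1 := by gcongr; exact hW1 x
          _ ≤ B := by rw [mul_one]; exact hB x)
  have h1 : ∫ x, f x * W x ∂m = ∑ i, ∫ x in E i, f x * W x ∂m := by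
    rw [← setIntegral_eq_integral_of_forall_compl_eq_zero (s := ⋃ i, E i)]
    · exact integral_iUnion_fintype hE hdisj hfi
    · intro x hx
      rw [hf0 x (by simpa using hx), zero_mul]
  rw [h1, ← Finset.sum_sub_distrib, Finset.mul_sum]
  refine norm_sum_le_of_le _ fun i _ => ?_
  rw [← integral_const_mul, ← integral_sub (hfi i) ((hWi i).const_mul _)]
  refine norm_setIntegral_le_of_norm_le_const (hfin i).lt_top fun x hx => ?_
  rw [← sub_mul, norm_mul]
  calc ‖f x - a i‖ * ‖W x‖ ≤ ‖f x - a i‖ * 1 := by gcongr; exact hW1 x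
    _ ≤ η := by rw [mul_one]; exact ha i x hx

lemma norm_setIntegral_sub_setIntegral_le {Z : Type*} [MeasurableSpace Z] {m : Measure Z}
    [IsFiniteMeasure m] {D E : Set Z} (hD : MeasurableSet D) (hE : MeasurableSet E) {W : Z → ℂ}
    (hW : Measurable W) (hW1 : ∀ x, ‖W x‖ ≤ 1) :
    ‖∫ x in E, W x ∂m - ∫ x in D, W x ∂m‖ ≤ m.real (D \ E) + m.real (E \ D) := by
  have hWi : ∀ s : Set Z, IntegrableOn W s m := fun s =>
    Measure.integrableOn_of_bounded (measure_ne_top _ _) hW.aestronglyMeasurable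
      (Eventually.of_forall fun x => hW1 x)
  rw [← integral_inter_add_sdiff hD (hWi E), ← integral_inter_add_sdiff hE (hWi D), inter_comm D E]
  rw [add_sub_add_left_eq_sub, add_comm]
  refine (norm_sub_le _ _).trans ?_
  have h : ∀ s : Set Z, ‖∫ x in s, W x ∂m‖ ≤ m.real s := fun s => by
    simpa using norm_setIntegral_le_of_norm_le_const (μ := m) (measure_lt_top m s)
      fun x _ => hW1 x
  exact add_le_add (h _) (h _)

section Dynamics

variable {X : Type*} [MeasurableSpace X]

/-- The correlations of the indicator of `D` with integrable functions of the future decay at the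
rate `C ρ_n`. -/
structure DecSet (μ : Measure X) (T : X → X) (ρ : ℕ → ℝ) (C : ℝ) (D : Set X) : Prop where
  nonneg : 0 ≤ C
  measurableSet : MeasurableSet D
  decay : ∀ ψ : X → ℝ, Integrable ψ μ → ∀ n, 1 ≤ n →
    |∫ x in D, ψ (T^[n] x) ∂μ - μ.real D * ∫ x, ψ x ∂μ| ≤ C * ρ n * ∫ x, |ψ x| ∂μ

variable {μ : Measure X} [IsProbabilityMeasure μ] {T : X → X} {ρ : ℕ → ℝ}

lemma DecSet.mono {C C' : ℝ} (hC : C ≤ C') {D : Set X} (hρ : ∀ n, 0 ≤ ρ n)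
    (h : DecSet μ T ρ C D) : DecSet μ T ρ C' D where
  nonneg := h.nonneg.trans hC
  measurableSet := h.measurableSet
  decay ψ hψ n hn := (h.decay ψ hψ n hn).trans (by
    have := hρ n
    have h2 : 0 ≤ ∫ x, |ψ x| ∂μ := integral_nonneg fun _ => abs_nonneg _
    gcongr)

/-- The correlation is linear in the indicator of the set, so the constants add. This produces
shells from nested balls. -/
lemma DecSet.diff (hT : MeasurePreserving T μ μ) {C C' : ℝ} {D D' : Set X}
    (h : DecSet μ T ρ C D) (h' : DecSet μ T ρ C' D') (hsub : D' ⊆ D) :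
    DecSet μ T ρ (C + C') (D \ D') where
  nonneg := add_nonneg h.nonneg h'.nonneg
  measurableSet := h.measurableSet.diff h'.measurableSet
  decay ψ hψ n hn := by
    have hi : Integrable (fun x => ψ (T^[n] x)) μ := (hT.iterate n).integrable_comp_of_integrable hψ
    rw [setIntegral_sdiff h'.measurableSet hi.integrableOn hsub,
      measureReal_sdiff hsub h'.measurableSet]
    have e1 := h.decay ψ hψ n hn
    have e2 := h'.decay ψ hψ n hn
    rw [abs_le] at e1 e2 ⊢
    constructor <;> linarith [e1.1, e1.2, e2.1, e2.2]

/-- The decay is stated for real observables; real and imaginary parts are treated separately, which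
accounts for the factor 2. -/
lemma DecSet.norm_le (hT : MeasurePreserving T μ μ) (hρ : ∀ n, 0 ≤ ρ n) {C : ℝ} {D : Set X}
    (h : DecSet μ T ρ C D) {W : X → ℂ} (hW : Measurable W) (hW1 : ∀ x, ‖W x‖ ≤ 1) {n : ℕ}
    (hn : 1 ≤ n) :
    ‖∫ x in D, W (T^[n] x) ∂μ - μ.real D * ∫ x, W x ∂μ‖ ≤ 2 * C * ρ n := by
  have hWi : Integrable W μ := Integrable.of_bound hW.aestronglyMeasurable 1
    (Eventually.of_forall hW1)
  have hWT : Integrable (fun x => W (T^[n] x)) (μ.restrict D) :=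
    ((hT.iterate n).integrable_comp_of_integrable hWi).integrableOn
  have hCρ : 0 ≤ C * ρ n := mul_nonneg h.nonneg (hρ n)
  have bound : ∀ L : ℂ →L[ℝ] ℝ, (∀ z, |L z| ≤ ‖z‖) →
      |L (∫ x in D, W (T^[n] x) ∂μ - μ.real D * ∫ x, W x ∂μ)| ≤ C * ρ n := by
    intro L hL
    have e : L (∫ x in D, W (T^[n] x) ∂μ - μ.real D * ∫ x, W x ∂μ) =
        ∫ x in D, L (W (T^[n] x)) ∂μ - μ.real D * ∫ x, L (W x) ∂μ := by
      rw [map_sub, ← Complex.real_smul, map_smul, L.integral_comp_comm hWT, L.integral_comp_comm hWi,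
        smul_eq_mul]
    rw [e]
    refine (h.decay (fun x => L (W x)) (L.integrable_comp hWi) n hn).trans ?_
    have : ∫ x, |L (W x)| ∂μ ≤ 1 := by
      calc ∫ x, |L (W x)| ∂μ ≤ ∫ _, 1 ∂μ := integral_mono (L.integrable_comp hWi).abs
            (integrable_const _) fun x => (hL _).trans (hW1 x)
        _ = 1 := by simp
    nlinarith
  refine (Complex.norm_le_abs_re_add_abs_im _).trans ?_
  have h1 := bound Complex.reCLM Complex.abs_re_le_norm
  have h2 := bound Complex.imCLM Complex.abs_im_le_norm
  simp only [Complex.reCLM_apply, Complex.imCLM_apply] at h1 h2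
  linarith

variable {S : Type*} [MetricSpace S] [ProperSpace S] [MeasurableSpace S] [BorelSpace S]

/-- A measurable set of marks whose rescaled frequency converges, and whose occurrence is
approximated by sets with decay of correlations. -/
structure GoodCell (μ : Measure X) (T : X → X) (ρ : ℕ → ℝ) (ν : Measure S) (dom : ℕ → Set X)
    (Y : ℕ → X → S) (Q : Set S) : Prop where
  measurableSet : MeasurableSet Q
  finite : ν Q ≠ ∞
  tendsto : Tendsto (fun n : ℕ => (n : ℝ) * μ.real (dom n ∩ Y n ⁻¹' Q)) atTop (𝓝 (ν.real Q))
  approx : ∀ ε : ℝ, 0 < ε → ∃ C, ∀ᶠ n : ℕ in atTop, ∃ D, DecSet μ T ρ C D ∧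
    (n : ℝ) * (μ.real (D \ (dom n ∩ Y n ⁻¹' Q)) + μ.real ((dom n ∩ Y n ⁻¹' Q) \ D)) ≤ ε

/-- Marks `Y n` observed at visits to the rare sets `dom n`, whose intensity converges to `ν`, and
whose short returns occur at the times in `R`, where the mark is moved by the maps `g j`. -/
structure RareMarks (μ : Measure X) (T : X → X) (ρ : ℕ → ℝ) (ν : Measure S) (dom : ℕ → Set X)
    (Y : ℕ → X → S) (R : Set ℕ) (g : ℕ → S → S) : Prop where
  meas : ∀ n B, MeasurableSet B → MeasurableSet (dom n ∩ Y n ⁻¹' B)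
  cells : ∀ K : Set S, IsCompact K → ∃ V : ℝ, ∀ δ : ℝ, 0 < δ →
    ∃ (N : ℕ) (Q : Fin N → Set S) (y : Fin N → S), Pairwise (Function.onFun Disjoint Q) ∧
      K ⊆ ⋃ i, Q i ∧ (∀ i, ∀ z ∈ Q i, dist z (y i) ≤ δ) ∧
      (∀ i, GoodCell μ T ρ ν dom Y (Q i)) ∧ ∑ i, ν.real (Q i) ≤ V
  cover : ∀ K : Set S, IsCompact K → ∃ C : ℝ, ∀ᶠ n : ℕ in atTop, ∃ D, DecSet μ T ρ C D ∧
    dom n ∩ Y n ⁻¹' K ⊆ D ∧ (n : ℝ) * μ.real D ≤ C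
  noReturn : ∀ K : Set S, IsCompact K → ∀ j, 1 ≤ j → j ∉ R → ∀ᶠ n in atTop,
    ∀ x ∈ dom n, Y n x ∈ K → T^[j] x ∈ dom n → Y n (T^[j] x) ∉ K
  return_ : ∀ K : Set S, IsCompact K → ∀ j, 1 ≤ j → j ∈ R → ∀ η : ℝ, 0 < η → ∀ᶠ n in atTop,
    ∀ x ∈ dom n, Y n x ∈ K → T^[j] x ∈ dom n ∧ dist (Y n (T^[j] x)) (g j (Y n x)) ≤ η
  continuous : ∀ j ∈ R, Continuous (g j)

variable {ν : Measure S} {dom : ℕ → Set X} {Y : ℕ → X → S} {R : Set ℕ} {g : ℕ → S → S}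

lemma measurable_indicator_mark (hY : RareMarks μ T ρ ν dom Y R g) {Z : Type*} [MeasurableSpace Z]
    [Zero Z] {H : S → Z} (hH : Measurable H) (n : ℕ) :
    Measurable ((dom n).indicator fun x => H (Y n x)) := by
  classical
  have h := measurable_ite_comp (hY.meas n) hH 0
  convert h using 1
  ext x
  rw [indicator_apply]

/-- Intensities of continuous functions of the marks, and their decorrelation from the future. -/
lemma RareMarks.uniform_estimates (hT : MeasurePreserving T μ μ) (hρ : ∀ n, 0 ≤ ρ n)
    (hY : RareMarks μ T ρ ν dom Y R g) {ι : Type*} {H : ι → S → ℂ} {B : ℝ} (hB0 : 0 ≤ B)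
    (hB : ∀ s y, ‖H s y‖ ≤ B) (hH : ∀ s, Measurable (H s)) {K : Set S} (hK : IsCompact K)
    (hsupp : ∀ s, ∀ y ∉ K, H s y = 0)
    (hequi : ∀ η : ℝ, 0 < η → ∃ δ : ℝ, 0 < δ ∧ ∀ s y y', dist y y' ≤ δ → ‖H s y - H s y'‖ ≤ η)
    {ε : ℝ} (hε : 0 < ε) :
    ∃ C : ℝ, 0 ≤ C ∧ ∀ᶠ n : ℕ in atTop, ∀ s,
      ‖n * ∫ x, (dom n).indicator (fun x => H s (Y n x)) x ∂μ - ∫ y, H s y ∂ν‖ ≤ ε ∧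
      ∀ t, 1 ≤ t → ∀ W : X → ℂ, Measurable W → (∀ x, ‖W x‖ ≤ 1) →
        n * ‖∫ x, (dom n).indicator (fun x => H s (Y n x)) x * W (T^[t] x) ∂μ -
          (∫ x, (dom n).indicator (fun x => H s (Y n x)) x ∂μ) * ∫ x, W x ∂μ‖ ≤
          ε + C * (n * ρ t) := by
  classical
  obtain ⟨V, hV⟩ := hY.cells K hK
  have hV1 : 0 < |V| + 1 := by positivity
  -- Truncating at one keeps the total frequency error N ε' of the cells below one.
  set ε₁ := min ε 1 with hε₁
  have hε₁0 : 0 < ε₁ := lt_min hε one_pos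
  have hε₁ε : ε₁ ≤ ε := min_le_left _ _
  have hε₁1 : ε₁ ≤ 1 := min_le_right _ _
  -- The rescaled mass of all cells is at most |V| + 1, with V independent of their size, so an
  -- oscillation η on each cell costs ε₁/4 in total.
  set η := ε₁ / (4 * (|V| + 1)) with hη
  have hη0 : 0 < η := by positivity
  obtain ⟨δ, hδ, hδ'⟩ := hequi η hη0
  obtain ⟨N, Q, y, hdisj, hcov, hdist, hgood, hsum⟩ := hV δ hδ
  -- Accuracy per cell: over N cells, with H bounded by B, the errors ε' sum to at most ε₁/4.
  set ε' := ε₁ / (4 * (B + 1) * (N + 1)) with hε'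
  have hε'0 : 0 < ε' := by positivity
  choose C hC using fun i => (hgood i).approx ε' hε'0
  let E : ℕ → Fin N → Set X := fun n i => dom n ∩ Y n ⁻¹' Q i
  have hE : ∀ n i, MeasurableSet (E n i) := fun n i => hY.meas n _ (hgood i).measurableSet
  have hEd : ∀ n, Pairwise (Function.onFun Disjoint (E n)) := fun n i j hij =>
    ((hdisj hij).preimage (Y n)).mono inter_subset_right inter_subset_right
  -- the limit of the frequencies of the cells
  have hfreq : ∀ᶠ n : ℕ in atTop, ∀ i, |n * μ.real (E n i) - ν.real (Q i)| ≤ ε' := by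
    rw [eventually_all]
    intro i
    have := (Metric.tendsto_nhds.1 (hgood i).tendsto) ε' hε'0
    filter_upwards [this] with n hn
    rw [← Real.dist_eq]; exact hn.le
  have hCev : ∀ᶠ n : ℕ in atTop, ∀ i, ∃ D, DecSet μ T ρ (C i) D ∧
      (n : ℝ) * (μ.real (D \ E n i) + μ.real (E n i \ D)) ≤ ε' := by
    rw [eventually_all]
    exact fun i => hC i
  have hNε : (B + 1) * (N * ε') ≤ ε₁ / 4 := by
    rw [hε']
    have h1 : (B + 1) * ((N : ℝ) * (ε₁ / (4 * (B + 1) * (N + 1)))) = ε₁ / 4 * (N / (N + 1)) := by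
      field_simp
    rw [h1]
    have : (N : ℝ) / (N + 1) ≤ 1 := by rw [div_le_one (by positivity)]; linarith
    nlinarith
  have hηV : η * (|V| + 1) = ε₁ / 4 := by rw [hη]; field_simp
  have hNε0 : 0 ≤ N * ε' := by positivity
  have hNε' : N * ε' ≤ 1 := by nlinarith
  have hBNε : B * (N * ε') ≤ ε₁ / 4 := by nlinarith
  refine ⟨∑ i, B * (2 * |C i|), by positivity, ?_⟩
  filter_upwards [hfreq, hCev, eventually_ge_atTop 1] with n hn1 hn2 hn3 s
  have hn0 : (0 : ℝ) ≤ n := by positivity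
  -- total mass of the cells
  have hmass : n * ∑ i, μ.real (E n i) ≤ |V| + 1 := by
    rw [Finset.mul_sum]
    calc ∑ i, n * μ.real (E n i) ≤ ∑ i, (ν.real (Q i) + ε') :=
          Finset.sum_le_sum fun i _ => by linarith [(abs_le.1 (hn1 i)).2]
      _ = ∑ i, ν.real (Q i) + N * ε' := by rw [Finset.sum_add_distrib]; simp
      _ ≤ _ := by linarith [le_abs_self V]
  -- the step function approximation
  have hstep : ∀ W : X → ℂ, Measurable W → (∀ x, ‖W x‖ ≤ 1) →
      ‖∫ x, (dom n).indicator (fun x => H s (Y n x)) x * W x ∂μ -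
        ∑ i, H s (y i) * ∫ x in E n i, W x ∂μ‖ ≤ η * ∑ i, μ.real (E n i) := by
    intro W hW hW1
    refine norm_integral_mul_sub_sum_le (B := B) (hE n) (fun i => measure_ne_top _ _) (hEd n)
      (measurable_indicator_mark hY (hH s) n) hW hW1 (fun x => ?_) _ (fun i x hx => ?_) fun x hx => ?_
    · rw [indicator_apply]
      split_ifs
      · exact hB _ _
      · simpa using hB0
    · rw [indicator_of_mem hx.1]
      exact hδ' _ _ _ (hdist i _ hx.2)
    · rw [indicator_apply]
      split_ifs with hd
      · refine hsupp _ _ fun hK => ?_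
        obtain ⟨i, hi⟩ := mem_iUnion.1 (hcov hK)
        exact hx i ⟨hd, hi⟩
      · rfl
  have hstep1 : ‖∫ x, (dom n).indicator (fun x => H s (Y n x)) x ∂μ -
        ∑ i, H s (y i) * (μ.real (E n i) : ℂ)‖ ≤ η * ∑ i, μ.real (E n i) := by
    have := hstep (fun _ => 1) measurable_const (fun _ => by simp)
    simpa using this
  have hν : ‖∫ z, H s z ∂ν - ∑ i, H s (y i) * (ν.real (Q i) : ℂ)‖ ≤ η * ∑ i, ν.real (Q i) := by
    have := norm_integral_mul_sub_sum_le (m := ν) (W := fun _ => 1) (fun i => (hgood i).measurableSet)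
      (fun i => (hgood i).finite) hdisj (hH s) measurable_const (fun _ => by simp) (B := B)
      (hB s) (fun i => H s (y i)) (η := η) (fun i x hx => hδ' _ _ _ (hdist i x hx)) (fun x hx => ?_)
    · simpa using this
    · refine hsupp _ _ fun hK => ?_
      obtain ⟨i, hi⟩ := mem_iUnion.1 (hcov hK)
      exact hx i hi
  have hηmass : n * (η * ∑ i, μ.real (E n i)) ≤ ε₁ / 4 := by
    rw [← hηV, mul_left_comm]; gcongr
  refine ⟨?_, fun t ht W hW hW1 => ?_⟩
  · have e : (n : ℂ) * ∫ x, (dom n).indicator (fun x => H s (Y n x)) x ∂μ - ∫ y, H s y ∂ν =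
        n * (∫ x, (dom n).indicator (fun x => H s (Y n x)) x ∂μ -
          ∑ i, H s (y i) * (μ.real (E n i) : ℂ)) +
        ∑ i, H s (y i) * ((n * μ.real (E n i) - ν.real (Q i) : ℝ) : ℂ) -
        (∫ z, H s z ∂ν - ∑ i, H s (y i) * (ν.real (Q i) : ℂ)) := by
      push_cast
      simp only [mul_sub, Finset.sum_sub_distrib, Finset.mul_sum]
      have : ∀ i, H s (y i) * ((n : ℂ) * μ.real (E n i)) = n * (H s (y i) * μ.real (E n i)) :=
        fun i => by ring
      simp only [this]
      ring
    have h1 : ‖(n : ℂ) * (∫ x, (dom n).indicator (fun x => H s (Y n x)) x ∂μ -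
          ∑ i, H s (y i) * (μ.real (E n i) : ℂ))‖ ≤ ε₁ / 4 := by
      rw [norm_mul, Complex.norm_natCast]
      exact (mul_le_mul_of_nonneg_left hstep1 hn0).trans hηmass
    have h2 : ‖∑ i, H s (y i) * ((n * μ.real (E n i) - ν.real (Q i) : ℝ) : ℂ)‖ ≤ ε₁ / 4 := by
      refine le_trans (norm_sum_le_of_le (n := fun _ => B * ε') _ fun i _ => ?_) ?_
      · rw [norm_mul, Complex.norm_real, Real.norm_eq_abs]
        exact mul_le_mul (hB _ _) (hn1 i) (abs_nonneg _) hB0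
      · simp only [Finset.sum_const, Finset.card_univ, Fintype.card_fin, nsmul_eq_mul]
        linarith
    have h3 : η * ∑ i, ν.real (Q i) ≤ ε₁ / 4 := by
      rw [← hηV]; gcongr; linarith [le_abs_self V]
    rw [e]
    refine (norm_sub_le _ _).trans ?_
    linarith [norm_add_le ((n : ℂ) * (∫ x, (dom n).indicator (fun x => H s (Y n x)) x ∂μ -
          ∑ i, H s (y i) * (μ.real (E n i) : ℂ)))
          (∑ i, H s (y i) * ((n * μ.real (E n i) - ν.real (Q i) : ℝ) : ℂ))]
  · have hWT : Measurable fun x => W (T^[t] x) := hW.comp (hT.measurable.iterate t)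
    have hint : ‖∫ x, W x ∂μ‖ ≤ 1 := by
      simpa using norm_integral_le_of_norm_le_const (μ := μ) (Eventually.of_forall hW1)
    have e : ∫ x, (dom n).indicator (fun x => H s (Y n x)) x * W (T^[t] x) ∂μ -
          (∫ x, (dom n).indicator (fun x => H s (Y n x)) x ∂μ) * ∫ x, W x ∂μ =
        (∫ x, (dom n).indicator (fun x => H s (Y n x)) x * W (T^[t] x) ∂μ -
          ∑ i, H s (y i) * ∫ x in E n i, W (T^[t] x) ∂μ) +
        ∑ i, H s (y i) * (∫ x in E n i, W (T^[t] x) ∂μ - μ.real (E n i) * ∫ x, W x ∂μ) -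
        (∫ x, (dom n).indicator (fun x => H s (Y n x)) x ∂μ -
          ∑ i, H s (y i) * (μ.real (E n i) : ℂ)) * ∫ x, W x ∂μ := by
      simp only [mul_sub, sub_mul, Finset.sum_sub_distrib, Finset.sum_mul, mul_assoc]
      ring
    have h1 := hstep _ hWT (fun x => hW1 _)
    have h2 : ‖(∫ x, (dom n).indicator (fun x => H s (Y n x)) x ∂μ -
          ∑ i, H s (y i) * (μ.real (E n i) : ℂ)) * ∫ x, W x ∂μ‖ ≤ η * ∑ i, μ.real (E n i) := by
      rw [norm_mul]
      calc _ ≤ (η * ∑ i, μ.real (E n i)) * 1 :=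
            mul_le_mul hstep1 hint (norm_nonneg _) (by positivity)
        _ = _ := mul_one _
    have h3 : n * ‖∑ i, H s (y i) * (∫ x in E n i, W (T^[t] x) ∂μ - μ.real (E n i) * ∫ x, W x ∂μ)‖ ≤
        B * (2 * (N * ε')) + (∑ i, B * (2 * |C i|)) * (n * ρ t) := by
      have hterm : ∀ i, n * ‖H s (y i) * (∫ x in E n i, W (T^[t] x) ∂μ -
          μ.real (E n i) * ∫ x, W x ∂μ)‖ ≤ B * (2 * ε') + B * (2 * |C i|) * (n * ρ t) := by
        intro i
        obtain ⟨D, hD, hDε⟩ := hn2 i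
        have a1 := norm_setIntegral_sub_setIntegral_le (m := μ) hD.measurableSet (hE n i) hWT
          (fun x => hW1 _)
        have a2 := hD.norm_le hT hρ hW hW1 ht
        have a3 := norm_setIntegral_sub_setIntegral_le (m := μ) (hE n i) hD.measurableSet
          (W := fun _ => 1) measurable_const (fun x => by simp)
        simp only [setIntegral_const, Complex.real_smul, mul_one] at a3
        have a4 : ‖((μ.real D : ℂ) - μ.real (E n i)) * ∫ x, W x ∂μ‖ ≤
            μ.real (E n i \ D) + μ.real (D \ E n i) := by
          rw [norm_mul]
          calc _ ≤ (μ.real (E n i \ D) + μ.real (D \ E n i)) * 1 :=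
                mul_le_mul a3 hint (norm_nonneg _) (by positivity)
            _ = _ := mul_one _
        -- The cell is exchanged for its approximating set D, the decay is applied to D, and μ(D) is
        -- exchanged back for the measure of the cell. The symmetric difference enters twice.
        have a5 : ‖∫ x in E n i, W (T^[t] x) ∂μ - μ.real (E n i) * ∫ x, W x ∂μ‖ ≤
            2 * (μ.real (D \ E n i) + μ.real (E n i \ D)) + 2 * C i * ρ t := by
          have e' : ∫ x in E n i, W (T^[t] x) ∂μ - μ.real (E n i) * ∫ x, W x ∂μ =
            (∫ x in E n i, W (T^[t] x) ∂μ - ∫ x in D, W (T^[t] x) ∂μ) +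
            (∫ x in D, W (T^[t] x) ∂μ - μ.real D * ∫ x, W x ∂μ) +
            ((μ.real D : ℂ) - μ.real (E n i)) * ∫ x, W x ∂μ := by ring
          rw [e']
          refine (norm_add₃_le).trans ?_
          linarith
        have hCi := le_abs_self (C i)
        have hnρ : 0 ≤ n * ρ t := mul_nonneg hn0 (hρ t)
        rw [norm_mul, mul_left_comm]
        calc ‖H s (y i)‖ * (n * ‖∫ x in E n i, W (T^[t] x) ∂μ - μ.real (E n i) * ∫ x, W x ∂μ‖)
            ≤ B * (n * (2 * (μ.real (D \ E n i) + μ.real (E n i \ D)) + 2 * C i * ρ t)) := by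
              refine mul_le_mul (hB _ _) ?_ (by positivity) hB0
              gcongr
          _ = B * (2 * (n * (μ.real (D \ E n i) + μ.real (E n i \ D))) + 2 * C i * (n * ρ t)) := by
              ring
          _ ≤ B * (2 * ε' + 2 * |C i| * (n * ρ t)) := by gcongr
          _ = _ := by ring
      calc _ ≤ n * ∑ i, ‖H s (y i) * (∫ x in E n i, W (T^[t] x) ∂μ -
            μ.real (E n i) * ∫ x, W x ∂μ)‖ := by gcongr; exact norm_sum_le _ _
        _ = ∑ i, n * ‖H s (y i) * (∫ x in E n i, W (T^[t] x) ∂μ -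
            μ.real (E n i) * ∫ x, W x ∂μ)‖ := Finset.mul_sum _ _ _
        _ ≤ ∑ i, (B * (2 * ε') + B * (2 * |C i|) * (n * ρ t)) := Finset.sum_le_sum fun i _ => hterm i
        _ = _ := by
          rw [Finset.sum_add_distrib, Finset.sum_mul]
          simp only [Finset.sum_const, Finset.card_univ, Fintype.card_fin, nsmul_eq_mul]
          ring
    rw [e]
    have h4 := mul_le_mul_of_nonneg_left h1 hn0
    have h5 := mul_le_mul_of_nonneg_left h2 hn0
    refine (mul_le_mul_of_nonneg_left ((norm_sub_le _ _).trans
      (add_le_add_left (norm_add_le _ _) _)) hn0).trans ?_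
    rw [mul_add, mul_add]
    linarith

end Dynamics

/-! ### Exponential functionals of the future of an orbit -/

section FutureProduct

variable {X : Type*} [MeasurableSpace X] {μ : Measure X} [IsProbabilityMeasure μ] {T : X → X}

/-- `exp (i ∑_{j < N} f_{k+j} ∘ T^j)`. -/
def futureProduct (T : X → X) (f : ℕ → X → ℝ) (N k : ℕ) (x : X) : ℂ :=
  cis (∑ j ∈ Finset.range N, f (k + j) (T^[j] x))

variable {f : ℕ → X → ℝ} {N : ℕ}

lemma norm_futureProduct (k : ℕ) (x : X) : ‖futureProduct T f N k x‖ = 1 := norm_cis _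

lemma measurable_futureProduct (hT : Measurable T) (hf : ∀ j, Measurable (f j)) (k : ℕ) :
    Measurable (futureProduct T f N k) :=
  continuous_cis.measurable.comp
    (Finset.measurable_fun_sum _ fun j _ => (hf _).comp (hT.iterate j))

lemma futureProduct_end (hN : ∀ j, N ≤ j → f j = 0) (x : X) : futureProduct T f N N x = 1 := by
  unfold futureProduct
  rw [Finset.sum_eq_zero fun j _ => by rw [hN _ (Nat.le_add_right _ _)]; rfl, cis_zero]

/-- Since f_j = 0 from N on, always summing N terms loses nothing when the starting index moves, and
the splitting at time t is exact. -/
lemma futureProduct_add (hN : ∀ j, N ≤ j → f j = 0) (k t : ℕ) (x : X) :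
    futureProduct T f N k x = cis (∑ j ∈ Finset.range t, f (k + j) (T^[j] x)) *
      futureProduct T f N (k + t) (T^[t] x) := by
  unfold futureProduct
  rw [← cis_add]
  congr 1
  have h1 : ∑ j ∈ Finset.range N, f (k + j) (T^[j] x) =
      ∑ j ∈ Finset.range (N + t), f (k + j) (T^[j] x) := by
    rw [Finset.sum_range_add, left_eq_add]
    refine Finset.sum_eq_zero fun j _ => ?_
    rw [hN _ (by omega)]; rfl
  rw [h1, add_comm N t, Finset.sum_range_add]
  congr 1
  refine Finset.sum_congr rfl fun j _ => ?_
  rw [← Function.iterate_add_apply, add_assoc, add_comm t j]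

/-- Correlations of sets with decay of correlations control the returns. -/
lemma DecSet.measureReal_inter_preimage_le {ρ : ℕ → ℝ} {C : ℝ} {D A : Set X} (h : DecSet μ T ρ C D)
    (hA : MeasurableSet A) (hAD : A ⊆ D) (hT : MeasurePreserving T μ μ) {j : ℕ} (hj : 1 ≤ j) :
    μ.real (A ∩ T^[j] ⁻¹' A) ≤ μ.real D * μ.real A + C * ρ j * μ.real A := by
  have hTA : MeasurableSet (T^[j] ⁻¹' A) := (hT.measurable.iterate j) hA
  -- The decay is tested on the indicator of A, whose L¹ norm is μ(A). This norm supplies the extra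
  -- factor of order 1/n in the error, the point at which decay against L¹ is used.
  have h1 := h.decay (A.indicator fun _ => 1) ((integrable_const _).indicator hA) j hj
  have e1 : ∫ x in D, A.indicator (fun _ => (1 : ℝ)) (T^[j] x) ∂μ = μ.real (D ∩ T^[j] ⁻¹' A) := by
    have : (fun x => A.indicator (fun _ => (1 : ℝ)) (T^[j] x)) =
        (T^[j] ⁻¹' A).indicator fun _ => 1 := rfl
    rw [this, setIntegral_indicator hTA]
    simp
  have e2 : ∫ x, A.indicator (fun _ => (1 : ℝ)) x ∂μ = μ.real A := by
    rw [integral_indicator hA]; simp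
  have e3 : ∫ x, |A.indicator (fun _ => (1 : ℝ)) x| ∂μ = μ.real A := by
    rw [← e2]
    congr 1; ext x
    exact abs_of_nonneg (indicator_nonneg (fun _ _ => zero_le_one) _)
  rw [e1, e2, e3] at h1
  have h2 : μ.real (A ∩ T^[j] ⁻¹' A) ≤ μ.real (D ∩ T^[j] ⁻¹' A) :=
    measureReal_mono (inter_subset_inter_left _ hAD)
  linarith [(abs_le.1 h1).2]

/-- By invariance the second integral may be composed with T; then the two integrands share all
factors except e^{i f_k}. -/
lemma integral_futureProduct_sub (hT : MeasurePreserving T μ μ) (hf : ∀ j, Measurable (f j))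
    (hN : ∀ j, N ≤ j → f j = 0) (k : ℕ) :
    ∫ x, futureProduct T f N k x ∂μ - ∫ x, futureProduct T f N (k + 1) x ∂μ =
      ∫ x, (cis (f k x) - 1) * futureProduct T f N (k + 1) (T x) ∂μ := by
  have hm := measurable_futureProduct (N := N) hT.measurable hf
  have hi : ∀ k, Integrable (futureProduct T f N k) μ := fun k =>
    Integrable.of_bound (hm k).aestronglyMeasurable 1
      (Eventually.of_forall fun x => (norm_futureProduct k x).le)
  have e : ∫ x, futureProduct T f N (k + 1) x ∂μ = ∫ x, futureProduct T f N (k + 1) (T x) ∂μ := by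
    rw [← integral_map hT.measurable.aemeasurable
      (by rw [hT.map_eq]; exact (hm _).aestronglyMeasurable), hT.map_eq]
  have hiT : Integrable (fun x => futureProduct T f N (k + 1) (T x)) μ :=
    hT.integrable_comp_of_integrable (hi (k + 1))
  rw [e, ← integral_sub (hi k) hiT]
  congr 1
  ext x
  have := futureProduct_add (T := T) hN k 1 x
  simp only [Finset.range_one, Finset.sum_singleton, add_zero, Function.iterate_zero, id,
    Function.iterate_one] at this
  rw [this]; ring

variable {A : Set X}

/-- The two integrands differ only if x ∈ A and T^j x ∈ A for some j with Q < j < t. There they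
differ by a product of two factors e^{ia} - 1, of modulus at most 2 each; the union bound does the
rest. -/
lemma norm_integral_drop_returns_le (hT : MeasurePreserving T μ μ) (hf : ∀ j, Measurable (f j))
    (hN : ∀ j, N ≤ j → f j = 0) (hA : MeasurableSet A) (hfA : ∀ j, ∀ x ∉ A, f j x = 0)
    (k : ℕ) {Q t : ℕ} (hQt : Q < t) :
    ‖∫ x, (cis (f k x) - 1) * futureProduct T f N (k + 1) (T x) ∂μ -
      ∫ x, (cis (f k x) - 1) * cis (∑ j ∈ Finset.Ico 1 (Q + 1), f (k + j) (T^[j] x)) *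
        futureProduct T f N (k + t) (T^[t] x) ∂μ‖ ≤
      4 * ∑ j ∈ Finset.Ico (Q + 1) t, μ.real (A ∩ T^[j] ⁻¹' A) := by
  have hm := measurable_futureProduct (N := N) hT.measurable hf
  have hTm := fun j => hT.measurable.iterate j
  have hc1 : Measurable fun x => cis (f k x) - 1 :=
    (continuous_cis.measurable.comp (hf k)).sub measurable_const
  have hc2 : Measurable fun x => cis (∑ j ∈ Finset.Ico 1 (Q + 1), f (k + j) (T^[j] x)) :=
    continuous_cis.measurable.comp (Finset.measurable_fun_sum _ fun j _ => (hf _).comp (hTm j))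
  have i1 : Integrable (fun x => (cis (f k x) - 1) * futureProduct T f N (k + 1) (T x)) μ := by
    refine Integrable.of_bound (hc1.mul ((hm _).comp hT.measurable)).aestronglyMeasurable 2
      (Eventually.of_forall fun x => ?_)
    rw [norm_mul, norm_futureProduct, mul_one]
    exact norm_cis_sub_one_le _
  have i2 : Integrable (fun x => (cis (f k x) - 1) *
      cis (∑ j ∈ Finset.Ico 1 (Q + 1), f (k + j) (T^[j] x)) *
        futureProduct T f N (k + t) (T^[t] x)) μ := by
    refine Integrable.of_bound ((hc1.mul hc2).mul ((hm _).comp (hTm t))).aestronglyMeasurable 2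
      (Eventually.of_forall fun x => ?_)
    rw [norm_mul, norm_mul, norm_futureProduct, norm_cis, mul_one, mul_one]
    exact norm_cis_sub_one_le _
  have hAj : ∀ j, MeasurableSet (A ∩ T^[j] ⁻¹' A) := fun j => hA.inter (hTm j hA)
  rw [← integral_sub i1 i2]
  have hint : ∑ j ∈ Finset.Ico (Q + 1) t, μ.real (A ∩ T^[j] ⁻¹' A) =
      ∫ x, ∑ j ∈ Finset.Ico (Q + 1) t, (A ∩ T^[j] ⁻¹' A).indicator (fun _ => (1 : ℝ)) x ∂μ := by
    rw [integral_finsetSum _ fun j _ => (integrable_const _).indicator (hAj j)]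
    refine Finset.sum_congr rfl fun j _ => ?_
    rw [integral_indicator (hAj j)]; simp
  rw [hint, ← integral_const_mul]
  refine norm_integral_le_of_norm_le ((integrable_finsetSum _ fun j _ =>
    (integrable_const _).indicator (hAj j)).const_mul _) (Eventually.of_forall fun x => ?_)
  have e1 : futureProduct T f N (k + 1) (T x) =
      cis (∑ j ∈ Finset.Ico 1 t, f (k + j) (T^[j] x)) * futureProduct T f N (k + t) (T^[t] x) := by
    have h := futureProduct_add (T := T) hN (k + 1) (t - 1) (T x)
    rw [h, Finset.sum_Ico_eq_sum_range]
    congr 2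
    · refine Finset.sum_congr rfl fun j _ => ?_
      rw [← Function.iterate_succ_apply, add_assoc, Nat.succ_eq_add_one, add_comm j 1]
    · rw [add_assoc]; congr 1; omega
    · rw [← Function.iterate_succ_apply]; congr 2; omega
  rw [e1, ← Finset.sum_Ico_consecutive _ (show 1 ≤ Q + 1 by omega) (show Q + 1 ≤ t by omega), cis_add]
  set a := cis (∑ j ∈ Finset.Ico 1 (Q + 1), f (k + j) (T^[j] x)) with ha
  set b := ∑ j ∈ Finset.Ico (Q + 1) t, f (k + j) (T^[j] x) with hb
  set w := futureProduct T f N (k + t) (T^[t] x) with hw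
  have e2 : (cis (f k x) - 1) * (a * cis b * w) - (cis (f k x) - 1) * a * w =
      (cis (f k x) - 1) * (a * w * (cis b - 1)) := by ring
  have hna : ‖a * w‖ = 1 := by rw [norm_mul, norm_cis, norm_futureProduct, one_mul]
  rw [e2, norm_mul, norm_mul, hna, one_mul]
  have hnn : ∀ j, 0 ≤ (A ∩ T^[j] ⁻¹' A).indicator (fun _ => (1 : ℝ)) x := fun j =>
    indicator_nonneg (fun _ _ => zero_le_one) _
  by_cases hx : x ∈ A
  · by_cases hj : ∃ j ∈ Finset.Ico (Q + 1) t, T^[j] x ∈ A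
    · obtain ⟨j, hj, hjA⟩ := hj
      have h1 : (1 : ℝ) ≤ ∑ j ∈ Finset.Ico (Q + 1) t,
          (A ∩ T^[j] ⁻¹' A).indicator (fun _ => (1 : ℝ)) x := by
        refine le_trans ?_ (Finset.single_le_sum (fun j _ => hnn j) hj)
        rw [indicator_of_mem (show x ∈ A ∩ T^[j] ⁻¹' A from ⟨hx, hjA⟩)]
      have h2 := norm_cis_sub_one_le (f k x)
      have h3 := norm_cis_sub_one_le b
      have := mul_le_mul h2 h3 (norm_nonneg _) zero_le_two
      linarith
    · push Not at hj
      have hb0 : b = 0 := Finset.sum_eq_zero fun j hj' => hfA _ _ (hj j hj')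
      rw [hb0, cis_zero, sub_self, norm_zero, mul_zero]
      exact mul_nonneg (by norm_num) (Finset.sum_nonneg fun j _ => hnn j)
  · rw [hfA k x hx, cis_zero, sub_self, norm_zero, zero_mul]
    exact mul_nonneg (by norm_num) (Finset.sum_nonneg fun j _ => hnn j)

/-- After composition with T^t, which preserves μ, the integrands agree unless the orbit meets A
during its first t steps. This lets the future after the gap be replaced by the full future. -/
lemma norm_integral_futureProduct_shift_le (hT : MeasurePreserving T μ μ)
    (hf : ∀ j, Measurable (f j)) (hN : ∀ j, N ≤ j → f j = 0) (hA : MeasurableSet A)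
    (hfA : ∀ j, ∀ x ∉ A, f j x = 0) (k t : ℕ) :
    ‖∫ x, futureProduct T f N (k + t) x ∂μ - ∫ x, futureProduct T f N k x ∂μ‖ ≤
      2 * t * μ.real A := by
  have hm := measurable_futureProduct (N := N) hT.measurable hf
  have hTm := fun j => hT.measurable.iterate j
  have hi : ∀ k, Integrable (futureProduct T f N k) μ := fun k =>
    Integrable.of_bound (hm k).aestronglyMeasurable 1
      (Eventually.of_forall fun x => (norm_futureProduct k x).le)
  have e : ∫ x, futureProduct T f N (k + t) x ∂μ =
      ∫ x, futureProduct T f N (k + t) (T^[t] x) ∂μ := by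
    rw [← integral_map (hTm t).aemeasurable
      (by rw [(hT.iterate t).map_eq]; exact (hm _).aestronglyMeasurable), (hT.iterate t).map_eq]
  have hiT : Integrable (fun x => futureProduct T f N (k + t) (T^[t] x)) μ :=
    (hT.iterate t).integrable_comp_of_integrable (hi (k + t))
  rw [e, ← integral_sub hiT (hi k)]
  have hAj : ∀ j, MeasurableSet (T^[j] ⁻¹' A) := fun j => hTm j hA
  have hint : 2 * t * μ.real A =
      ∫ x, 2 * ∑ j ∈ Finset.range t, (T^[j] ⁻¹' A).indicator (fun _ => (1 : ℝ)) x ∂μ := by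
    rw [integral_const_mul,
      integral_finsetSum _ fun j _ => (integrable_const _).indicator (hAj j)]
    have : ∀ j, ∫ x, (T^[j] ⁻¹' A).indicator (fun _ => (1 : ℝ)) x ∂μ = μ.real A := fun j => by
      rw [integral_indicator (hAj j)]
      simp [(hT.iterate j).measureReal_preimage hA.nullMeasurableSet]
    simp only [this, Finset.sum_const, Finset.card_range, nsmul_eq_mul]
    ring
  rw [hint]
  refine norm_integral_le_of_norm_le ((integrable_finsetSum _ fun j _ =>
    (integrable_const _).indicator (hAj j)).const_mul _) (Eventually.of_forall fun x => ?_)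
  rw [futureProduct_add hN k t x]
  set b := ∑ j ∈ Finset.range t, f (k + j) (T^[j] x) with hb
  set w := futureProduct T f N (k + t) (T^[t] x) with hw
  have e2 : w - cis b * w = -(w * (cis b - 1)) := by ring
  rw [e2, norm_neg, norm_mul, norm_futureProduct, one_mul]
  have hnn : ∀ j, 0 ≤ (T^[j] ⁻¹' A).indicator (fun _ => (1 : ℝ)) x := fun j =>
    indicator_nonneg (fun _ _ => zero_le_one) _
  by_cases hj : ∃ j ∈ Finset.range t, T^[j] x ∈ A
  · obtain ⟨j, hj, hjA⟩ := hj
    have h1 : (1 : ℝ) ≤ ∑ j ∈ Finset.range t,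
        (T^[j] ⁻¹' A).indicator (fun _ => (1 : ℝ)) x := by
      refine le_trans ?_ (Finset.single_le_sum (fun j _ => hnn j) hj)
      rw [indicator_of_mem (show x ∈ T^[j] ⁻¹' A from hjA)]
    linarith [norm_cis_sub_one_le b]
  · push Not at hj
    have hb0 : b = 0 := Finset.sum_eq_zero fun j hj' => hfA _ _ (hj j hj')
    rw [hb0, cis_zero, sub_self, norm_zero]
    exact mul_nonneg (by norm_num) (Finset.sum_nonneg fun j _ => hnn j)

end FutureProduct

/-! ### The recursion for the characteristic functional of rare marks -/

section CharFunctional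

variable {X : Type*} [MeasurableSpace X] {μ : Measure X} [IsProbabilityMeasure μ] {T : X → X}
  {ρ : ℕ → ℝ} {S : Type*} [MetricSpace S] [ProperSpace S] [MeasurableSpace S] [BorelSpace S]
  {ν : Measure S} {dom : ℕ → Set X} {Y : ℕ → X → S} {R : Set ℕ} {g : ℕ → S → S}

open Classical in
/-- The contribution of a mark `y` at time `s` and of its returns up to time `Q`. -/
def returnFun (F : C_c(ℝ≥0 × S, ℝ)) (R : Set ℕ) (g : ℕ → S → S) (Q : ℕ) (s : ℝ≥0) (y : S) : ℂ :=
  (cis (F (s, y)) - 1) * cis (∑ j ∈ Finset.Ico 1 (Q + 1), if j ∈ R then F (s, g j y) else 0)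

lemma norm_returnFun_le (F : C_c(ℝ≥0 × S, ℝ)) (Q : ℕ) (s : ℝ≥0) (y : S) :
    ‖returnFun F R g Q s y‖ ≤ 2 := by
  unfold returnFun
  rw [norm_mul, norm_cis, mul_one]
  exact norm_cis_sub_one_le _

lemma continuous_returnFun (hg : ∀ j ∈ R, Continuous (g j)) (F : C_c(ℝ≥0 × S, ℝ)) (Q : ℕ) :
    Continuous fun p : ℝ≥0 × S => returnFun F R g Q p.1 p.2 := by
  unfold returnFun
  refine ((continuous_cis.comp F.continuous).sub continuous_const).mul
    (continuous_cis.comp (continuous_finsetSum _ fun j _ => ?_))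
  split_ifs with hj
  · exact F.continuous.comp (continuous_fst.prodMk ((hg j hj).comp continuous_snd))
  · exact continuous_const

lemma uniformContinuous_returnFun (hg : ∀ j ∈ R, Continuous (g j)) (F : C_c(ℝ≥0 × S, ℝ)) (Q : ℕ) :
    UniformContinuous fun p : ℝ≥0 × S => returnFun F R g Q p.1 p.2 := by
  refine HasCompactSupport.uniformContinuous_of_continuous ?_ (continuous_returnFun hg F Q)
  refine F.hasCompactSupport.mono fun p hp hF => hp ?_
  unfold returnFun
  simp only [Prod.mk.eta]
  rw [hF, cis_zero, sub_self, zero_mul]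

/-- The value at time `j` of the test function at a mark. -/
def markSeq (F : C_c(ℝ≥0 × S, ℝ)) (dom : Set X) (Y : X → S) (n j : ℕ) : X → ℝ :=
  dom.indicator fun x => F ((j : ℝ≥0) / (n : ℝ≥0), Y x)

/-- Returns at times outside R have marks off K and contribute nothing. Those at times in R are
close to g_j(y), and the delay j/n ≤ Q/n is harmless by uniform continuity of F. The bound is
uniform in the starting time k. -/
lemma RareMarks.returns_approx (hY : RareMarks μ T ρ ν dom Y R g) (F : C_c(ℝ≥0 × S, ℝ)) {K : Set S}
    (hK : IsCompact K) (hFK : ∀ s, ∀ y ∉ K, F (s, y) = 0) (Q : ℕ) {η : ℝ} (hη : 0 < η) :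
    ∀ᶠ n : ℕ in atTop, ∀ k, ∀ x ∈ dom n, Y n x ∈ K →
      ‖(cis (markSeq F (dom n) (Y n) n k x) - 1) *
          cis (∑ j ∈ Finset.Ico 1 (Q + 1), markSeq F (dom n) (Y n) n (k + j) (T^[j] x)) -
        returnFun F R g Q ((k : ℝ≥0) / n) (Y n x)‖ ≤ η := by
  classical
  have hF := F.hasCompactSupport.uniformContinuous_of_continuous F.continuous
  obtain ⟨δ, hδ, hδ'⟩ := Metric.uniformContinuous_iff.1 hF (η / (2 * (Q + 1))) (by positivity)
  have h1 : ∀ᶠ n in atTop, ∀ j ∈ Finset.Ico 1 (Q + 1), j ∉ R →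
      ∀ x ∈ dom n, Y n x ∈ K → T^[j] x ∈ dom n → Y n (T^[j] x) ∉ K := by
    rw [Finset.eventually_all]
    intro j hj
    by_cases hjR : j ∈ R
    · exact Eventually.of_forall fun n h => absurd hjR h
    · filter_upwards [hY.noReturn K hK j (Finset.mem_Ico.1 hj).1 hjR] with n hn _ using hn
  have h2 : ∀ᶠ n in atTop, ∀ j ∈ Finset.Ico 1 (Q + 1), j ∈ R →
      ∀ x ∈ dom n, Y n x ∈ K → T^[j] x ∈ dom n ∧ dist (Y n (T^[j] x)) (g j (Y n x)) ≤ δ / 2 := by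
    rw [Finset.eventually_all]
    intro j hj
    by_cases hjR : j ∈ R
    · filter_upwards [hY.return_ K hK j (Finset.mem_Ico.1 hj).1 hjR (δ / 2) (by positivity)]
        with n hn _ using hn
    · exact Eventually.of_forall fun n h => absurd h hjR
  obtain ⟨n₀, hn₀⟩ := exists_nat_gt ((Q + 1) / δ)
  filter_upwards [h1, h2, eventually_ge_atTop (n₀ + 1)] with n hn1 hn2 hn3 k x hx hxK
  have hn0 : (0 : ℝ) < n := by exact_mod_cast (by omega : 0 < n)
  have e1 : markSeq F (dom n) (Y n) n k x = F ((k : ℝ≥0) / n, Y n x) := indicator_of_mem hx _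
  unfold returnFun
  rw [e1, ← mul_sub, norm_mul]
  have hsum : ‖cis (∑ j ∈ Finset.Ico 1 (Q + 1), markSeq F (dom n) (Y n) n (k + j) (T^[j] x)) -
      cis (∑ j ∈ Finset.Ico 1 (Q + 1), if j ∈ R then F ((k : ℝ≥0) / n, g j (Y n x)) else 0)‖ ≤
      η / 2 := by
    refine (norm_cis_sub_cis_le _ _).trans ?_
    rw [← Finset.sum_sub_distrib]
    refine (Finset.abs_sum_le_sum_abs _ _).trans ?_
    calc _ ≤ ∑ j ∈ Finset.Ico 1 (Q + 1), η / (2 * (Q + 1)) := ?_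
      _ = Q * (η / (2 * (Q + 1))) := by simp
      _ ≤ (Q + 1) * (η / (2 * (Q + 1))) := by gcongr; linarith
      _ = η / 2 := by field_simp
    refine Finset.sum_le_sum fun j hj => ?_
    by_cases hjR : j ∈ R
    · obtain ⟨hd, hdist⟩ := hn2 j hj hjR x hx hxK
      rw [if_pos hjR, markSeq, indicator_of_mem hd, ← Real.dist_eq]
      refine (hδ' ?_).le
      rw [Prod.dist_eq, max_lt_iff]
      refine ⟨?_, by linarith⟩
      rw [NNReal.dist_eq]
      push_cast
      rw [← sub_div, add_sub_cancel_left, abs_of_nonneg (by positivity), div_lt_iff₀ hn0]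
      rw [div_lt_iff₀ hδ] at hn₀
      have hj' : (j : ℝ) ≤ Q := by exact_mod_cast (by have := Finset.mem_Ico.1 hj; omega : j ≤ Q)
      have hnn : (n₀ : ℝ) ≤ n := by exact_mod_cast (by omega : n₀ ≤ n)
      nlinarith
    · have h0 : markSeq F (dom n) (Y n) n (k + j) (T^[j] x) = 0 := by
        unfold markSeq
        by_cases hd : T^[j] x ∈ dom n
        · rw [indicator_of_mem hd]
          exact hFK _ _ (hn1 j hj hjR x hx hxK hd)
        · rw [indicator_of_notMem hd]
      rw [h0, if_neg hjR, sub_zero, abs_zero]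
      positivity
  have := mul_le_mul (norm_cis_sub_one_le (F ((k : ℝ≥0) / n, Y n x))) hsum (norm_nonneg _) zero_le_two
  linarith

/-- One step of the recursion for the characteristic functional. -/
lemma RareMarks.step_estimate (hT : MeasurePreserving T μ μ) (hρs : Summable ρ)
    (hρ : ∀ n, 0 ≤ ρ n) (hY : RareMarks μ T ρ ν dom Y R g) (F : C_c(ℝ≥0 × S, ℝ)) {M : ℕ}
    (hM : ∀ (t : ℝ≥0) y, (M : ℝ≥0) ≤ t → F (t, y) = 0) {c : ℝ → ℂ} (hc : Continuous c)
    (hlim : ∀ ε : ℝ, 0 < ε → ∀ᶠ Q : ℕ in atTop, ∀ s : ℝ≥0,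
      ‖∫ y, returnFun F R g Q s y ∂ν - c s‖ ≤ ε) {ε : ℝ} (hε : 0 < ε) :
    ∀ᶠ n : ℕ in atTop, ∀ k < M * n,
      ‖∫ x, futureProduct T (markSeq F (dom n) (Y n) n) (M * n) k x ∂μ -
        Complex.exp (c (k / n) / n) *
          ∫ x, futureProduct T (markSeq F (dom n) (Y n) n) (M * n) (k + 1) x ∂μ‖ ≤ ε / n := by
  let K : Set S := Prod.snd '' tsupport F
  have hK : IsCompact K := F.hasCompactSupport.isCompact.image continuous_snd
  have hFK : ∀ s, ∀ y ∉ K, F (s, y) = 0 := fun s y hy =>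
    image_eq_zero_of_notMem_tsupport fun h => hy ⟨_, h, rfl⟩
  obtain ⟨C₀, hC₀⟩ := hY.cover K hK
  set C := max C₀ 1 with hCdef
  have hC1 : 1 ≤ C := le_max_right _ _
  have hC0 : 0 < C := by linarith
  -- The errors `s1` to `s6` below amount to 2 + 1 + 2 + 1 + 2 + 1 = 9 times ε₁.
  set ε₁ := ε / 10 with hε₁
  have hε₁0 : 0 < ε₁ := by positivity
  -- the cutoff for the returns
  have htail : ∀ᶠ Q : ℕ in atTop, ∀ t, ∑ j ∈ Finset.Ico (Q + 1) t, ρ j ≤ ε₁ / (4 * C ^ 2) := by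
    have h1 := tendsto_sum_nat_add ρ
    have h2 := (h1.comp (tendsto_add_atTop_nat 1)).eventually
      (gt_mem_nhds (show (0 : ℝ) < ε₁ / (4 * C ^ 2) by positivity))
    filter_upwards [h2] with Q hQ t
    refine le_trans ?_ hQ.le
    rw [Finset.sum_Ico_eq_sum_range]
    simp only [Function.comp_apply]
    have h3 : Summable fun i => ρ (i + (Q + 1)) := (summable_nat_add_iff (Q + 1)).2 hρs
    refine le_trans (le_of_eq ?_) (h3.sum_le_tsum (Finset.range (t - (Q + 1))) fun i _ => hρ _)
    exact Finset.sum_congr rfl fun i _ => by rw [add_comm]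
  obtain ⟨Q, hQtail, hQlim⟩ := (htail.and (hlim ε₁ hε₁0)).exists
  -- the gap
  obtain ⟨t', ht', ht'ρ⟩ := exists_gap hρs hρ
  -- The gap t will satisfy t ≤ 4κn. This makes tμ(A) ≤ 4κC, small enough both for accidental
  -- returns inside the gap and for forgetting the gap at the end.
  set κ := ε₁ / (64 * C ^ 2) with hκ
  have hκ0 : 0 < κ := by positivity
  obtain ⟨C', hC'0, hunif⟩ := hY.uniform_estimates hT hρ (H := returnFun F R g Q) zero_le_two
    (norm_returnFun_le F Q) (fun s => ((continuous_returnFun hY.continuous F Q).comp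
      (Continuous.prodMk_right s)).measurable) hK
    (fun s y hy => by unfold returnFun; rw [hFK s y hy, cis_zero, sub_self, zero_mul])
    (fun η hη => by
      obtain ⟨δ, hδ, hδ'⟩ := Metric.uniformContinuous_iff.1
        (uniformContinuous_returnFun hY.continuous F Q) η hη
      refine ⟨δ / 2, by positivity, fun s y y' hy => ?_⟩
      have := @hδ' (s, y) (s, y') (by
        rw [Prod.dist_eq, dist_self]; exact max_lt hδ (by linarith))
      rw [dist_eq_norm] at this
      exact this.le) hε₁0
  have hpat := hY.returns_approx F hK hFK Q (η := ε₁ / C) (by positivity)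
  let m : ℕ → ℕ := fun n => ⌈κ * n⌉₊
  have hm : Tendsto m atTop atTop :=
    tendsto_nat_ceil_atTop.comp (tendsto_natCast_atTop_atTop.const_mul_atTop hκ0)
  -- The gap lies in [m, 2m) with m ≥ κn and m ρ_t → 0, so n ρ_t ≤ m ρ_t / κ tends to 0 as well.
  have hgap : ∀ᶠ n : ℕ in atTop, C' * (n * ρ (t' (m n))) ≤ ε₁ := by
    have h1 : Tendsto (fun n => C' / κ * ((m n : ℝ) * ρ (t' (m n)))) atTop (𝓝 0) := by
      simpa using (ht'ρ.comp hm).const_mul (C' / κ)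
    filter_upwards [h1.eventually (gt_mem_nhds hε₁0)] with n hn
    refine le_trans ?_ hn.le
    have h2 : κ * n ≤ m n := Nat.le_ceil _
    have h3 : (n : ℝ) ≤ m n / κ := by rw [le_div_iff₀ hκ0]; linarith
    calc C' * (n * ρ (t' (m n))) ≤ C' * (m n / κ * ρ (t' (m n))) := by
          gcongr
          exact hρ _
      _ = _ := by ring
  obtain ⟨Bc, hBc⟩ := (isCompact_Icc (a := (0 : ℝ)) (b := M)).exists_bound_of_continuousOn
    hc.continuousOn
  set B := max Bc 1 with hB
  have hB1 : 1 ≤ B := le_max_right _ _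
  -- The three terms serve, in this order, for the quadratic remainder of the exponential, for B/n ≤
  -- 1, and for absorbing the rounding up of κn.
  obtain ⟨n₁, hn₁⟩ := exists_nat_ge (B ^ 2 / ε₁ + B + 1 / κ)
  filter_upwards [hC₀, hunif, hpat, hgap, hm.eventually_ge_atTop (Q + 1), eventually_ge_atTop (n₁ + 1)]
    with n hcov hun hpa hga hmQ hnn k hk
  have hn0 : (0 : ℝ) < n := by exact_mod_cast (by omega : 0 < n)
  have hnB : B ^ 2 / ε₁ + B + 1 / κ ≤ n := hn₁.trans (by exact_mod_cast (by omega : n₁ ≤ n))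
  obtain ⟨D, hD, hAD, hDC⟩ := hcov
  replace hD := hD.mono (le_max_left C₀ 1) hρ
  replace hDC : n * μ.real D ≤ C := hDC.trans (le_max_left C₀ 1)
  set A := dom n ∩ Y n ⁻¹' K with hA
  have hAm : MeasurableSet A := hY.meas n K hK.measurableSet
  have hAC : n * μ.real A ≤ C :=
    (mul_le_mul_of_nonneg_left (measureReal_mono hAD) hn0.le).trans hDC
  set f := markSeq F (dom n) (Y n) n with hf
  have hfm : ∀ j, Measurable (f j) := fun j =>
    measurable_indicator_mark hY (F.continuous.measurable.comp measurable_prodMk_left) n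
  have hfA : ∀ j, ∀ x ∉ A, f j x = 0 := by
    intro j x hx
    by_cases hd : x ∈ dom n
    · rw [hf, markSeq, indicator_of_mem hd]
      exact hFK _ _ fun h => hx ⟨hd, h⟩
    · rw [hf, markSeq, indicator_of_notMem hd]
  have hfN : ∀ j, M * n ≤ j → f j = 0 := by
    intro j hj
    ext x
    rw [hf, markSeq, Pi.zero_apply, indicator_apply_eq_zero]
    intro _
    refine hM _ _ ?_
    rw [le_div_iff₀ (by exact_mod_cast hn0)]
    exact_mod_cast hj
  set t := t' (m n) with ht
  have hm1 : 1 ≤ m n := by omega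
  have htm := ht' (m n) hm1
  have ht1 : 1 ≤ t := by omega
  have hQt : Q < t := by omega
  have htn : (t : ℝ) ≤ 4 * κ * n := by
    have h1 : (t : ℝ) ≤ 2 * m n := by exact_mod_cast htm.2.le
    have h2 : (m n : ℝ) < κ * n + 1 := Nat.ceil_lt_add_one (by positivity)
    have h3 : 1 / κ ≤ n := by
      have : 0 ≤ B ^ 2 / ε₁ := by positivity
      linarith
    rw [div_le_iff₀ hκ0] at h3
    nlinarith
  have htμA : t * μ.real A ≤ 4 * κ * C := by
    calc t * μ.real A ≤ 4 * κ * n * μ.real A := by gcongr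
      _ = 4 * κ * (n * μ.real A) := by ring
      _ ≤ _ := by gcongr
  set w : ℕ → ℂ := fun k => ∫ x, futureProduct T f (M * n) k x ∂μ with hw
  have hwm := measurable_futureProduct (N := M * n) hT.measurable hfm
  have hw1 : ∀ k, ‖w k‖ ≤ 1 := fun k => by
    simpa using norm_integral_le_of_norm_le_const (μ := μ)
      (Eventually.of_forall fun x => (norm_futureProduct (T := T) (f := f) (N := M * n) k x).le)
  set s : ℝ≥0 := (k : ℝ≥0) / n with hs
  set h : X → ℂ := (dom n).indicator (fun x => returnFun F R g Q s (Y n x)) with hh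
  have hhA : ∀ x ∉ A, h x = 0 := by
    intro x hx
    by_cases hd : x ∈ dom n
    · rw [hh, indicator_of_mem hd]
      unfold returnFun
      rw [hFK _ _ fun h => hx ⟨hd, h⟩, cis_zero, sub_self, zero_mul]
    · rw [hh, indicator_of_notMem hd]
  have hh2 : ∀ x, ‖h x‖ ≤ 2 := by
    intro x
    by_cases hd : x ∈ dom n
    · rw [hh, indicator_of_mem hd]; exact norm_returnFun_le F Q s _
    · rw [hh, indicator_of_notMem hd]; simp
  have hhm : Measurable h := measurable_indicator_mark hY
    ((continuous_returnFun hY.continuous F Q).comp (Continuous.prodMk_right s)).measurable n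
  -- the chain of approximations
  set I₁ : ℂ := ∫ x, (cis (f k x) - 1) * cis (∑ j ∈ Finset.Ico 1 (Q + 1), f (k + j) (T^[j] x)) *
        futureProduct T f (M * n) (k + t) (T^[t] x) ∂μ with hI₁
  set I₂ : ℂ := ∫ x, h x * futureProduct T f (M * n) (k + t) (T^[t] x) ∂μ with hI₂
  -- Returns between Q and t are dropped: t μ(D) μ(A) is small since t is a small multiple of n, and
  -- the sum of the ρ_j over j > Q is small by the choice of Q.
  have s1 : n * ‖w k - w (k + 1) - I₁‖ ≤ 2 * ε₁ := by
    have h1 := norm_integral_drop_returns_le hT hfm hfN hAm hfA k hQt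
    rw [← integral_futureProduct_sub hT hfm hfN k] at h1
    have h2 : ∑ j ∈ Finset.Ico (Q + 1) t, μ.real (A ∩ T^[j] ⁻¹' A) ≤
        t * (μ.real D * μ.real A) + C * (ε₁ / (4 * C ^ 2)) * μ.real A := by
      calc _ ≤ ∑ j ∈ Finset.Ico (Q + 1) t, (μ.real D * μ.real A + C * ρ j * μ.real A) :=
            Finset.sum_le_sum fun j hj => hD.measureReal_inter_preimage_le hAm hAD hT
              (by have := Finset.mem_Ico.1 hj; omega)
        _ = ((t - (Q + 1) : ℕ) : ℝ) * (μ.real D * μ.real A) +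
            C * (∑ j ∈ Finset.Ico (Q + 1) t, ρ j) * μ.real A := by
            rw [Finset.sum_add_distrib, Finset.mul_sum, Finset.sum_mul]
            simp
        _ ≤ _ := by
            gcongr
            · omega
            · exact hQtail t
    have h3 : n * (t * (μ.real D * μ.real A)) ≤ C * (4 * κ * C) := by
      calc _ = (n * μ.real D) * (t * μ.real A) := by ring
        _ ≤ _ := by gcongr
    have h4 : n * (C * (ε₁ / (4 * C ^ 2)) * μ.real A) ≤ ε₁ / 4 := by
      calc _ = C * (ε₁ / (4 * C ^ 2)) * (n * μ.real A) := by ring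
        _ ≤ C * (ε₁ / (4 * C ^ 2)) * C := by gcongr
        _ = ε₁ / 4 := by field_simp
    have h5 : C * (4 * κ * C) = ε₁ / 16 := by rw [hκ]; field_simp; norm_num
    calc n * ‖w k - w (k + 1) - I₁‖
        ≤ n * (4 * (t * (μ.real D * μ.real A) + C * (ε₁ / (4 * C ^ 2)) * μ.real A)) := by
          gcongr
          exact h1.trans (by gcongr)
      _ = 4 * (n * (t * (μ.real D * μ.real A)) + n * (C * (ε₁ / (4 * C ^ 2)) * μ.real A)) := by ring
      _ ≤ _ := by linarith
  -- The returns up to time Q become a function `h` of the first mark alone.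
  have s2 : n * ‖I₁ - I₂‖ ≤ ε₁ := by
    have hcm : Measurable fun x => (cis (f k x) - 1) *
        cis (∑ j ∈ Finset.Ico 1 (Q + 1), f (k + j) (T^[j] x)) :=
      ((continuous_cis.measurable.comp (hfm k)).sub measurable_const).mul
        (continuous_cis.measurable.comp (Finset.measurable_fun_sum _ fun j _ =>
          (hfm _).comp (hT.measurable.iterate j)))
    have hFm : Measurable fun x => futureProduct T f (M * n) (k + t) (T^[t] x) :=
      (hwm _).comp (hT.measurable.iterate t)
    have hb : ∀ x, ‖(cis (f k x) - 1) * cis (∑ j ∈ Finset.Ico 1 (Q + 1), f (k + j) (T^[j] x)) *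
        futureProduct T f (M * n) (k + t) (T^[t] x) -
        h x * futureProduct T f (M * n) (k + t) (T^[t] x)‖ ≤ A.indicator (fun _ => ε₁ / C) x := by
      intro x
      rw [← sub_mul, norm_mul, norm_futureProduct, mul_one]
      by_cases hx : x ∈ A
      · rw [indicator_of_mem hx, hh, indicator_of_mem hx.1]
        exact hpa k x hx.1 hx.2
      · rw [indicator_of_notMem hx, hhA x hx, hfA k x hx, cis_zero, sub_self, zero_mul, sub_self,
          norm_zero]
    rw [hI₁, hI₂, ← integral_sub]
    · calc n * _ ≤ n * ∫ x, A.indicator (fun _ => ε₁ / C) x ∂μ := by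
            gcongr
            exact norm_integral_le_of_norm_le ((integrable_const _).indicator hAm)
              (Eventually.of_forall hb)
        _ = (n * μ.real A) * (ε₁ / C) := by
            rw [integral_indicator hAm, setIntegral_const, smul_eq_mul]; ring
        _ ≤ C * (ε₁ / C) := by gcongr
        _ = ε₁ := by field_simp
    · refine Integrable.of_bound (hcm.mul hFm).aestronglyMeasurable 2
        (Eventually.of_forall fun x => ?_)
      rw [norm_mul, norm_mul, norm_futureProduct, norm_cis, mul_one, mul_one]
      exact norm_cis_sub_one_le _
    · refine Integrable.of_bound (hhm.mul hFm).aestronglyMeasurable 2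
        (Eventually.of_forall fun x => ?_)
      rw [norm_mul, norm_futureProduct, mul_one]
      exact hh2 x
  -- The first mark decorrelates from the future after the gap.
  have s3 : n * ‖I₂ - (∫ x, h x ∂μ) * w (k + t)‖ ≤ 2 * ε₁ := by
    have h1 := (hun s).2 t ht1 _ (hwm (k + t)) (fun x => (norm_futureProduct _ _).le)
    linarith
  have hIh : n * ‖∫ x, h x ∂μ‖ ≤ 2 * C := by
    have h1 : ‖∫ x, h x ∂μ‖ ≤ ∫ x, A.indicator (fun _ => (2 : ℝ)) x ∂μ := by
      refine norm_integral_le_of_norm_le ((integrable_const _).indicator hAm)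
        (Eventually.of_forall fun x => ?_)
      by_cases hx : x ∈ A
      · rw [indicator_of_mem hx]; exact hh2 x
      · rw [indicator_of_notMem hx, hhA x hx, norm_zero]
    rw [integral_indicator hAm, setIntegral_const, smul_eq_mul] at h1
    nlinarith
  -- The integral of h is already O(1/n), so it is enough that w changes little over the gap.
  have s4 : n * ‖(∫ x, h x ∂μ) * w (k + t) - (∫ x, h x ∂μ) * w (k + 1)‖ ≤ ε₁ := by
    have h1 := norm_integral_futureProduct_shift_le hT hfm hfN hAm hfA (k + 1) (t - 1)
    have e : k + 1 + (t - 1) = k + t := by omega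
    rw [e] at h1
    have h2 : ((t - 1 : ℕ) : ℝ) ≤ t := by exact_mod_cast Nat.sub_le _ _
    have h3 : ‖w (k + t) - w (k + 1)‖ ≤ 2 * (4 * κ * C) := by
      refine h1.trans ?_
      calc 2 * ((t - 1 : ℕ) : ℝ) * μ.real A ≤ 2 * t * μ.real A := by gcongr
        _ = 2 * (t * μ.real A) := by ring
        _ ≤ _ := by gcongr
    rw [← mul_sub, norm_mul, ← mul_assoc]
    calc _ ≤ 2 * C * (2 * (4 * κ * C)) := mul_le_mul hIh h3 (norm_nonneg _) (by positivity)
      _ = ε₁ / 4 := by rw [hκ]; field_simp; norm_num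
      _ ≤ ε₁ := by linarith
  have hsk : ((s : ℝ≥0) : ℝ) = k / n := by rw [hs]; push_cast; rfl
  have s5 : ‖n * ((∫ x, h x ∂μ) * w (k + 1)) - c (k / n) * w (k + 1)‖ ≤ 2 * ε₁ := by
    have h1 := (hun s).1
    have h2 := hQlim s
    rw [hsk] at h2
    rw [← mul_assoc, ← sub_mul, norm_mul]
    have h3 : ‖(n : ℂ) * ∫ x, h x ∂μ - c (k / n)‖ ≤ 2 * ε₁ := by
      have := norm_sub_le_norm_sub_add_norm_sub ((n : ℂ) * ∫ x, h x ∂μ)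
        (∫ y, returnFun F R g Q s y ∂ν) (c (k / n))
      linarith
    calc _ ≤ 2 * ε₁ * 1 := mul_le_mul h3 (hw1 _) (norm_nonneg _) (by positivity)
      _ = _ := mul_one _
  have s6 : ‖n * ((Complex.exp (c (k / n) / n) - 1) * w (k + 1)) - c (k / n) * w (k + 1)‖ ≤ ε₁ := by
    have hkM : (k : ℝ) / n ∈ Icc (0 : ℝ) M := by
      refine ⟨by positivity, ?_⟩
      rw [div_le_iff₀ hn0]; exact_mod_cast hk.le
    have hcB : ‖c (k / n)‖ ≤ B := (hBc _ hkM).trans (le_max_left _ _)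
    have hz : ‖c (k / n) / n‖ ≤ B / n := by
      rw [norm_div, Complex.norm_natCast]; gcongr
    have hBn : B / n ≤ 1 := by
      rw [div_le_one hn0]
      have : 0 ≤ B ^ 2 / ε₁ + 1 / κ := by positivity
      linarith
    have h1 := Complex.norm_exp_sub_one_sub_id_le (hz.trans hBn)
    have e : n * ((Complex.exp (c (k / n) / n) - 1) * w (k + 1)) - c (k / n) * w (k + 1) =
        n * (Complex.exp (c (k / n) / n) - 1 - c (k / n) / n) * w (k + 1) := by
      have : (n : ℂ) ≠ 0 := by exact_mod_cast hn0.ne'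
      field_simp
    rw [e, norm_mul, norm_mul, Complex.norm_natCast]
    calc _ ≤ n * (B / n) ^ 2 * 1 := by
          refine mul_le_mul ?_ (hw1 _) (norm_nonneg _) (by positivity)
          gcongr
          exact h1.trans (by gcongr)
      _ = B ^ 2 / n := by field_simp
      _ ≤ ε₁ := by
          rw [div_le_iff₀ hn0]
          have : B ^ 2 / ε₁ ≤ n := by
            have : 0 ≤ 1 / κ := by positivity
            linarith
          rw [div_le_iff₀ hε₁0] at this
          linarith
  have hfin : n * ‖w k - Complex.exp (c (k / n) / n) * w (k + 1)‖ ≤ ε := by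
    have e : (n : ℂ) * (w k - Complex.exp (c (k / n) / n) * w (k + 1)) =
        n * (w k - w (k + 1) - I₁) + n * (I₁ - I₂) + n * (I₂ - (∫ x, h x ∂μ) * w (k + t)) +
        n * ((∫ x, h x ∂μ) * w (k + t) - (∫ x, h x ∂μ) * w (k + 1)) +
        (n * ((∫ x, h x ∂μ) * w (k + 1)) - c (k / n) * w (k + 1)) -
        (n * ((Complex.exp (c (k / n) / n) - 1) * w (k + 1)) - c (k / n) * w (k + 1)) := by ring
    have hnorm : ∀ z : ℂ, ‖(n : ℂ) * z‖ = n * ‖z‖ := fun z => by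
      rw [norm_mul, Complex.norm_natCast]
    rw [← hnorm, e]
    refine (norm_sub_le _ _).trans ?_
    refine (add_le_add_left (norm_add_le _ _) _).trans ?_
    refine (add_le_add_left (add_le_add_left (norm_add_le _ _) _) _).trans ?_
    refine (add_le_add_left (add_le_add_left (add_le_add_left norm_add₃_le _) _) _).trans ?_
    simp only [hnorm]
    linarith
  rw [le_div_iff₀ hn0]
  linarith

/-- Convergence of the characteristic functionals of the empirical processes of rare marks. -/
theorem RareMarks.tendsto_charFunctional (hT : MeasurePreserving T μ μ) (hρs : Summable ρ)
    (hρ : ∀ n, 0 ≤ ρ n) (hY : RareMarks μ T ρ ν dom Y R g) (F : C_c(ℝ≥0 × S, ℝ)) {M : ℕ}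
    (hM : ∀ (t : ℝ≥0) y, (M : ℝ≥0) ≤ t → F (t, y) = 0) {c : ℝ → ℂ} (hc : Continuous c)
    (hre : ∀ s, (c s).re ≤ 0)
    (hlim : ∀ ε : ℝ, 0 < ε → ∀ᶠ Q : ℕ in atTop, ∀ s : ℝ≥0,
      ‖∫ y, returnFun F R g Q s y ∂ν - c s‖ ≤ ε) :
    Tendsto (fun n => ∫ x, cis (∫ y, F y ∂(empiricalMarks T (dom n) (Y n) n x).1) ∂μ) atTop
      (𝓝 (Complex.exp (∫ s in (0 : ℝ)..M, c s))) := by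
  classical
  have hexp := (Complex.continuous_exp.tendsto _).comp (tendsto_riemann_sum hc M)
  refine tendsto_of_tendsto_of_dist hexp ?_
  rw [Metric.tendsto_nhds]
  intro ε hε
  -- There are Mn steps, each with error ε/((M+1)n), which leaves a total below ε.
  filter_upwards [hY.step_estimate hT hρs hρ F hM hc hlim (ε := ε / (M + 1)) (by positivity),
    eventually_ge_atTop 1] with n hn hn1
  have hn0 : (0 : ℝ) < n := by exact_mod_cast hn1
  have hfN : ∀ j, M * n ≤ j → markSeq F (dom n) (Y n) n j = 0 := by
    intro j hj
    ext x
    rw [markSeq, Pi.zero_apply, indicator_apply_eq_zero]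
    intro _
    refine hM _ _ ?_
    rw [le_div_iff₀ (by exact_mod_cast hn0)]
    exact_mod_cast hj
  have hre' : ∀ k : ℕ, (c (k / n) / n).re ≤ 0 := fun k => by
    rw [Complex.div_natCast_re]
    exact div_nonpos_of_nonpos_of_nonneg (hre _) hn0.le
  have h := norm_sub_exp_sum_le (N := M * n)
    (w := fun k => ∫ x, futureProduct T (markSeq F (dom n) (Y n) n) (M * n) k x ∂μ)
    (by simp [futureProduct_end hfN]) hre' hn
  have e : ∫ x, cis (∫ y, F y ∂(empiricalMarks T (dom n) (Y n) n x).1) ∂μ =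
      ∫ x, futureProduct T (markSeq F (dom n) (Y n) n) (M * n) 0 x ∂μ := by
    congr 1
    ext x
    rw [integral_empiricalMarks T (dom n) (Y n) hn1 F hM x]
    unfold futureProduct markSeq
    simp only [zero_add, indicator_apply]
  rw [dist_zero_right, Real.norm_of_nonneg dist_nonneg, dist_comm, dist_eq_norm, e]
  refine h.trans_lt ?_
  push_cast
  have : (M : ℝ) * n * (ε / (M + 1) / n) = ε * (M / (M + 1)) := by field_simp
  rw [this]
  have h1 : (M : ℝ) / (M + 1) < 1 := by rw [div_lt_one (by positivity)]; linarith
  nlinarith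

end CharFunctional

/-! ### Characteristic functionals of Poisson cluster processes -/

section Independence

variable {Ω : Type*} [MeasurableSpace Ω] {P : Measure Ω} [IsProbabilityMeasure P]

/-- Rectangles form a π-system generating the σ-algebra of each pair. On rectangles, independence of
the two whole families separates the f-part from the g-part, and each part then factorises. -/
lemma iIndepFun_prodMk {ι β γ : Type*} [MeasurableSpace β] [MeasurableSpace γ] {f : ι → Ω → β}
    {g : ι → Ω → γ} (hfm : ∀ i, Measurable (f i)) (hgm : ∀ i, Measurable (g i))
    (hf : iIndepFun f P) (hg : iIndepFun g P)
    (hfg : IndepFun (fun ω i => f i ω) (fun ω i => g i ω) P) :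
    iIndepFun (fun i ω => (f i ω, g i ω)) P := by
  classical
  rw [iIndepFun_iff_iIndep]
  refine iIndepSets.iIndep (fun i => ((hfm i).prodMk (hgm i)).comap_le)
    (fun i => {s | ∃ a b, MeasurableSet a ∧ MeasurableSet b ∧ s = f i ⁻¹' a ∩ g i ⁻¹' b}) ?_ ?_ ?_
  · rintro i _ ⟨a, b, ha, hb, rfl⟩ _ ⟨a', b', ha', hb', rfl⟩ -
    refine ⟨a ∩ a', b ∩ b', ha.inter ha', hb.inter hb', ?_⟩
    rw [preimage_inter, preimage_inter, inter_inter_inter_comm]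
  · intro i
    rw [← generateFrom_prod, MeasurableSpace.comap_generateFrom]
    congr 1
    ext s
    constructor
    · rintro ⟨_, ⟨a, ha, b, hb, rfl⟩, rfl⟩
      exact ⟨a, b, ha, hb, rfl⟩
    · rintro ⟨a, b, ha, hb, rfl⟩
      exact ⟨a ×ˢ b, ⟨a, ha, b, hb, rfl⟩, rfl⟩
  · rw [iIndepSets_iff]
    intro s F hF
    have hF' : ∀ i, ∃ a b, MeasurableSet a ∧ MeasurableSet b ∧
        (i ∈ s → F i = f i ⁻¹' a ∩ g i ⁻¹' b) := by
      intro i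
      by_cases hi : i ∈ s
      · obtain ⟨a, b, ha, hb, h⟩ := hF i hi
        exact ⟨a, b, ha, hb, fun _ => h⟩
      · exact ⟨univ, univ, .univ, .univ, fun h => absurd h hi⟩
    choose a b ha hb hab using hF'
    have e1 : (⋂ i ∈ s, F i) = (fun ω i => f i ω) ⁻¹' {y | ∀ i ∈ s, y i ∈ a i} ∩
        (fun ω i => g i ω) ⁻¹' {y | ∀ i ∈ s, y i ∈ b i} := by
      ext ω
      simp only [mem_iInter, mem_inter_iff, mem_preimage, mem_ofPred_eq]
      constructor
      · intro h
        refine ⟨fun i hi => ?_, fun i hi => ?_⟩ <;>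
        · have := h i hi
          rw [hab i hi] at this
          first | exact this.1 | exact this.2
      · intro h i hi
        rw [hab i hi]
        exact ⟨h.1 i hi, h.2 i hi⟩
    have hA : MeasurableSet {y : ι → β | ∀ i ∈ s, y i ∈ a i} := by
      have : {y : ι → β | ∀ i ∈ s, y i ∈ a i} = ⋂ i ∈ s, (fun y => y i) ⁻¹' a i := by
        ext y; simp
      rw [this]
      exact Finset.measurableSet_biInter _ fun i _ => measurable_pi_apply i (ha i)
    have hB : MeasurableSet {y : ι → γ | ∀ i ∈ s, y i ∈ b i} := by
      have : {y : ι → γ | ∀ i ∈ s, y i ∈ b i} = ⋂ i ∈ s, (fun y => y i) ⁻¹' b i := by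
        ext y; simp
      rw [this]
      exact Finset.measurableSet_biInter _ fun i _ => measurable_pi_apply i (hb i)
    rw [e1, hfg.measure_inter_preimage_eq_mul _ _ hA hB]
    have e2 : (fun ω i => f i ω) ⁻¹' {y | ∀ i ∈ s, y i ∈ a i} = ⋂ i ∈ s, f i ⁻¹' a i := by
      ext ω; simp
    have e3 : (fun ω i => g i ω) ⁻¹' {y | ∀ i ∈ s, y i ∈ b i} = ⋂ i ∈ s, g i ⁻¹' b i := by
      ext ω; simp
    rw [e2, e3, hf.measure_inter_preimage_eq_mul _ (fun i _ => ha i),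
      hg.measure_inter_preimage_eq_mul _ (fun i _ => hb i), ← Finset.prod_mul_distrib]
    refine Finset.prod_congr rfl fun i hi => ?_
    have hi2 : IndepFun (f i) (g i) P := hfg.comp (measurable_pi_apply i) (measurable_pi_apply i)
    rw [hab i hi, hi2.measure_inter_preimage_eq_mul _ _ (ha i) (hb i)]

end Independence

/-! ### Exponential waiting times and the renewal equation -/

section Exponential

lemma integral_expMeasure {r : ℝ} (hr : 0 < r) (ψ : ℝ → ℂ) :
    ∫ t, ψ t ∂(expMeasure r) = ∫ t in Ioi 0, (r * Real.exp (-(r * t)) : ℝ) * ψ t := by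
  have hpdf : Measurable (exponentialPDFReal r) := measurable_exponentialPDFReal r
  have e : expMeasure r = volume.withDensity (fun x => ENNReal.ofReal (exponentialPDFReal r x)) := rfl
  rw [e, integral_withDensity_eq_integral_toReal_smul hpdf.ennreal_ofReal
    (Eventually.of_forall fun x => ENNReal.ofReal_lt_top)]
  have e2 : (fun x => (ENNReal.ofReal (exponentialPDFReal r x)).toReal • ψ x) =
      (Ici 0).indicator (fun t => ((r * Real.exp (-(r * t)) : ℝ) : ℂ) * ψ t) := by
    ext x
    rw [ENNReal.toReal_ofReal (exponentialPDFReal_nonneg hr x)]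
    by_cases hx : 0 ≤ x
    · rw [indicator_of_mem (show x ∈ Ici 0 from hx)]
      simp [exponentialPDFReal, gammaPDFReal, hx]
    · rw [indicator_of_notMem (show x ∉ Ici 0 from hx)]
      simp [exponentialPDFReal, gammaPDFReal, hx]
  rw [e2, integral_indicator measurableSet_Ici, integral_Ici_eq_integral_Ioi]

lemma expMeasure_Iic_zero {r : ℝ} : expMeasure r (Iic 0) = 0 := by
  have e : expMeasure r = volume.withDensity (exponentialPDF r) := rfl
  rw [e, withDensity_apply _ measurableSet_Iic]
  rw [← setLIntegral_congr Iio_ae_eq_Iic]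
  exact lintegral_exponentialPDF_of_nonpos le_rfl

/-- The conditional expectation of the product over the arrivals after time `s`. -/
def renewalFun (r : ℝ) (M : ℝ) (γ : ℝ → ℂ) (s : ℝ) : ℂ :=
  Complex.exp (r * ∫ t in s..M, (γ t - 1))

variable {r M : ℝ} {γ : ℝ → ℂ}

/-- This differential equation turns the renewal equation below into an instance of the fundamental
theorem of calculus. -/
lemma hasDerivAt_renewalFun (hγ : Continuous γ) (s : ℝ) :
    HasDerivAt (renewalFun r M γ) (-(r * (γ s - 1)) * renewalFun r M γ s) s := by
  have h1 : HasDerivAt (fun s => ∫ t in s..M, (γ t - 1)) (-(γ s - 1)) s :=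
    intervalIntegral.integral_hasDerivAt_left ((hγ.sub continuous_const).intervalIntegrable _ _)
      (hγ.sub continuous_const).stronglyMeasurable.stronglyMeasurableAtFilter
      (hγ.sub continuous_const).continuousAt
  have h2 := (h1.const_mul (r : ℂ)).cexp
  unfold renewalFun
  convert h2 using 1
  ring

lemma continuous_renewalFun (hγ : Continuous γ) : Continuous (renewalFun r M γ) :=
  continuous_iff_continuousAt.2 fun s => (hasDerivAt_renewalFun hγ s).continuousAt

lemma renewalFun_of_le (hM : ∀ t, M ≤ t → γ t = 1) {s : ℝ} (hs : M ≤ s) :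
    renewalFun r M γ s = 1 := by
  unfold renewalFun
  rw [intervalIntegral.integral_symm, intervalIntegral.integral_of_le hs,
    setIntegral_eq_zero_of_forall_eq_zero fun t ht => by rw [hM t ht.1.le, sub_self]]
  simp

lemma norm_renewalFun_le (hr : 0 ≤ r) (hγ : Continuous γ) (hγ1 : ∀ t, ‖γ t‖ ≤ 1)
    (hM : ∀ t, M ≤ t → γ t = 1) (s : ℝ) : ‖renewalFun r M γ s‖ ≤ 1 := by
  rcases le_total M s with hs | hs
  · rw [renewalFun_of_le hM hs, norm_one]
  · unfold renewalFun
    rw [Complex.norm_exp, Real.exp_le_one_iff, Complex.re_ofReal_mul]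
    refine mul_nonpos_of_nonneg_of_nonpos hr ?_
    have hi : IntervalIntegrable (fun t => γ t - 1) volume s M :=
      (hγ.sub continuous_const).intervalIntegrable _ _
    rw [intervalIntegral.integral_of_le hs]
    have := Complex.reCLM.integral_comp_comm hi.1
    simp only [Complex.reCLM_apply] at this
    rw [← this]
    refine integral_nonpos fun t => ?_
    simp only [Complex.sub_re, Complex.one_re, Pi.zero_apply]
    linarith [(Complex.re_le_norm (γ t)).trans (hγ1 t)]

/-- The renewal equation. -/
lemma integral_expMeasure_renewalFun (hr : 0 < r) (hγ : Continuous γ) (hγ1 : ∀ t, ‖γ t‖ ≤ 1)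
    (hM : ∀ t, M ≤ t → γ t = 1) (s : ℝ) :
    ∫ t, γ (s + t) * renewalFun r M γ (s + t) ∂(expMeasure r) = renewalFun r M γ s := by
  rw [integral_expMeasure hr]
  have hb := norm_renewalFun_le hr.le hγ hγ1 hM
  have hc := continuous_renewalFun (r := r) (M := M) hγ
  -- The integrand is exactly the derivative of `e`: differentiating the exponential gives the term
  -- with 1, differentiating the renewal function the term with γ - 1.
  let e : ℝ → ℂ := fun t => -((Real.exp (-(r * t)) : ℝ) : ℂ) * renewalFun r M γ (s + t)
  have hexp : ∀ t : ℝ, HasDerivAt (fun t : ℝ => ((Real.exp (-(r * t)) : ℝ) : ℂ))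
      ((-(r * Real.exp (-(r * t))) : ℝ) : ℂ) t := by
    intro t
    have h1 : HasDerivAt (fun t : ℝ => Real.exp (-(r * t))) (-(r * Real.exp (-(r * t)))) t := by
      have h0 : HasDerivAt (fun t : ℝ => -(r * t)) (-r) t := by
        simpa using (hasDerivAt_id' t).const_mul (-r)
      convert h0.exp using 1
      ring
    exact h1.ofReal_comp
  have hder : ∀ t ∈ Ici (0 : ℝ), HasDerivAt e
      ((r * Real.exp (-(r * t)) : ℝ) * (γ (s + t) * renewalFun r M γ (s + t))) t := by
    intro t _
    have h2 := (hasDerivAt_renewalFun (r := r) (M := M) hγ (s + t)).comp_const_add s t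
    have h3 : HasDerivAt e (-((-(r * Real.exp (-(r * t))) : ℝ) : ℂ) * renewalFun r M γ (s + t) +
        -((Real.exp (-(r * t)) : ℝ) : ℂ) *
          (-(r * (γ (s + t) - 1)) * renewalFun r M γ (s + t))) t := (hexp t).neg.mul h2
    refine h3.congr_deriv ?_
    push_cast
    ring
  have hint : IntegrableOn (fun t => ((r * Real.exp (-(r * t)) : ℝ) : ℂ) *
      (γ (s + t) * renewalFun r M γ (s + t))) (Ioi 0) := by
    have h1 : IntegrableOn (fun t => r * Real.exp (-(r * t))) (Ioi 0) := by
      have := (integrableOn_exp_mul_Ioi (neg_lt_zero.2 hr) 0).const_mul r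
      simpa [neg_mul, IntegrableOn] using this
    refine Integrable.mono' h1 ?_ (Eventually.of_forall fun t => ?_)
    · exact Continuous.aestronglyMeasurable (by fun_prop)
    · rw [norm_mul, norm_mul, Complex.norm_real, Real.norm_of_nonneg (by positivity)]
      have := mul_le_one₀ (hγ1 (s + t)) (norm_nonneg _) (hb (s + t))
      have h0 : 0 ≤ r * Real.exp (-(r * t)) := by positivity
      nlinarith
  have hlim : Tendsto e atTop (𝓝 0) := by
    have h1 : Tendsto (fun t : ℝ => Real.exp (-(r * t))) atTop (𝓝 0) := by
      refine Real.tendsto_exp_atBot.comp (tendsto_neg_atTop_atBot.comp ?_)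
      exact tendsto_id.const_mul_atTop hr
    refine squeeze_zero_norm (fun t => ?_) h1
    rw [norm_mul, norm_neg, Complex.norm_real, Real.norm_of_nonneg (by positivity)]
    have h0 : 0 ≤ Real.exp (-(r * t)) := by positivity
    nlinarith [hb (s + t)]
  rw [integral_Ioi_of_hasDerivAt_of_tendsto' hder hint hlim]
  simp [e]

end Exponential

/-! ### Products over the arrivals of a marked array -/

section MarkedArrays

variable {Ω : Type*} [MeasurableSpace Ω] {P : Measure Ω} [IsProbabilityMeasure P]
  {S : Type*} [MeasurableSpace S]

/-- Independent arrays of exponential waiting times of rates `r i` and of marks of laws `νs i`. -/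
structure MarkedArray (P : Measure Ω) (r : ℕ → ℝ) (νs : ℕ → Measure S) (τ : ℕ → ℕ → Ω → ℝ)
    (V : ℕ → ℕ → Ω → S) : Prop where
  pos : ∀ i, 0 < r i
  measurable_time : ∀ i j, Measurable (τ i j)
  measurable_mark : ∀ i j, Measurable (V i j)
  law_time : ∀ i j, P.map (τ i j) = expMeasure (r i)
  law_mark : ∀ i j, P.map (V i j) = νs i
  indep_pair : ∀ i j, IndepFun (τ i j) (V i j) P
  indep : iIndepFun (fun (k : ℕ × ℕ) ω => (τ k.1 k.2 ω, V k.1 k.2 ω)) P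

/-- The pair (τ, V) is independent of the past (A, s). Integrating out the mark replaces G by γ, and
integrating out the waiting time is the renewal equation: one more arrival leaves the integral
unchanged. -/
lemma integral_renewal_step {τ : Ω → ℝ} {V : Ω → S} (hτ : Measurable τ) (hV : Measurable V)
    (hτV : IndepFun τ V P) {r : ℝ} (hr : 0 < r) (hτr : P.map τ = expMeasure r) {A : Ω → ℂ}
    {s : Ω → ℝ} (hA : Measurable A) (hs : Measurable s) (hA1 : ∀ ω, ‖A ω‖ ≤ 1)
    (hind : IndepFun (fun ω => (A ω, s ω)) (fun ω => (τ ω, V ω)) P) {G : ℝ → S → ℂ}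
    (hG : Measurable (Function.uncurry G)) (hG1 : ∀ t v, ‖G t v‖ ≤ 1) {γ : ℝ → ℂ}
    (hγ : Continuous γ) (hGγ : ∀ t, ∫ v, G t v ∂(P.map V) = γ t) {M : ℝ}
    (hM : ∀ t, M ≤ t → γ t = 1) :
    ∫ ω, A ω * (G (s ω + τ ω) (V ω) * renewalFun r M γ (s ω + τ ω)) ∂P =
      ∫ ω, A ω * renewalFun r M γ (s ω) ∂P := by
  have hPV : IsProbabilityMeasure (P.map V) := Measure.isProbabilityMeasure_map hV.aemeasurable
  have hPτ : IsProbabilityMeasure (P.map τ) := Measure.isProbabilityMeasure_map hτ.aemeasurable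
  have hγ1 : ∀ t, ‖γ t‖ ≤ 1 := fun t => by
    rw [← hGγ]
    simpa using norm_integral_le_of_norm_le_const (μ := P.map V)
      (Eventually.of_forall fun v => hG1 t v)
  have hcont := continuous_renewalFun (r := r) (M := M) hγ
  have hb := norm_renewalFun_le hr.le hγ hγ1 hM
  let Ψ : (ℂ × ℝ) × (ℝ × S) → ℂ := fun p =>
    p.1.1 * (G (p.1.2 + p.2.1) p.2.2 * renewalFun r M γ (p.1.2 + p.2.1))
  have hGc : Measurable fun p : (ℂ × ℝ) × (ℝ × S) => G (p.1.2 + p.2.1) p.2.2 :=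
    hG.comp (((measurable_snd.comp measurable_fst).add (measurable_fst.comp measurable_snd)).prodMk
      (measurable_snd.comp measurable_snd))
  have hΨ : Measurable Ψ := (measurable_fst.comp measurable_fst).mul (hGc.mul
    (hcont.measurable.comp ((measurable_snd.comp measurable_fst).add
      (measurable_fst.comp measurable_snd))))
  have hAs : Measurable fun ω => (A ω, s ω) := hA.prodMk hs
  have hτVm : Measurable fun ω => (τ ω, V ω) := hτ.prodMk hV
  have hprod := hind.map_prod_eq_prod_map_map hAs.aemeasurable hτVm.aemeasurable
  have hprod2 := hτV.map_prod_eq_prod_map_map hτ.aemeasurable hV.aemeasurable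
  have hP1 : IsProbabilityMeasure (P.map fun ω => (A ω, s ω)) :=
    Measure.isProbabilityMeasure_map hAs.aemeasurable
  have hGR : ∀ a b v, ‖G a v * renewalFun r M γ b‖ ≤ 1 := fun a b v => by
    rw [norm_mul]; exact mul_le_one₀ (hG1 _ _) (norm_nonneg _) (hb _)
  have hint : Integrable Ψ ((P.map fun ω => (A ω, s ω)).prod (P.map fun ω => (τ ω, V ω))) := by
    rw [← hprod, integrable_map_measure hΨ.aestronglyMeasurable (hAs.prodMk hτVm).aemeasurable]
    refine Integrable.of_bound (hΨ.comp (hAs.prodMk hτVm)).aestronglyMeasurable 1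
      (Eventually.of_forall fun ω => ?_)
    simp only [Function.comp_apply, Ψ]
    rw [norm_mul]
    exact mul_le_one₀ (hA1 ω) (norm_nonneg _) (hGR _ _ _)
  have e1 : ∫ ω, A ω * (G (s ω + τ ω) (V ω) * renewalFun r M γ (s ω + τ ω)) ∂P =
      ∫ p, Ψ p ∂((P.map fun ω => (A ω, s ω)).prod (P.map fun ω => (τ ω, V ω))) := by
    rw [← hprod, integral_map (hAs.prodMk hτVm).aemeasurable hΨ.aestronglyMeasurable]
  have e2 : ∀ x : ℂ × ℝ, ∫ z, Ψ (x, z) ∂(P.map fun ω => (τ ω, V ω)) =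
      x.1 * renewalFun r M γ x.2 := by
    intro x
    simp only [Ψ]
    rw [integral_const_mul, hprod2]
    congr 1
    have hm : Measurable fun z : ℝ × S => G (x.2 + z.1) z.2 * renewalFun r M γ (x.2 + z.1) :=
      (hG.comp ((measurable_const.add measurable_fst).prodMk measurable_snd)).mul
        (hcont.measurable.comp (measurable_const.add measurable_fst))
    rw [integral_prod _ (Integrable.of_bound hm.aestronglyMeasurable 1
      (Eventually.of_forall fun z => hGR _ _ _))]
    simp only [integral_mul_const, hGγ]
    rw [hτr, integral_expMeasure_renewalFun hr hγ hγ1 hM]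
  rw [e1, integral_prod _ hint]
  simp only [e2]
  have hm : Measurable fun x : ℂ × ℝ => x.1 * renewalFun r M γ x.2 :=
    measurable_fst.mul (hcont.measurable.comp measurable_snd)
  rw [integral_map hAs.aemeasurable hm.aestronglyMeasurable]

variable {r : ℕ → ℝ} {νs : ℕ → Measure S} {τ : ℕ → ℕ → Ω → ℝ} {V : ℕ → ℕ → Ω → S}

/-- The `σ`-algebra generated by the entries with indices in a set. -/
abbrev arraySigma (τ : ℕ → ℕ → Ω → ℝ) (V : ℕ → ℕ → Ω → S) (s : Set (ℕ × ℕ)) : MeasurableSpace Ω :=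
  ⨆ k ∈ s, MeasurableSpace.comap (fun ω => (τ k.1 k.2 ω, V k.1 k.2 ω)) inferInstance

/-- The indices before `(I, n)` in the lexicographic order. -/
def indicesBefore (I n : ℕ) : Set (ℕ × ℕ) := {k | k.1 < I ∨ k.1 = I ∧ k.2 < n}

lemma arraySigma_mono {s t : Set (ℕ × ℕ)} (h : s ⊆ t) : arraySigma τ V s ≤ arraySigma τ V t :=
  biSup_mono h

lemma measurable_pair_arraySigma {s : Set (ℕ × ℕ)} {k : ℕ × ℕ} (hk : k ∈ s) :
    Measurable[arraySigma τ V s] fun ω => (τ k.1 k.2 ω, V k.1 k.2 ω) :=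
  (comap_measurable _).mono (le_iSup₂ (f := fun k (_ : k ∈ s) => MeasurableSpace.comap
    (fun ω => (τ k.1 k.2 ω, V k.1 k.2 ω)) inferInstance) k hk) le_rfl

lemma MarkedArray.arraySigma_le (h : MarkedArray P r νs τ V) (s : Set (ℕ × ℕ)) :
    arraySigma τ V s ≤ ‹MeasurableSpace Ω› :=
  iSup₂_le fun _ _ => ((h.measurable_time _ _).prodMk (h.measurable_mark _ _)).comap_le

/-- The sum of the first `n` waiting times. -/
def arrival (τ : ℕ → ℕ → Ω → ℝ) (i n : ℕ) (ω : Ω) : ℝ := ∑ l ∈ Finset.range n, τ i l ω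

lemma measurable_arrival_arraySigma {s : Set (ℕ × ℕ)} {i n : ℕ} (hs : ∀ j < n, (i, j) ∈ s) :
    Measurable[arraySigma τ V s] (arrival τ i n) :=
  Finset.measurable_fun_sum _ fun l hl => measurable_fst.comp
    (measurable_pair_arraySigma (τ := τ) (V := V) (hs l (Finset.mem_range.1 hl)))

lemma MarkedArray.measurable_arrival (h : MarkedArray P r νs τ V) (i n : ℕ) :
    Measurable (arrival τ i n) :=
  Finset.measurable_fun_sum _ fun l _ => h.measurable_time i l

variable {G : ℝ → S → ℂ} {γ : ℕ → ℝ → ℂ} {M : ℝ}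

/-- The product over the first `n` arrivals in row `i`. -/
def rowProduct (τ : ℕ → ℕ → Ω → ℝ) (V : ℕ → ℕ → Ω → S) (G : ℝ → S → ℂ) (i n : ℕ) (ω : Ω) : ℂ :=
  ∏ j ∈ Finset.range n, G (arrival τ i (j + 1) ω) (V i j ω)

lemma norm_rowProduct_le (hG1 : ∀ t v, ‖G t v‖ ≤ 1) (i n : ℕ) (ω : Ω) :
    ‖rowProduct τ V G i n ω‖ ≤ 1 := by
  unfold rowProduct
  rw [norm_prod]
  exact Finset.prod_le_one (fun _ _ => norm_nonneg _) fun _ _ => hG1 _ _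

lemma measurable_rowProduct_arraySigma (hG : Measurable (Function.uncurry G)) {s : Set (ℕ × ℕ)}
    {i n : ℕ} (hs : ∀ j < n, (i, j) ∈ s) :
    Measurable[arraySigma τ V s] (rowProduct τ V G i n) := by
  refine Finset.measurable_fun_prod _ fun j hj => ?_
  rw [Finset.mem_range] at hj
  exact hG.comp ((measurable_arrival_arraySigma fun l hl => hs l (by omega)).prodMk
    (measurable_snd.comp (measurable_pair_arraySigma (τ := τ) (V := V) (hs j hj))))

/-- The product over the first n arrivals times the conditional expectation of the rest has an
integral that does not depend on n. The factor A, measurable in the earlier rows, is carried along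
so that the rows can afterwards be treated one by one. -/
lemma MarkedArray.integral_row (h : MarkedArray P r νs τ V) (hG : Measurable (Function.uncurry G))
    (hG1 : ∀ t v, ‖G t v‖ ≤ 1) (hγ : ∀ i, Continuous (γ i))
    (hGγ : ∀ i t, ∫ v, G t v ∂(νs i) = γ i t) (hM : ∀ i t, M ≤ t → γ i t = 1) {I : ℕ}
    {A : Ω → ℂ} (hA : Measurable[arraySigma τ V (indicesBefore I 0)] A) (hA1 : ∀ ω, ‖A ω‖ ≤ 1)
    (n : ℕ) :
    ∫ ω, A ω * (rowProduct τ V G I n ω * renewalFun (r I) M (γ I) (arrival τ I n ω)) ∂P =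
      (∫ ω, A ω ∂P) * renewalFun (r I) M (γ I) 0 := by
  induction n with
  | zero => simp [rowProduct, arrival, integral_mul_const]
  | succ n ih =>
    rw [← ih]
    have hsub : ∀ j < n, (I, j) ∈ indicesBefore I n := fun j hj => Or.inr ⟨rfl, hj⟩
    have hAm : Measurable[arraySigma τ V (indicesBefore I n)] A :=
      hA.mono (arraySigma_mono fun k hk => by
        rcases hk with hk | hk
        · exact Or.inl hk
        · omega) le_rfl
    have hA' : Measurable[arraySigma τ V (indicesBefore I n)]
        (fun ω => A ω * rowProduct τ V G I n ω) :=
      hAm.mul (measurable_rowProduct_arraySigma hG hsub)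
    have hs' : Measurable[arraySigma τ V (indicesBefore I n)] (arrival τ I n) :=
      measurable_arrival_arraySigma hsub
    have hle := h.arraySigma_le (indicesBefore I n)
    have hdisj : Disjoint (indicesBefore I n) {(I, n)} := by
      rw [Set.disjoint_singleton_right]
      rintro (hk | hk)
      · simp at hk
      · simp at hk
    have hIndep := indep_iSup_of_disjoint
      (fun k : ℕ × ℕ => ((h.measurable_time k.1 k.2).prodMk (h.measurable_mark k.1 k.2)).comap_le)
      ((iIndepFun_iff_iIndep _ _ _).1 h.indep) hdisj
    -- All that has been accumulated depends only on entries before (I, n) in the lexicographic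
    -- order, hence is independent of the entry (I, n).
    have hind : IndepFun (fun ω => (A ω * rowProduct τ V G I n ω, arrival τ I n ω))
        (fun ω => (τ I n ω, V I n ω)) P := by
      rw [IndepFun_iff_Indep]
      refine indep_of_indep_of_le_left (indep_of_indep_of_le_right hIndep ?_) ?_
      · simp
      · exact (hA'.prodMk hs').comap_le
    have key := integral_renewal_step (h.measurable_time I n) (h.measurable_mark I n)
      (h.indep_pair I n) (h.pos I) (h.law_time I n) (hA'.mono hle le_rfl) (hs'.mono hle le_rfl)
      (fun ω => by
        rw [norm_mul]; exact mul_le_one₀ (hA1 ω) (norm_nonneg _) (norm_rowProduct_le hG1 _ _ _))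
      hind hG hG1 (hγ I) (fun t => by rw [h.law_mark]; exact hGγ I t) (hM I)
    simp only [mul_assoc] at key
    rw [← key]
    congr 1
    ext ω
    have e1 : arrival τ I (n + 1) ω = arrival τ I n ω + τ I n ω := Finset.sum_range_succ _ _
    have e2 : rowProduct τ V G I (n + 1) ω =
        rowProduct τ V G I n ω * G (arrival τ I (n + 1) ω) (V I n ω) := Finset.prod_range_succ _ _
    rw [e2, e1]
    ring

/-- Induction on the number of rows: the last row is integrated out by `MarkedArray.integral_row`
with the product of the earlier rows as the factor A. -/
lemma MarkedArray.integral_rows (h : MarkedArray P r νs τ V) (hG : Measurable (Function.uncurry G))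
    (hG1 : ∀ t v, ‖G t v‖ ≤ 1) (hγ : ∀ i, Continuous (γ i))
    (hGγ : ∀ i t, ∫ v, G t v ∂(νs i) = γ i t) (hM : ∀ i t, M ≤ t → γ i t = 1) (I n : ℕ) :
    ∫ ω, ∏ i ∈ Finset.range I,
        (rowProduct τ V G i n ω * renewalFun (r i) M (γ i) (arrival τ i n ω)) ∂P =
      ∏ i ∈ Finset.range I, renewalFun (r i) M (γ i) 0 := by
  have hγ1 : ∀ i t, ‖γ i t‖ ≤ 1 := fun i t => by
    have : IsProbabilityMeasure (νs i) := by
      rw [← h.law_mark i 0]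
      exact Measure.isProbabilityMeasure_map (h.measurable_mark i 0).aemeasurable
    rw [← hGγ]
    simpa using norm_integral_le_of_norm_le_const (μ := νs i)
      (Eventually.of_forall fun v => hG1 t v)
  induction I with
  | zero => simp
  | succ I ih =>
    simp only [Finset.prod_range_succ]
    rw [h.integral_row hG hG1 hγ hGγ hM _ _ n, ih]
    · refine Finset.measurable_fun_prod _ fun i hi => ?_
      have hi := Finset.mem_range.1 hi
      exact (measurable_rowProduct_arraySigma hG fun j _ => Or.inl hi).mul
        ((continuous_renewalFun (hγ i)).measurable.comp
          (measurable_arrival_arraySigma fun j _ => Or.inl hi))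
    · intro ω
      rw [norm_prod]
      refine Finset.prod_le_one (fun _ _ => norm_nonneg _) fun i _ => ?_
      rw [norm_mul]
      exact mul_le_one₀ (norm_rowProduct_le hG1 _ _ _) (norm_nonneg _)
        (norm_renewalFun_le (h.pos i).le (hγ i) (hγ1 i) (hM i) _)

/-- The arrival times tend to infinity. -/
lemma MarkedArray.ae_tendsto_arrival (h : MarkedArray P r νs τ V) :
    ∀ᵐ ω ∂P, ∀ i, Tendsto (fun n => arrival τ i n ω) atTop atTop := by
  rw [ae_all_iff]
  intro i
  -- By independence the expectation of exp(-arrival) after n steps is q^n with q < 1. These are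
  -- summable, so exp(-arrival) tends to 0 almost surely.
  set q : ℝ≥0∞ := ∫⁻ t, ENNReal.ofReal (Real.exp (-t)) ∂(expMeasure (r i)) with hq
  have hexpm : Measurable fun t : ℝ => ENNReal.ofReal (Real.exp (-t)) := by fun_prop
  have hprob := isProbabilityMeasure_expMeasure (h.pos i)
  have hposexp : ∀ᵐ t ∂(expMeasure (r i)), 0 < t := by
    rw [ae_iff]
    convert expMeasure_Iic_zero (r := r i) using 2
    ext t; simp
  have hq1 : q < 1 := by
    have h1 : q < ∫⁻ _, 1 ∂(expMeasure (r i)) := by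
      refine lintegral_strict_mono (IsProbabilityMeasure.ne_zero _) (by fun_prop) ?_ ?_
      · refine ne_of_lt (lt_of_le_of_lt (lintegral_mono_ae (g := fun _ => 1) ?_) (by simp))
        filter_upwards [hposexp] with t ht
        rw [ENNReal.ofReal_le_one]
        exact Real.exp_le_one_iff.2 (by linarith)
      · filter_upwards [hposexp] with t ht
        rw [ENNReal.ofReal_lt_one]
        exact Real.exp_lt_one_iff.2 (by linarith)
    simpa using h1
  have hindep : iIndepFun (fun j => τ i j) P := by
    have h1 := h.indep.precomp (g := fun j : ℕ => (i, j)) (fun a b hab => (Prod.mk.inj hab).2)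
    exact h1.comp (fun _ => Prod.fst) fun _ => measurable_fst
  have hE : ∀ n, ∫⁻ ω, ENNReal.ofReal (Real.exp (-arrival τ i n ω)) ∂P = q ^ n := by
    intro n
    have e1 : ∀ ω, ENNReal.ofReal (Real.exp (-arrival τ i n ω)) =
        ∏ j ∈ Finset.range n, ENNReal.ofReal (Real.exp (-τ i j ω)) := by
      intro ω
      rw [arrival, ← Finset.sum_neg_distrib, Real.exp_sum,
        ENNReal.ofReal_prod_of_nonneg fun _ _ => (Real.exp_pos _).le]
    simp only [e1]
    clear e1
    have hm : ∀ j, Measurable fun ω => ENNReal.ofReal (Real.exp (-τ i j ω)) :=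
      fun j => hexpm.comp (h.measurable_time i j)
    have h2 : iIndepFun (fun j ω => ENNReal.ofReal (Real.exp (-τ i j ω))) P :=
      hindep.comp (fun _ t => ENNReal.ofReal (Real.exp (-t))) fun _ => hexpm
    induction n with
    | zero => simp
    | succ n ih =>
      simp only [Finset.prod_range_succ]
      have h3 : IndepFun (∏ j ∈ Finset.range n, fun ω => ENNReal.ofReal (Real.exp (-τ i j ω)))
          (fun ω => ENNReal.ofReal (Real.exp (-τ i n ω))) P :=
        h2.indepFun_finsetProd_of_notMem hm (by simp)
      have hm2 : Measurable (∏ j ∈ Finset.range n, fun ω => ENNReal.ofReal (Real.exp (-τ i j ω))) :=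
        (Finset.prod_fn (Finset.range n) fun j ω => ENNReal.ofReal (Real.exp (-τ i j ω))) ▸
          Finset.measurable_fun_prod _ fun j _ => hm j
      have h4 := lintegral_mul_eq_lintegral_mul_lintegral_of_indepFun hm2 (hm n) h3
      simp only [Pi.mul_apply, Finset.prod_apply] at h4
      rw [h4, ih, pow_succ, hq, ← h.law_time i n, lintegral_map hexpm (h.measurable_time i n)]
  have hsum : ∫⁻ ω, ∑' n, ENNReal.ofReal (Real.exp (-arrival τ i n ω)) ∂P ≠ ∞ := by
    have hm : ∀ n, AEMeasurable (fun ω => ENNReal.ofReal (Real.exp (-arrival τ i n ω))) P :=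
      fun n => (hexpm.comp (h.measurable_arrival i n)).aemeasurable
    rw [lintegral_tsum hm]
    simp only [hE]
    rw [ENNReal.tsum_geometric]
    exact ENNReal.inv_ne_top.2 (tsub_pos_of_lt hq1).ne'
  have hfin : ∀ᵐ ω ∂P, ∑' n, ENNReal.ofReal (Real.exp (-arrival τ i n ω)) < ∞ :=
    ae_lt_top (Measurable.tsum fun n => hexpm.comp (h.measurable_arrival i n)) hsum
  filter_upwards [hfin] with ω hω
  have h1 := ENNReal.tendsto_atTop_zero_of_tsum_ne_top hω.ne
  have h2 : Tendsto (fun n => Real.exp (-arrival τ i n ω)) atTop (𝓝 0) := by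
    have := (ENNReal.tendsto_toReal ENNReal.zero_ne_top).comp h1
    simpa [Function.comp_def, ENNReal.toReal_ofReal (Real.exp_pos _).le] using this
  have h3 : Tendsto (fun n => -arrival τ i n ω) atTop atBot := Real.tendsto_exp_comp_nhds_zero.1 h2
  simpa [Function.comp_def] using tendsto_neg_atBot_atTop.comp h3

end MarkedArrays

/-! ### Poisson cluster processes and their characteristic functionals -/

section Cluster

variable {Ω : Type*} [MeasurableSpace Ω] {P : Measure Ω} [IsProbabilityMeasure P]
  {S κ : Type*} [MetricSpace S] [ProperSpace S] [MeasurableSpace S] [BorelSpace S] [Countable κ]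

/-- Maps `g k` producing the points of a cluster from its initial mark; the marks in the shell `Sh i`
have finite intensity, and the null set `Z` contains the marks with accumulating clusters. -/
structure ClusterMaps (ν : Measure S) (Sh : ℕ → Set S) (Z : Set S) (g : κ → S → S) : Prop where
  measurableSet_shell : ∀ i, MeasurableSet (Sh i)
  disjoint : Pairwise (Function.onFun Disjoint Sh)
  measure_ne_zero : ∀ i, ν (Sh i) ≠ 0
  measure_ne_top : ∀ i, ν (Sh i) ≠ ∞
  measurableSet_null : MeasurableSet Z
  null : ν Z = 0
  continuous : ∀ k, Continuous (g k)
  finite_visits : ∀ v ∉ Z, ∀ K : Set S, IsCompact K → {k | g k v ∈ K}.Finite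
  bounded : ∀ K : Set S, IsCompact K → ∃ I : ℕ, ∀ v ∉ Z, ∀ k, g k v ∈ K → ∃ i < I, v ∈ Sh i

variable {ν : Measure S} {Sh : ℕ → Set S} {Z : Set S} {g : κ → S → S}

open Classical in
/-- `exp (i ∑_k F(t, g_k v))`, the contribution of a cluster. -/
def clusterFun (F : C_c(ℝ≥0 × S, ℝ)) (Z : Set S) (g : κ → S → S) (t : ℝ) (v : S) : ℂ :=
  if v ∈ Z then 1 else cis (∑' k, F (t.toNNReal, g k v))

lemma norm_clusterFun_le (F : C_c(ℝ≥0 × S, ℝ)) (t : ℝ) (v : S) : ‖clusterFun F Z g t v‖ ≤ 1 := by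
  unfold clusterFun
  split_ifs
  · simp
  · exact (norm_cis _).le

lemma test_eq_zero (F : C_c(ℝ≥0 × S, ℝ)) (t : ℝ≥0) {y : S} (hy : y ∉ Prod.snd '' tsupport F) :
    F (t, y) = 0 :=
  image_eq_zero_of_notMem_tsupport fun h => hy ⟨_, h, rfl⟩

lemma isCompact_snd_tsupport (F : C_c(ℝ≥0 × S, ℝ)) : IsCompact (Prod.snd '' tsupport F) :=
  F.hasCompactSupport.isCompact.image continuous_snd

lemma ClusterMaps.tsum_eq (h : ClusterMaps ν Sh Z g) (F : C_c(ℝ≥0 × S, ℝ)) {v : S} (hv : v ∉ Z)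
    (t : ℝ≥0) : HasSum (fun k => F (t, g k v))
      (∑ k ∈ (h.finite_visits v hv _ (isCompact_snd_tsupport F)).toFinset, F (t, g k v)) := by
  refine hasSum_sum_of_ne_finset_zero fun k hk => test_eq_zero F t ?_
  simpa using hk

lemma ClusterMaps.measurable_clusterFun (h : ClusterMaps ν Sh Z g) (F : C_c(ℝ≥0 × S, ℝ)) :
    Measurable (Function.uncurry (clusterFun F Z g)) := by
  classical
  refine measurable_of_tendsto_metrizable' (atTop : Filter (Finset κ))
    (f := fun s p => if p.2 ∈ Z then 1 else cis (∑ k ∈ s, F (p.1.toNNReal, g k p.2))) (fun s => ?_) ?_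
  · refine Measurable.ite (measurable_snd h.measurableSet_null) measurable_const ?_
    refine continuous_cis.measurable.comp (Finset.measurable_fun_sum _ fun k _ => ?_)
    exact (F.continuous.comp ((continuous_real_toNNReal.comp continuous_fst).prodMk
      ((h.continuous k).comp continuous_snd))).measurable
  · rw [tendsto_pi_nhds]
    rintro ⟨t, v⟩
    simp only [Function.uncurry, clusterFun]
    by_cases hv : v ∈ Z
    · simp only [hv, if_true]; exact tendsto_const_nhds
    · simp only [hv, if_false]
      exact (continuous_cis.tendsto _).comp (h.tsum_eq F hv _).summable.hasSum

lemma ClusterMaps.continuous_clusterFun (h : ClusterMaps ν Sh Z g) (F : C_c(ℝ≥0 × S, ℝ)) (v : S) :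
    Continuous fun t => clusterFun F Z g t v := by
  unfold clusterFun
  split_ifs with hv
  · exact continuous_const
  · simp only [(h.tsum_eq F hv _).tsum_eq]
    refine continuous_cis.comp (continuous_finsetSum _ fun k _ => ?_)
    exact F.continuous.comp (continuous_real_toNNReal.prodMk continuous_const)

lemma clusterFun_of_le {F : C_c(ℝ≥0 × S, ℝ)} {M : ℕ}
    (hM : ∀ (t : ℝ≥0) y, (M : ℝ≥0) ≤ t → F (t, y) = 0) {t : ℝ} (ht : M ≤ t) (v : S) :
    clusterFun F Z g t v = 1 := by
  unfold clusterFun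
  have h1 : (M : ℝ≥0) ≤ t.toNNReal := by
    rw [← NNReal.coe_le_coe, NNReal.coe_natCast, Real.coe_toNNReal _ ((Nat.cast_nonneg M).trans ht)]
    exact ht
  simp [hM _ _ h1, cis_zero]

lemma clusterFun_eq_one {F : C_c(ℝ≥0 × S, ℝ)} {I : ℕ}
    (hI : ∀ v ∉ Z, ∀ k, g k v ∈ Prod.snd '' tsupport F → ∃ i < I, v ∈ Sh i) (t : ℝ) {v : S}
    (hv : ∀ i < I, v ∉ Sh i) : clusterFun F Z g t v = 1 := by
  unfold clusterFun
  split_ifs with hZ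
  · rfl
  · have : ∀ k, F (t.toNNReal, g k v) = 0 := fun k => test_eq_zero F _ fun hk => by
      obtain ⟨i, hi, hvi⟩ := hI v hZ k hk
      exact hv i hi hvi
    simp [this, cis_zero]

/-- The mean contribution of a cluster started in the shell `i`. -/
def clusterMean (F : C_c(ℝ≥0 × S, ℝ)) (ν : Measure S) (Sh : ℕ → Set S) (Z : Set S) (g : κ → S → S)
    (i : ℕ) (t : ℝ) : ℂ := ∫ v, clusterFun F Z g t v ∂(cond ν (Sh i))

/-- The exponent of the characteristic functional of the cluster process at time `t`. -/
def clusterIntensity (F : C_c(ℝ≥0 × S, ℝ)) (ν : Measure S) (Z : Set S) (g : κ → S → S) (θ : ℝ)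
    (t : ℝ) : ℂ := θ * ∫ v, (clusterFun F Z g t v - 1) ∂ν

lemma ClusterMaps.isProbabilityMeasure_cond (h : ClusterMaps ν Sh Z g) (i : ℕ) :
    IsProbabilityMeasure (cond ν (Sh i)) :=
  cond_isProbabilityMeasure_of_finite (h.measure_ne_zero i) (h.measure_ne_top i)

lemma ClusterMaps.continuous_clusterMean (h : ClusterMaps ν Sh Z g) (F : C_c(ℝ≥0 × S, ℝ)) (i : ℕ) :
    Continuous (clusterMean F ν Sh Z g i) := by
  have := h.isProbabilityMeasure_cond i
  refine continuous_of_dominated (bound := fun _ => 1)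
    (fun t => ((h.measurable_clusterFun F).comp measurable_prodMk_left).aestronglyMeasurable)
    (fun t => Eventually.of_forall fun v => norm_clusterFun_le F t v) (integrable_const _)
    (Eventually.of_forall fun v => h.continuous_clusterFun F v)

/-- Clusters started outside the first I shells miss the support of F, so the integral reduces to
finitely many shells of finite mass. On these it is expressed by the conditional laws of the marks;
continuity and the sign of the real part can then be read off. -/
lemma ClusterMaps.clusterIntensity_eq (h : ClusterMaps ν Sh Z g) {F : C_c(ℝ≥0 × S, ℝ)} {I : ℕ}
    (hI : ∀ v ∉ Z, ∀ k, g k v ∈ Prod.snd '' tsupport F → ∃ i < I, v ∈ Sh i) (θ t : ℝ) :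
    clusterIntensity F ν Z g θ t = ∑ i ∈ Finset.range I,
      ((θ * ν.real (Sh i) : ℝ) : ℂ) * (clusterMean F ν Sh Z g i t - 1) := by
  unfold clusterIntensity
  have hm : Measurable fun v => clusterFun F Z g t v :=
    (h.measurable_clusterFun F).comp measurable_prodMk_left
  have hint : ∀ i, IntegrableOn (fun v => clusterFun F Z g t v - 1) (Sh i) ν := fun i =>
    Measure.integrableOn_of_bounded (M := 2) (h.measure_ne_top i)
      (hm.sub measurable_const).aestronglyMeasurable (Eventually.of_forall fun v => by
        refine (norm_sub_le _ _).trans ?_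
        rw [norm_one]; linarith [norm_clusterFun_le (Z := Z) (g := g) F t v])
  have e1 : ∫ v, (clusterFun F Z g t v - 1) ∂ν =
      ∑ i ∈ Finset.range I, ∫ v in Sh i, (clusterFun F Z g t v - 1) ∂ν := by
    rw [← setIntegral_eq_integral_of_forall_compl_eq_zero (s := ⋃ i ∈ Finset.range I, Sh i)]
    · exact integral_biUnion_finset _ (fun i _ => h.measurableSet_shell i)
        (fun i _ j _ hij => h.disjoint hij) fun i _ => hint i
    · intro v hv
      rw [clusterFun_eq_one hI t (fun i hi hvi => hv ?_), sub_self]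
      simp only [Finset.mem_range, mem_iUnion]
      exact ⟨i, hi, hvi⟩
  rw [e1, Finset.mul_sum]
  refine Finset.sum_congr rfl fun i _ => ?_
  have := h.isProbabilityMeasure_cond i
  have hr : ν.real (Sh i) ≠ 0 := by
    rw [Measure.real, ne_eq, ENNReal.toReal_eq_zero_iff, not_or]
    exact ⟨h.measure_ne_zero i, h.measure_ne_top i⟩
  have hrC : (ν.real (Sh i) : ℂ) ≠ 0 := by exact_mod_cast hr
  have e2 : clusterMean F ν Sh Z g i t - 1 = ∫ v, (clusterFun F Z g t v - 1) ∂(cond ν (Sh i)) := by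
    rw [integral_sub _ (integrable_const _)]
    · simp [clusterMean]
    · exact Integrable.of_bound hm.aestronglyMeasurable 1
        (Eventually.of_forall fun v => norm_clusterFun_le F t v)
  rw [e2, ProbabilityTheory.cond, integral_smul_measure, ENNReal.toReal_inv, ← Measure.real, Complex.real_smul]
  push_cast
  field_simp

lemma ClusterMaps.continuous_clusterIntensity (h : ClusterMaps ν Sh Z g) (F : C_c(ℝ≥0 × S, ℝ))
    (θ : ℝ) : Continuous (clusterIntensity F ν Z g θ) := by
  obtain ⟨I, hI⟩ := h.bounded _ (isCompact_snd_tsupport F)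
  have : clusterIntensity F ν Z g θ = fun t => ∑ i ∈ Finset.range I,
      ((θ * ν.real (Sh i) : ℝ) : ℂ) * (clusterMean F ν Sh Z g i t - 1) :=
    funext fun t => h.clusterIntensity_eq hI θ t
  rw [this]
  exact continuous_finsetSum _ fun i _ =>
    continuous_const.mul ((h.continuous_clusterMean F i).sub continuous_const)

lemma ClusterMaps.re_clusterIntensity_nonpos (h : ClusterMaps ν Sh Z g) (F : C_c(ℝ≥0 × S, ℝ))
    {θ : ℝ} (hθ : 0 ≤ θ) (t : ℝ) : (clusterIntensity F ν Z g θ t).re ≤ 0 := by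
  obtain ⟨I, hI⟩ := h.bounded _ (isCompact_snd_tsupport F)
  rw [h.clusterIntensity_eq hI, Complex.re_sum]
  refine Finset.sum_nonpos fun i _ => ?_
  rw [Complex.re_ofReal_mul]
  refine mul_nonpos_of_nonneg_of_nonpos (by positivity) ?_
  have := h.isProbabilityMeasure_cond i
  have h1 : ‖clusterMean F ν Sh Z g i t‖ ≤ 1 := by
    simpa [clusterMean] using norm_integral_le_of_norm_le_const (μ := cond ν (Sh i))
      (Eventually.of_forall fun v => norm_clusterFun_le F t v)
  simp only [Complex.sub_re, Complex.one_re]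
  linarith [(Complex.re_le_norm _).trans h1]

/-- The points of the cluster process. -/
def clusterPoint (τ : ℕ → ℕ → Ω → ℝ) (V : ℕ → ℕ → Ω → S) (g : κ → S → S) (ω : Ω)
    (k : ℕ × ℕ × κ) : ℝ≥0 × S :=
  ((arrival τ k.1 (k.2.1 + 1) ω).toNNReal, g k.2.2 (V k.1 k.2.1 ω))

/-- The cluster process. -/
def clusterMeasure (τ : ℕ → ℕ → Ω → ℝ) (V : ℕ → ℕ → Ω → S) (g : κ → S → S) (ω : Ω) :
    PointMeasure (ℝ≥0 × S) :=
  toPointMeasure (Measure.sum fun k : ℕ × ℕ × κ => Measure.dirac (clusterPoint τ V g ω k))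

variable {θ : ℝ} {τ : ℕ → ℕ → Ω → ℝ} {V : ℕ → ℕ → Ω → S}

lemma ClusterMaps.ae_mark (h : ClusterMaps ν Sh Z g)
    (ha : MarkedArray P (fun i => θ * ν.real (Sh i)) (fun i => cond ν (Sh i)) τ V) :
    ∀ᵐ ω ∂P, ∀ i j, V i j ω ∈ Sh i ∧ V i j ω ∉ Z := by
  rw [ae_all_iff]; intro i
  rw [ae_all_iff]; intro j
  refine ae_of_ae_map (ha.measurable_mark i j).aemeasurable (p := fun v => v ∈ Sh i ∧ v ∉ Z) ?_
  rw [ha.law_mark]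
  refine (ae_cond_mem (h.measurableSet_shell i)).and ?_
  exact (cond_absolutelyContinuous.ae_le : ae (cond ν (Sh i)) ≤ ae ν)
    (measure_eq_zero_iff_ae_notMem.1 h.null)

lemma exists_arrival_bound {ω : Ω} (hω : ∀ i, Tendsto (fun n => arrival τ i n ω) atTop atTop)
    (I : ℕ) (B : ℝ) : ∃ J, ∀ i < I, ∀ j, J ≤ j → B < arrival τ i j ω := by
  have h : ∀ᶠ J in atTop, ∀ i ∈ Finset.range I, B < arrival τ i J ω := by
    rw [Finset.eventually_all]
    exact fun i _ => (hω i).eventually_gt_atTop B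
  obtain ⟨J, hJ⟩ := eventually_atTop.1 h
  exact ⟨J, fun i hi j hj => hJ j hj i (Finset.mem_range.2 hi)⟩

/-- A compact set bounds all three indices: the shell by `bounded`, the arrival because arrival
times tend to infinity, and the position in the cluster by `finite_visits`. -/
lemma ClusterMaps.finite_points (h : ClusterMaps ν Sh Z g) {ω : Ω}
    (hω : ∀ i, Tendsto (fun n => arrival τ i n ω) atTop atTop)
    (hω' : ∀ i j, V i j ω ∈ Sh i ∧ V i j ω ∉ Z) (K : Set (ℝ≥0 × S)) (hK : IsCompact K) :
    {k : ℕ × ℕ × κ | clusterPoint τ V g ω k ∈ K}.Finite := by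
  obtain ⟨I, hI⟩ := h.bounded _ (hK.image continuous_snd)
  obtain ⟨B, hB⟩ := (hK.image continuous_fst).bddAbove
  obtain ⟨J, hJ⟩ := exists_arrival_bound hω I B
  refine Set.Finite.subset ((finite_Iio I).biUnion fun i _ => (finite_Iio J).biUnion fun j _ =>
    ((h.finite_visits (V i j ω) (hω' i j).2 _ (hK.image continuous_snd)).image
      fun k => (i, j, k))) ?_
  rintro ⟨i, j, k⟩ hk
  have hk2 : g k (V i j ω) ∈ Prod.snd '' K := ⟨_, hk, rfl⟩
  have hi : i < I := by
    obtain ⟨i', hi', hv⟩ := hI _ (hω' i j).2 k hk2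
    have : i = i' := by
      by_contra hne
      exact (Set.disjoint_left.1 (h.disjoint hne)) (hω' i j).1 hv
    omega
  have hj : j < J := by
    by_contra! hj
    have h1 := hJ i hi (j + 1) (by omega)
    have h2 := hB ⟨_, hk, rfl⟩
    simp only [clusterPoint] at h2
    have h3 := Real.toNNReal_le_iff_le_coe.1 h2
    linarith
  simp only [mem_iUnion, mem_image]
  exact ⟨i, hi, j, hj, k, hk2, rfl⟩

lemma aemeasurable_toPointMeasure {E : Type*} [MetricSpace E] [ProperSpace E] [MeasurableSpace E]
    [BorelSpace E] {m : Ω → Measure E} (hm : Measurable m)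
    (hgood : ∀ᵐ ω ∂P, IsPointMeasure (m ω) ∧ ∀ K : Set E, IsCompact K → m ω K < ∞) :
    AEMeasurable (fun ω => toPointMeasure (m ω)) P := by
  classical
  -- The set where the default value is used need not be measurable; a measurable null superset of
  -- it provides the measurable version.
  obtain ⟨s, hs, hsm, hs0⟩ := exists_measurable_superset_of_null (ae_iff.1 hgood)
  refine ⟨fun ω => if ω ∈ s then PointMeasure.zero E else toPointMeasure (m ω), ?_, ?_⟩
  · rw [PointMeasure.measurable_iff]
    have e : (fun ω => (if ω ∈ s then PointMeasure.zero E else toPointMeasure (m ω)).1) =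
        fun ω => if ω ∈ s then (0 : Measure E) else m ω := by
      ext ω : 1
      split_ifs with hω
      · rfl
      · exact toPointMeasure_val (by_contra fun hn => hω (hs hn))
    rw [e]
    exact Measurable.ite hsm measurable_const hm
  · have : ∀ᵐ ω ∂P, ω ∉ s := measure_eq_zero_iff_ae_notMem.1 hs0
    filter_upwards [this] with ω hω
    rw [if_neg hω]

lemma ClusterMaps.aemeasurable_clusterMeasure (h : ClusterMaps ν Sh Z g)
    (ha : MarkedArray P (fun i => θ * ν.real (Sh i)) (fun i => cond ν (Sh i)) τ V) :
    AEMeasurable (clusterMeasure τ V g) P := by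
  refine aemeasurable_toPointMeasure (measurable_sum_measure fun k =>
    Measure.measurable_dirac.comp ?_) ?_
  · exact (measurable_real_toNNReal.comp (ha.measurable_arrival _ _)).prodMk
      ((h.continuous _).measurable.comp (ha.measurable_mark _ _))
  · filter_upwards [ha.ae_tendsto_arrival, h.ae_mark ha] with ω h1 h2
    exact ⟨isPointMeasure_sum_dirac _, sum_dirac_lt_top (h.finite_points h1 h2)⟩

/-- For a fixed realisation only finitely many rows and arrivals reach the support of F, so the
functional equals a finite product of cluster contributions. -/
lemma ClusterMaps.cis_integral_eq (h : ClusterMaps ν Sh Z g) {ω : Ω}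
    (hω : ∀ i, Tendsto (fun n => arrival τ i n ω) atTop atTop)
    (hω' : ∀ i j, V i j ω ∈ Sh i ∧ V i j ω ∉ Z) {F : C_c(ℝ≥0 × S, ℝ)} {M : ℕ}
    (hM : ∀ (t : ℝ≥0) y, (M : ℝ≥0) ≤ t → F (t, y) = 0) {I : ℕ}
    (hI : ∀ v ∉ Z, ∀ k, g k v ∈ Prod.snd '' tsupport F → ∃ i < I, v ∈ Sh i) {J : ℕ}
    (hJ : ∀ i < I, ∀ j, J ≤ j → (M : ℝ) < arrival τ i j ω) {n : ℕ} (hn : J ≤ n) :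
    cis (∫ y, F y ∂(clusterMeasure τ V g ω).1) =
      ∏ i ∈ Finset.range I, rowProduct τ V (clusterFun F Z g) i n ω := by
  have hsum := hasSum_integral_toPointMeasure (h.finite_points hω hω') F
  set a := ∫ y, F y ∂(toPointMeasure (Measure.sum fun k : ℕ × ℕ × κ =>
    Measure.dirac (clusterPoint τ V g ω k))).1 with ha
  let f : ℕ → ℕ → ℝ := fun i j => ∑' k, F (clusterPoint τ V g ω (i, j, k))
  have h1 : ∀ i, HasSum (fun j => f i j) (∑' p : ℕ × κ, F (clusterPoint τ V g ω (i, p))) :=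
    fun i => (hsum.summable.prod_factor i).hasSum.prod_fiberwise fun j =>
      ((hsum.summable.prod_factor i).prod_factor j).hasSum
  have h2 : HasSum (fun i => ∑' p : ℕ × κ, F (clusterPoint τ V g ω (i, p))) a :=
    hsum.prod_fiberwise fun i => (hsum.summable.prod_factor i).hasSum
  have hI0 : ∀ i, I ≤ i → ∀ p : ℕ × κ, F (clusterPoint τ V g ω (i, p)) = 0 := by
    intro i hi p
    refine test_eq_zero F _ fun hk => ?_
    obtain ⟨i', hi', hv⟩ := hI _ (hω' i p.1).2 p.2 hk
    exact (Set.disjoint_left.1 (h.disjoint (by omega : i ≠ i'))) (hω' i p.1).1 hv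
  have hj0 : ∀ i < I, ∀ j, n ≤ j → f i j = 0 := by
    intro i hi j hj
    have h3 := hJ i hi (j + 1) (by omega)
    have h4 : (M : ℝ≥0) ≤ (arrival τ i (j + 1) ω).toNNReal := by
      rw [← NNReal.coe_le_coe, NNReal.coe_natCast,
        Real.coe_toNNReal _ ((Nat.cast_nonneg M).trans h3.le)]
      exact h3.le
    have : ∀ k, F (clusterPoint τ V g ω (i, j, k)) = 0 := fun k => hM _ _ h4
    simp [f, this]
  have e1 : a = ∑ i ∈ Finset.range I, ∑ j ∈ Finset.range n, f i j := by
    rw [h2.unique (hasSum_sum_of_ne_finset_zero (s := Finset.range I) fun i hi => by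
      simp [hI0 i (by simpa using hi)])]
    refine Finset.sum_congr rfl fun i hi => ?_
    exact (h1 i).unique (hasSum_sum_of_ne_finset_zero fun j hj =>
      hj0 i (Finset.mem_range.1 hi) j (by simpa using hj))
  have hcis : ∀ (s : Finset ℕ) (b : ℕ → ℝ), cis (∑ i ∈ s, b i) = ∏ i ∈ s, cis (b i) := by
    intro s b
    simp only [cis]
    rw [← Complex.exp_sum]
    push_cast
    rw [Finset.mul_sum]
  change cis a = _
  rw [e1, hcis]
  refine Finset.prod_congr rfl fun i _ => ?_
  rw [hcis]
  refine Finset.prod_congr rfl fun j _ => ?_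
  unfold clusterFun
  rw [if_neg (hω' i j).2]
  rfl

/-- The characteristic functional of the cluster process. -/
theorem ClusterMaps.integral_cis_clusterMeasure (h : ClusterMaps ν Sh Z g)
    (ha : MarkedArray P (fun i => θ * ν.real (Sh i)) (fun i => cond ν (Sh i)) τ V)
    (F : C_c(ℝ≥0 × S, ℝ)) {M : ℕ} (hM : ∀ (t : ℝ≥0) y, (M : ℝ≥0) ≤ t → F (t, y) = 0) :
    ∫ ω, cis (∫ y, F y ∂(clusterMeasure τ V g ω).1) ∂P =
      Complex.exp (∫ s in (0 : ℝ)..M, clusterIntensity F ν Z g θ s) := by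
  obtain ⟨I, hI⟩ := h.bounded _ (isCompact_snd_tsupport F)
  have hG := h.measurable_clusterFun F
  have hG1 := norm_clusterFun_le (Z := Z) (g := g) F
  have hγ := h.continuous_clusterMean F
  have hγM : ∀ i (t : ℝ), (M : ℝ) ≤ t → clusterMean F ν Sh Z g i t = 1 := by
    intro i t ht
    have := h.isProbabilityMeasure_cond i
    simp [clusterMean, clusterFun_of_le hM ht]
  have hrows := fun n => ha.integral_rows hG hG1 hγ (fun i t => rfl) hγM I n
  have hγ1 : ∀ i t, ‖clusterMean F ν Sh Z g i t‖ ≤ 1 := fun i t => by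
    have := h.isProbabilityMeasure_cond i
    simpa [clusterMean] using norm_integral_le_of_norm_le_const (μ := cond ν (Sh i))
      (Eventually.of_forall fun v => norm_clusterFun_le F t v)
  -- By `integral_rows` the integral of `f n` does not depend on n. Almost surely, for large n all
  -- arrivals exceed M, the renewal factors are one, and `f n` is the functional itself. Dominated
  -- convergence joins the two facts.
  set f : ℕ → Ω → ℂ := fun n ω => ∏ i ∈ Finset.range I, (rowProduct τ V (clusterFun F Z g) i n ω *
    renewalFun (θ * ν.real (Sh i)) M (clusterMean F ν Sh Z g i) (arrival τ i n ω)) with hf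
  have hlim : Tendsto (fun n => ∫ ω, f n ω ∂P) atTop
      (𝓝 (∫ ω, cis (∫ y, F y ∂(clusterMeasure τ V g ω).1) ∂P)) := by
    refine tendsto_integral_of_dominated_convergence (fun _ => 1) (fun n => ?_) (integrable_const _)
      (fun n => Eventually.of_forall fun ω => ?_) ?_
    · refine Measurable.aestronglyMeasurable (Finset.measurable_fun_prod _ fun i _ => ?_)
      refine Measurable.mul ?_
        ((continuous_renewalFun (hγ i)).measurable.comp (ha.measurable_arrival i n))
      exact Finset.measurable_fun_prod _ fun j _ =>
        hG.comp ((ha.measurable_arrival i (j + 1)).prodMk (ha.measurable_mark i j))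
    · rw [hf, norm_prod]
      refine Finset.prod_le_one (fun _ _ => norm_nonneg _) fun i _ => ?_
      rw [norm_mul]
      exact mul_le_one₀ (norm_rowProduct_le hG1 _ _ _) (norm_nonneg _)
        (norm_renewalFun_le (ha.pos i).le (hγ i) (hγ1 i) (hγM i) _)
    · filter_upwards [ha.ae_tendsto_arrival, h.ae_mark ha] with ω h1 h2
      obtain ⟨J, hJ⟩ := exists_arrival_bound h1 I M
      refine tendsto_const_nhds.congr' ?_
      filter_upwards [eventually_ge_atTop J] with n hn
      rw [h.cis_integral_eq h1 h2 hM hI hJ hn, hf]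
      refine Finset.prod_congr rfl fun i hi => ?_
      rw [renewalFun_of_le (hγM i) (hJ i (Finset.mem_range.1 hi) n hn).le, mul_one]
  simp only [hf, hrows] at hlim
  refine (tendsto_nhds_unique hlim tendsto_const_nhds).trans ?_
  simp only [renewalFun]
  rw [← Complex.exp_sum]
  congr 1
  simp only [h.clusterIntensity_eq hI]
  have hii : ∀ i ∈ Finset.range I, IntervalIntegrable
      (fun s => ((θ * ν.real (Sh i) : ℝ) : ℂ) * (clusterMean F ν Sh Z g i s - 1)) volume 0 M :=
    fun i _ => (continuous_const.mul ((hγ i).sub continuous_const)).intervalIntegrable _ _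
  rw [intervalIntegral.integral_finsetSum hii]
  simp only [intervalIntegral.integral_const_mul]

end Cluster

/-! ### From characteristic functionals to convergence; clusters of an expanding map -/

section PoissonArray

variable {Ω : Type*} [MeasurableSpace Ω] {P : Measure Ω} [IsProbabilityMeasure P]

/-- A measurable version of a Poisson array whose marks are transformed by `φ`. -/
lemma IsPoissonArray.exists_markedArray {S S' : Type*} [MeasureSpace S] [MeasurableSpace S']
    {shell : ℕ → Set S} {θ : ℝ} {Tbar : ℕ → ℕ → Ω → ℝ} {U : ℕ → ℕ → Ω → S}
    (h : IsPoissonArray P shell θ Tbar U) (hpos : ∀ i, 0 < θ * volume.real (shell i))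
    {φ : S → S'} (hφ : Measurable φ) :
    ∃ (τ : ℕ → ℕ → Ω → ℝ) (V : ℕ → ℕ → Ω → S'),
      MarkedArray P (fun i => θ * volume.real (shell i))
        (fun i => (ProbabilityTheory.cond volume (shell i)).map φ) τ V ∧
      ∀ᵐ ω ∂P, ∀ i j, Tbar i j ω = τ i j ω ∧ φ (U i j ω) = V i j ω := by
  have hT := fun i j => (h.law_Tbar i j).aemeasurable
  have hU := fun i j => (h.law_U i j).aemeasurable
  -- `HasLaw` only gives almost everywhere measurable variables, so the array is replaced by a
  -- measurable modification.
  let τ : ℕ → ℕ → Ω → ℝ := fun i j => (hT i j).mk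
  let V : ℕ → ℕ → Ω → S := fun i j => (hU i j).mk
  have hτm : ∀ i j, Measurable (τ i j) := fun i j => (hT i j).measurable_mk
  have hVm : ∀ i j, Measurable (V i j) := fun i j => (hU i j).measurable_mk
  have hτ : ∀ i j, Tbar i j =ᵐ[P] τ i j := fun i j => (hT i j).ae_eq_mk
  have hV : ∀ i j, U i j =ᵐ[P] V i j := fun i j => (hU i j).ae_eq_mk
  have hτ' : (fun ω (k : ℕ × ℕ) => Tbar k.1 k.2 ω) =ᵐ[P] fun ω (k : ℕ × ℕ) => τ k.1 k.2 ω := by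
    have : ∀ᵐ ω ∂P, ∀ k : ℕ × ℕ, Tbar k.1 k.2 ω = τ k.1 k.2 ω :=
      ae_all_iff.2 fun k => hτ k.1 k.2
    filter_upwards [this] with ω hω using funext hω
  have hV' : (fun ω (k : ℕ × ℕ) => U k.1 k.2 ω) =ᵐ[P] fun ω (k : ℕ × ℕ) => V k.1 k.2 ω := by
    have : ∀ᵐ ω ∂P, ∀ k : ℕ × ℕ, U k.1 k.2 ω = V k.1 k.2 ω :=
      ae_all_iff.2 fun k => hV k.1 k.2
    filter_upwards [this] with ω hω using funext hω
  have hind : IndepFun (fun ω (k : ℕ × ℕ) => τ k.1 k.2 ω) (fun ω (k : ℕ × ℕ) => V k.1 k.2 ω) P :=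
    h.indep.congr hτ' hV'
  have hind' : IndepFun (fun ω (k : ℕ × ℕ) => τ k.1 k.2 ω)
      (fun ω (k : ℕ × ℕ) => φ (V k.1 k.2 ω)) P :=
    hind.comp (φ := id) (ψ := fun (f : ℕ × ℕ → S) k => φ (f k)) measurable_id
      (measurable_pi_lambda _ fun k => hφ.comp (measurable_pi_apply k))
  refine ⟨τ, fun i j ω => φ (V i j ω), ⟨hpos, hτm, fun i j => hφ.comp (hVm i j), fun i j => ?_,
    fun i j => ?_, fun i j => ?_, ?_⟩, ?_⟩
  · rw [← (h.law_Tbar i j).map_eq]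
    exact Measure.map_congr (hτ i j).symm
  · rw [← (h.law_U i j).map_eq, Measure.map_congr (hV i j), Measure.map_map hφ (hVm i j)]
    rfl
  · exact hind'.comp (φ := fun f : ℕ × ℕ → ℝ => f (i, j)) (ψ := fun f : ℕ × ℕ → S' => f (i, j))
      (measurable_pi_apply _) (measurable_pi_apply _)
  · refine iIndepFun_prodMk (fun k => hτm k.1 k.2) (fun k => hφ.comp (hVm k.1 k.2)) ?_ ?_ hind'
    · exact h.indep_Tbar.congr fun k : ℕ × ℕ => hτ k.1 k.2
    · exact (h.indep_U.congr fun k : ℕ × ℕ => hV k.1 k.2).comp (fun _ => φ) fun _ => hφ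
  · rw [ae_all_iff]; intro i
    rw [ae_all_iff]; intro j
    filter_upwards [hτ i j, hV i j] with ω h1 h2
    exact ⟨h1, by rw [h2]⟩

variable {X : Type*} [MeasurableSpace X] {μ : Measure X} [IsProbabilityMeasure μ] {T : X → X}
  {ρ : ℕ → ℝ} {S : Type*} [MetricSpace S] [ProperSpace S] [MeasurableSpace S] [BorelSpace S]
  [Nonempty S] {ν : Measure S} {dom : ℕ → Set X} {Y : ℕ → X → S} {R : Set ℕ} {g : ℕ → S → S}
  {κ : Type*} [Countable κ] {γ : κ → S → S} {Sh : ℕ → Set S} {Z : Set S} {θ : ℝ}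
  {τ : ℕ → ℕ → Ω → ℝ} {V : ℕ → ℕ → Ω → S}

lemma exists_time_bound (F : C_c(ℝ≥0 × S, ℝ)) :
    ∃ M : ℕ, ∀ (t : ℝ≥0) y, (M : ℝ≥0) ≤ t → F (t, y) = 0 := by
  obtain ⟨B, hB⟩ := (F.hasCompactSupport.isCompact.image continuous_fst).bddAbove
  obtain ⟨M, hM⟩ := exists_nat_gt B
  refine ⟨M, fun t y ht => image_eq_zero_of_notMem_tsupport fun hmem => ?_⟩
  exact absurd (hB ⟨_, hmem, rfl⟩) (not_le.2 (hM.trans_le ht))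

/-- Convergence of the empirical mark process to a cluster process, if the mean contributions of the
returns converge. -/
theorem RareMarks.convergesWeakly (hT : MeasurePreserving T μ μ) (hρs : Summable ρ)
    (hρ : ∀ n, 0 ≤ ρ n) (hY : RareMarks μ T ρ ν dom Y R g) (h : ClusterMaps ν Sh Z γ) (hθ : 0 ≤ θ)
    (ha : MarkedArray P (fun i => θ * ν.real (Sh i)) (fun i => ProbabilityTheory.cond ν (Sh i)) τ V)
    {N₀ : Ω → PointMeasure (ℝ≥0 × S)} (hN₀ : N₀ =ᵐ[P] clusterMeasure τ V γ)
    (hlim : ∀ F : C_c(ℝ≥0 × S, ℝ), ∀ ε : ℝ, 0 < ε → ∀ᶠ Q : ℕ in atTop, ∀ s : ℝ≥0,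
      ‖∫ y, returnFun F R g Q s y ∂ν - clusterIntensity F ν Z γ θ s‖ ≤ ε) :
    ConvergesWeakly μ (fun n => empiricalMarks T (dom n) (Y n) n) P N₀ := by
  refine convergesWeakly_of_tendsto_charFunctional
    (fun n hn => measurable_empiricalMarks hT.measurable (hY.meas n) hn)
    ((h.aemeasurable_clusterMeasure ha).congr hN₀.symm) fun F => ?_
  obtain ⟨M, hM⟩ := exists_time_bound F
  have h1 := hY.tendsto_charFunctional hT hρs hρ F hM (h.continuous_clusterIntensity F θ)
    (h.re_clusterIntensity_nonpos F hθ) (hlim F)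
  rw [← h.integral_cis_clusterMeasure ha F hM] at h1
  have h2 : ∫ ω, cis (∫ y, F y ∂(clusterMeasure τ V γ ω).1) ∂P =
      ∫ ω, cis (∫ y, F y ∂(N₀ ω).1) ∂P :=
    integral_congr_ae (hN₀.mono fun ω hω => by simp only [hω])
  rw [h2] at h1
  exact h1

lemma returnFun_empty (F : C_c(ℝ≥0 × S, ℝ)) (Q : ℕ) (s : ℝ≥0) (y : S) :
    returnFun F ∅ g Q s y = cis (F (s, y)) - 1 := by
  simp [returnFun, cis_zero]

/-- Without short returns the limit is a Poisson process. -/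
lemma returnFun_empty_lim (F : C_c(ℝ≥0 × S, ℝ)) (s : ℝ≥0) (Q : ℕ) :
    ∫ y, returnFun F ∅ g Q s y ∂ν = clusterIntensity F ν ∅ (fun (_ : Unit) (y : S) => y) 1 s := by
  simp only [returnFun_empty, clusterIntensity, clusterFun, mem_empty_iff_false, if_false,
    Complex.ofReal_one, one_mul, Real.toNNReal_coe, tsum_fintype, Finset.univ_unique,
    Finset.sum_singleton]

/-- A continuous map expanding away from a null point `o`, which multiplies `ν` by a factor. -/
structure ExpandingMap (ν : Measure S) (o : S) (L : S → S) (b : ℝ) : Prop where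
  continuous : Continuous L
  null : ν {o} = 0
  ne : ∀ y, y ≠ o → L y ≠ o
  escape : ∀ y, y ≠ o → Tendsto (fun l => L^[l] y) atTop (cocompact S)
  bounded : ∀ K : Set S, IsCompact K → ∃ K' : Set S, IsCompact K' ∧ ∀ l y, L^[l] y ∈ K → y ∈ K'
  map_eq : ν.map L = ENNReal.ofReal b • ν
  nonneg : 0 ≤ b

lemma ExpandingMap.finite_visits {o : S} {L : S → S} {b : ℝ} (hL : ExpandingMap ν o L b) {y : S}
    (hy : y ≠ o) {K : Set S} (hK : IsCompact K) : {l | L^[l] y ∈ K}.Finite := by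
  have := (hL.escape y hy).eventually hK.compl_mem_cocompact
  obtain ⟨N, hN⟩ := eventually_atTop.1 this
  exact (finite_Iio N).subset fun l hl => by_contra fun h => hN l (not_lt.1 h) hl

lemma ExpandingMap.clusterMaps {o : S} {L : S → S} {b : ℝ} (hL : ExpandingMap ν o L b)
    (hm : ∀ i, MeasurableSet (Sh i)) (hd : Pairwise (Function.onFun Disjoint Sh))
    (h0 : ∀ i, ν (Sh i) ≠ 0) (ht : ∀ i, ν (Sh i) ≠ ∞)
    (hb : ∀ K : Set S, IsCompact K → ∃ I : ℕ, ∀ v ≠ o, v ∈ K → ∃ i < I, v ∈ Sh i) :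
    ClusterMaps ν Sh {o} fun (l : ℕ) => L^[l] where
  measurableSet_shell := hm
  disjoint := hd
  measure_ne_zero := h0
  measure_ne_top := ht
  measurableSet_null := measurableSet_singleton o
  null := hL.null
  continuous l := hL.continuous.iterate l
  finite_visits _ hv _ hK := hL.finite_visits hv hK
  bounded K hK := by
    obtain ⟨K', hK', h⟩ := hL.bounded K hK
    obtain ⟨I, hI⟩ := hb K' hK'
    exact ⟨I, fun v hv l hl => hI v hv (h l v hl)⟩

lemma sum_multiples {p : ℕ} (hp : 0 < p) (Q : ℕ) (f : ℕ → ℝ) :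
    (∑ j ∈ Finset.Ico 1 (Q + 1), if p ∣ j then f (j / p) else 0) =
      ∑ l ∈ Finset.range (Q / p), f (l + 1) := by
  rw [← Finset.sum_filter]
  symm
  refine Finset.sum_bij (fun l _ => p * (l + 1)) (fun l hl => ?_) (fun l _ l' _ h => ?_)
    (fun j hj => ?_) (fun l _ => ?_)
  · rw [Finset.mem_range, Nat.lt_iff_add_one_le, Nat.le_div_iff_mul_le hp] at hl
    simp only [Finset.mem_filter, Finset.mem_Ico, dvd_mul_right, and_true]
    have := Nat.mul_pos hp (Nat.succ_pos l)
    constructor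
    · exact this
    · rw [mul_comm]; omega
  · have := Nat.eq_of_mul_eq_mul_left hp h
    omega
  · simp only [Finset.mem_filter, Finset.mem_Ico] at hj
    obtain ⟨⟨h1, h2⟩, k, rfl⟩ := hj
    have hk : 1 ≤ k := Nat.pos_of_ne_zero fun h => by simp [h] at h1
    refine ⟨k - 1, ?_, by rw [Nat.sub_add_cancel hk]⟩
    rw [Finset.mem_range]
    have : k ≤ Q / p := by rw [Nat.le_div_iff_mul_le hp, mul_comm]; omega
    omega
  · rw [Nat.mul_div_cancel_left _ hp]

/-- Let G be the contribution of a whole cluster. Since G(y) = e^{iF(s,y)} G(Ly), the contribution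
(e^{iF(s,y)} - 1) G(Ly) of a mark followed by all its returns is G - G∘L. The integral of G∘L - 1 is
1 - θ times that of G - 1, so the integral of the difference is θ ∫ (G - 1) dν. -/
lemma ExpandingMap.returnFun_lim [IsFiniteMeasureOnCompacts ν] {o : S} {L : S → S}
    (hL : ExpandingMap ν o L (1 - θ)) (hc : ClusterMaps ν Sh {o} fun (l : ℕ) => L^[l]) {p : ℕ}
    (hp : 0 < p) (F : C_c(ℝ≥0 × S, ℝ)) {ε : ℝ} (hε : 0 < ε) :
    ∀ᶠ Q : ℕ in atTop, ∀ s : ℝ≥0,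
      ‖∫ y, returnFun F {j | p ∣ j} (fun j => L^[j / p]) Q s y ∂ν -
        clusterIntensity F ν {o} (fun (l : ℕ) => L^[l]) θ s‖ ≤ ε := by
  classical
  set K := Prod.snd '' tsupport F with hKdef
  have hK : IsCompact K := isCompact_snd_tsupport F
  have hcont : ∀ l, Continuous L^[l] := fun l => hL.continuous.iterate l
  -- Marks of K that visit K again after more than q iterates of L. Only on this set does cutting
  -- the returns off at time Q matter, with q = Q / p; its measure tends to 0 since every point
  -- except o visits K finitely often.
  let B : ℕ → Set S := fun q => K ∩ ⋃ l ∈ Ioi q, L^[l] ⁻¹' K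
  have hBm : ∀ q, MeasurableSet (B q) := fun q => hK.measurableSet.inter
    (MeasurableSet.biUnion (to_countable _) fun l _ => (hcont l).measurable hK.measurableSet)
  have hB : Tendsto (fun q => ν.real (B q)) atTop (𝓝 0) := by
    have hfin : ν (B 0) ≠ ∞ :=
      ((measure_mono inter_subset_left).trans_lt hK.measure_lt_top).ne
    have h1 : Tendsto (fun q => ν (B q)) atTop (𝓝 (ν (⋂ q, B q))) := by
      refine tendsto_measure_iInter_atTop (fun q => (hBm q).nullMeasurableSet) ?_ ⟨0, hfin⟩
      intro q q' hq
      refine inter_subset_inter_right _ (biUnion_subset_biUnion_left fun l hl => ?_)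
      exact lt_of_le_of_lt hq hl
    have h2 : ν (⋂ q, B q) = 0 := by
      refine measure_mono_null (fun y hy => ?_) hL.null
      by_contra hne
      obtain ⟨N, hN⟩ := (hL.finite_visits hne hK).bddAbove
      obtain ⟨-, hy2⟩ := mem_iInter.1 hy N
      simp only [mem_iUnion, mem_Ioi, exists_prop] at hy2
      obtain ⟨l, hl, hlK⟩ := hy2
      exact absurd (hN hlK) (not_le.2 hl)
    rw [h2] at h1
    exact (ENNReal.tendsto_toReal ENNReal.zero_ne_top).comp h1
  have hq : Tendsto (fun Q : ℕ => Q / p) atTop atTop := Nat.tendsto_div_const_atTop hp.ne'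
  have hev := (hB.comp hq).eventually (gt_mem_nhds (show (0 : ℝ) < ε / 4 by positivity))
  filter_upwards [hev] with Q hQ s
  set G := clusterFun F {o} (fun (l : ℕ) => L^[l]) s with hG
  have hGm : Measurable G := (hc.measurable_clusterFun F).comp measurable_prodMk_left
  have hG1 : ∀ y, ‖G y‖ ≤ 1 := norm_clusterFun_le F s
  have hGint : Integrable (fun y => G y - 1) ν := by
    obtain ⟨I, hI⟩ := hc.bounded _ hK
    have hfin : ν (⋃ i ∈ Finset.range I, Sh i) ≠ ∞ :=
      ((measure_biUnion_finset_le _ _).trans_lt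
        (ENNReal.sum_lt_top.2 fun i _ => (hc.measure_ne_top i).lt_top)).ne
    refine (integrableOn_iff_integrable_of_support_subset (s := ⋃ i ∈ Finset.range I, Sh i)
      fun y hy => ?_).1 (Measure.integrableOn_of_bounded (M := 2) hfin
        (hGm.sub measurable_const).aestronglyMeasurable (Eventually.of_forall fun y => ?_))
    · by_contra hn
      refine hy ?_
      simp only [hG]
      rw [clusterFun_eq_one hI _ fun i hi hvi => hn (by simpa using ⟨i, hi, hvi⟩), sub_self]
    · refine (norm_sub_le _ _).trans ?_
      rw [norm_one]; linarith [hG1 y]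
  have hLm := hL.continuous.measurable
  have hmapint : Integrable (fun y => G y - 1) (ν.map L) := by
    rw [hL.map_eq]; exact hGint.smul_measure ENNReal.ofReal_ne_top
  have hGLint : Integrable (fun y => G (L y) - 1) ν := hmapint.comp_measurable hLm
  -- One is subtracted before changing variables because ν may be infinite: G itself need not be
  -- integrable, whereas G - 1 is supported in finitely many shells.
  have hGL : ∫ y, (G (L y) - 1) ∂ν = ((1 - θ : ℝ) : ℂ) * ∫ y, (G y - 1) ∂ν := by
    rw [← integral_map hLm.aemeasurable (f := fun y => G y - 1) hmapint.aestronglyMeasurable,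
      hL.map_eq, integral_smul_measure, ENNReal.toReal_ofReal hL.nonneg, Complex.real_smul]
  have hci : clusterIntensity F ν {o} (fun (l : ℕ) => L^[l]) θ s = ∫ y, (G y - G (L y)) ∂ν := by
    have e1 : ∀ y, G y - G (L y) = (G y - 1) - (G (L y) - 1) := fun y => by ring
    simp only [e1]
    rw [integral_sub hGint hGLint, hGL]
    unfold clusterIntensity
    push_cast
    ring
  have hstep : ∀ y, y ≠ o → G y = cis (F (s, y)) * G (L y) := by
    intro y hy
    simp only [hG, clusterFun, mem_singleton_iff, hy, hL.ne y hy, if_false, Real.toNNReal_coe]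
    rw [← cis_add]
    congr 1
    have h1 := (hc.tsum_eq F (v := y) hy s).summable
    rw [h1.tsum_eq_zero_add]
    simp only [Function.iterate_zero, id, Function.iterate_succ_apply]
  have hret : ∀ y, y ≠ o → y ∉ B (Q / p) →
      returnFun F {j | p ∣ j} (fun j => L^[j / p]) Q s y = G y - G (L y) := by
    intro y hy hyB
    rw [hstep y hy]
    have e : ∀ a b : ℂ, a * b - b = (a - 1) * b := fun a b => by ring
    rw [e]
    unfold returnFun
    by_cases hyK : y ∈ K
    · congr 1
      simp only [hG, clusterFun, mem_singleton_iff, hL.ne y hy, if_false, Real.toNNReal_coe,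
        mem_ofPred_eq]
      congr 1
      rw [sum_multiples hp Q fun l => F (s, L^[l] y)]
      refine (tsum_eq_sum fun l hl => ?_).symm
      refine test_eq_zero F s fun hmem => hyB ⟨hyK, ?_⟩
      simp only [mem_iUnion, mem_Ioi, exists_prop]
      exact ⟨l + 1, by simp at hl; omega, hmem⟩
    · rw [test_eq_zero F s hyK, cis_zero]; ring
  have hne : ∀ᵐ y ∂ν, y ≠ o := measure_eq_zero_iff_ae_notMem.1 hL.null
  have hRm : Measurable fun y => returnFun F {j | p ∣ j} (fun j => L^[j / p]) Q s y :=
    ((continuous_returnFun (fun j _ => hcont (j / p)) F Q).comp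
      (continuous_const.prodMk continuous_id)).measurable
  have hRint : Integrable (fun y => returnFun F {j | p ∣ j} (fun j => L^[j / p]) Q s y) ν := by
    refine (integrableOn_iff_integrable_of_support_subset (s := K) fun y hy => ?_).1
      (Measure.integrableOn_of_bounded (M := 2) hK.measure_lt_top.ne hRm.aestronglyMeasurable
        (Eventually.of_forall fun y => norm_returnFun_le F Q s y))
    by_contra hn
    refine hy ?_
    simp only [returnFun]
    rw [test_eq_zero F s hn, cis_zero, sub_self, zero_mul]
  have hDint : Integrable (fun y => G y - G (L y)) ν := by
    refine (hGint.sub hGLint).congr (Eventually.of_forall fun y => ?_)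
    simp only [Pi.sub_apply]; ring
  rw [hci, ← integral_sub hRint hDint]
  calc ‖∫ y, (returnFun F {j | p ∣ j} (fun j => L^[j / p]) Q s y - (G y - G (L y))) ∂ν‖
      ≤ ∫ y, (B (Q / p)).indicator (fun _ => (4 : ℝ)) y ∂ν := by
        refine norm_integral_le_of_norm_le ?_ ?_
        · rw [integrable_indicator_iff (hBm _)]
          exact integrableOn_const
            ((measure_mono inter_subset_left).trans_lt hK.measure_lt_top).ne
        · filter_upwards [hne] with y hy
          by_cases hyB : y ∈ B (Q / p)
          · rw [indicator_of_mem hyB]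
            have h1 := norm_returnFun_le (R := {j | p ∣ j}) (g := fun j => L^[j / p]) F Q s y
            have h2 := (norm_sub_le (G y) (G (L y))).trans (add_le_add (hG1 y) (hG1 (L y)))
            refine (norm_sub_le _ _).trans ?_
            linarith
          · rw [indicator_of_notMem hyB, hret y hy hyB, sub_self, norm_zero]
    _ = ν.real (B (Q / p)) * 4 := by
        rw [integral_indicator (hBm _), setIntegral_const, smul_eq_mul]
    _ ≤ ε := by
        have : ν.real (B (Q / p)) < ε / 4 := hQ
        linarith

end PoissonArray

/-! ### Euclidean shells and Lebesgue measure on the half-line -/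

section Shells

lemma measurableSet_unitShell (d i : ℕ) : MeasurableSet (unitShell d i) :=
  Metric.isOpen_ball.measurableSet.diff Metric.isOpen_ball.measurableSet

lemma mem_unitShell {d i : ℕ} {v : EuclideanSpace ℝ (Fin d)} :
    v ∈ unitShell d i ↔ ⌊‖v‖⌋₊ = i := by
  rw [Nat.floor_eq_iff (norm_nonneg v)]
  simp [unitShell, and_comm]

lemma disjoint_unitShell (d : ℕ) : Pairwise (Function.onFun Disjoint (unitShell d)) := by
  intro i j hij
  rw [Function.onFun, Set.disjoint_left]
  intro v hi hj
  rw [mem_unitShell] at hi hj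
  exact hij (hi.symm.trans hj)

lemma volume_unitShell_ne_top (d i : ℕ) : volume (unitShell d i) ≠ ∞ :=
  ((measure_mono sdiff_subset).trans_lt measure_ball_lt_top).ne

lemma volume_unitShell_ne_zero {d : ℕ} (hd : 1 ≤ d) (i : ℕ) : volume (unitShell d i) ≠ 0 := by
  have : Nonempty (Fin d) := ⟨⟨0, hd⟩⟩
  obtain ⟨v, hv⟩ := exists_norm_eq (EuclideanSpace ℝ (Fin d)) (show (0 : ℝ) ≤ i + 1 / 2 by positivity)
  have hopen : IsOpen (Metric.ball (0 : EuclideanSpace ℝ (Fin d)) (i + 1) \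
      Metric.closedBall 0 (i : ℝ)) := Metric.isOpen_ball.sdiff Metric.isClosed_closedBall
  have hsub : Metric.ball (0 : EuclideanSpace ℝ (Fin d)) (i + 1) \ Metric.closedBall 0 (i : ℝ) ⊆
      unitShell d i := sdiff_subset_sdiff_right Metric.ball_subset_closedBall
  refine ne_of_gt (lt_of_lt_of_le (hopen.measure_pos volume ⟨v, ?_⟩) (measure_mono hsub))
  simp only [Set.mem_sdiff, mem_ball_zero_iff, mem_closedBall_zero_iff, hv]
  constructor <;> linarith

lemma exists_unitShell_bound (d : ℕ) (K : Set (EuclideanSpace ℝ (Fin d))) (hK : IsCompact K) :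
    ∃ I : ℕ, ∀ v ∈ K, ∃ i < I, v ∈ unitShell d i := by
  obtain ⟨B, hB⟩ := hK.isBounded.exists_norm_le
  refine ⟨⌊B⌋₊ + 1, fun v hv => ⟨⌊‖v‖⌋₊, ?_, mem_unitShell.2 rfl⟩⟩
  exact Nat.lt_succ_of_le (Nat.floor_le_floor (hB v hv))

/-- Lebesgue measure on `[0, ∞)`. -/
def halfLineMeasure : Measure ℝ≥0 := (volume.restrict (Ioi (0 : ℝ))).map Real.toNNReal

/-- The interval `(i, i + 1]` in `[0, ∞)`. -/
def halfLineShell (i : ℕ) : Set ℝ≥0 := Ioc (i : ℝ≥0) (i + 1)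

lemma toNNReal_preimage_Ioc (a b : ℝ≥0) : Ioi (0 : ℝ) ∩ Real.toNNReal ⁻¹' Ioc a b =
    Ioc (a : ℝ) b := by
  ext x
  simp only [mem_inter_iff, mem_Ioi, mem_preimage, mem_Ioc]
  constructor
  · rintro ⟨hx, h1, h2⟩
    exact ⟨(Real.lt_toNNReal_iff_coe_lt).1 h1, (Real.toNNReal_le_iff_le_coe).1 h2⟩
  · rintro ⟨h1, h2⟩
    have hx : 0 < x := a.2.trans_lt h1
    exact ⟨hx, (Real.lt_toNNReal_iff_coe_lt).2 h1, (Real.toNNReal_le_iff_le_coe).2 h2⟩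

lemma halfLineMeasure_apply {s : Set ℝ≥0} (hs : MeasurableSet s) :
    halfLineMeasure s = volume (Ioi (0 : ℝ) ∩ Real.toNNReal ⁻¹' s) := by
  rw [halfLineMeasure, Measure.map_apply measurable_real_toNNReal hs,
    Measure.restrict_apply (measurable_real_toNNReal hs), inter_comm]

lemma halfLineMeasure_shell (i : ℕ) : halfLineMeasure (halfLineShell i) = 1 := by
  rw [halfLineShell, halfLineMeasure_apply measurableSet_Ioc, toNNReal_preimage_Ioc, Real.volume_Ioc]
  simp

lemma volume_unitInterval2d (i : ℕ) : volume (unitInterval2d i) = 1 := by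
  simp [unitInterval2d]

lemma cond_halfLineMeasure (i : ℕ) :
    ProbabilityTheory.cond halfLineMeasure (halfLineShell i) =
      (ProbabilityTheory.cond volume (unitInterval2d i)).map Real.toNNReal := by
  unfold ProbabilityTheory.cond
  rw [Measure.map_smul, halfLineMeasure_shell, volume_unitInterval2d]
  congr 1
  rw [halfLineMeasure, halfLineShell,
    Measure.restrict_map measurable_real_toNNReal measurableSet_Ioc,
    Measure.restrict_restrict (measurable_real_toNNReal measurableSet_Ioc), inter_comm,
    toNNReal_preimage_Ioc, unitInterval2d]
  simp

lemma halfLineMeasure_Iic_lt_top (b : ℝ≥0) : halfLineMeasure (Iic b) < ∞ := by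
  rw [halfLineMeasure_apply measurableSet_Iic]
  refine (measure_mono fun x hx => ?_).trans_lt (measure_Icc_lt_top (a := (0 : ℝ)) (b := b))
  exact ⟨(mem_Ioi.1 hx.1).le, Real.toNNReal_le_iff_le_coe.1 hx.2⟩

instance : IsFiniteMeasureOnCompacts halfLineMeasure where
  lt_top_of_isCompact K hK := by
    obtain ⟨b, hb⟩ := hK.bddAbove
    exact (measure_mono hb).trans_lt (halfLineMeasure_Iic_lt_top b)

lemma halfLineMeasure_singleton (a : ℝ≥0) : halfLineMeasure {a} = 0 := by
  rw [halfLineMeasure_apply (measurableSet_singleton a)]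
  refine measure_mono_null (fun x hx => ?_) (Real.volume_singleton (a := (a : ℝ)))
  have h2 : x.toNNReal = a := hx.2
  rw [mem_singleton_iff, ← h2, Real.coe_toNNReal _ (mem_Ioi.1 hx.1).le]

lemma measurableSet_halfLineShell (i : ℕ) : MeasurableSet (halfLineShell i) := measurableSet_Ioc

lemma mem_halfLineShell {i : ℕ} {v : ℝ≥0} : v ∈ halfLineShell i ↔ ⌈v⌉₊ = i + 1 := by
  rw [Nat.ceil_eq_iff (by omega)]
  simp [halfLineShell]

lemma disjoint_halfLineShell : Pairwise (Function.onFun Disjoint halfLineShell) := by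
  intro i j hij
  rw [Function.onFun, Set.disjoint_left]
  intro v hi hj
  rw [mem_halfLineShell] at hi hj
  omega

lemma exists_halfLineShell_bound (K : Set ℝ≥0) (hK : IsCompact K) :
    ∃ I : ℕ, ∀ v ≠ 0, v ∈ K → ∃ i < I, v ∈ halfLineShell i := by
  obtain ⟨B, hB⟩ := hK.bddAbove
  refine ⟨⌈B⌉₊ + 1, fun v hv0 hv => ⟨⌈v⌉₊ - 1, ?_, ?_⟩⟩
  · have := Nat.ceil_mono (hB hv)
    omega
  · rw [mem_halfLineShell]
    have := Nat.ceil_pos.2 (pos_iff_ne_zero.2 hv0)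
    omega

end Shells

/-! ### The four limiting processes as cluster processes -/

section Limits

variable {X : Type*} [MeasurableSpace X] {μ : Measure X} [IsProbabilityMeasure μ] {T : X → X}
  {ρ : ℕ → ℝ} {dom : ℕ → Set X} {Ω : Type*} [MeasurableSpace Ω] {P : Measure Ω}
  [IsProbabilityMeasure P] {Tbar : ℕ → ℕ → Ω → ℝ}

/-- A Poisson process is a cluster process whose clusters are single points, indexed by `Unit`. -/
lemma sum_measure_unit {E : Type*} [MeasurableSpace E] (f : ℕ × ℕ → E) :
    (Measure.sum fun k : ℕ × ℕ => Measure.dirac (f k)) =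
      Measure.sum fun k : ℕ × ℕ × Unit => Measure.dirac (f (k.1, k.2.1)) := by
  ext s hs
  rw [Measure.sum_apply _ hs, Measure.sum_apply _ hs]
  exact (Equiv.tsum_eq ((Equiv.refl ℕ).prodCongr (Equiv.prodUnique ℕ Unit))
    (fun k => Measure.dirac (f k) s)).symm

lemma arrival_congr {τ : ℕ → ℕ → Ω → ℝ} {ω : Ω} (h : ∀ i j, Tbar i j ω = τ i j ω) (i j : ℕ) :
    arrivalTime Tbar i j ω = (arrival τ i (j + 1) ω).toNNReal := by
  simp only [arrivalTime, arrival, h]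

lemma RareMarks.convergesWeakly_poissonMulti {d : ℕ} (hd : 1 ≤ d)
    {Y : ℕ → X → EuclideanSpace ℝ (Fin d)} {g : ℕ → EuclideanSpace ℝ (Fin d) → EuclideanSpace ℝ (Fin d)}
    (hT : MeasurePreserving T μ μ) (hρs : Summable ρ) (hρ : ∀ n, 0 ≤ ρ n)
    (hY : RareMarks μ T ρ volume dom Y ∅ g) {U : ℕ → ℕ → Ω → EuclideanSpace ℝ (Fin d)}
    (hU : IsPoissonArray P (unitShell d) 1 Tbar U) :
    ConvergesWeakly μ (fun n => empiricalMarks T (dom n) (Y n) n) P (poissonMulti Tbar U) := by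
  have hpos : ∀ i, 0 < volume.real (unitShell d i) := fun i =>
    ENNReal.toReal_pos (volume_unitShell_ne_zero hd i) (volume_unitShell_ne_top d i)
  obtain ⟨τ, V, ha, hae⟩ := hU.exists_markedArray (fun i => mul_pos one_pos (hpos i)) measurable_id
  have hc : ClusterMaps volume (unitShell d) ∅
      (fun (_ : Unit) (y : EuclideanSpace ℝ (Fin d)) => y) := by
    refine ⟨measurableSet_unitShell d, disjoint_unitShell d, volume_unitShell_ne_zero hd,
      volume_unitShell_ne_top d, MeasurableSet.empty, measure_empty, fun _ => continuous_id,
      fun _ _ _ _ => toFinite _, fun K hK => ?_⟩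
    obtain ⟨I, hI⟩ := exists_unitShell_bound d K hK
    exact ⟨I, fun v _ _ hv => hI v hv⟩
  simp only [Measure.map_id] at ha
  refine hY.convergesWeakly hT hρs hρ hc zero_le_one ha ?_ fun F ε hε =>
    Eventually.of_forall fun Q s => by rw [returnFun_empty_lim, sub_self, norm_zero]; exact hε.le
  filter_upwards [hae] with ω hω
  unfold poissonMulti clusterMeasure clusterPoint
  rw [sum_measure_unit]
  congr 3
  ext k : 1
  rw [arrival_congr fun i j => (hω i j).1, ← (hω _ _).2]
  rfl

lemma RareMarks.convergesWeakly_poisson2d {Y : ℕ → X → ℝ≥0} {g : ℕ → ℝ≥0 → ℝ≥0}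
    (hT : MeasurePreserving T μ μ) (hρs : Summable ρ) (hρ : ∀ n, 0 ≤ ρ n)
    (hY : RareMarks μ T ρ halfLineMeasure dom Y ∅ g) {U : ℕ → ℕ → Ω → ℝ}
    (hU : IsPoissonArray P unitInterval2d 1 Tbar U) :
    ConvergesWeakly μ (fun n => empiricalMarks T (dom n) (Y n) n) P (poisson2d Tbar U) := by
  obtain ⟨τ, V, ha, hae⟩ := hU.exists_markedArray
    (fun i => by simp [Measure.real, volume_unitInterval2d]) measurable_real_toNNReal
  -- The shells (i, i+1] omit 0, so 0 is put into the exceptional null set. This does not affect the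
  -- intensity, which is compared at the end with the one for the empty exceptional set.
  have hc : ClusterMaps halfLineMeasure halfLineShell {0} (fun (_ : Unit) (y : ℝ≥0) => y) := by
    refine ⟨measurableSet_halfLineShell, disjoint_halfLineShell, fun i => ?_, fun i => ?_,
      measurableSet_singleton _, halfLineMeasure_singleton 0, fun _ => continuous_id,
      fun _ _ _ _ => toFinite _, fun K hK => ?_⟩
    · rw [halfLineMeasure_shell]; exact one_ne_zero
    · rw [halfLineMeasure_shell]; exact ENNReal.one_ne_top
    obtain ⟨I, hI⟩ := exists_halfLineShell_bound K hK
    exact ⟨I, fun v h0 _ hv => hI v h0 hv⟩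
  have ha' : MarkedArray P (fun i => 1 * halfLineMeasure.real (halfLineShell i))
      (fun i => ProbabilityTheory.cond halfLineMeasure (halfLineShell i)) τ V := by
    simp only [cond_halfLineMeasure, Measure.real, halfLineMeasure_shell]
    simpa only [Measure.real, volume_unitInterval2d] using ha
  refine hY.convergesWeakly hT hρs hρ hc zero_le_one ha' ?_ fun F ε hε =>
    Eventually.of_forall fun Q s => ?_
  · filter_upwards [hae] with ω hω
    unfold poisson2d clusterMeasure clusterPoint
    rw [sum_measure_unit]
    congr 3
    ext k : 1
    rw [arrival_congr fun i j => (hω i j).1, ← (hω _ _).2]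
  · rw [returnFun_empty_lim]
    have : clusterIntensity F halfLineMeasure ∅ (fun (_ : Unit) (y : ℝ≥0) => y) 1 s =
        clusterIntensity F halfLineMeasure {0} (fun (_ : Unit) (y : ℝ≥0) => y) 1 s := by
      unfold clusterIntensity
      congr 1
      refine integral_congr_ae ?_
      filter_upwards [measure_eq_zero_iff_ae_notMem.1 (halfLineMeasure_singleton 0)] with y hy
      simp [clusterFun, show y ≠ 0 from hy]
    rw [this, sub_self, norm_zero]; exact hε.le

lemma RareMarks.convergesWeakly_clusterMulti {d : ℕ} (hd : 1 ≤ d)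
    {Y : ℕ → X → EuclideanSpace ℝ (Fin d)}
    {L : EuclideanSpace ℝ (Fin d) →L[ℝ] EuclideanSpace ℝ (Fin d)} {p : ℕ} (hp : 0 < p)
    (hT : MeasurePreserving T μ μ) (hρs : Summable ρ) (hρ : ∀ n, 0 ≤ ρ n) {θ : ℝ} (hθ : 0 < θ)
    (hL : ExpandingMap volume 0 L (1 - θ))
    (hY : RareMarks μ T ρ volume dom Y {j | p ∣ j} fun j => L^[j / p])
    {U : ℕ → ℕ → Ω → EuclideanSpace ℝ (Fin d)} (hU : IsPoissonArray P (unitShell d) θ Tbar U) :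
    ConvergesWeakly μ (fun n => empiricalMarks T (dom n) (Y n) n) P (clusterMulti L Tbar U) := by
  have hpos : ∀ i, 0 < volume.real (unitShell d i) := fun i =>
    ENNReal.toReal_pos (volume_unitShell_ne_zero hd i) (volume_unitShell_ne_top d i)
  obtain ⟨τ, V, ha, hae⟩ := hU.exists_markedArray (fun i => mul_pos hθ (hpos i)) measurable_id
  have hc := hL.clusterMaps (measurableSet_unitShell d) (disjoint_unitShell d)
    (volume_unitShell_ne_zero hd) (volume_unitShell_ne_top d) fun K hK => by
      obtain ⟨I, hI⟩ := exists_unitShell_bound d K hK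
      exact ⟨I, fun v _ hv => hI v hv⟩
  simp only [Measure.map_id] at ha
  refine hY.convergesWeakly hT hρs hρ hc hθ.le ha ?_ fun F ε hε => hL.returnFun_lim hc hp F hε
  filter_upwards [hae] with ω hω
  unfold clusterMulti clusterMeasure clusterPoint
  congr 3
  ext k : 1
  rw [arrival_congr fun i j => (hω i j).1, ← (hω _ _).2, FunLike.coe_pow_eq_iterate]
  rfl

lemma RareMarks.convergesWeakly_cluster2d {d : ℕ} {α : ℝ} (hα : 0 < α) {Y : ℕ → X → ℝ≥0} {p : ℕ}
    (hp : 0 < p) (hT : MeasurePreserving T μ μ) (hρs : Summable ρ) (hρ : ∀ n, 0 ≤ ρ n) {θ : ℝ}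
    (hθ : 0 < θ) (hL : ExpandingMap halfLineMeasure 0 (fun y => (α ^ d).toNNReal * y) (1 - θ))
    (hY : RareMarks μ T ρ halfLineMeasure dom Y {j | p ∣ j}
      fun j => (fun y => (α ^ d).toNNReal * y)^[j / p])
    {U : ℕ → ℕ → Ω → ℝ} (hU : IsPoissonArray P unitInterval2d θ Tbar U) :
    ConvergesWeakly μ (fun n => empiricalMarks T (dom n) (Y n) n) P (cluster2d d α Tbar U) := by
  obtain ⟨τ, V, ha, hae⟩ := hU.exists_markedArray
    (fun i => by simpa [Measure.real, volume_unitInterval2d]) measurable_real_toNNReal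
  have hc := hL.clusterMaps measurableSet_halfLineShell disjoint_halfLineShell
    (fun i => by rw [halfLineMeasure_shell]; exact one_ne_zero)
    (fun i => by rw [halfLineMeasure_shell]; exact ENNReal.one_ne_top) exists_halfLineShell_bound
  have ha' : MarkedArray P (fun i => θ * halfLineMeasure.real (halfLineShell i))
      (fun i => ProbabilityTheory.cond halfLineMeasure (halfLineShell i)) τ V := by
    simp only [cond_halfLineMeasure, Measure.real, halfLineMeasure_shell]
    simpa only [Measure.real, volume_unitInterval2d] using ha
  refine hY.convergesWeakly hT hρs hρ hc hθ.le ha' ?_ fun F ε hε => hL.returnFun_lim hc hp F hε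
  filter_upwards [hae] with ω hω
  unfold cluster2d clusterMeasure clusterPoint
  congr 3
  ext k : 1
  rw [arrival_congr fun i j => (hω i j).1, ← (hω _ _).2]
  simp only [mul_left_iterate]
  rw [Real.toNNReal_mul (by positivity), ← Real.toNNReal_pow (by positivity), mul_comm k.2.2 d, pow_mul]

lemma expandingMap_halfLine {β : ℝ} (hβ : 1 < β) :
    ExpandingMap halfLineMeasure 0 (fun y => β.toNNReal * y) β⁻¹ := by
  have hβ0 : 0 < β := one_pos.trans hβ
  have hb : 1 < β.toNNReal := Real.one_lt_toNNReal.2 hβ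
  refine ⟨by fun_prop, halfLineMeasure_singleton 0, fun y hy => ?_, fun y hy => ?_, fun K hK => ?_, ?_,
    (inv_pos.2 hβ0).le⟩
  · exact mul_ne_zero (one_pos.trans hb).ne' hy
  · simp only [mul_left_iterate]
    rw [cocompact_eq_atTop]
    exact (tendsto_pow_atTop_atTop_of_one_lt hb).atTop_mul_const (pos_iff_ne_zero.2 hy)
  · obtain ⟨b, hB⟩ := hK.bddAbove
    refine ⟨Icc 0 b, isCompact_Icc, fun l y hy => ⟨zero_le, ?_⟩⟩
    simp only [mul_left_iterate] at hy
    refine le_trans ?_ (hB hy)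
    exact le_mul_of_one_le_left zero_le (one_le_pow₀ hb.le)
  · refine Measure.ext fun s hs => ?_
    have hm : Measurable fun y : ℝ≥0 => β.toNNReal * y := by fun_prop
    rw [Measure.map_apply hm hs, halfLineMeasure_apply (hm hs), Measure.smul_apply,
      halfLineMeasure_apply hs, smul_eq_mul]
    have : Ioi (0 : ℝ) ∩ Real.toNNReal ⁻¹' ((fun y => β.toNNReal * y) ⁻¹' s) =
        (fun x => β * x) ⁻¹' (Ioi (0 : ℝ) ∩ Real.toNNReal ⁻¹' s) := by
      ext x
      simp only [mem_inter_iff, mem_Ioi, mem_preimage, Real.toNNReal_mul hβ0.le,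
        mul_pos_iff_of_pos_left hβ0]
    rw [this, Real.volume_preimage_mul_left hβ0.ne', abs_of_pos (inv_pos.2 hβ0)]

end Limits

/-! ### Linear maps with all eigenvalues outside the unit disc -/

section Repelling

/-- Powers of an element of spectral radius less than one tend to zero. -/
lemma tendsto_pow_zero_of_spectralRadius_lt_one {A : Type*} [NormedRing A] [NormedAlgebra ℂ A]
    [CompleteSpace A] {a : A} (h : spectralRadius ℂ a < 1) :
    Tendsto (fun n : ℕ => a ^ n) atTop (𝓝 0) := by
  obtain ⟨r, hr, hr1⟩ := ENNReal.lt_iff_exists_nnreal_btwn.1 h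
  have hr1' : r < 1 := by exact_mod_cast hr1
  -- Gelfand's formula: the n-th root of the norm of a^n is eventually below r < 1, so that norm is
  -- eventually at most r^n.
  have h1 := (spectrum.pow_nnnorm_pow_one_div_tendsto_nhds_spectralRadius a).eventually
    (gt_mem_nhds hr)
  rw [tendsto_zero_iff_norm_tendsto_zero]
  refine squeeze_zero' (Eventually.of_forall fun n => norm_nonneg _) ?_
    (tendsto_pow_atTop_nhds_zero_of_lt_one r.2 (by exact_mod_cast hr1'))
  filter_upwards [h1, eventually_ge_atTop 1] with n hn hn1
  have hn0 : (n : ℝ) ≠ 0 := by positivity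
  have h2 := ENNReal.rpow_le_rpow hn.le (Nat.cast_nonneg (α := ℝ) n)
  rw [← ENNReal.rpow_mul, one_div, inv_mul_cancel₀ hn0, ENNReal.rpow_one, ENNReal.rpow_natCast] at h2
  exact_mod_cast h2

variable {n : Type*} [Fintype n] [DecidableEq n]

/-- The powers of the inverse of a complex matrix tend to zero if its eigenvalues lie outside the
closed unit disc. -/
lemma tendsto_inv_pow_apply [Nonempty n] (M : Matrix n n ℂ) (hdet : M.det ≠ 0)
    (h : ∀ z : ℂ, M.charpoly.IsRoot z → 1 < ‖z‖) (i j : n) :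
    Tendsto (fun l : ℕ => (M⁻¹ ^ l) i j) atTop (𝓝 0) := by
  let _ := Matrix.linftyOpNormedRing (n := n) (α := ℂ)
  let _ := Matrix.linftyOpNormedAlgebra (R := ℂ) (n := n) (α := ℂ)
  have hu : IsUnit M := (Matrix.isUnit_iff_isUnit_det M).2 (isUnit_iff_ne_zero.2 hdet)
  have hspec : ∀ z ∈ spectrum ℂ M⁻¹, ‖z‖₊ < 1 := by
    intro z hz
    have hz0 : z ≠ 0 := by
      rintro rfl
      exact (spectrum.zero_mem_iff ℂ).1 hz ((Matrix.isUnit_nonsing_inv_iff).2 hu)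
    have h1 : z⁻¹ ∈ spectrum ℂ M := by
      obtain ⟨w, rfl⟩ := hu
      have := (spectrum.inv_mem_iff (R := ℂ) (r := (Units.mk0 z hz0)⁻¹) (a := w)).2
      rw [inv_inv] at this
      simp only [Units.val_inv_eq_inv_val, Units.val_mk0, Matrix.coe_units_inv] at this
      exact this hz
    have h2 := h _ (Matrix.mem_spectrum_iff_isRoot_charpoly.1 h1)
    rw [norm_inv] at h2
    rw [← NNReal.coe_lt_coe, coe_nnnorm, NNReal.coe_one]
    exact (one_lt_inv₀ (norm_pos_iff.2 hz0)).1 h2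
  have h3 := tendsto_pow_zero_of_spectralRadius_lt_one
    (by simpa using spectrum.spectralRadius_lt_of_forall_lt (M⁻¹) hspec)
  rw [tendsto_zero_iff_norm_tendsto_zero] at h3 ⊢
  refine squeeze_zero (fun _ => norm_nonneg _) (fun l => ?_) h3
  rw [Matrix.linfty_opNorm_def, ← coe_nnnorm, NNReal.coe_le_coe]
  exact (Finset.single_le_sum (f := fun j => ‖(M⁻¹ ^ l) i j‖₊) (fun _ _ => zero_le)
    (Finset.mem_univ j)).trans (Finset.le_sup (f := fun i => ∑ j, ‖(M⁻¹ ^ l) i j‖₊)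
      (Finset.mem_univ i))

/-- Over ℂ the determinant is the product of the eigenvalues. There is at least one of them, which
makes the inequality strict. -/
lemma one_lt_norm_det [Nonempty n] (M : Matrix n n ℂ)
    (h : ∀ z : ℂ, M.charpoly.IsRoot z → 1 < ‖z‖) : 1 < ‖M.det‖ := by
  rw [Matrix.det_eq_prod_roots_charpoly]
  have hcard : M.charpoly.roots.card = Fintype.card n := by
    rw [← Matrix.charpoly_natDegree_eq_dim M]
    exact (IsAlgClosed.splits M.charpoly).natDegree_eq_card_roots.symm
  have hne : M.charpoly.roots ≠ 0 := fun h0 => by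
    rw [h0, Multiset.card_zero] at hcard
    exact Fintype.card_ne_zero hcard.symm
  have hroots : ∀ z ∈ M.charpoly.roots, 1 < ‖z‖ := fun z hz => h z (Polynomial.isRoot_of_mem_roots hz)
  generalize M.charpoly.roots = s at hne hroots
  clear hcard
  induction s using Multiset.induction_on with
  | empty => exact absurd rfl hne
  | cons a s ih =>
    rw [Multiset.prod_cons, norm_mul]
    have ha := hroots a (Multiset.mem_cons_self a s)
    by_cases hs : s = 0
    · simpa [hs] using ha
    · exact one_lt_mul_of_lt_of_le ha
        (ih hs fun z hz => hroots z (Multiset.mem_cons_of_mem hz)).le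

variable {d : ℕ} {L : EuclideanSpace ℝ (Fin d) →L[ℝ] EuclideanSpace ℝ (Fin d)}

lemma IsRepelling.isRoot_toMatrix (hL : IsRepelling L) (z : ℂ)
    (hz : (((LinearMap.toMatrix (EuclideanSpace.basisFun (Fin d) ℝ).toBasis
      (EuclideanSpace.basisFun (Fin d) ℝ).toBasis L.toLinearMap).map
        (algebraMap ℝ ℂ)).charpoly).IsRoot z) : 1 < ‖z‖ := by
  rw [Matrix.charpoly_map, LinearMap.charpoly_toMatrix] at hz
  exact hL z (by rw [Polynomial.aeval_def, ← Polynomial.eval_map]; exact hz)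

lemma IsRepelling.one_lt_abs_det (hd : 1 ≤ d) (hL : IsRepelling L) : 1 < |L.det| := by
  have : Nonempty (Fin d) := ⟨⟨0, hd⟩⟩
  have h := one_lt_norm_det _ hL.isRoot_toMatrix
  rw [← RingHom.mapMatrix_apply, ← RingHom.map_det, LinearMap.det_toMatrix] at h
  simpa using h

/-- A repelling linear map has an inverse whose iterates tend to zero. -/
lemma IsRepelling.exists_inverse (hd : 1 ≤ d) (hL : IsRepelling L) :
    ∃ J : EuclideanSpace ℝ (Fin d) →L[ℝ] EuclideanSpace ℝ (Fin d), J * L = 1 ∧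
      Tendsto (fun l : ℕ => ‖J ^ l‖) atTop (𝓝 0) := by
  have : Nonempty (Fin d) := ⟨⟨0, hd⟩⟩
  set b := (EuclideanSpace.basisFun (Fin d) ℝ).toBasis with hb
  set A := LinearMap.toMatrix b b L.toLinearMap with hA
  have hdetA : A.det ≠ 0 := by
    rw [hA, LinearMap.det_toMatrix]
    have := hL.one_lt_abs_det hd
    exact fun h0 => by
      have h1 : L.det = 0 := h0
      rw [h1, abs_zero] at this
      linarith
  -- The eigenvalue condition is complex, so convergence is proved for the complexified matrix; its
  -- entries are real and are recovered by taking real parts.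
  have hlim : ∀ i j, Tendsto (fun l : ℕ => (A⁻¹ ^ l) i j) atTop (𝓝 0) := by
    intro i j
    have hdetM : (A.map (algebraMap ℝ ℂ)).det ≠ 0 := by
      rw [← RingHom.mapMatrix_apply, ← RingHom.map_det]
      simpa using hdetA
    have h1 := tendsto_inv_pow_apply _ hdetM hL.isRoot_toMatrix i j
    have h2 : (A.map (algebraMap ℝ ℂ))⁻¹ = (algebraMap ℝ ℂ).mapMatrix A⁻¹ := by
      refine Matrix.inv_eq_left_inv ?_
      rw [← RingHom.mapMatrix_apply, ← map_mul,
        Matrix.nonsing_inv_mul _ (isUnit_iff_ne_zero.2 hdetA), map_one]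
    rw [h2] at h1
    have h3 := (Complex.continuous_re.tendsto _).comp h1
    refine h3.congr fun l => ?_
    simp only [Function.comp_apply]
    rw [← map_pow]
    rfl
  let φ : Matrix (Fin d) (Fin d) ℝ →ₗ[ℝ]
      (EuclideanSpace ℝ (Fin d) →L[ℝ] EuclideanSpace ℝ (Fin d)) :=
    (LinearMap.toContinuousLinearMap (𝕜 := ℝ) (E := EuclideanSpace ℝ (Fin d))
      (F' := EuclideanSpace ℝ (Fin d))).toLinearMap.comp (Matrix.toLin b b).toLinearMap
  have hφ : Continuous φ := LinearMap.continuous_of_finiteDimensional φ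
  have hφmul : ∀ B C, φ (B * C) = φ B * φ C := fun B C => by
    ext1 v
    simp only [φ, LinearMap.comp_apply, LinearEquiv.coe_coe, mul_apply_eq_comp,
      LinearMap.coe_toContinuousLinearMap', Matrix.toLin_mul b b b]
  have hφone : φ 1 = 1 := by
    ext1 v
    simp [φ]
  have hφpow : ∀ l : ℕ, φ (A⁻¹ ^ l) = φ A⁻¹ ^ l := by
    intro l
    induction l with
    | zero => simp [hφone]
    | succ l ih => rw [pow_succ, pow_succ, hφmul, ih]
  have hφA : φ A = L := by
    ext1 v
    simp [φ, hA]
  refine ⟨φ A⁻¹, ?_, ?_⟩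
  · rw [← hφA, ← hφmul, hA, Matrix.nonsing_inv_mul _ (isUnit_iff_ne_zero.2 hdetA), hφone]
  · have h1 : Tendsto (fun l : ℕ => A⁻¹ ^ l) atTop (𝓝 0) :=
      tendsto_pi_nhds.2 fun i => tendsto_pi_nhds.2 fun j => hlim i j
    have h2 := (hφ.tendsto 0).comp h1
    rw [map_zero] at h2
    simp only [Function.comp_def, hφpow] at h2
    exact tendsto_zero_iff_norm_tendsto_zero.1 h2

/-- With J the inverse of L, ‖y‖ ≤ ‖J^l‖ ‖L^l y‖ and ‖J^l‖ → 0. This yields both the escape of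
nonzero orbits and the common bound on all preimages of a compact set. The factor of the measure is
the change of variables formula. -/
lemma IsRepelling.expandingMap (hd : 1 ≤ d) (hL : IsRepelling L) :
    ExpandingMap volume 0 L |L.det|⁻¹ := by
  have : Nonempty (Fin d) := ⟨⟨0, hd⟩⟩
  obtain ⟨J, hJL, hJ⟩ := hL.exists_inverse hd
  have hJL' : ∀ (l : ℕ) y, (J ^ l) ((L : _ → _)^[l] y) = y := by
    intro l
    induction l with
    | zero => simp
    | succ l ih =>
      intro y
      rw [Function.iterate_succ_apply', pow_succ, mul_apply_eq_comp,
        ← mul_apply_eq_comp J L, hJL]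
      exact ih y
  have hbd : ∀ (l : ℕ) y, ‖y‖ ≤ ‖J ^ l‖ * ‖(L : _ → _)^[l] y‖ := fun l y => by
    conv_lhs => rw [← hJL' l y]
    exact ContinuousLinearMap.le_opNorm _ _
  have hdet : L.det ≠ 0 := fun h0 => by
    have := hL.one_lt_abs_det hd
    rw [h0, abs_zero] at this
    linarith
  refine ⟨L.continuous, measure_singleton 0, fun y hy h0 => hy ?_, fun y hy => ?_, fun K hK => ?_, ?_,
    by positivity⟩
  · have := hbd 1 y
    simp only [Function.iterate_one, h0, norm_zero, mul_zero] at this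
    simpa using this
  · rw [← Metric.cobounded_eq_cocompact, ← comap_norm_atTop, tendsto_comap_iff]
    have hy0 : 0 < ‖y‖ := norm_pos_iff.2 hy
    have hJpos : ∀ l : ℕ, 0 < ‖J ^ l‖ := fun l => by
      by_contra! hle
      have h1 := hbd l y
      rw [le_antisymm hle (norm_nonneg _), zero_mul] at h1
      linarith
    have h1 : Tendsto (fun l : ℕ => ‖y‖ * ‖J ^ l‖⁻¹) atTop atTop := by
      refine Tendsto.const_mul_atTop hy0 ?_
      exact (tendsto_nhdsWithin_iff.2 ⟨hJ, Eventually.of_forall hJpos⟩).inv_tendsto_nhdsGT_zero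
    refine tendsto_atTop_mono (fun l => ?_) h1
    rw [← div_eq_mul_inv, div_le_iff₀ (hJpos l), mul_comm]
    exact hbd l y
  · obtain ⟨C, hC⟩ := hJ.bddAbove_range
    obtain ⟨B, hB⟩ := hK.isBounded.exists_norm_le
    refine ⟨Metric.closedBall 0 (C * B), isCompact_closedBall _ _, fun l y hy => ?_⟩
    rw [mem_closedBall_zero_iff]
    have hC0 : 0 ≤ C := (norm_nonneg _).trans (hC ⟨0, rfl⟩)
    exact (hbd l y).trans (mul_le_mul (hC ⟨l, rfl⟩) (hB _ hy) (norm_nonneg _) hC0)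
  · rw [← abs_inv]
    exact Measure.map_linearMap_addHaar_eq_smul_addHaar volume (f := L.toLinearMap) hdet

end Repelling

/-! ### Metric distortion of the chart on the Riemannian manifold -/

section TangentChart

variable {d : ℕ} {H : Type*} [TopologicalSpace H]
  {I : ModelWithCorners ℝ (EuclideanSpace ℝ (Fin d)) H}
  {X : Type*} [MetricSpace X] [ChartedSpace H X] [IsManifold I 1 X]
  [RiemannianBundle (fun x : X => TangentSpace I x)]
  [IsContinuousRiemannianBundle (EuclideanSpace ℝ (Fin d)) (fun x : X => TangentSpace I x)]
  {ζ : X} {e : EuclideanSpace ℝ (Fin d) ≃ₗᵢ[ℝ] TangentSpace I ζ}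
  {Φ : OpenPartialHomeomorph (EuclideanSpace ℝ (Fin d)) X}

lemma IsTangentChart.zero_mem (hΦ : IsTangentChart I ζ e Φ) : (0 : EuclideanSpace ℝ (Fin d)) ∈ Φ.source := by
  obtain ⟨R, hR, h⟩ := hΦ.source
  rw [h]; exact Metric.mem_ball_self hR

/-- All tangent spaces share one underlying type but have norms depending on the base point. This
compares vectors whose base points are only propositionally equal, such as Φ (Φ.symm x) and x. -/
lemma norm_tangent_congr {x y : X} (h : x = y) (u : TangentSpace I x) (w : TangentSpace I y)
    (huw : (u : EuclideanSpace ℝ (Fin d)) = w) : ‖u‖ = ‖w‖ := by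
  subst h
  have : u = w := huw
  rw [this]

/-- The norm of the derivative of the chart, as a function of the base point and the vector. -/
lemma IsTangentChart.continuousOn_norm_mfderiv (hΦ : IsTangentChart I ζ e Φ) :
    ContinuousOn (fun q : EuclideanSpace ℝ (Fin d) × EuclideanSpace ℝ (Fin d) =>
      ‖mfderiv 𝓘(ℝ, EuclideanSpace ℝ (Fin d)) I Φ q.1 q.2‖) (Φ.source ×ˢ univ) := by
  have h1 := hΦ.contMDiffOn.continuousOn_tangentMapWithin le_rfl Φ.open_source.uniqueMDiffOn
  have h2 : Continuous fun q : EuclideanSpace ℝ (Fin d) × EuclideanSpace ℝ (Fin d) =>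
      (⟨q.1, q.2⟩ : TangentBundle 𝓘(ℝ, EuclideanSpace ℝ (Fin d)) (EuclideanSpace ℝ (Fin d))) :=
    (tangentBundleModelSpaceHomeomorph 𝓘(ℝ, EuclideanSpace ℝ (Fin d))).symm.continuous
  have h3 : ContinuousOn (fun q : EuclideanSpace ℝ (Fin d) × EuclideanSpace ℝ (Fin d) =>
      (⟨Φ q.1, mfderiv 𝓘(ℝ, EuclideanSpace ℝ (Fin d)) I Φ q.1 q.2⟩ : TangentBundle I X))
      (Φ.source ×ˢ univ) := by
    refine (h1.comp h2.continuousOn fun q hq => hq.1).congr fun q hq => ?_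
    simp only [Function.comp_apply]
    rw [tangentMapWithin_eq_tangentMap (Φ.open_source.uniqueMDiffOn _ hq.1)
      ((hΦ.contMDiffOn.mdifferentiableOn one_ne_zero _ hq.1).mdifferentiableAt
        (Φ.open_source.mem_nhds hq.1))]
    rfl
  have h4 := (h3.inner_bundle h3)
  refine (Real.continuous_sqrt.comp_continuousOn h4).congr fun q _ => ?_
  simp only [Function.comp_apply]
  rw [norm_eq_sqrt_real_inner]

lemma IsTangentChart.norm_mfderiv_zero (hΦ : IsTangentChart I ζ e Φ) (w : EuclideanSpace ℝ (Fin d)) :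
    ‖mfderiv 𝓘(ℝ, EuclideanSpace ℝ (Fin d)) I Φ 0 w‖ = ‖w‖ := by
  have h0 := hΦ.map_zero
  have h1 := hΦ.mfderiv_zero w
  clear hΦ
  subst h0
  have h2 : mfderiv 𝓘(ℝ, EuclideanSpace ℝ (Fin d)) I Φ 0 w = e w := h1
  rw [h2, e.norm_map]

/-- The chart almost preserves the length of tangent vectors near the origin. -/
lemma IsTangentChart.exists_norm_mfderiv_bound (hΦ : IsTangentChart I ζ e Φ) {ε : ℝ} (hε : 0 < ε) :
    ∃ r : ℝ, 0 < r ∧ Metric.ball 0 r ⊆ Φ.source ∧ ∀ v ∈ Metric.ball 0 r,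
      ∀ w : EuclideanSpace ℝ (Fin d),
        (1 - ε) * ‖w‖ ≤ ‖mfderiv 𝓘(ℝ, EuclideanSpace ℝ (Fin d)) I Φ v w‖ ∧
        ‖mfderiv 𝓘(ℝ, EuclideanSpace ℝ (Fin d)) I Φ v w‖ ≤ (1 + ε) * ‖w‖ := by
  -- Compactness of the unit sphere makes the estimate uniform in the direction; homogeneity then
  -- extends it to all vectors.
  have hev : ∀ᶠ v in 𝓝 (0 : EuclideanSpace ℝ (Fin d)),
      ∀ w ∈ Metric.sphere (0 : EuclideanSpace ℝ (Fin d)) 1,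
        |‖mfderiv 𝓘(ℝ, EuclideanSpace ℝ (Fin d)) I Φ v w‖ - 1| < ε := by
    refine (isCompact_sphere _ _).eventually_forall_of_forall_eventually fun w hw => ?_
    have hc := (hΦ.continuousOn_norm_mfderiv.continuousAt (x := (0, w))
      ((Φ.open_source.prod isOpen_univ).mem_nhds ⟨hΦ.zero_mem, mem_univ _⟩)).tendsto
    have hw1 : ‖mfderiv 𝓘(ℝ, EuclideanSpace ℝ (Fin d)) I Φ 0 w‖ = 1 := by
      rw [hΦ.norm_mfderiv_zero]; simpa using hw
    simp only [hw1] at hc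
    exact hc.eventually (Metric.ball_mem_nhds 1 hε)
  obtain ⟨r, hr, hrs⟩ := Metric.mem_nhds_iff.1
    (inter_mem hev (Φ.open_source.mem_nhds hΦ.zero_mem))
  refine ⟨r, hr, fun v hv => (hrs hv).2, fun v hv w => ?_⟩
  by_cases hw : w = 0
  · subst hw
    have : mfderiv 𝓘(ℝ, EuclideanSpace ℝ (Fin d)) I Φ v (0 : EuclideanSpace ℝ (Fin d)) = 0 :=
      ContinuousLinearMap.map_zero (mfderiv 𝓘(ℝ, EuclideanSpace ℝ (Fin d)) I Φ v)
    rw [this]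
    simp
  · have hw0 : 0 < ‖w‖ := norm_pos_iff.2 hw
    have h1 := (hrs hv).1 (‖w‖⁻¹ • w) (by
      rw [mem_sphere_zero_iff_norm, norm_smul, norm_inv, norm_norm, inv_mul_cancel₀ hw0.ne'])
    have h2 : mfderiv 𝓘(ℝ, EuclideanSpace ℝ (Fin d)) I Φ v (‖w‖⁻¹ • w) =
        ‖w‖⁻¹ • mfderiv 𝓘(ℝ, EuclideanSpace ℝ (Fin d)) I Φ v w := map_smul _ _ _
    rw [h2, norm_smul, norm_inv, norm_norm, abs_lt] at h1
    set a := ‖mfderiv 𝓘(ℝ, EuclideanSpace ℝ (Fin d)) I Φ v w‖ with ha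
    have h3 : ‖w‖ * (‖w‖⁻¹ * a) = a := by field_simp
    constructor
    · nlinarith
    · nlinarith

lemma IsTangentChart.mdifferentiableAt (hΦ : IsTangentChart I ζ e Φ) {v : EuclideanSpace ℝ (Fin d)}
    (hv : v ∈ Φ.source) : MDifferentiableAt 𝓘(ℝ, EuclideanSpace ℝ (Fin d)) I Φ v :=
  (hΦ.contMDiffOn.mdifferentiableOn one_ne_zero _ hv).mdifferentiableAt (Φ.open_source.mem_nhds hv)

lemma IsTangentChart.mdifferentiableAt_symm (hΦ : IsTangentChart I ζ e Φ) {x : X}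
    (hx : x ∈ Φ.target) : MDifferentiableAt I 𝓘(ℝ, EuclideanSpace ℝ (Fin d)) Φ.symm x :=
  (hΦ.contMDiffOn_symm.mdifferentiableOn one_ne_zero _ hx).mdifferentiableAt
    (Φ.open_target.mem_nhds hx)

lemma IsTangentChart.mfderiv_comp_symm (hΦ : IsTangentChart I ζ e Φ) {x : X} (hx : x ∈ Φ.target)
    (u : TangentSpace I x) :
    (mfderiv 𝓘(ℝ, EuclideanSpace ℝ (Fin d)) I Φ (Φ.symm x)
      (mfderiv I 𝓘(ℝ, EuclideanSpace ℝ (Fin d)) Φ.symm x u) : EuclideanSpace ℝ (Fin d)) = u := by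
  have h1 := mfderiv_comp x (hΦ.mdifferentiableAt (Φ.map_target hx)) (hΦ.mdifferentiableAt_symm hx)
  have h2 : (Φ ∘ Φ.symm) =ᶠ[𝓝 x] id := by
    filter_upwards [Φ.open_target.mem_nhds hx] with y hy using Φ.right_inv hy
  rw [h2.mfderiv_eq, mfderiv_id] at h1
  exact (congrArg (fun A : EuclideanSpace ℝ (Fin d) →L[ℝ] EuclideanSpace ℝ (Fin d) => A u) h1).symm

/-- The chart expands distances at most by a factor close to one near the origin. -/
lemma IsTangentChart.exists_riemannianEDist_le (hΦ : IsTangentChart I ζ e Φ) {ε : ℝ} (hε : 0 < ε) :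
    ∃ r : ℝ, 0 < r ∧ Metric.ball 0 r ⊆ Φ.source ∧ ∀ v ∈ Metric.ball 0 r, ∀ w ∈ Metric.ball 0 r,
      riemannianEDist I (Φ v) (Φ w) ≤ ENNReal.ofReal (1 + ε) * edist v w := by
  obtain ⟨r, hr, hrs, hb⟩ := hΦ.exists_norm_mfderiv_bound hε
  refine ⟨r, hr, hrs, fun v hv w hw => ?_⟩
  let η := ContinuousAffineMap.lineMap (R := ℝ) v w
  have hη : Icc (0 : ℝ) 1 ⊆ η ⁻¹' Metric.ball 0 r := by
    rw [← image_subset_iff, ContinuousAffineMap.coe_lineMap_eq, ← segment_eq_image_lineMap]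
    exact (convex_ball _ _).segment_subset hv hw
  have η_smooth : ContMDiffOn 𝓘(ℝ, ℝ) 𝓘(ℝ, EuclideanSpace ℝ (Fin d)) 1 η (Icc 0 1) := by
    apply ContMDiff.contMDiffOn
    rw [contMDiff_iff_contDiff]
    exact ContinuousAffineMap.contDiff _
  -- The image of the straight segment is a competitor in the definition of the distance.
  have h1 : riemannianEDist I (Φ v) (Φ w) ≤ pathELength I (Φ ∘ η) 0 1 := by
    apply riemannianEDist_le_pathELength _ _ _ zero_le_one
    · exact hΦ.contMDiffOn.comp η_smooth fun t ht => hrs (hη ht)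
    · simp [η, ContinuousAffineMap.coe_lineMap_eq]
    · simp [η, ContinuousAffineMap.coe_lineMap_eq]
  refine h1.trans ?_
  rw [← lintegral_fderiv_lineMap_eq_edist, pathELength_eq_lintegral_mfderivWithin_Icc,
    ← lintegral_const_mul' _ _ ENNReal.ofReal_ne_top]
  refine setLIntegral_mono' measurableSet_Icc fun t ht => ?_
  have h2 : mfderivWithin 𝓘(ℝ, ℝ) I (Φ ∘ η) (Icc 0 1) t =
      (mfderiv 𝓘(ℝ, EuclideanSpace ℝ (Fin d)) I Φ (η t)) ∘L
        (mfderivWithin 𝓘(ℝ, ℝ) 𝓘(ℝ, EuclideanSpace ℝ (Fin d)) η (Icc 0 1) t) := by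
    apply mfderiv_comp_mfderivWithin
    · exact hΦ.mdifferentiableAt (hrs (hη ht))
    · exact η_smooth.mdifferentiableOn one_ne_zero t ht
    · rw [uniqueMDiffWithinAt_iff_uniqueDiffWithinAt]
      exact uniqueDiffOn_Icc zero_lt_one t ht
  rw [h2]
  have h3 := (hb (η t) (hη ht) (fderivWithin ℝ η (Icc 0 1) t 1)).2
  rw [mfderivWithin_eq_fderivWithin]
  change ‖mfderiv 𝓘(ℝ, EuclideanSpace ℝ (Fin d)) I Φ (η t) (fderivWithin ℝ η (Icc 0 1) t 1)‖ₑ ≤ _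
  rw [← ofReal_norm, ← ofReal_norm,
    ← ENNReal.ofReal_mul (by positivity)]
  exact ENNReal.ofReal_le_ofReal h3

/-- A path in the image of a ball on which the chart contracts little has a short image. -/
lemma IsTangentChart.edist_symm_le_pathELength (hΦ : IsTangentChart I ζ e Φ) {r c : ℝ} (hc : 0 < c)
    (hrs : Metric.ball 0 r ⊆ Φ.source)
    (hb : ∀ v ∈ Metric.ball 0 r, ∀ w : EuclideanSpace ℝ (Fin d),
      c * ‖w‖ ≤ ‖mfderiv 𝓘(ℝ, EuclideanSpace ℝ (Fin d)) I Φ v w‖)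
    {γ : ℝ → X} (hγ : ContMDiff 𝓘(ℝ, ℝ) I 1 γ) {t₁ : ℝ} (ht₁ : 0 ≤ t₁)
    (hmem : ∀ t ∈ Icc 0 t₁, γ t ∈ Φ '' Metric.ball 0 r) :
    edist (Φ.symm (γ t₁)) (Φ.symm (γ 0)) ≤ ENNReal.ofReal c⁻¹ * pathELength I γ 0 t₁ := by
  rcases ht₁.eq_or_lt with rfl | h0
  · simp
  have htar : ∀ t ∈ Icc 0 t₁, γ t ∈ Φ.target ∧ Φ.symm (γ t) ∈ Metric.ball 0 r := by
    intro t ht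
    obtain ⟨v, hv, hvt⟩ := hmem t ht
    rw [← hvt, Φ.left_inv (hrs hv)]
    exact ⟨Φ.map_source (hrs hv), hv⟩
  have hC : ContMDiffOn 𝓘(ℝ, ℝ) 𝓘(ℝ, EuclideanSpace ℝ (Fin d)) 1 (Φ.symm ∘ γ) (Icc 0 t₁) :=
    hΦ.contMDiffOn_symm.comp hγ.contMDiffOn fun t ht => (htar t ht).1
  rw [edist_eq_enorm_sub]
  calc ‖(Φ.symm ∘ γ) t₁ - (Φ.symm ∘ γ) 0‖ₑ
      ≤ ∫⁻ t in Icc 0 t₁, ‖derivWithin (Φ.symm ∘ γ) (Icc 0 t₁) t‖ₑ := by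
        apply enorm_sub_le_lintegral_derivWithin_Icc_of_contDiffOn_Icc _ ht₁
        rwa [← contMDiffOn_iff_contDiffOn]
    _ ≤ ∫⁻ t in Icc 0 t₁, ENNReal.ofReal c⁻¹ * ‖mfderivWithin 𝓘(ℝ, ℝ) I γ (Icc 0 t₁) t 1‖ₑ := by
        refine setLIntegral_mono' measurableSet_Icc fun t ht => ?_
        have h2 : mfderivWithin 𝓘(ℝ, ℝ) 𝓘(ℝ, EuclideanSpace ℝ (Fin d)) (Φ.symm ∘ γ) (Icc 0 t₁) t =
            (mfderiv I 𝓘(ℝ, EuclideanSpace ℝ (Fin d)) Φ.symm (γ t)) ∘L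
              (mfderivWithin 𝓘(ℝ, ℝ) I γ (Icc 0 t₁) t) := by
          apply mfderiv_comp_mfderivWithin
          · exact hΦ.mdifferentiableAt_symm (htar t ht).1
          · exact (hγ.mdifferentiable one_ne_zero).mdifferentiableOn _ ht
          · rw [uniqueMDiffWithinAt_iff_uniqueDiffWithinAt]
            exact uniqueDiffOn_Icc h0 _ ht
        set u : TangentSpace I (γ t) := mfderivWithin 𝓘(ℝ, ℝ) I γ (Icc 0 t₁) t 1 with hu
        have h3 : derivWithin (Φ.symm ∘ γ) (Icc 0 t₁) t =
            (mfderiv I 𝓘(ℝ, EuclideanSpace ℝ (Fin d)) Φ.symm (γ t) u : EuclideanSpace ℝ (Fin d)) := by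
          rw [← fderivWithin_derivWithin, ← mfderivWithin_eq_fderivWithin, h2]
          rfl
        rw [h3]
        set w : EuclideanSpace ℝ (Fin d) :=
          mfderiv I 𝓘(ℝ, EuclideanSpace ℝ (Fin d)) Φ.symm (γ t) u with hw
        have h4 := hb _ (htar t ht).2 w
        have h5 := hΦ.mfderiv_comp_symm (htar t ht).1 u
        have h6 : ‖mfderiv 𝓘(ℝ, EuclideanSpace ℝ (Fin d)) I Φ (Φ.symm (γ t)) w‖ = ‖u‖ := by
          exact norm_tangent_congr (Φ.right_inv (htar t ht).1) _ _ h5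
        rw [h6] at h4
        rw [← ofReal_norm, ← ofReal_norm, ← ENNReal.ofReal_mul (by positivity)]
        refine ENNReal.ofReal_le_ofReal ?_
        rw [inv_mul_eq_div, le_div_iff₀ hc, mul_comm]
        exact h4
    _ = _ := by
        rw [lintegral_const_mul' _ _ ENNReal.ofReal_ne_top, pathELength_eq_lintegral_mfderivWithin_Icc]

/-- The chart is almost isometric near the origin. -/
theorem IsTangentChart.exists_biLipschitz [IsRiemannianManifold I X] (hΦ : IsTangentChart I ζ e Φ)
    {ε : ℝ} (hε : 0 < ε) (hε1 : ε < 1) :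
    ∃ r : ℝ, 0 < r ∧ Metric.ball 0 r ⊆ Φ.source ∧ ∀ v ∈ Metric.ball 0 r, ∀ w ∈ Metric.ball 0 r,
      (1 - ε) * dist v w ≤ dist (Φ v) (Φ w) ∧ dist (Φ v) (Φ w) ≤ (1 + ε) * dist v w := by
  obtain ⟨r₁, hr₁, hrs₁, h₁⟩ := hΦ.exists_riemannianEDist_le hε
  obtain ⟨r₂, hr₂, hrs₂, hb⟩ := hΦ.exists_norm_mfderiv_bound hε
  have hc : 0 < 1 - ε := by linarith
  refine ⟨min r₁ (r₂ / 4), by positivity,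
    (Metric.ball_subset_ball (min_le_left _ _)).trans hrs₁, fun v hv w hw => ⟨?_, ?_⟩⟩
  · have hv' : dist v 0 < r₂ / 4 := lt_of_lt_of_le hv (min_le_right _ _)
    have hw' : dist w 0 < r₂ / 4 := lt_of_lt_of_le hw (min_le_right _ _)
    have hvw : dist w v < r₂ / 2 := by
      have := dist_triangle_right w v 0
      linarith
    have hvs : v ∈ Φ.source := hrs₂ (lt_of_lt_of_le hv' (by linarith))
    have hws : w ∈ Φ.source := hrs₂ (lt_of_lt_of_le hw' (by linarith))
    by_contra! hlt
    have hlt' : riemannianEDist I (Φ v) (Φ w) < ENNReal.ofReal ((1 - ε) * dist v w) := by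
      rw [← IsRiemannianManifold.out (I := I), edist_dist]
      exact (ENNReal.ofReal_lt_ofReal_iff_of_nonneg dist_nonneg).2 hlt
    -- If the lower bound failed, some path from Φ v to Φ w would be shorter than (1 - ε) dist v w.
    -- Read in the chart it would join v to w with length below dist v w, which is absurd provided
    -- that it stays in the domain of the chart.
    obtain ⟨γ, hγ0, hγ1, hγs, hγl, -⟩ := exists_lt_locally_constant_of_riemannianEDist_lt hlt' one_pos
    have hbound : ∀ t₁ ∈ Icc (0 : ℝ) 1, (∀ t ∈ Icc 0 t₁, γ t ∈ Φ '' Metric.ball 0 r₂) →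
        dist (Φ.symm (γ t₁)) v < dist v w := by
      intro t₁ ht₁ hmem
      have h2 := hΦ.edist_symm_le_pathELength hc hrs₂ (fun v hv w => (hb v hv w).1) hγs ht₁.1 hmem
      rw [hγ0, Φ.left_inv hvs] at h2
      have h3 : ENNReal.ofReal (1 - ε)⁻¹ * pathELength I γ 0 t₁ < ENNReal.ofReal (dist v w) := by
        have h4 : pathELength I γ 0 t₁ < ENNReal.ofReal ((1 - ε) * dist v w) :=
          (pathELength_mono le_rfl ht₁.2).trans_lt hγl
        have h5 := (ENNReal.mul_lt_mul_iff_right (a := ENNReal.ofReal (1 - ε)⁻¹)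
          (ENNReal.ofReal_pos.2 (inv_pos.2 hc)).ne' ENNReal.ofReal_ne_top).2 h4
        rwa [← ENNReal.ofReal_mul (by positivity), inv_mul_cancel_left₀ hc.ne'] at h5
      have h6 := h2.trans_lt h3
      rw [edist_dist] at h6
      exact (ENNReal.ofReal_lt_ofReal_iff_of_nonneg dist_nonneg).1 h6
    have hsub : Metric.closedBall (0 : EuclideanSpace ℝ (Fin d)) (3 / 4 * r₂) ⊆ Metric.ball 0 r₂ :=
      Metric.closedBall_subset_ball (by linarith)
    have hclosed : IsClosed (Φ '' Metric.closedBall 0 (3 / 4 * r₂)) :=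
      ((isCompact_closedBall _ _).image_of_continuousOn
        (Φ.continuousOn.mono (hsub.trans hrs₂))).isClosed
    have hopen : IsOpen (Φ '' Metric.ball 0 (3 / 4 * r₂)) :=
      Φ.isOpen_image_of_subset_source Metric.isOpen_ball
        ((Metric.ball_subset_closedBall.trans hsub).trans hrs₂)
    -- Continuity argument: as long as the path stays in the image of the closed ball of radius
    -- 3r₂/4, its chart coordinate is within dist v w < r₂/2 of v, hence at norm strictly less than
    -- 3r₂/4, so the path cannot leave.
    have hall : Icc (0 : ℝ) 1 ⊆ γ ⁻¹' (Φ '' Metric.closedBall 0 (3 / 4 * r₂)) := by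
      refine IsClosed.Icc_subset_of_forall_mem_nhdsGT_of_Icc_subset
        ((hclosed.preimage hγs.continuous).inter isClosed_Icc) ?_ fun t₁ ht₁ hmem => ?_
      · refine ⟨v, ?_, hγ0.symm⟩
        rw [Metric.mem_closedBall]; linarith
      · have h1 := hbound t₁ ⟨ht₁.1, ht₁.2.le⟩ fun t ht => image_mono hsub (hmem ht)
        have h2 : γ t₁ ∈ Φ '' Metric.ball 0 (3 / 4 * r₂) := by
          obtain ⟨z, hz, hzt⟩ := hmem (right_mem_Icc.2 ht₁.1)
          refine ⟨z, ?_, hzt⟩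
          rw [← hzt, Φ.left_inv (hrs₂ (hsub hz)), dist_comm v w] at h1
          have := dist_triangle z v 0
          rw [Metric.mem_ball]
          linarith
        exact hγs.continuous.continuousWithinAt
          (mem_of_superset (hopen.mem_nhds h2) (image_mono Metric.ball_subset_closedBall))
    have hfin := hbound 1 (right_mem_Icc.2 zero_le_one) fun t ht => image_mono hsub (hall ht)
    rw [hγ1, Φ.left_inv hws, dist_comm w v] at hfin
    exact lt_irrefl _ hfin
  · have h2 := h₁ v (Metric.ball_subset_ball (min_le_left _ _) hv) w
      (Metric.ball_subset_ball (min_le_left _ _) hw)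
    rw [← IsRiemannianManifold.out (I := I), edist_dist, edist_dist,
      ← ENNReal.ofReal_mul (by positivity)] at h2
    exact (ENNReal.ofReal_le_ofReal_iff (by positivity)).1 h2

lemma IsTangentChart.mfderiv_symm (hΦ : IsTangentChart I ζ e Φ) (u : EuclideanSpace ℝ (Fin d)) :
    (mfderiv I 𝓘(ℝ, EuclideanSpace ℝ (Fin d)) Φ.symm ζ u : EuclideanSpace ℝ (Fin d)) = e.symm u := by
  have h0 := hΦ.map_zero
  have hζ : ζ ∈ Φ.target := h0 ▸ Φ.map_source hΦ.zero_mem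
  have hsymm : Φ.symm ζ = 0 := by rw [← h0, Φ.left_inv hΦ.zero_mem]
  have h1 := hΦ.mfderiv_comp_symm hζ u
  set w : EuclideanSpace ℝ (Fin d) := mfderiv I 𝓘(ℝ, EuclideanSpace ℝ (Fin d)) Φ.symm ζ u with hw
  have h2 : ∀ z : EuclideanSpace ℝ (Fin d), z = 0 →
      (mfderiv 𝓘(ℝ, EuclideanSpace ℝ (Fin d)) I Φ z w : EuclideanSpace ℝ (Fin d)) = e w := by
    rintro _ rfl
    exact hΦ.mfderiv_zero w
  have h3 : e w = (u : TangentSpace I ζ) := (h2 _ hsymm).symm.trans h1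
  have h4 : e.symm (e w) = e.symm u := congrArg (fun z : TangentSpace I ζ => e.symm z) h3
  rwa [e.symm_apply_apply] at h4

/-- In the chart, a differentiable return map has derivative `periodDeriv` at the origin. -/
lemma IsTangentChart.hasFDerivAt_return (hΦ : IsTangentChart I ζ e Φ) {T : X → X} {p : ℕ}
    (hp : T^[p] ζ = ζ) (hT : MDifferentiableAt I I T^[p] ζ) :
    HasFDerivAt (Φ.symm ∘ T^[p] ∘ Φ) (periodDeriv I T p ζ e) 0 := by
  have h0 := hΦ.map_zero
  have hζ : ζ ∈ Φ.target := h0 ▸ Φ.map_source hΦ.zero_mem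
  have hsymm : Φ.symm ζ = 0 := by rw [← h0, Φ.left_inv hΦ.zero_mem]
  have hd1 : MDifferentiableAt 𝓘(ℝ, EuclideanSpace ℝ (Fin d)) I (T^[p] ∘ Φ) 0 := by
    refine MDifferentiableAt.comp 0 (by rwa [h0]) (hΦ.mdifferentiableAt hΦ.zero_mem)
  have hd2 : MDifferentiableAt 𝓘(ℝ, EuclideanSpace ℝ (Fin d)) 𝓘(ℝ, EuclideanSpace ℝ (Fin d))
      (Φ.symm ∘ T^[p] ∘ Φ) 0 := by
    refine MDifferentiableAt.comp 0 ?_ hd1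
    simp only [Function.comp_apply, h0, hp]
    exact hΦ.mdifferentiableAt_symm hζ
  have hd3 := (mdifferentiableAt_iff_differentiableAt.1 hd2).hasFDerivAt
  refine hd3.congr_fderiv ?_
  ext1 v
  rw [← mfderiv_eq_fderiv, mfderiv_comp 0 (I' := I) (by
    simp only [Function.comp_apply, h0, hp]; exact hΦ.mdifferentiableAt_symm hζ) hd1,
    mfderiv_comp 0 (I' := I) (by rwa [h0]) (hΦ.mdifferentiableAt hΦ.zero_mem)]
  -- The chain rule evaluates derivatives at Φ 0 and T^p (Φ 0), which equal ζ only propositionally;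
  -- these two facts move them to ζ.
  have h1 : ∀ x, x = ζ → ∀ u : EuclideanSpace ℝ (Fin d),
      (mfderiv I 𝓘(ℝ, EuclideanSpace ℝ (Fin d)) Φ.symm x u : EuclideanSpace ℝ (Fin d)) =
        e.symm u := by
    rintro _ rfl u
    exact hΦ.mfderiv_symm u
  have h2 : ∀ x, x = ζ → ∀ u : EuclideanSpace ℝ (Fin d),
      (mfderiv I I T^[p] x u : EuclideanSpace ℝ (Fin d)) = mfderiv I I T^[p] ζ u := by
    rintro _ rfl u
    rfl
  refine (h1 (T^[p] (Φ 0)) (by rw [h0, hp]) _).trans ?_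
  have h3 := (h2 (Φ 0) h0 (mfderiv 𝓘(ℝ, EuclideanSpace ℝ (Fin d)) I Φ 0 v)).trans
    (congrArg (fun u : EuclideanSpace ℝ (Fin d) =>
      (mfderiv I I T^[p] ζ u : EuclideanSpace ℝ (Fin d))) (hΦ.mfderiv_zero v))
  exact congrArg (fun u : EuclideanSpace ℝ (Fin d) => e.symm u) h3

end TangentChart

section Charts

open scoped Pointwise

/-! ### Riemannian volume as normalised Hausdorff measure -/

section HausdorffLebesgue

lemma riemannianLeb_image_le (d : ℕ) {Y Z : Type*} [MetricSpace Y] [MeasurableSpace Y] [BorelSpace Y]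
    [MetricSpace Z] [MeasurableSpace Z] [BorelSpace Z] {f : Y → Z} {s : Set Y} {K : ℝ≥0}
    (hf : LipschitzOnWith K f s) :
    riemannianLeb d Z (f '' s) ≤ (K : ℝ≥0∞) ^ d * riemannianLeb d Y s := by
  have h := hf.hausdorffMeasure_image_le (d := d) (Nat.cast_nonneg d)
  rw [ENNReal.rpow_natCast] at h
  simp only [riemannianLeb, Measure.smul_apply, smul_eq_mul]
  refine (mul_le_mul_right h _).trans_eq ?_
  ring

/-- Hausdorff measure of dimension d on ℝ^d is translation invariant, hence proportional to Lebesgue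
measure; the normalisation is the proportionality factor read off on the unit ball. -/
lemma riemannianLeb_euclidean (d : ℕ) :
    riemannianLeb d (EuclideanSpace ℝ (Fin d)) = volume := by
  have hfr : ((Module.finrank ℝ (EuclideanSpace ℝ (Fin d)) : ℕ) : ℝ) = d := by
    rw [finrank_euclideanSpace_fin]
  have : Measure.IsAddHaarMeasure (G := EuclideanSpace ℝ (Fin d)) μH[(d : ℝ)] := by
    rw [← hfr]; infer_instance
  have h1 := Measure.isAddLeftInvariant_eq_smul
    (volume : Measure (EuclideanSpace ℝ (Fin d))) (μH[(d : ℝ)])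
  have hb0 : μH[(d : ℝ)] (Metric.ball (0 : EuclideanSpace ℝ (Fin d)) 1) ≠ 0 :=
    (Metric.measure_ball_pos _ _ one_pos).ne'
  have hbt : μH[(d : ℝ)] (Metric.ball (0 : EuclideanSpace ℝ (Fin d)) 1) ≠ ∞ :=
    measure_ball_lt_top.ne
  have h2 : volume (Metric.ball (0 : EuclideanSpace ℝ (Fin d)) 1) /
      μH[(d : ℝ)] (Metric.ball (0 : EuclideanSpace ℝ (Fin d)) 1) =
      (Measure.addHaarScalarFactor (volume : Measure (EuclideanSpace ℝ (Fin d))) (μH[(d : ℝ)]) :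
        ℝ≥0∞) := by
    conv_lhs => rw [h1]
    rw [Measure.smul_apply]
    exact ENNReal.mul_div_cancel_right hb0 hbt
  rw [riemannianLeb, h2]
  exact h1.symm

end HausdorffLebesgue

/-! ### Balls and volume in almost isometric coordinates -/

section AlmostIsometric

variable {d : ℕ} {X : Type*} [MetricSpace X]

/-- Coordinates that are almost isometric near the origin, which is sent to `ζ`. -/
structure IsAlmostIsometric (ζ : X) (Φ : OpenPartialHomeomorph (EuclideanSpace ℝ (Fin d)) X) :
    Prop where
  zero_mem : (0 : EuclideanSpace ℝ (Fin d)) ∈ Φ.source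
  map_zero : Φ 0 = ζ
  biLipschitz : ∀ ε : ℝ, 0 < ε → ε < 1 → ∃ r : ℝ, 0 < r ∧ Metric.ball 0 r ⊆ Φ.source ∧
    ∀ v ∈ Metric.ball 0 r, ∀ w ∈ Metric.ball 0 r,
      (1 - ε) * dist v w ≤ dist (Φ v) (Φ w) ∧ dist (Φ v) (Φ w) ≤ (1 + ε) * dist v w

variable {ζ : X} {Φ : OpenPartialHomeomorph (EuclideanSpace ℝ (Fin d)) X}

lemma IsAlmostIsometric.mem_target (hΦ : IsAlmostIsometric ζ Φ) : ζ ∈ Φ.target :=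
  hΦ.map_zero ▸ Φ.map_source hΦ.zero_mem

lemma IsAlmostIsometric.symm_apply (hΦ : IsAlmostIsometric ζ Φ) : Φ.symm ζ = 0 := by
  rw [← hΦ.map_zero, Φ.left_inv hΦ.zero_mem]

/-- Balls around `ζ` are squeezed between the images of Euclidean balls. -/
lemma IsAlmostIsometric.exists_ball (hΦ : IsAlmostIsometric ζ Φ) {ε : ℝ} (hε : 0 < ε) (hε1 : ε < 1) :
    ∃ s₀ : ℝ, 0 < s₀ ∧ Metric.ball (0 : EuclideanSpace ℝ (Fin d)) s₀ ⊆ Φ.source ∧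
      ∀ s, 0 < s → s ≤ s₀ → Φ '' Metric.ball 0 s ⊆ Metric.ball ζ ((1 + ε) * s) ∧
        Metric.ball ζ ((1 - ε) * s) ⊆ Φ '' Metric.ball 0 s := by
  obtain ⟨r, hr, hrs, hb⟩ := hΦ.biLipschitz ε hε hε1
  have hopen : IsOpen (Φ '' Metric.ball 0 r) := Φ.isOpen_image_of_subset_source Metric.isOpen_ball hrs
  obtain ⟨s₁, hs₁, hsub⟩ := Metric.isOpen_iff.1 hopen ζ ⟨0, Metric.mem_ball_self hr, hΦ.map_zero⟩
  have h0 : (0 : EuclideanSpace ℝ (Fin d)) ∈ Metric.ball 0 r := Metric.mem_ball_self hr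
  refine ⟨min r s₁, lt_min hr hs₁, (Metric.ball_subset_ball (min_le_left _ _)).trans hrs,
    fun s hs hle => ⟨?_, ?_⟩⟩
  · rintro _ ⟨v, hv, rfl⟩
    have h1 := (hb v (Metric.ball_subset_ball (hle.trans (min_le_left _ _)) hv) 0 h0).2
    rw [hΦ.map_zero] at h1
    rw [Metric.mem_ball] at hv ⊢
    nlinarith
  · intro x hx
    rw [Metric.mem_ball] at hx
    have hxs : x ∈ Metric.ball ζ s₁ := by
      rw [Metric.mem_ball]
      have := hle.trans (min_le_right r s₁)
      nlinarith
    obtain ⟨v, hv, rfl⟩ := hsub hxs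
    refine ⟨v, ?_, rfl⟩
    have h1 := (hb v hv 0 h0).1
    rw [hΦ.map_zero] at h1
    rw [Metric.mem_ball]
    have hpos : 0 < 1 - ε := by linarith
    exact lt_of_mul_lt_mul_left (h1.trans_lt hx) hpos.le

lemma IsAlmostIsometric.exists_dist_bound (hΦ : IsAlmostIsometric ζ Φ) {ε : ℝ} (hε : 0 < ε)
    (hε1 : ε < 1) : ∃ r : ℝ, 0 < r ∧ Metric.ball (0 : EuclideanSpace ℝ (Fin d)) r ⊆ Φ.source ∧
      ∀ v ∈ Metric.ball (0 : EuclideanSpace ℝ (Fin d)) r,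
        (1 - ε) * ‖v‖ ≤ dist (Φ v) ζ ∧ dist (Φ v) ζ ≤ (1 + ε) * ‖v‖ := by
  obtain ⟨r, hr, hrs, hb⟩ := hΦ.biLipschitz ε hε hε1
  refine ⟨r, hr, hrs, fun v hv => ?_⟩
  have := hb v hv 0 (Metric.mem_ball_self hr)
  rwa [hΦ.map_zero, dist_zero_right] at this

variable [MeasurableSpace X] [BorelSpace X]

lemma measurableSet_target_inter {A : Set (EuclideanSpace ℝ (Fin d))} (hA : MeasurableSet A) :
    MeasurableSet (Φ.target ∩ Φ.symm ⁻¹' A) := by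
  have h1 : Measurable fun x : Φ.target => Φ.symm x :=
    (continuousOn_iff_continuous_domRestrict.1 Φ.continuousOn_symm).measurable
  have h2 := (Φ.open_target.measurableSet).subtype_image (h1 hA)
  convert h2 using 1
  ext x
  constructor
  · rintro ⟨hx, hxA⟩
    exact ⟨⟨x, hx⟩, hxA, rfl⟩
  · rintro ⟨⟨y, hy⟩, hyA, rfl⟩
    exact ⟨hy, hyA⟩

lemma measurableSet_chart_image {A : Set (EuclideanSpace ℝ (Fin d))} (hA : MeasurableSet A)
    (hAs : A ⊆ Φ.source) : MeasurableSet (Φ '' A) := by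
  rw [Φ.image_eq_target_inter_inv_preimage hAs]
  exact measurableSet_target_inter hA

/-- The Lipschitz bound for Hausdorff measure is applied to Φ on A and to its inverse on the image.
-/
lemma IsAlmostIsometric.exists_leb_bound (hΦ : IsAlmostIsometric ζ Φ) {ε : ℝ} (hε : 0 < ε)
    (hε1 : ε < 1) : ∃ r : ℝ, 0 < r ∧ Metric.ball (0 : EuclideanSpace ℝ (Fin d)) r ⊆ Φ.source ∧
      ∀ A ⊆ Metric.ball (0 : EuclideanSpace ℝ (Fin d)) r,
        riemannianLeb d X (Φ '' A) ≠ ∞ ∧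
        (1 - ε) ^ d * volume.real A ≤ (riemannianLeb d X).real (Φ '' A) ∧
        (riemannianLeb d X).real (Φ '' A) ≤ (1 + ε) ^ d * volume.real A := by
  obtain ⟨r, hr, hrs, hb⟩ := hΦ.biLipschitz ε hε hε1
  refine ⟨r, hr, hrs, fun A hA => ?_⟩
  have hc : 0 < 1 - ε := by linarith
  have hAfin : volume A ≠ ∞ := ((measure_mono hA).trans_lt measure_ball_lt_top).ne
  have hL1 : LipschitzOnWith (1 + ε).toNNReal Φ A := by
    refine LipschitzOnWith.of_dist_le_mul fun v hv w hw => ?_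
    rw [Real.coe_toNNReal _ (by linarith)]
    exact (hb v (hA hv) w (hA hw)).2
  have hL2 : LipschitzOnWith (1 - ε)⁻¹.toNNReal Φ.symm (Φ '' A) := by
    refine LipschitzOnWith.of_dist_le_mul ?_
    rintro _ ⟨v, hv, rfl⟩ _ ⟨w, hw, rfl⟩
    rw [Φ.left_inv (hrs (hA hv)), Φ.left_inv (hrs (hA hw)), Real.coe_toNNReal _ (by positivity),
      inv_mul_eq_div, le_div_iff₀ hc, mul_comm]
    exact (hb v (hA hv) w (hA hw)).1
  have h1 := riemannianLeb_image_le d hL1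
  have h2 := riemannianLeb_image_le d hL2
  have himg : Φ.symm '' (Φ '' A) = A := by
    rw [image_image]
    exact (image_congr fun v hv => Φ.left_inv (hrs (hA hv))).trans (image_id' A)
  rw [himg, riemannianLeb_euclidean] at h2
  rw [riemannianLeb_euclidean] at h1
  have hfin : riemannianLeb d X (Φ '' A) ≠ ∞ :=
    (h1.trans_lt (ENNReal.mul_lt_top (ENNReal.pow_lt_top ENNReal.coe_lt_top) hAfin.lt_top)).ne
  refine ⟨hfin, ?_, ?_⟩
  · have h3 := ENNReal.toReal_mono (ENNReal.mul_ne_top (ENNReal.pow_ne_top ENNReal.coe_ne_top) hfin) h2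
    rw [ENNReal.toReal_mul, ENNReal.toReal_pow, ENNReal.coe_toReal,
      Real.coe_toNNReal _ (by positivity), inv_pow, inv_mul_eq_div, le_div_iff₀ (by positivity),
      mul_comm] at h3
    exact h3
  · have h3 := ENNReal.toReal_mono
      (ENNReal.mul_ne_top (ENNReal.pow_ne_top ENNReal.coe_ne_top) hAfin) h1
    rwa [ENNReal.toReal_mul, ENNReal.toReal_pow, ENNReal.coe_toReal,
      Real.coe_toNNReal _ (by linarith)] at h3

lemma volume_real_smul (ρ : ℝ) (hρ : 0 ≤ ρ) (A : Set (EuclideanSpace ℝ (Fin d))) :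
    volume.real (ρ • A) = ρ ^ d * volume.real A := by
  rw [Measure.real, Measure.addHaar_smul, finrank_euclideanSpace_fin, ENNReal.toReal_mul,
    ENNReal.toReal_ofReal (abs_nonneg _), abs_of_nonneg (by positivity), Measure.real]

lemma smul_subset_ball {A : Set (EuclideanSpace ℝ (Fin d))} {B : ℝ} (hA : A ⊆ Metric.ball 0 B)
    {ρ r : ℝ} (hρ : 0 < ρ) (hr : ρ * B ≤ r) : ρ • A ⊆ Metric.ball 0 r := by
  rintro _ ⟨v, hv, rfl⟩
  have hv' := hA hv
  simp only [mem_ball_zero_iff] at hv' ⊢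
  rw [norm_smul, Real.norm_of_nonneg hρ.le]
  exact (mul_lt_mul_of_pos_left hv' hρ).trans_le hr

lemma eventually_mul_le (B : ℝ) {r : ℝ} (hr : 0 < r) : ∀ᶠ ρ : ℝ in 𝓝[>] 0, ρ * B ≤ r := by
  have h : Tendsto (fun ρ : ℝ => ρ * B) (𝓝[>] 0) (𝓝 0) := by
    have : Tendsto (fun ρ : ℝ => ρ * B) (𝓝 0) (𝓝 (0 * B)) := tendsto_id.mul_const B
    rw [zero_mul] at this
    exact this.mono_left nhdsWithin_le_nhds
  exact (h.eventually (gt_mem_nhds hr)).mono fun _ h => h.le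

/-- A quantity squeezed between multiples of a constant that are close to one converges. -/
lemma tendsto_of_squeeze_pow {α : Type*} {l : Filter α} {f : α → ℝ} {c : ℝ} (d : ℕ)
    (h : ∀ ε : ℝ, 0 < ε → ε < 1 → ∀ᶠ a in l, (1 - ε) ^ d * c ≤ f a ∧ f a ≤ (1 + ε) ^ d * c) :
    Tendsto f l (𝓝 c) := by
  have h1 : Tendsto (fun ε : ℝ => (1 - ε) ^ d * c) (𝓝[>] 0) (𝓝 c) := by
    have : Continuous fun ε : ℝ => (1 - ε) ^ d * c := by fun_prop
    simpa using (this.tendsto 0).mono_left nhdsWithin_le_nhds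
  have h2 : Tendsto (fun ε : ℝ => (1 + ε) ^ d * c) (𝓝[>] 0) (𝓝 c) := by
    have : Continuous fun ε : ℝ => (1 + ε) ^ d * c := by fun_prop
    simpa using (this.tendsto 0).mono_left nhdsWithin_le_nhds
  have h01 : ∀ᶠ ε : ℝ in 𝓝[>] 0, 0 < ε ∧ ε < 1 := by
    filter_upwards [Ioo_mem_nhdsGT one_pos] with ε hε using hε
  rw [tendsto_order]
  constructor
  · intro a ha
    obtain ⟨ε, ⟨hε, hε1⟩, hlt⟩ := (h01.and (h1.eventually (lt_mem_nhds ha))).exists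
    filter_upwards [h ε hε hε1] with x hx using hlt.trans_le hx.1
  · intro a ha
    obtain ⟨ε, ⟨hε, hε1⟩, hlt⟩ := (h01.and (h2.eventually (gt_mem_nhds ha))).exists
    filter_upwards [h ε hε hε1] with x hx using hx.2.trans_lt hlt

lemma IsAlmostIsometric.tendsto_leb_image (hΦ : IsAlmostIsometric ζ Φ)
    {A : Set (EuclideanSpace ℝ (Fin d))} (hA : Bornology.IsBounded A) :
    Tendsto (fun ρ : ℝ => (riemannianLeb d X).real (Φ '' (ρ • A)) / ρ ^ d) (𝓝[>] 0)
      (𝓝 (volume.real A)) := by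
  obtain ⟨B, hB⟩ := hA.subset_ball 0
  refine tendsto_of_squeeze_pow d fun ε hε hε1 => ?_
  obtain ⟨r, hr, -, hb⟩ := hΦ.exists_leb_bound hε hε1
  filter_upwards [eventually_mul_le B hr, self_mem_nhdsWithin] with ρ h1 h2
  have hρ : 0 < ρ := h2
  obtain ⟨-, h3, h4⟩ := hb _ (smul_subset_ball hB hρ h1)
  rw [volume_real_smul ρ hρ.le] at h3 h4
  rw [le_div_iff₀ (by positivity), div_le_iff₀ (by positivity)]
  constructor <;> linarith

lemma IsAlmostIsometric.eventually_leb_ball_ne_top (hΦ : IsAlmostIsometric ζ Φ) :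
    ∀ᶠ s : ℝ in 𝓝[>] 0, riemannianLeb d X (Metric.ball ζ s) ≠ ∞ := by
  obtain ⟨r, hr, hrs, hb⟩ := hΦ.exists_leb_bound one_half_pos one_half_lt_one
  obtain ⟨s₀, hs₀, -, hs⟩ := hΦ.exists_ball one_half_pos one_half_lt_one
  have hm : 0 < min r s₀ := lt_min hr hs₀
  filter_upwards [Ioo_mem_nhdsGT (half_pos hm)] with s hs'
  have h1 := (hs (min r s₀) hm (min_le_right _ _)).2
  have h2 : Metric.ball ζ s ⊆ Φ '' Metric.ball 0 (min r s₀) :=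
    (Metric.ball_subset_ball (by linarith [hs'.2])).trans h1
  exact ((measure_mono h2).trans_lt
    (hb _ (Metric.ball_subset_ball (min_le_left _ _))).1.lt_top).ne

lemma ball_eq_smul {s : ℝ} (hs : 0 < s) :
    s • Metric.ball (0 : EuclideanSpace ℝ (Fin d)) 1 = Metric.ball 0 s := by
  rw [smul_ball hs.ne', smul_zero, Real.norm_of_nonneg hs.le, mul_one]

/-- The ball of radius s around ζ lies between the images of the Euclidean balls of radii s/(1+ε)
and s/(1-ε), and each image distorts volume by at most (1±ε)^d. -/
lemma IsAlmostIsometric.tendsto_leb_ball (hΦ : IsAlmostIsometric ζ Φ) :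
    Tendsto (fun s : ℝ => (riemannianLeb d X).real (Metric.ball ζ s) / s ^ d) (𝓝[>] 0)
      (𝓝 (volume.real (Metric.ball (0 : EuclideanSpace ℝ (Fin d)) 1))) := by
  set v := volume.real (Metric.ball (0 : EuclideanSpace ℝ (Fin d)) 1) with hv
  have hv0 : 0 ≤ v := measureReal_nonneg
  have key : ∀ ε : ℝ, 0 < ε → ε < 1 → ∀ᶠ s : ℝ in 𝓝[>] 0,
      ((1 - ε) / (1 + ε)) ^ d * v ≤ (riemannianLeb d X).real (Metric.ball ζ s) / s ^ d ∧
      (riemannianLeb d X).real (Metric.ball ζ s) / s ^ d ≤ ((1 + ε) / (1 - ε)) ^ d * v := by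
    intro ε hε hε1
    have hc : 0 < 1 - ε := by linarith
    have hc' : 0 < 1 + ε := by linarith
    obtain ⟨r, hr, hrs, hb⟩ := hΦ.exists_leb_bound hε hε1
    obtain ⟨s₀, hs₀, -, hball⟩ := hΦ.exists_ball hε hε1
    have hm : 0 < min r s₀ := lt_min hr hs₀
    filter_upwards [eventually_mul_le (1 - ε)⁻¹ hm, self_mem_nhdsWithin,
      hΦ.eventually_leb_ball_ne_top] with s h1 h2 hfin
    have hs : 0 < s := h2
    have hle : s / (1 + ε) ≤ s * (1 - ε)⁻¹ := by
      rw [← div_eq_mul_inv]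
      exact div_le_div_of_nonneg_left hs.le hc (by linarith)
    have e1 := (hball (s / (1 + ε)) (by positivity) (hle.trans (h1.trans (min_le_right _ _)))).1
    have e2 := (hball (s * (1 - ε)⁻¹) (by positivity) (h1.trans (min_le_right _ _))).2
    rw [mul_div_cancel₀ _ hc'.ne'] at e1
    rw [mul_comm s, mul_inv_cancel_left₀ hc.ne', mul_comm] at e2
    obtain ⟨-, f1, -⟩ := hb (Metric.ball 0 (s / (1 + ε)))
      (Metric.ball_subset_ball (hle.trans (h1.trans (min_le_left _ _))))
    obtain ⟨g0, -, g1⟩ := hb (Metric.ball 0 (s * (1 - ε)⁻¹))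
      (Metric.ball_subset_ball (h1.trans (min_le_left _ _)))
    rw [← ball_eq_smul (by positivity), volume_real_smul _ (by positivity), ← hv] at f1 g1
    rw [le_div_iff₀ (by positivity), div_le_iff₀ (by positivity)]
    constructor
    · refine le_trans (le_of_eq ?_) (f1.trans ?_)
      · rw [div_pow, div_pow]; field_simp
      · rw [ball_eq_smul (by positivity)]
        exact measureReal_mono e1 hfin
    · refine (measureReal_mono e2 g0).trans ?_
      rw [← ball_eq_smul (by positivity)]
      refine g1.trans (le_of_eq ?_)
      rw [div_pow, mul_pow, inv_pow]; field_simp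
  have h1 : Tendsto (fun ε : ℝ => ((1 - ε) / (1 + ε)) ^ d * v) (𝓝[>] 0) (𝓝 v) := by
    have : ContinuousAt (fun ε : ℝ => ((1 - ε) / (1 + ε)) ^ d * v) 0 := by
      fun_prop (disch := norm_num)
    simpa using this.tendsto.mono_left nhdsWithin_le_nhds
  have h2 : Tendsto (fun ε : ℝ => ((1 + ε) / (1 - ε)) ^ d * v) (𝓝[>] 0) (𝓝 v) := by
    have : ContinuousAt (fun ε : ℝ => ((1 + ε) / (1 - ε)) ^ d * v) 0 := by
      fun_prop (disch := norm_num)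
    simpa using this.tendsto.mono_left nhdsWithin_le_nhds
  have h01 : ∀ᶠ ε : ℝ in 𝓝[>] 0, 0 < ε ∧ ε < 1 := by
    filter_upwards [Ioo_mem_nhdsGT one_pos] with ε hε using hε
  rw [tendsto_order]
  constructor
  · intro a ha
    obtain ⟨ε, ⟨hε, hε1⟩, hlt⟩ := (h01.and (h1.eventually (lt_mem_nhds ha))).exists
    filter_upwards [key ε hε hε1] with x hx using hlt.trans_le hx.1
  · intro a ha
    obtain ⟨ε, ⟨hε, hε1⟩, hlt⟩ := (h01.and (h2.eventually (gt_mem_nhds ha))).exists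
    filter_upwards [key ε hε hε1] with x hx using hx.2.trans_lt hlt

end AlmostIsometric

/-! ### Asymptotics of the invariant measure near ζ -/

section Density

variable {d : ℕ} {X : Type*} [MetricSpace X] [MeasurableSpace X] [BorelSpace X] {μ : Measure X}
  [IsProbabilityMeasure μ] {h : X → ℝ≥0} {ζ : X}
  {Φ : OpenPartialHomeomorph (EuclideanSpace ℝ (Fin d)) X}

/-- The asymptotic constant of `μ(B_s(ζ)) / s^d`. -/
def ballConstant (d : ℕ) (h : X → ℝ≥0) (ζ : X) : ℝ :=
  h ζ * volume.real (Metric.ball (0 : EuclideanSpace ℝ (Fin d)) 1)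

lemma volume_real_ball_pos : 0 < volume.real (Metric.ball (0 : EuclideanSpace ℝ (Fin d)) 1) :=
  ENNReal.toReal_pos (Metric.measure_ball_pos _ _ one_pos).ne' measure_ball_lt_top.ne

lemma ballConstant_pos (hpos : 0 < h ζ) : 0 < ballConstant d h ζ :=
  mul_pos (by exact_mod_cast hpos) volume_real_ball_pos

/-- Only the density of μ along balls enters, not the Lebesgue point property. The convergence of
the two-dimensional processes rests on this alone. -/
lemma tendsto_measure_ball (hΦ : IsAlmostIsometric ζ Φ)
    (hdens : Tendsto (fun ε : ℝ => μ.real (Metric.ball ζ ε) /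
      (riemannianLeb d X).real (Metric.ball ζ ε)) (𝓝[>] 0) (𝓝 (h ζ : ℝ))) :
    Tendsto (fun s : ℝ => μ.real (Metric.ball ζ s) / s ^ d) (𝓝[>] 0) (𝓝 (ballConstant d h ζ)) := by
  have h1 := hΦ.tendsto_leb_ball
  refine (hdens.mul h1).congr' ?_
  have h2 := h1.eventually (lt_mem_nhds volume_real_ball_pos)
  filter_upwards [h2, self_mem_nhdsWithin] with s hs hs0
  have hs0' : (0 : ℝ) < s := hs0
  have : (riemannianLeb d X).real (Metric.ball ζ s) ≠ 0 := by
    intro h0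
    rw [h0, zero_div] at hs
    exact lt_irrefl _ hs
  field_simp

lemma integrable_density (hh : Measurable h)
    (hμ : μ = (riemannianLeb d X).withDensity (fun x => (h x : ℝ≥0∞))) :
    Integrable (fun x => (h x : ℝ)) (riemannianLeb d X) := by
  refine ⟨hh.coe_nnreal_real.aestronglyMeasurable, ?_⟩
  have h1 : μ univ < ∞ := measure_lt_top μ univ
  rw [hμ, withDensity_apply _ MeasurableSet.univ, Measure.restrict_univ] at h1
  rw [hasFiniteIntegral_iff_enorm]
  refine lt_of_eq_of_lt (lintegral_congr fun x => ?_) h1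
  rw [Real.enorm_eq_ofReal (NNReal.coe_nonneg _), ENNReal.ofReal_coe_nnreal]

lemma measureReal_eq_setIntegral (hh : Measurable h)
    (hμ : μ = (riemannianLeb d X).withDensity (fun x => (h x : ℝ≥0∞))) {A : Set X}
    (hA : MeasurableSet A) : μ.real A = ∫ x in A, (h x : ℝ) ∂(riemannianLeb d X) := by
  rw [integral_eq_lintegral_of_nonneg_ae (Eventually.of_forall fun x => NNReal.coe_nonneg (h x))
    hh.coe_nnreal_real.aestronglyMeasurable, Measure.real]
  conv_lhs => rw [hμ, withDensity_apply _ hA]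
  simp only [ENNReal.ofReal_coe_nnreal]

/-- Near a Lebesgue point of the density, the measure of a set in the chart is proportional to its
volume. -/
lemma tendsto_measure_image (hΦ : IsAlmostIsometric ζ Φ) (hh : Measurable h)
    (hμ : μ = (riemannianLeb d X).withDensity (fun x => (h x : ℝ≥0∞)))
    (hleb : IsLebesguePoint d h ζ) {A : Set (EuclideanSpace ℝ (Fin d))} (hAm : MeasurableSet A)
    (hA : Bornology.IsBounded A) :
    Tendsto (fun ρ : ℝ => μ.real (Φ '' (ρ • A)) / ρ ^ d) (𝓝[>] 0) (𝓝 (h ζ * volume.real A)) := by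
  obtain ⟨B', hB'⟩ := hA.subset_ball 0
  set B := max B' 1 with hBdef
  have hB : A ⊆ Metric.ball 0 B := hB'.trans (Metric.ball_subset_ball (le_max_left _ _))
  have hB1 : 0 < B := lt_of_lt_of_le one_pos (le_max_right _ _)
  obtain ⟨s₀, hs₀, hsrc, hball⟩ := hΦ.exists_ball one_half_pos one_half_lt_one
  have hscale : Tendsto (fun ρ : ℝ => 3 / 2 * B * ρ) (𝓝[>] 0) (𝓝[>] 0) := by
    refine tendsto_nhdsWithin_iff.2 ⟨?_, ?_⟩
    · have : Continuous fun ρ : ℝ => 3 / 2 * B * ρ := by fun_prop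
      simpa using (this.tendsto 0).mono_left nhdsWithin_le_nhds
    · filter_upwards [self_mem_nhdsWithin] with ρ hρ
      have : (0 : ℝ) < ρ := hρ
      exact mem_Ioi.2 (by positivity)
  have h1 := (hΦ.tendsto_leb_image hA).const_mul (h ζ : ℝ)
  have h2 := (hleb.comp hscale).mul ((hΦ.tendsto_leb_ball (d := d)).comp hscale)
  -- The image of ρ • A lies in this ball, so replacing h by h ζ costs at most the oscillation over
  -- it. At a Lebesgue point this is o(ρ^d).
  have h3 : Tendsto (fun ρ : ℝ => (∫ x in Metric.ball ζ (3 / 2 * B * ρ), |(h x : ℝ) - h ζ|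
      ∂(riemannianLeb d X)) / ρ ^ d) (𝓝[>] 0) (𝓝 0) := by
    have h4 := h2.mul_const ((3 / 2 * B) ^ d)
    rw [zero_mul, zero_mul] at h4
    refine h4.congr' ?_
    have h5 := ((hΦ.tendsto_leb_ball (d := d)).comp hscale).eventually
      (lt_mem_nhds volume_real_ball_pos)
    filter_upwards [h5, self_mem_nhdsWithin] with ρ hρ hρ0
    have hρ0' : (0 : ℝ) < ρ := hρ0
    simp only [Function.comp_apply] at hρ ⊢
    have : (riemannianLeb d X).real (Metric.ball ζ (3 / 2 * B * ρ)) ≠ 0 := by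
      intro h0
      rw [h0, zero_div] at hρ
      exact lt_irrefl _ hρ
    rw [setAverage_eq, smul_eq_mul, mul_pow (3 / 2 * B) ρ d]
    have hB0 : (3 / 2 * B) ^ d ≠ 0 := by positivity
    have hρd : ρ ^ d ≠ 0 := by positivity
    generalize (3 / 2 * B) ^ d = b at *
    generalize ρ ^ d = c at *
    generalize (riemannianLeb d X).real (Metric.ball ζ (3 / 2 * B * ρ)) = a at *
    field_simp
  refine tendsto_of_tendsto_of_dist h1 ?_
  refine squeeze_zero' (Eventually.of_forall fun _ => dist_nonneg) ?_ h3
  filter_upwards [eventually_mul_le B hs₀, self_mem_nhdsWithin,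
    hscale.eventually hΦ.eventually_leb_ball_ne_top] with ρ hρB hρ0 hfin
  have hρ : (0 : ℝ) < ρ := hρ0
  have hAB : ρ • A ⊆ Metric.ball 0 (ρ * B) := smul_subset_ball hB hρ le_rfl
  have hsub : Φ '' (ρ • A) ⊆ Metric.ball ζ (3 / 2 * B * ρ) := by
    refine (image_mono hAB).trans (((hball (ρ * B) (by positivity) hρB).1).trans_eq ?_)
    congr 1; ring
  have hm : MeasurableSet (Φ '' (ρ • A)) := measurableSet_chart_image
    (hAm.const_smul₀ ρ) ((hAB.trans (Metric.ball_subset_ball hρB)).trans hsrc)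
  have hint := integrable_density hh hμ
  have hconst : IntegrableOn (fun _ : X => (h ζ : ℝ)) (Metric.ball ζ (3 / 2 * B * ρ))
      (riemannianLeb d X) := integrableOn_const hfin
  have hi : IntegrableOn (fun x => (h x : ℝ) - h ζ) (Metric.ball ζ (3 / 2 * B * ρ))
      (riemannianLeb d X) := hint.integrableOn.sub hconst
  rw [Real.dist_eq, measureReal_eq_setIntegral hh hμ hm, ← mul_div_assoc, ← sub_div, abs_div,
    abs_of_pos (pow_pos hρ d)]
  refine div_le_div_of_nonneg_right ?_ (by positivity)
  have e1 : (h ζ : ℝ) * (riemannianLeb d X).real (Φ '' (ρ • A)) =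
      ∫ x in Φ '' (ρ • A), (h ζ : ℝ) ∂(riemannianLeb d X) := by
    rw [setIntegral_const, smul_eq_mul, mul_comm]
  rw [e1, abs_sub_comm, ← integral_sub hint.integrableOn (hconst.mono_set hsub)]
  refine (abs_integral_le_integral_abs).trans ?_
  exact setIntegral_mono_set hi.abs (Eventually.of_forall fun x => abs_nonneg _)
    (LE.le.eventuallyLE hsub)

end Density

/-! ### Extracting decorrelation of sets from the decay of correlations -/

section Decay

variable {d : ℕ} {X : Type*} [MetricSpace X] [MeasurableSpace X] {μ : Measure X}
  [IsProbabilityMeasure μ] {T : X → X} {C₁ : Type*} [NormedAddCommGroup C₁] [NormedSpace ℝ C₁]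
  {ι : C₁ →ₗ[ℝ] (X →ₘ[μ] ℝ)}

/-- Tame sets decorrelate, uniformly for each complexity `K`. -/
lemma SummableDecayAgainstL1.exists_decSet (hT : MeasurePreserving T μ μ)
    (hdecay : SummableDecayAgainstL1 d μ T ι) :
    ∃ ρ : ℕ → ℝ, Summable ρ ∧ (∀ n, 0 ≤ ρ n) ∧ ∀ K : ℕ, ∃ C : ℝ, ∀ B : Set X, MeasurableSet B →
      IsTameSet d K B → DecSet μ T ρ C B := by
  obtain ⟨ρ, hρ, hcor⟩ := hdecay.decay
  refine ⟨fun n => |ρ n|, hρ.abs, fun n => abs_nonneg _, fun K => ?_⟩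
  obtain ⟨C, hC⟩ := hdecay.indicator K
  refine ⟨max C 0, fun B hBm hB => ⟨le_max_right _ _, hBm, fun ψ hψ n hn => ?_⟩⟩
  obtain ⟨φ, hφ, hφC⟩ := hC B hBm hB
  have h1 := hcor φ ψ hψ n hn
  have e1 : ∫ x, ι φ x * ψ (T^[n] x) ∂μ = ∫ x in B, ψ (T^[n] x) ∂μ := by
    rw [← integral_indicator hBm]
    refine integral_congr_ae ?_
    filter_upwards [hφ] with x hx
    rw [hx]
    by_cases hxB : x ∈ B <;> simp [hxB]
  have e2 : ∫ x, ι φ x ∂μ = μ.real B := by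
    rw [integral_congr_ae hφ, integral_indicator hBm, setIntegral_const, smul_eq_mul, mul_one]
  unfold correlation at h1
  rw [e1, e2] at h1
  have hI : 0 ≤ ∫ x, |ψ x| ∂μ := integral_nonneg fun x => abs_nonneg _
  -- `correlation` divides by ‖φ‖ ∫ |ψ| and is zero when this vanishes, so its bound then says
  -- nothing. In those cases ψ or the indicator of B is null and the claim is checked directly.
  rcases hI.eq_or_lt with hI0 | hI0
  · have hψ0 : ψ =ᵐ[μ] 0 := by
      have := (integral_eq_zero_iff_of_nonneg (fun x => abs_nonneg (ψ x)) hψ.abs).1 hI0.symm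
      filter_upwards [this] with x hx using abs_eq_zero.1 hx
    have hψT : (fun x => ψ (T^[n] x)) =ᵐ[μ] 0 :=
      (hT.iterate n).quasiMeasurePreserving.ae_eq_comp hψ0
    rw [← hI0, setIntegral_congr_ae (g := fun _ => (0 : ℝ)) hBm
      (hψT.mono fun x hx _ => hx), integral_congr_ae hψ0]
    simp
  · rcases (norm_nonneg φ).eq_or_lt with hφ0 | hφ0
    · have hφz : φ = 0 := norm_eq_zero.1 hφ0.symm
      have hB0 : μ B = 0 := by
        rw [hφz, map_zero] at hφ
        have h2 : B.indicator (fun _ => (1 : ℝ)) =ᵐ[μ] 0 := hφ.symm.trans AEEqFun.coeFn_zero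
        rw [measure_eq_zero_iff_ae_notMem]
        filter_upwards [h2] with x hx hxB
        simp [hxB] at hx
      rw [Measure.restrict_eq_zero.2 hB0, Measure.real, hB0]
      simp only [integral_zero_measure, ENNReal.toReal_zero, zero_mul, sub_zero, abs_zero]
      have := le_max_right C 0
      positivity
    · rw [one_div, inv_mul_eq_div, div_le_iff₀ (by positivity)] at h1
      refine h1.trans ?_
      have h2 : ρ n * ‖φ‖ ≤ max C 0 * |ρ n| := by
        rw [mul_comm]
        calc ‖φ‖ * ρ n ≤ ‖φ‖ * |ρ n| := mul_le_mul_of_nonneg_left (le_abs_self _) hφ0.le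
          _ ≤ max C 0 * |ρ n| :=
            mul_le_mul_of_nonneg_right (hφC.trans (le_max_left _ _)) (abs_nonneg _)
      calc ρ n * (‖φ‖ * ∫ x, |ψ x| ∂μ) = ρ n * ‖φ‖ * ∫ x, |ψ x| ∂μ := by ring
        _ ≤ _ := mul_le_mul_of_nonneg_right h2 hI

end Decay

/-! ### Tameness of small boxes and balls in the chart -/

section Tame

variable {d : ℕ} {X : Type*} [MetricSpace X] {ζ : X}
  {Φ : OpenPartialHomeomorph (EuclideanSpace ℝ (Fin d)) X}

/-- A bounded connected set whose frontier is covered by Lipschitz images of `[0,1]^{d-1}`. -/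
structure IsTameModel (Q : Set (EuclideanSpace ℝ (Fin d))) : Prop where
  isPreconnected : IsPreconnected Q
  isBounded : Bornology.IsBounded Q
  measurableSet : MeasurableSet Q
  frontier : ∃ (m : ℕ) (f : Fin m → (Fin (d - 1) → ℝ) → EuclideanSpace ℝ (Fin d)) (C : ℝ≥0),
    (∀ i, LipschitzOnWith C (f i) (Icc 0 1)) ∧ frontier Q ⊆ ⋃ i, f i '' Icc 0 1

/-- The closure of Q is compact, so its image is closed in X; the chart maps the interior to an open
set. Hence the frontier of the image cannot exceed the image of the frontier. -/
lemma frontier_chart_image_subset {Q : Set (EuclideanSpace ℝ (Fin d))} (hQ : Bornology.IsBounded Q)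
    {ρ : ℝ} (hρ : ρ ≠ 0) (hs : ρ • closure Q ⊆ Φ.source) :
    frontier (Φ '' (ρ • Q)) ⊆ Φ '' (ρ • frontier Q) := by
  have hcl : IsCompact (ρ • closure Q) := hQ.isCompact_closure.smul ρ
  have h1 : closure (Φ '' (ρ • Q)) ⊆ Φ '' (ρ • closure Q) :=
    closure_minimal (image_mono (smul_set_mono subset_closure))
      (hcl.image_of_continuousOn (Φ.continuousOn.mono hs)).isClosed
  have hopen : IsOpen (ρ • interior Q) := isOpen_interior.smul₀ hρ
  have h2 : Φ '' (ρ • interior Q) ⊆ interior (Φ '' (ρ • Q)) := by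
    refine interior_maximal (image_mono (smul_set_mono interior_subset)) ?_
    exact Φ.isOpen_image_of_subset_source hopen
      ((smul_set_mono (interior_subset.trans subset_closure)).trans hs)
  rintro x ⟨hx1, hx2⟩
  obtain ⟨_, ⟨v, hv, rfl⟩, rfl⟩ := h1 hx1
  exact ⟨_, ⟨v, ⟨hv, fun hvi => hx2 (h2 ⟨_, ⟨v, hvi, rfl⟩, rfl⟩)⟩, rfl⟩, rfl⟩

lemma ENat_card_connectedComponents_le {Y : Type*} [TopologicalSpace Y] {s : Set Y}
    (hs : IsPreconnected s) : ENat.card (ConnectedComponents s) ≤ 1 := by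
  rw [ENat.card_le_one_iff_subsingleton]
  have : PreconnectedSpace s := isPreconnected_iff_preconnectedSpace.1 hs
  infer_instance

/-- The images in the chart of the dilates of a tame model are tame, uniformly. -/
lemma IsAlmostIsometric.exists_isTameSet (hΦ : IsAlmostIsometric ζ Φ)
    {Q : Set (EuclideanSpace ℝ (Fin d))} (hQ : IsTameModel Q) :
    ∃ (K : ℕ) (r : ℝ), 0 < r ∧ ∀ ρ, 0 < ρ → ρ ≤ r → ρ • Q ⊆ Φ.source ∧
      IsTameSet d K (Φ '' (ρ • Q)) := by
  obtain ⟨m, f, C, hf, hfr⟩ := hQ.frontier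
  obtain ⟨r₁, hr₁, hrs, hb⟩ := hΦ.biLipschitz (1 / 2) one_half_pos one_half_lt_one
  have hbd : Bornology.IsBounded (closure Q ∪ ⋃ i, f i '' Icc 0 1) := by
    refine hQ.isBounded.closure.union (Bornology.isBounded_iUnion.2 fun i => ?_)
    exact (isCompact_Icc.image_of_continuousOn (hf i).continuousOn).isBounded
  obtain ⟨B', hB'⟩ := hbd.subset_ball 0
  set B := max B' 1
  have hB : closure Q ∪ ⋃ i, f i '' Icc 0 1 ⊆ Metric.ball 0 B :=
    hB'.trans (Metric.ball_subset_ball (le_max_left _ _))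
  have hB1 : 0 < B := lt_of_lt_of_le one_pos (le_max_right _ _)
  obtain ⟨c, hc⟩ := exists_nat_ge (2 * C)
  -- K dominates the number m of covering maps, the Lipschitz constant 2C (Φ is 3/2-Lipschitz and ρ
  -- ≤ 1) and the single component. It does not depend on ρ.
  refine ⟨max (max m c) 1, min 1 (r₁ / B), lt_min one_pos (div_pos hr₁ hB1), fun ρ hρ hρr => ?_⟩
  have hρ1 : ρ ≤ 1 := hρr.trans (min_le_left _ _)
  have hρB : ρ * B ≤ r₁ := (le_div_iff₀ hB1).1 (hρr.trans (min_le_right _ _))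
  have hsub : ∀ v ∈ closure Q ∪ ⋃ i, f i '' Icc 0 1, ρ • v ∈ Metric.ball 0 r₁ := fun v hv =>
    smul_subset_ball hB hρ hρB ⟨v, hv, rfl⟩
  have hcl : ρ • closure Q ⊆ Φ.source := by
    rintro _ ⟨v, hv, rfl⟩
    exact hrs (hsub v (Or.inl hv))
  refine ⟨(smul_set_mono subset_closure).trans hcl, ?_, ?_⟩
  · have h1 : IsPreconnected (Φ '' (ρ • Q)) := by
      refine IsPreconnected.image ?_ _ (Φ.continuousOn.mono ((smul_set_mono subset_closure).trans hcl))
      exact hQ.isPreconnected.image _ (continuous_const_smul ρ).continuousOn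
    refine (ENat_card_connectedComponents_le h1).trans ?_
    exact_mod_cast le_max_right _ _
  · classical
    -- Exactly K maps are required; the surplus ones are constant.
    refine ⟨fun i => if hi : i.1 < m then fun t => Φ (ρ • f ⟨i.1, hi⟩ t) else fun _ => Φ 0,
      fun i => ?_, fun x hx => ?_⟩
    · by_cases hi : i.1 < m
      · simp only [hi, dif_pos]
        refine LipschitzOnWith.of_dist_le_mul fun t ht t' ht' => ?_
        have hm : ∀ s ∈ Icc (0 : Fin (d - 1) → ℝ) 1, ρ • f ⟨i.1, hi⟩ s ∈ Metric.ball 0 r₁ :=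
          fun s hs => hsub _ (Or.inr (mem_iUnion.2 ⟨_, s, hs, rfl⟩))
        have h1 := (hb _ (hm t ht) _ (hm t' ht')).2
        have h2 := (hf ⟨i.1, hi⟩).dist_le_mul t ht t' ht'
        rw [dist_smul₀, Real.norm_of_nonneg hρ.le] at h1
        have h3 : (2 : ℝ) * C ≤ ((max (max m c) 1 : ℕ) : ℝ) := by
          have h4 : (2 : ℝ) * C ≤ c := by exact_mod_cast hc
          refine h4.trans ?_
          exact_mod_cast (le_max_right m c).trans (le_max_left _ _)
        have h5 : ρ * dist (f ⟨i.1, hi⟩ t) (f ⟨i.1, hi⟩ t') ≤ C * dist t t' := by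
          refine le_trans ?_ h2
          exact mul_le_of_le_one_left dist_nonneg hρ1
        rw [NNReal.coe_natCast]
        calc dist (Φ (ρ • f ⟨i.1, hi⟩ t)) (Φ (ρ • f ⟨i.1, hi⟩ t'))
            ≤ (1 + 1 / 2) * (C * dist t t') := h1.trans (by gcongr)
          _ ≤ 2 * C * dist t t' := by
              have : 0 ≤ (C : ℝ) * dist t t' := by positivity
              linarith
          _ ≤ _ := mul_le_mul_of_nonneg_right h3 dist_nonneg
      · simp only [hi, dif_neg, not_false_eq_true]
        exact (LipschitzWith.const _).lipschitzOnWith.weaken zero_le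
    · obtain ⟨_, ⟨v, hv, rfl⟩, rfl⟩ := frontier_chart_image_subset hQ.isBounded hρ.ne' hcl hx
      obtain ⟨i, t, ht, rfl⟩ := mem_iUnion.1 (hfr hv)
      refine mem_iUnion.2 ⟨⟨i.1, lt_of_lt_of_le i.2 ((le_max_left _ _).trans (le_max_left _ _))⟩,
        t, ht, ?_⟩
      simp

/-- Lipschitz covers indexed by a finite type. -/
lemma exists_lipschitz_cover {ι : Type*} [Finite ι] {Q : Set (EuclideanSpace ℝ (Fin d))}
    (f : ι → (Fin (d - 1) → ℝ) → EuclideanSpace ℝ (Fin d)) (hf : ∀ i, ContDiff ℝ 1 (f i))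
    (hQ : Q ⊆ ⋃ i, f i '' Icc 0 1) :
    ∃ (m : ℕ) (f : Fin m → (Fin (d - 1) → ℝ) → EuclideanSpace ℝ (Fin d)) (C : ℝ≥0),
      (∀ i, LipschitzOnWith C (f i) (Icc 0 1)) ∧ Q ⊆ ⋃ i, f i '' Icc 0 1 := by
  classical
  have := Fintype.ofFinite ι
  have hC : ∀ i, ∃ C, LipschitzOnWith C (f i) (Icc 0 1) := fun i =>
    (hf i).contDiffOn.exists_lipschitzOnWith one_ne_zero (convex_Icc _ _) isCompact_Icc
  choose C hC using hC
  let σ := Fintype.equivFin ι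
  refine ⟨Fintype.card ι, fun i => f (σ.symm i), Finset.univ.sup C, fun i => ?_, fun x hx => ?_⟩
  · exact (hC _).weaken (Finset.le_sup (Finset.mem_univ _))
  · obtain ⟨i, hi⟩ := mem_iUnion.1 (hQ hx)
    exact mem_iUnion.2 ⟨σ i, by simpa using hi⟩

/-- The point with `i`-th coordinate `c` and the other coordinates given by `t`. -/
def facePoint {m : ℕ} (i : Fin (m + 1)) (c : ℝ) (t : Fin m → ℝ) : EuclideanSpace ℝ (Fin (m + 1)) :=
  WithLp.toLp 2 (i.insertNth (α := fun _ => ℝ) c t)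

lemma facePoint_same {m : ℕ} (i : Fin (m + 1)) (c : ℝ) (t : Fin m → ℝ) : facePoint i c t i = c := by
  simp [facePoint]

lemma facePoint_succAbove {m : ℕ} (i : Fin (m + 1)) (c : ℝ) (t : Fin m → ℝ) (j : Fin m) :
    facePoint i c t (i.succAbove j) = t j := by
  simp [facePoint]

lemma contDiff_facePoint {m : ℕ} (i : Fin (m + 1)) (c : ℝ) {F : Type*} [NormedAddCommGroup F]
    [NormedSpace ℝ F] {t : F → Fin m → ℝ} (ht : ContDiff ℝ 1 t) :
    ContDiff ℝ 1 fun s => facePoint i c (t s) := by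
  rw [contDiff_euclidean]
  intro k
  refine Fin.succAboveCases i ?_ (fun j => ?_) k
  · simp only [facePoint_same]; exact contDiff_const
  · simp only [facePoint_succAbove]; exact contDiff_pi.1 ht j

lemma eq_facePoint {m : ℕ} (i : Fin (m + 1)) (x : EuclideanSpace ℝ (Fin (m + 1))) :
    x = facePoint i (x i) fun j => x (i.succAbove j) := by
  ext k
  refine Fin.succAboveCases i ?_ (fun j => ?_) k
  · rw [facePoint_same]
  · rw [facePoint_succAbove]

/-- The half-open box with sides `[a i, b i)`. -/
def halfOpenBox (a b : Fin d → ℝ) : Set (EuclideanSpace ℝ (Fin d)) := {x | ∀ i, a i ≤ x i ∧ x i < b i}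

lemma frontier_halfOpenBox_subset {a b : Fin d → ℝ} {x : EuclideanSpace ℝ (Fin d)}
    (hx : x ∈ frontier (halfOpenBox a b)) :
    (∀ i, a i ≤ x i ∧ x i ≤ b i) ∧ ∃ i, x i = a i ∨ x i = b i := by
  have hcl : IsClosed {x : EuclideanSpace ℝ (Fin d) | ∀ i, a i ≤ x i ∧ x i ≤ b i} := by
    have : {x : EuclideanSpace ℝ (Fin d) | ∀ i, a i ≤ x i ∧ x i ≤ b i} =
        ⋂ i, {x | a i ≤ x i ∧ x i ≤ b i} := by ext; simp
    rw [this]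
    refine isClosed_iInter fun i => ?_
    have hc : Continuous fun x : EuclideanSpace ℝ (Fin d) => x i := by fun_prop
    exact (isClosed_le continuous_const hc).inter (isClosed_le hc continuous_const)
  have hop : IsOpen {x : EuclideanSpace ℝ (Fin d) | ∀ i, a i < x i ∧ x i < b i} := by
    have : {x : EuclideanSpace ℝ (Fin d) | ∀ i, a i < x i ∧ x i < b i} =
        ⋂ i, {x | a i < x i ∧ x i < b i} := by ext; simp
    rw [this]
    refine isOpen_iInter_of_finite fun i => ?_
    have hc : Continuous fun x : EuclideanSpace ℝ (Fin d) => x i := by fun_prop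
    exact (isOpen_lt continuous_const hc).inter (isOpen_lt hc continuous_const)
  have h1 : ∀ i, a i ≤ x i ∧ x i ≤ b i :=
    closure_minimal (fun y hy i => ⟨(hy i).1, (hy i).2.le⟩) hcl hx.1
  refine ⟨h1, ?_⟩
  by_contra! hne
  refine hx.2 (interior_maximal (fun y hy i => ⟨(hy i).1.le, (hy i).2⟩) hop fun i => ?_)
  exact ⟨lt_of_le_of_ne (h1 i).1 (hne i).1.symm, lt_of_le_of_ne (h1 i).2 (hne i).2⟩

/-- Each of the 2d faces is an affine image of the cube [0,1]^{d-1}, obtained by freezing one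
coordinate. -/
lemma isTameModel_halfOpenBox (hd : 1 ≤ d) {a b : Fin d → ℝ} (hab : ∀ i, a i < b i) :
    IsTameModel (halfOpenBox a b) := by
  obtain ⟨m, rfl⟩ : ∃ m, d = m + 1 := ⟨d - 1, by omega⟩
  refine ⟨?_, ?_, ?_, ?_⟩
  · refine Convex.isPreconnected fun x hx y hy s t hs ht hst i => ?_
    have h1 := hx i
    have h2 := hy i
    have e : (s • x + t • y) i = s * x i + t * y i := by simp
    rw [e]
    have ht' : t = 1 - s := by linarith
    subst ht'
    constructor
    · nlinarith
    · rcases hs.eq_or_lt with rfl | hs'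
      · simpa using h2.2
      · nlinarith
  · have h1 : IsCompact (Icc a b) := isCompact_Icc
    have h2 := h1.image (PiLp.continuous_toLp 2 fun _ : Fin (m + 1) => ℝ)
    refine h2.isBounded.subset fun x hx => ⟨x.ofLp, ⟨fun i => (hx i).1, fun i => (hx i).2.le⟩, rfl⟩
  · have : halfOpenBox a b = ⋂ i, {x | a i ≤ x i ∧ x i < b i} := by ext; simp [halfOpenBox]
    rw [this]
    refine MeasurableSet.iInter fun i => ?_
    have hm : Measurable fun x : EuclideanSpace ℝ (Fin (m + 1)) => x i := by fun_prop
    exact (measurableSet_le measurable_const hm).inter (measurableSet_lt hm measurable_const)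
  · refine exists_lipschitz_cover (ι := Fin (m + 1) × Bool)
      (fun k t => facePoint k.1 (if k.2 then a k.1 else b k.1) fun j =>
        a (k.1.succAbove j) + t j * (b (k.1.succAbove j) - a (k.1.succAbove j))) (fun k => ?_) ?_
    · exact contDiff_facePoint _ _ (by fun_prop)
    · intro x hx
      obtain ⟨h1, i, hi⟩ := frontier_halfOpenBox_subset hx
      have hpos : ∀ j, 0 < b j - a j := fun j => sub_pos.2 (hab j)
      refine mem_iUnion.2 ⟨(i, decide (x i = a i)), fun j => (x (i.succAbove j) - a (i.succAbove j)) /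
        (b (i.succAbove j) - a (i.succAbove j)), ⟨fun j => ?_, fun j => ?_⟩, ?_⟩
      · exact div_nonneg (sub_nonneg.2 (h1 _).1) (hpos _).le
      · exact (div_le_one (hpos _)).2 (by linarith [(h1 (i.succAbove j)).2])
      · rw [eq_facePoint i x]
        have e1 : (if (decide (x i = a i)) = true then a i else b i) = x i := by
          by_cases h : x i = a i
          · simp [h]
          · simp only [h, decide_false]
            rcases hi with h' | h'
            · exact absurd h' h
            · simp [h']
        simp only [facePoint_same, facePoint_succAbove]
        rw [e1]
        congr 1
        ext j
        rw [div_mul_cancel₀ _ (hpos _).ne']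
        ring

/-- The sphere is the radial projection of the boundary of [-1,1]^d. A point x comes from the face
of its coordinate of largest modulus, dividing by which puts x onto that face. The projection is
smooth there because faces avoid the origin. -/
lemma isTameModel_ball (hd : 1 ≤ d) : IsTameModel (Metric.ball (0 : EuclideanSpace ℝ (Fin d)) 1) := by
  obtain ⟨m, rfl⟩ : ∃ m, d = m + 1 := ⟨d - 1, by omega⟩
  refine ⟨(convex_ball _ _).isPreconnected, Metric.isBounded_ball, Metric.isOpen_ball.measurableSet, ?_⟩
  have hsign : ∀ b : Bool, (if b then (1 : ℝ) else -1) ≠ 0 := fun b => by cases b <;> simp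
  have hne : ∀ (k : Fin (m + 1) × Bool) (t : Fin m → ℝ),
      facePoint k.1 (if k.2 then (1 : ℝ) else -1) (fun j => 2 * t j - 1) ≠ 0 := fun k t h0 => by
    have := congrArg (fun v : EuclideanSpace ℝ (Fin (m + 1)) => v k.1) h0
    simp only [facePoint_same] at this
    exact hsign k.2 (by simpa using this)
  refine exists_lipschitz_cover (ι := Fin (m + 1) × Bool)
    (fun k t => ‖facePoint k.1 (if k.2 then (1 : ℝ) else -1) fun j => 2 * t j - 1‖⁻¹ •
      facePoint k.1 (if k.2 then (1 : ℝ) else -1) fun j => 2 * t j - 1) (fun k => ?_) ?_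
  · have h1 : ContDiff ℝ 1 fun t : Fin m → ℝ =>
        facePoint k.1 (if k.2 then (1 : ℝ) else -1) fun j => 2 * t j - 1 :=
      contDiff_facePoint _ _ (by fun_prop)
    exact ((h1.norm ℝ (hne k)).inv fun t => norm_ne_zero_iff.2 (hne k t)).smul h1
  · intro x hx
    have hx1 : ‖x‖ = 1 := by
      have := Metric.frontier_ball_subset_sphere hx
      simpa using this
    obtain ⟨i, -, hi⟩ := Finset.exists_max_image Finset.univ (fun i => |x i|) ⟨0, Finset.mem_univ 0⟩
    have hxi : 0 < |x i| := by
      rw [abs_pos]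
      intro h0
      have : x = 0 := by
        ext j
        have := hi j (Finset.mem_univ j)
        rw [h0, abs_zero] at this
        exact abs_eq_zero.1 (le_antisymm this (abs_nonneg _))
      rw [this, norm_zero] at hx1
      exact zero_ne_one hx1
    have hle : ∀ j, |x j / (|x i|)| ≤ 1 := fun j => by
      rw [abs_div, abs_abs]
      exact (div_le_one hxi).2 (hi j (Finset.mem_univ j))
    have hy : facePoint i (if (decide (0 ≤ x i)) = true then (1 : ℝ) else -1)
        (fun j => 2 * ((x (i.succAbove j) / |x i| + 1) / 2) - 1) = |x i|⁻¹ • x := by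
      rw [eq_facePoint i (|x i|⁻¹ • x)]
      congr 1
      · simp only [PiLp.smul_apply, smul_eq_mul, decide_eq_true_eq]
        split_ifs with h
        · rw [abs_of_nonneg h] at hxi ⊢
          rw [inv_mul_cancel₀ hxi.ne']
        · push Not at h
          rw [abs_of_neg h] at hxi ⊢
          rw [inv_neg, neg_mul, inv_mul_cancel₀ h.ne]
      · ext j
        simp only [PiLp.smul_apply, smul_eq_mul]
        ring
    refine mem_iUnion.2 ⟨(i, decide (0 ≤ x i)), fun j => (x (i.succAbove j) / |x i| + 1) / 2,
      ⟨fun j => ?_, fun j => ?_⟩, ?_⟩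
    · have := (abs_le.1 (hle (i.succAbove j))).1
      simp only [Pi.zero_apply]; linarith
    · have := (abs_le.1 (hle (i.succAbove j))).2
      simp only [Pi.one_apply]; linarith
    · simp only [hy]
      rw [norm_smul, hx1, mul_one, norm_inv, Real.norm_of_nonneg hxi.le, inv_inv, smul_smul,
        mul_inv_cancel₀ hxi.ne', one_smul]

variable [MeasurableSpace X] [BorelSpace X] {μ : Measure X} {T : X → X}

/-- Uniform decorrelation of the images in the chart of the dilates of a tame model. -/
lemma IsAlmostIsometric.exists_decSet (hΦ : IsAlmostIsometric ζ Φ) {ρ : ℕ → ℝ}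
    (hdec : ∀ K : ℕ, ∃ C : ℝ, ∀ B : Set X, MeasurableSet B → IsTameSet d K B → DecSet μ T ρ C B)
    {Q : Set (EuclideanSpace ℝ (Fin d))} (hQ : IsTameModel Q) :
    ∃ (C r : ℝ), 0 < r ∧ ∀ s, 0 < s → s ≤ r → s • Q ⊆ Φ.source ∧
      DecSet μ T ρ C (Φ '' (s • Q)) := by
  obtain ⟨K, r, hr, h⟩ := hΦ.exists_isTameSet hQ
  obtain ⟨C, hC⟩ := hdec K
  refine ⟨C, r, hr, fun s hs hsr => ⟨(h s hs hsr).1, hC _ ?_ (h s hs hsr).2⟩⟩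
  exact measurableSet_chart_image (hQ.measurableSet.const_smul₀ s) (h s hs hsr).1

end Tame

/-! ### Levels of the observable and radii of balls -/

section Levels

variable {d : ℕ} {X : Type*} [MetricSpace X] [MeasurableSpace X] {μ : Measure X}
  [IsProbabilityMeasure μ] {ζ : X} {g : ℝ → EReal} {δ : ℝ} {u : ℕ → ℝ → ℝ} {κ : ℝ}

lemma measureReal_ball_pos (hκ : 0 < κ)
    (hball : Tendsto (fun s : ℝ => μ.real (Metric.ball ζ s) / s ^ d) (𝓝[>] 0) (𝓝 κ)) {r : ℝ}
    (hr : 0 < r) : 0 < μ.real (Metric.ball ζ r) := by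
  have h1 := (hball.eventually (lt_mem_nhds hκ)).and (Ioo_mem_nhdsGT hr)
  obtain ⟨s, hs, hs0, hsr⟩ := h1.exists
  have h2 : 0 < μ.real (Metric.ball ζ s) := by
    by_contra! hle
    exact absurd (div_nonpos_of_nonpos_of_nonneg hle (pow_nonneg hs0.le d)) (not_le.2 hs)
  exact h2.trans_le (measureReal_mono (Metric.ball_subset_ball hsr.le))

/-- For large `n`, the set where the observable exceeds a level is a small ball around `ζ`. -/
lemma eventually_level (hg : IsProfile g δ) (hu : IsNormalising μ (fun x => g (dist x ζ)) u)
    (hκ : 0 < κ)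
    (hball : Tendsto (fun s : ℝ => μ.real (Metric.ball ζ s) / s ^ d) (𝓝[>] 0) (𝓝 κ)) {τ : ℝ}
    (hτ : 0 < τ) {r' : ℝ} (hr' : 0 < r') :
    ∀ᶠ n in atTop, 0 < profileInv g δ (u n τ) ∧ profileInv g δ (u n τ) < r' ∧
      {x | (u n τ : EReal) < g (dist x ζ)} = Metric.ball ζ (profileInv g δ (u n τ)) := by
  obtain ⟨c, hc, hsep⟩ := hg.separated
  have h0mem : (0 : ℝ) ∈ Ico 0 δ := ⟨le_rfl, hg.pos⟩
  have hev : ∀ᶠ r in 𝓝[>] (0 : ℝ), c < g r ∧ r < min r' δ ∧ 0 < r := by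
    have h1 : ∀ᶠ r in 𝓝[Ico 0 δ] (0 : ℝ), c < g r :=
      (hg.continuousOn 0 h0mem).eventually (lt_mem_nhds hc)
    have h2 : ∀ᶠ r in 𝓝[>] (0 : ℝ), c < g r := by
      have : 𝓝[>] (0 : ℝ) ≤ 𝓝[Ico 0 δ] 0 := by
        rw [← nhdsWithin_Ioo_eq_nhdsGT hg.pos]
        exact nhdsWithin_mono _ Ioo_subset_Ico_self
      exact this h1
    filter_upwards [h2, Ioo_mem_nhdsGT (lt_min hr' hg.pos)] with r h3 h4 using ⟨h3, h4.2, h4.1⟩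
  obtain ⟨r₁, hcr, hrmin, hr₁⟩ := hev.exists
  have hrδ : r₁ < δ := hrmin.trans_le (min_le_right _ _)
  have hrr : r₁ < r' := hrmin.trans_le (min_le_left _ _)
  have hlim := hu.tendsto τ hτ
  have hb := measureReal_ball_pos hκ hball hr₁
  have hinf : Tendsto (fun n : ℕ => (n : ℝ) * μ.real (Metric.ball ζ r₁)) atTop atTop :=
    tendsto_natCast_atTop_atTop.atTop_mul_const hb
  filter_upwards [hlim.eventually (lt_mem_nhds hτ), hlim.eventually (gt_mem_nhds (lt_add_one τ)),
    hinf.eventually_gt_atTop (τ + 1)] with n h1 h2 h3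
  -- Otherwise the exceedance set is empty, contradicting that n times its measure tends to τ > 0.
  have hlt0 : (u n τ : EReal) < g 0 := by
    by_contra! hle
    have : {x | (u n τ : EReal) < g (dist x ζ)} = ∅ := by
      ext x
      simp only [mem_ofPred_eq, mem_empty_iff_false, iff_false, not_lt]
      exact (hg.le_max _ dist_nonneg).trans hle
    rw [this, measureReal_empty, mul_zero] at h1
    exact lt_irrefl _ h1
  -- Otherwise the exceedance set contains a fixed ball, whose measure times n is unbounded.
  have hge : g r₁ ≤ (u n τ : EReal) := by
    by_contra! hlt
    have hsub : Metric.ball ζ r₁ ⊆ {x | (u n τ : EReal) < g (dist x ζ)} := by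
      intro x hx
      have hx' : dist x ζ < r₁ := hx
      exact hlt.trans (hg.strictAnti ⟨dist_nonneg, hx'.trans hrδ⟩ ⟨hr₁.le, hrδ⟩ hx')
    have := mul_le_mul_of_nonneg_left (measureReal_mono hsub (μ := μ)) (Nat.cast_nonneg (α := ℝ) n)
    linarith
  obtain ⟨r, hr, hgr⟩ := intermediate_value_Icc' hr₁.le
    (hg.continuousOn.mono fun y hy => ⟨hy.1, hy.2.trans_lt hrδ⟩) ⟨hge, hlt0.le⟩
  have hrI : r ∈ Ico 0 δ := ⟨hr.1, hr.2.trans_lt hrδ⟩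
  have hinv : profileInv g δ (u n τ) = r := by
    have hex : ∃ a ∈ Ico 0 δ, g a = (u n τ : EReal) := ⟨r, hrI, hgr⟩
    exact hg.strictAnti.injOn (Function.invFunOn_mem hex) hrI
      ((Function.invFunOn_eq hex).trans hgr.symm)
  have hr0 : 0 < r := by
    rcases hr.1.eq_or_lt with h | h
    · rw [← h] at hgr
      exact absurd hgr hlt0.ne'
    · exact h
  rw [hinv]
  refine ⟨hr0, hr.2.trans_lt hrr, ?_⟩
  ext x
  simp only [mem_ofPred_eq, Metric.mem_ball]
  rw [← hgr]
  by_cases hx : dist x ζ < δ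
  · exact hg.strictAnti.lt_iff_gt hrI ⟨dist_nonneg, hx⟩
  · push Not at hx
    constructor
    · intro h
      refine absurd h (not_lt.2 ?_)
      exact ((hsep _ hx).trans hcr.le).trans (hge.trans_eq hgr.symm)
    · intro h
      exact absurd (h.trans hrI.2) (not_lt.2 hx)

lemma tendsto_levelRadius (hg : IsProfile g δ) (hu : IsNormalising μ (fun x => g (dist x ζ)) u)
    (hκ : 0 < κ)
    (hball : Tendsto (fun s : ℝ => μ.real (Metric.ball ζ s) / s ^ d) (𝓝[>] 0) (𝓝 κ)) {τ : ℝ}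
    (hτ : 0 < τ) : Tendsto (fun n => profileInv g δ (u n τ)) atTop (𝓝[>] 0) := by
  refine tendsto_nhdsWithin_iff.2 ⟨?_, ?_⟩
  · rw [Metric.tendsto_nhds]
    intro ε hε
    filter_upwards [eventually_level hg hu hκ hball hτ hε] with n hn
    rw [Real.dist_eq, sub_zero, abs_of_pos hn.1]
    exact hn.2.1
  · filter_upwards [eventually_level hg hu hκ hball hτ one_pos] with n hn using hn.1

/-- With r the radius of the level, nμ(B_r) → τ by normalisation, while μ(B_r)/r^d → κ. -/
lemma tendsto_level (hg : IsProfile g δ) (hu : IsNormalising μ (fun x => g (dist x ζ)) u)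
    (hκ : 0 < κ)
    (hball : Tendsto (fun s : ℝ => μ.real (Metric.ball ζ s) / s ^ d) (𝓝[>] 0) (𝓝 κ)) {τ : ℝ}
    (hτ : 0 < τ) :
    Tendsto (fun n : ℕ => n * κ * profileInv g δ (u n τ) ^ d) atTop (𝓝 τ) := by
  have h1 := hball.comp (tendsto_levelRadius hg hu hκ hball hτ)
  have h2 := ((hu.tendsto τ hτ).div h1 hκ.ne').mul_const κ
  rw [div_mul_cancel₀ _ hκ.ne'] at h2
  refine h2.congr' ?_
  filter_upwards [eventually_level hg hu hκ hball hτ one_pos] with n hn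
  have hb := measureReal_ball_pos hκ hball hn.1
  have hr := hn.1
  simp only [Function.comp_apply, Pi.div_apply]
  rw [hn.2.2]
  field_simp

end Levels

/-! ### Short returns to ζ -/

section Returns

variable {X : Type*} [MetricSpace X] {T : X → X} {ζ : X} {S : Type*} [MetricSpace S] [ProperSpace S]
  {dom : ℕ → Set X} {Y : ℕ → X → S}

lemma continuousAt_iterate (hcont : ∀ j : ℕ, ContinuousAt T (T^[j] ζ)) (j : ℕ) :
    ContinuousAt T^[j] ζ := by
  induction j with
  | zero => exact continuousAt_id
  | succ j ih =>
    rw [Function.iterate_succ']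
    exact (hcont j).comp ih

/-- Marks in a compact set are only observed close to `ζ`. -/
def MarksShrink (ζ : X) (dom : ℕ → Set X) (Y : ℕ → X → S) : Prop :=
  ∀ K : Set S, IsCompact K → ∀ ε : ℝ, 0 < ε → ∀ᶠ n in atTop, ∀ x ∈ dom n, Y n x ∈ K → dist x ζ < ε

/-- Points near ζ are sent near T^j ζ ≠ ζ by continuity, whereas marks in K occur only near ζ. -/
lemma MarksShrink.noReturn (hY : MarksShrink ζ dom Y) {j : ℕ} (hcont : ContinuousAt T^[j] ζ)
    (hj : T^[j] ζ ≠ ζ) {K : Set S} (hK : IsCompact K) :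
    ∀ᶠ n in atTop, ∀ x ∈ dom n, Y n x ∈ K → T^[j] x ∈ dom n → Y n (T^[j] x) ∉ K := by
  set ε := dist (T^[j] ζ) ζ / 2 with hε
  have hε0 : 0 < ε := half_pos (dist_pos.2 hj)
  obtain ⟨η, hη, hηε⟩ := Metric.continuousAt_iff.1 hcont ε hε0
  filter_upwards [hY K hK η hη, hY K hK ε hε0] with n h1 h2 x hx hxK hTx hTxK
  have h3 := hηε (h1 x hx hxK)
  have h4 := h2 _ hTx hTxK
  have := dist_triangle_left (T^[j] ζ) ζ (T^[j] x)
  linarith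

/-- Returns at multiples of the period follow from the first return. -/
lemma return_of_step {L : S → S} (hL : Continuous L) {p : ℕ}
    (hstep : ∀ K : Set S, IsCompact K → ∀ η : ℝ, 0 < η → ∀ᶠ n in atTop, ∀ x ∈ dom n, Y n x ∈ K →
      T^[p] x ∈ dom n ∧ dist (Y n (T^[p] x)) (L (Y n x)) ≤ η) (l : ℕ) {K : Set S}
    (hK : IsCompact K) {η : ℝ} (hη : 0 < η) :
    ∀ᶠ n in atTop, ∀ x ∈ dom n, Y n x ∈ K →
      T^[p * l] x ∈ dom n ∧ dist (Y n (T^[p * l] x)) (L^[l] (Y n x)) ≤ η := by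
  induction l generalizing η with
  | zero =>
    refine Eventually.of_forall fun n x hx _ => ?_
    simp [hx, hη.le]
  | succ l ih =>
    -- A compact neighbourhood of the l-th images that contains the actual marks after l periods, so
    -- that the one-step statement applies again.
    set K' := Metric.cthickening 1 (L^[l] '' K) with hK'
    have hcK' : IsCompact K' := (hK.image (hL.iterate l)).cthickening
    have huc : UniformContinuousOn L K' := hcK'.uniformContinuousOn_of_continuous hL.continuousOn
    obtain ⟨η', hη', huc'⟩ := Metric.uniformContinuousOn_iff.1 huc (η / 2) (half_pos hη)
    have hmin : 0 < min (η' / 2) 1 := lt_min (half_pos hη') one_pos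
    filter_upwards [ih hmin, hstep K' hcK' (η / 2) (half_pos hη)] with n h1 h2 x hx hxK
    obtain ⟨h3, h4⟩ := h1 x hx hxK
    have hmem0 : L^[l] (Y n x) ∈ L^[l] '' K := ⟨_, hxK, rfl⟩
    have h5 : Y n (T^[p * l] x) ∈ K' :=
      Metric.mem_cthickening_of_dist_le _ _ _ _ hmem0 (h4.trans (min_le_right _ _))
    have h6 : L^[l] (Y n x) ∈ K' := Metric.self_subset_cthickening _ hmem0
    obtain ⟨h7, h8⟩ := h2 _ h3 h5
    rw [← Function.iterate_add_apply, show p + p * l = p * (l + 1) by ring] at h7 h8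
    refine ⟨h7, ?_⟩
    have h9 := huc' _ h5 _ h6 ((h4.trans (min_le_left _ _)).trans_lt (half_lt_self hη'))
    rw [Function.iterate_succ_apply']
    refine (dist_triangle _ (L (Y n (T^[p * l] x))) _).trans ?_
    linarith

end Returns

/-! ### Grids of half-open boxes -/

section Grid

variable {d : ℕ}

lemma halfOpenBox_mono {a b a' b' : Fin d → ℝ} (ha : ∀ i, a' i ≤ a i) (hb : ∀ i, b i ≤ b' i) :
    halfOpenBox a b ⊆ halfOpenBox a' b' :=
  fun _ hx i => ⟨(ha i).trans (hx i).1, (hx i).2.trans_le (hb i)⟩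

/-- Bounded sets are covered by finitely many disjoint small half-open boxes inside a fixed box. -/
lemma exists_grid {B : ℝ} (hB : 0 < B) {η : ℝ} (hη : 0 < η) :
    ∃ (N : ℕ) (a b : Fin N → Fin d → ℝ), (∀ k i, a k i < b k i) ∧
      Pairwise (Function.onFun Disjoint fun k => halfOpenBox (a k) (b k)) ∧
      Metric.ball (0 : EuclideanSpace ℝ (Fin d)) B ⊆ ⋃ k, halfOpenBox (a k) (b k) ∧
      (∀ k, halfOpenBox (a k) (b k) ⊆ halfOpenBox (fun _ => -B) fun _ => B) ∧
      ∀ k, ∀ z ∈ halfOpenBox (a k) (b k), dist z (WithLp.toLp 2 (a k)) ≤ η := by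
  classical
  -- The mesh s = 2B/m then satisfies s(d+1) ≤ η, which dominates the diameter √d s of a box.
  obtain ⟨m, hm⟩ := exists_nat_gt (2 * B * (d + 1) / η)
  have hm0 : (0 : ℝ) < m := lt_of_le_of_lt (by positivity) hm
  set s : ℝ := 2 * B / m with hs
  have hs0 : 0 < s := by positivity
  have hms : m * s = 2 * B := by rw [hs]; field_simp
  have hsη : s * (d + 1) ≤ η := by
    rw [div_lt_iff₀ hη] at hm
    rw [hs, div_mul_eq_mul_div, div_le_iff₀ hm0]
    linarith
  let σ := Fintype.equivFin (Fin d → Fin m)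
  let a : (Fin d → Fin m) → Fin d → ℝ := fun k i => -B + (k i : ℕ) * s
  let b : (Fin d → Fin m) → Fin d → ℝ := fun k i => -B + ((k i : ℕ) + 1) * s
  have hfl : ∀ k, ∀ z ∈ halfOpenBox (a k) (b k), ∀ i, ⌊(z i + B) / s⌋₊ = (k i : ℕ) := by
    intro k z hz i
    have h1 : -B + (k i : ℕ) * s ≤ z i := (hz i).1
    have h2 : z i < -B + ((k i : ℕ) + 1) * s := (hz i).2
    have hk : (0 : ℝ) ≤ (k i : ℕ) * s := by positivity
    rw [Nat.floor_eq_iff (div_nonneg (by linarith) hs0.le), le_div_iff₀ hs0, div_lt_iff₀ hs0]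
    constructor <;> linarith
  refine ⟨_, fun n => a (σ.symm n), fun n => b (σ.symm n), fun n i => ?_, fun n n' hn => ?_,
    fun z hz => ?_, fun n => halfOpenBox_mono (fun i => ?_) fun i => ?_, fun n z hz => ?_⟩
  · simp only [a, b]; linarith
  · rw [Function.onFun, Set.disjoint_left]
    intro z hz hz'
    refine hn (σ.symm.injective (funext fun i => Fin.ext ?_))
    rw [← hfl _ z hz i, ← hfl _ z hz' i]
  · have hzi : ∀ i, |z i| < B := fun i => by
      rw [mem_ball_zero_iff] at hz
      exact lt_of_le_of_lt (PiLp.norm_apply_le z i) hz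
    have hlt : ∀ i, ⌊(z i + B) / s⌋₊ < m := fun i => by
      have := abs_lt.1 (hzi i)
      rw [Nat.floor_lt (div_nonneg (by linarith) hs0.le), div_lt_iff₀ hs0, hms]
      linarith
    refine mem_iUnion.2 ⟨σ fun i => ⟨_, hlt i⟩, fun i => ?_⟩
    have := abs_lt.1 (hzi i)
    have h0 : 0 ≤ (z i + B) / s := div_nonneg (by linarith) hs0.le
    have h1 := Nat.floor_le h0
    have h2 := Nat.lt_floor_add_one ((z i + B) / s)
    rw [le_div_iff₀ hs0] at h1
    rw [div_lt_iff₀ hs0] at h2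
    simp only [a, b, Equiv.symm_apply_apply]
    constructor <;> linarith
  · simp only [a]
    have : (0 : ℝ) ≤ (σ.symm n i : ℕ) * s := by positivity
    linarith
  · simp only [b]
    have h1 : ((σ.symm n i : ℕ) : ℝ) + 1 ≤ m := by exact_mod_cast (σ.symm n i).2
    have := mul_le_mul_of_nonneg_right h1 hs0.le
    linarith
  · rw [EuclideanSpace.dist_eq, Real.sqrt_le_left hη.le]
    have h1 : ∀ i, dist (z i) (a (σ.symm n) i) ^ 2 ≤ s ^ 2 := fun i => by
      have h2 : a (σ.symm n) i ≤ z i := (hz i).1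
      have h3 : z i < b (σ.symm n) i := (hz i).2
      have h4 : b (σ.symm n) i = a (σ.symm n) i + s := by simp only [a, b]; ring
      rw [Real.dist_eq, abs_of_nonneg (by linarith)]
      exact pow_le_pow_left₀ (by linarith) (by linarith) 2
    calc ∑ i, dist (z i) (a (σ.symm n) i) ^ 2 ≤ ∑ _i : Fin d, s ^ 2 := Finset.sum_le_sum fun i _ => h1 i
      _ = d * s ^ 2 := by simp
      _ ≤ (s * (d + 1)) ^ 2 := by
          have : (0 : ℝ) ≤ d := Nat.cast_nonneg d
          nlinarith [sq_nonneg s]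
      _ ≤ η ^ 2 := pow_le_pow_left₀ (by positivity) hsη 2

end Grid

/-! ### Rescaled coordinates of the visits as rare marks -/

section Multi

variable {d : ℕ} {X : Type*} [MetricSpace X] [MeasurableSpace X] [BorelSpace X] {μ : Measure X}
  [IsProbabilityMeasure μ] {T : X → X} {h : X → ℝ≥0} {ζ : X}
  {Φ : OpenPartialHomeomorph (EuclideanSpace ℝ (Fin d)) X} {ρ : ℕ → ℝ} {s : ℕ → ℝ}

lemma target_inter_preimage_eq {c : ℝ} (hc : 0 < c) {Q : Set (EuclideanSpace ℝ (Fin d))}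
    (hQ : c • Q ⊆ Φ.source) : Φ.target ∩ (fun x => c⁻¹ • Φ.symm x) ⁻¹' Q = Φ '' (c • Q) := by
  rw [Φ.image_eq_target_inter_inv_preimage hQ]
  congr 1
  ext x
  simp only [mem_preimage]
  rw [mem_smul_set_iff_inv_smul_mem₀ hc.ne']

/-- The intensity of the marks converges to Lebesgue measure. -/
lemma tendsto_multi_intensity (hΦ : IsAlmostIsometric ζ Φ) (hh : Measurable h)
    (hμ : μ = (riemannianLeb d X).withDensity (fun x => (h x : ℝ≥0∞))) (hpos : 0 < h ζ)
    (hleb : IsLebesguePoint d h ζ) (hs : Tendsto s atTop (𝓝[>] 0))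
    (hns : Tendsto (fun n : ℕ => n * (h ζ : ℝ) * s n ^ d) atTop (𝓝 1))
    {Q : Set (EuclideanSpace ℝ (Fin d))} (hQm : MeasurableSet Q) (hQ : Bornology.IsBounded Q) :
    Tendsto (fun n : ℕ => (n : ℝ) * μ.real (Φ '' (s n • Q))) atTop (𝓝 (volume.real Q)) := by
  have hpos' : (0 : ℝ) < h ζ := by exact_mod_cast hpos
  have h1 := (hns.mul ((tendsto_measure_image hΦ hh hμ hleb hQm hQ).comp hs)).div_const (h ζ : ℝ)
  rw [one_mul, mul_div_cancel_left₀ _ hpos'.ne'] at h1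
  refine h1.congr' ?_
  filter_upwards [hs self_mem_nhdsWithin] with n hn
  have hn' : 0 < s n := hn
  simp only [Function.comp_apply]
  field_simp

lemma multi_goodCell (hΦ : IsAlmostIsometric ζ Φ) (hh : Measurable h)
    (hμ : μ = (riemannianLeb d X).withDensity (fun x => (h x : ℝ≥0∞))) (hpos : 0 < h ζ)
    (hleb : IsLebesguePoint d h ζ) (hs : Tendsto s atTop (𝓝[>] 0))
    (hns : Tendsto (fun n : ℕ => n * (h ζ : ℝ) * s n ^ d) atTop (𝓝 1))
    (hdec : ∀ K : ℕ, ∃ C : ℝ, ∀ B : Set X, MeasurableSet B → IsTameSet d K B → DecSet μ T ρ C B)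
    {Q : Set (EuclideanSpace ℝ (Fin d))} (hQ : IsTameModel Q) :
    GoodCell μ T ρ volume (fun _ => Φ.target) (fun n x => (s n)⁻¹ • Φ.symm x) Q := by
  obtain ⟨C, r, hr, hC⟩ := hΦ.exists_decSet hdec hQ
  have hev : ∀ᶠ n in atTop, 0 < s n ∧ s n ≤ r := by
    filter_upwards [hs (Ioo_mem_nhdsGT hr)] with n hn using ⟨hn.1, hn.2.le⟩
  refine ⟨hQ.measurableSet, hQ.isBounded.measure_lt_top.ne, ?_, fun ε hε => ⟨C, ?_⟩⟩
  · refine (tendsto_multi_intensity hΦ hh hμ hpos hleb hs hns hQ.measurableSet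
      hQ.isBounded).congr' ?_
    filter_upwards [hev] with n hn
    rw [target_inter_preimage_eq hn.1 (hC _ hn.1 hn.2).1]
  · filter_upwards [hev] with n hn
    refine ⟨_, (hC _ hn.1 hn.2).2, ?_⟩
    rw [target_inter_preimage_eq hn.1 (hC _ hn.1 hn.2).1, sdiff_self, measureReal_empty, add_zero,
      mul_zero]
    exact hε.le

lemma multi_marksShrink (hΦ : IsAlmostIsometric ζ Φ) (hs : Tendsto s atTop (𝓝[>] 0)) :
    MarksShrink ζ (fun _ => Φ.target) fun n x => (s n)⁻¹ • Φ.symm x := by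
  intro K hK ε hε
  obtain ⟨B, hB, hKB⟩ := hK.isBounded.subset_ball_lt 0 0
  have hopen := Φ.continuousAt hΦ.zero_mem
  rw [Metric.continuousAt_iff] at hopen
  obtain ⟨η, hη, hηε⟩ := hopen ε hε
  filter_upwards [hs (Ioo_mem_nhdsGT (show 0 < η / B by positivity))] with n hn x hx hxK
  have h1 : ‖(s n)⁻¹ • Φ.symm x‖ < B := by simpa using hKB hxK
  rw [norm_smul, norm_inv, Real.norm_of_nonneg hn.1.le, inv_mul_eq_div, div_lt_iff₀ hn.1] at h1
  have h2 : dist (Φ.symm x) 0 < η := by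
    rw [dist_zero_right]
    refine h1.trans ?_
    have := (lt_div_iff₀ hB).1 hn.2
    linarith
  have h3 := hηε h2
  rwa [Φ.right_inv hx, hΦ.map_zero] at h3

/-- The bound V is the volume of one fixed large box, in which all cells of every grid lie; it does
not depend on the mesh. -/
lemma multi_cells (hd : 1 ≤ d) (hΦ : IsAlmostIsometric ζ Φ) (hh : Measurable h)
    (hμ : μ = (riemannianLeb d X).withDensity (fun x => (h x : ℝ≥0∞))) (hpos : 0 < h ζ)
    (hleb : IsLebesguePoint d h ζ) (hs : Tendsto s atTop (𝓝[>] 0))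
    (hns : Tendsto (fun n : ℕ => n * (h ζ : ℝ) * s n ^ d) atTop (𝓝 1))
    (hdec : ∀ K : ℕ, ∃ C : ℝ, ∀ B : Set X, MeasurableSet B → IsTameSet d K B → DecSet μ T ρ C B)
    {K : Set (EuclideanSpace ℝ (Fin d))} (hK : IsCompact K) :
    ∃ V : ℝ, ∀ η : ℝ, 0 < η → ∃ (N : ℕ) (Q : Fin N → Set (EuclideanSpace ℝ (Fin d)))
      (y : Fin N → EuclideanSpace ℝ (Fin d)), Pairwise (Function.onFun Disjoint Q) ∧
      K ⊆ ⋃ i, Q i ∧ (∀ i, ∀ z ∈ Q i, dist z (y i) ≤ η) ∧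
      (∀ i, GoodCell μ T ρ volume (fun _ => Φ.target) (fun n x => (s n)⁻¹ • Φ.symm x) (Q i)) ∧
      ∑ i, volume.real (Q i) ≤ V := by
  obtain ⟨B, hB, hKB⟩ := hK.isBounded.subset_ball_lt 0 0
  have hbox : IsTameModel (halfOpenBox (fun _ : Fin d => -B) fun _ => B) :=
    isTameModel_halfOpenBox hd fun _ => by linarith
  refine ⟨volume.real (halfOpenBox (fun _ : Fin d => -B) fun _ => B), fun η hη => ?_⟩
  obtain ⟨N, a, b, hab, hdisj, hcov, hsub, hdist⟩ := exists_grid (d := d) hB hη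
  have htame := fun k => isTameModel_halfOpenBox hd (hab k)
  refine ⟨N, fun k => halfOpenBox (a k) (b k), fun k => WithLp.toLp 2 (a k), hdisj, hKB.trans hcov,
    hdist, fun k => multi_goodCell hΦ hh hμ hpos hleb hs hns hdec (htame k), ?_⟩
  rw [← measureReal_biUnion_finset (fun k _ k' _ hk => hdisj hk) (fun k _ => (htame k).measurableSet)
    (fun k _ => (htame k).isBounded.measure_lt_top.ne)]
  exact measureReal_mono (iUnion₂_subset fun k _ => hsub k) hbox.isBounded.measure_lt_top.ne

lemma multi_cover (hd : 1 ≤ d) (hΦ : IsAlmostIsometric ζ Φ) (hh : Measurable h)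
    (hμ : μ = (riemannianLeb d X).withDensity (fun x => (h x : ℝ≥0∞))) (hpos : 0 < h ζ)
    (hleb : IsLebesguePoint d h ζ) (hs : Tendsto s atTop (𝓝[>] 0))
    (hns : Tendsto (fun n : ℕ => n * (h ζ : ℝ) * s n ^ d) atTop (𝓝 1)) (hρ : ∀ n, 0 ≤ ρ n)
    (hdec : ∀ K : ℕ, ∃ C : ℝ, ∀ B : Set X, MeasurableSet B → IsTameSet d K B → DecSet μ T ρ C B)
    {K : Set (EuclideanSpace ℝ (Fin d))} (hK : IsCompact K) :
    ∃ C : ℝ, ∀ᶠ n : ℕ in atTop, ∃ D, DecSet μ T ρ C D ∧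
      Φ.target ∩ (fun x => (s n)⁻¹ • Φ.symm x) ⁻¹' K ⊆ D ∧ (n : ℝ) * μ.real D ≤ C := by
  obtain ⟨B, hB, hKB⟩ := hK.isBounded.subset_ball_lt 0 0
  obtain ⟨C, r, hr, hC⟩ := hΦ.exists_decSet hdec
    (isTameModel_halfOpenBox hd (a := fun _ => -B) (b := fun _ => B) fun _ => by linarith)
  set Q := halfOpenBox (fun _ : Fin d => -B) fun _ => B with hQ
  have hbox : IsTameModel Q := isTameModel_halfOpenBox hd fun _ => by linarith
  have hKQ : K ⊆ Q := by
    intro x hx i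
    have h1 := hKB hx
    rw [mem_ball_zero_iff] at h1
    have := abs_lt.1 (lt_of_le_of_lt (PiLp.norm_apply_le x i) h1)
    exact ⟨this.1.le, this.2⟩
  have hlim := tendsto_multi_intensity hΦ hh hμ hpos hleb hs hns hbox.measurableSet hbox.isBounded
  refine ⟨max C (volume.real Q + 1), ?_⟩
  filter_upwards [hs (Ioo_mem_nhdsGT hr), hlim.eventually (gt_mem_nhds (lt_add_one _))] with n hn hn2
  obtain ⟨h1, h2⟩ := hC _ hn.1 hn.2.le
  refine ⟨_, h2.mono (le_max_left _ _) hρ, ?_, hn2.le.trans (le_max_right _ _)⟩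
  rw [← target_inter_preimage_eq hn.1 h1]
  exact inter_subset_inter_right _ (preimage_mono hKQ)

/-- Marks in K have coordinates of size at most B s_n, on which the return map differs from L by
o(s_n). Rescaling by 1/s_n commutes with the linear map L and leaves o(1). -/
lemma multi_step (hΦ : IsAlmostIsometric ζ Φ) (hs : Tendsto s atTop (𝓝[>] 0)) {p : ℕ}
    (hcont : ContinuousAt T^[p] ζ) (hp : T^[p] ζ = ζ)
    {L : EuclideanSpace ℝ (Fin d) →L[ℝ] EuclideanSpace ℝ (Fin d)}
    (hL : HasFDerivAt (Φ.symm ∘ T^[p] ∘ Φ) L 0) (K : Set (EuclideanSpace ℝ (Fin d)))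
    (hK : IsCompact K) (η : ℝ) (hη : 0 < η) :
    ∀ᶠ n in atTop, ∀ x ∈ Φ.target, (s n)⁻¹ • Φ.symm x ∈ K →
      T^[p] x ∈ Φ.target ∧
        dist ((s n)⁻¹ • Φ.symm (T^[p] x)) (L ((s n)⁻¹ • Φ.symm x)) ≤ η := by
  obtain ⟨B, hB, hKB⟩ := hK.isBounded.subset_ball_lt 0 0
  have hnhds : ∀ᶠ x in 𝓝 ζ, T^[p] x ∈ Φ.target :=
    hcont.eventually (Φ.open_target.mem_nhds (by rw [hp]; exact hΦ.mem_target))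
  obtain ⟨ε, hε, hεt⟩ := Metric.eventually_nhds_iff.1 hnhds
  have hder := (hasFDerivAt_iff_isLittleO_nhds_zero.1 hL).def (show 0 < η / B by positivity)
  obtain ⟨r, hr, hrd⟩ := Metric.eventually_nhds_iff.1 hder
  filter_upwards [multi_marksShrink hΦ hs K hK ε hε,
    hs (Ioo_mem_nhdsGT (show 0 < r / B by positivity))] with n h1 hn x hx hxK
  refine ⟨hεt (h1 x hx hxK), ?_⟩
  have h2 : ‖(s n)⁻¹ • Φ.symm x‖ < B := by simpa using hKB hxK
  rw [norm_smul, norm_inv, Real.norm_of_nonneg hn.1.le, inv_mul_eq_div, div_lt_iff₀ hn.1] at h2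
  have h3 : dist (Φ.symm x) 0 < r := by
    rw [dist_zero_right]
    have := (lt_div_iff₀ hB).1 hn.2
    linarith
  have h4 := hrd h3
  simp only [zero_add, Function.comp_apply, Φ.right_inv hx, hΦ.map_zero, hp, hΦ.symm_apply,
    sub_zero] at h4
  rw [map_smul, dist_eq_norm, ← smul_sub, norm_smul, norm_inv, Real.norm_of_nonneg hn.1.le,
    inv_mul_eq_div, div_le_iff₀ hn.1]
  refine h4.trans ?_
  calc η / B * ‖Φ.symm x‖ ≤ η / B * (B * s n) := by gcongr
    _ = η * s n := by field_simp

/-- The rescaled coordinates of the visits to a neighbourhood of a non-periodic point. -/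
lemma rareMarks_multi (hd : 1 ≤ d) (hΦ : IsAlmostIsometric ζ Φ) (hh : Measurable h)
    (hμ : μ = (riemannianLeb d X).withDensity (fun x => (h x : ℝ≥0∞))) (hpos : 0 < h ζ)
    (hleb : IsLebesguePoint d h ζ) (hs : Tendsto s atTop (𝓝[>] 0))
    (hns : Tendsto (fun n : ℕ => n * (h ζ : ℝ) * s n ^ d) atTop (𝓝 1)) (hρ : ∀ n, 0 ≤ ρ n)
    (hdec : ∀ K : ℕ, ∃ C : ℝ, ∀ B : Set X, MeasurableSet B → IsTameSet d K B → DecSet μ T ρ C B)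
    (hcont : ∀ j : ℕ, ContinuousAt T (T^[j] ζ)) (hζ : ζ ∉ Function.periodicPts T) :
    RareMarks μ T ρ volume (fun _ => Φ.target) (fun n x => (s n)⁻¹ • Φ.symm x) ∅ fun _ y => y where
  meas _ _ hB := measurableSet_target_inter (hB.preimage (measurable_const_smul _))
  cells _ hK := multi_cells hd hΦ hh hμ hpos hleb hs hns hdec hK
  cover _ hK := multi_cover hd hΦ hh hμ hpos hleb hs hns hρ hdec hK
  noReturn _ hK j hj _ := (multi_marksShrink hΦ hs).noReturn (continuousAt_iterate hcont j)
    (fun h => hζ (Function.mk_mem_periodicPts hj h)) hK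
  return_ _ _ _ _ hj := absurd hj (notMem_empty _)
  continuous _ hj := absurd hj (notMem_empty _)

/-- The rescaled coordinates of the visits to a neighbourhood of a periodic point. -/
lemma rareMarks_multi_periodic (hd : 1 ≤ d) (hΦ : IsAlmostIsometric ζ Φ) (hh : Measurable h)
    (hμ : μ = (riemannianLeb d X).withDensity (fun x => (h x : ℝ≥0∞))) (hpos : 0 < h ζ)
    (hleb : IsLebesguePoint d h ζ) (hs : Tendsto s atTop (𝓝[>] 0))
    (hns : Tendsto (fun n : ℕ => n * (h ζ : ℝ) * s n ^ d) atTop (𝓝 1)) (hρ : ∀ n, 0 ≤ ρ n)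
    (hdec : ∀ K : ℕ, ∃ C : ℝ, ∀ B : Set X, MeasurableSet B → IsTameSet d K B → DecSet μ T ρ C B)
    (hcont : ∀ j : ℕ, ContinuousAt T (T^[j] ζ)) {p : ℕ} (hp0 : 0 < p)
    (hp : Function.minimalPeriod T ζ = p)
    {L : EuclideanSpace ℝ (Fin d) →L[ℝ] EuclideanSpace ℝ (Fin d)}
    (hL : HasFDerivAt (Φ.symm ∘ T^[p] ∘ Φ) L 0) :
    RareMarks μ T ρ volume (fun _ => Φ.target) (fun n x => (s n)⁻¹ • Φ.symm x) {j | p ∣ j}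
      fun j => L^[j / p] where
  meas _ _ hB := measurableSet_target_inter (hB.preimage (measurable_const_smul _))
  cells _ hK := multi_cells hd hΦ hh hμ hpos hleb hs hns hdec hK
  cover _ hK := multi_cover hd hΦ hh hμ hpos hleb hs hns hρ hdec hK
  noReturn _ hK j _ hj := (multi_marksShrink hΦ hs).noReturn (continuousAt_iterate hcont j)
    (fun h => hj (hp ▸ Function.IsPeriodicPt.minimalPeriod_dvd h)) hK
  return_ K hK j _ hj η hη := by
    obtain ⟨l, rfl⟩ := hj
    rw [Nat.mul_div_cancel_left _ hp0]
    have hpζ : T^[p] ζ = ζ := hp ▸ Function.isPeriodicPt_minimalPeriod T ζ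
    exact return_of_step (dom := fun _ => Φ.target) (Y := fun n x => (s n)⁻¹ • Φ.symm x) L.continuous
      (multi_step hΦ hs (continuousAt_iterate hcont p) hpζ hL) l hK hη
  continuous j _ := L.continuous.iterate _

end Multi

/-- Sublevel sets of the mark are superlevel sets of the observable. Continuity of v gives room for
some τ < b and hence the strict inequality; nonemptiness excludes the junk value 0 of the infimum of
the empty set, which stands for a mark at infinity. -/
lemma levelInv_lt_iff {v : ℝ → ℝ} (hc : ContinuousOn v (Ioi 0)) (ha : StrictAntiOn v (Ioi 0))
    {z : EReal} {b : ℝ} (hb : 0 < b) :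
    ((freqSet v z).Nonempty ∧ (levelInv v z : ℝ) < b) ↔ (v b : EReal) < z := by
  have hbdd : BddBelow (freqSet v z) := ⟨0, fun τ hτ => hτ.1.le⟩
  have hcoe : (levelInv v z : ℝ) = sInf (freqSet v z) :=
    Real.coe_toNNReal _ (Real.sInf_nonneg fun τ hτ => hτ.1.le)
  rw [hcoe]
  constructor
  · rintro ⟨hne, hlt⟩
    obtain ⟨τ, hτ, hτb⟩ := exists_lt_of_csInf_lt hne hlt
    exact (EReal.coe_lt_coe_iff.2 (ha hτ.1 hb hτb)).trans hτ.2
  · intro hlt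
    refine ⟨⟨b, hb, hlt⟩, ?_⟩
    have h1 : ContinuousAt (fun τ => (v τ : EReal)) b :=
      continuous_coe_real_ereal.continuousAt.comp (hc.continuousAt (Ioi_mem_nhds hb))
    have h2 : ∀ᶠ τ in 𝓝[<] b, (v τ : EReal) < z :=
      (h1.eventually (gt_mem_nhds hlt)).filter_mono nhdsWithin_le_nhds
    obtain ⟨τ, hτ, hτ0, hτb⟩ := (h2.and (Ioo_mem_nhdsLT hb)).exists
    exact (csInf_le hbdd ⟨hτ0, hτ⟩).trans_lt hτb

/-! ### Frequencies of the visits as rare marks -/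

section Level

variable {d : ℕ} {X : Type*} [MetricSpace X] [MeasurableSpace X] [BorelSpace X] {μ : Measure X}
  [IsProbabilityMeasure μ] {T : X → X} {ζ : X} {g : ℝ → EReal} {δ : ℝ} {u : ℕ → ℝ → ℝ} {κ : ℝ}
  {Φ : OpenPartialHomeomorph (EuclideanSpace ℝ (Fin d)) X} {ρ : ℕ → ℝ}

/-- The points whose observable has a finite frequency at time `n`. -/
abbrev levelDom (g : ℝ → EReal) (u : ℕ → ℝ → ℝ) (ζ : X) (n : ℕ) : Set X :=
  {x | (freqSet (u n) (g (dist x ζ))).Nonempty}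

/-- The frequency of the observable at time `n`. -/
abbrev levelMark (g : ℝ → EReal) (u : ℕ → ℝ → ℝ) (ζ : X) (n : ℕ) (x : X) : ℝ≥0 :=
  levelInv (u n) (g (dist x ζ))

lemma mem_levelDom_lt_iff (hu : IsNormalising μ (fun x => g (dist x ζ)) u) {b : ℝ} (hb : 0 < b)
    (n : ℕ) (x : X) :
    (x ∈ levelDom g u ζ n ∧ (levelMark g u ζ n x : ℝ) < b) ↔ (u n b : EReal) < g (dist x ζ) :=
  levelInv_lt_iff (hu.continuousOn n) (hu.strictAnti n) hb

lemma levelDom_inter_Iio (hu : IsNormalising μ (fun x => g (dist x ζ)) u) {b : ℝ≥0} (hb : 0 < b)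
    (n : ℕ) : levelDom g u ζ n ∩ levelMark g u ζ n ⁻¹' Iio b =
      {x | (u n b : EReal) < g (dist x ζ)} := by
  ext x
  exact mem_levelDom_lt_iff hu (NNReal.coe_pos.2 hb) n x

lemma measurableSet_levelDom_inter (hgm : Measurable fun x : X => g (dist x ζ))
    (hu : IsNormalising μ (fun x => g (dist x ζ)) u) (n : ℕ) {B : Set ℝ≥0}
    (hB : MeasurableSet B) : MeasurableSet (levelDom g u ζ n ∩ levelMark g u ζ n ⁻¹' B) := by
  have hlev : ∀ b : ℝ≥0, MeasurableSet {x | (u n b : EReal) < g (dist x ζ)} :=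
    fun b => hgm measurableSet_Ioi
  have hdom : MeasurableSet (levelDom g u ζ n) := by
    have : levelDom g u ζ n = ⋃ k : ℕ, {x | (u n ((k + 1 : ℕ) : ℝ≥0) : EReal) < g (dist x ζ)} := by
      ext x
      rw [mem_iUnion]
      constructor
      · intro hx
        obtain ⟨k, hk⟩ := exists_nat_gt (levelMark g u ζ n x)
        refine ⟨k, ?_⟩
        rw [← levelDom_inter_Iio hu (by positivity)]
        exact ⟨hx, hk.trans (by exact_mod_cast Nat.lt_succ_self k)⟩
      · rintro ⟨k, hk⟩
        rw [← levelDom_inter_Iio hu (by positivity)] at hk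
        exact hk.1
    rw [this]
    exact MeasurableSet.iUnion fun k => hlev _
  have hmeas : Measurable fun x : levelDom g u ζ n => levelMark g u ζ n x := by
    refine measurable_of_Iio fun b => ?_
    rcases eq_zero_or_pos b with rfl | hb
    · simp
    · have : (fun x : levelDom g u ζ n => levelMark g u ζ n x) ⁻¹' Iio b =
          Subtype.val ⁻¹' {x | (u n b : EReal) < g (dist x ζ)} := by
        rw [← levelDom_inter_Iio hu hb]
        ext x
        exact ⟨fun h => ⟨x.2, h⟩, fun h => h.2⟩
      rw [this]
      exact measurable_subtype_coe (hlev b)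
  have : levelDom g u ζ n ∩ levelMark g u ζ n ⁻¹' B =
      Subtype.val '' ((fun x : levelDom g u ζ n => levelMark g u ζ n x) ⁻¹' B) := by
    ext x
    exact ⟨fun h => ⟨⟨x, h.1⟩, h.2, rfl⟩, by rintro ⟨y, hy, rfl⟩; exact ⟨y.2, hy⟩⟩
  rw [this]
  exact hdom.subtype_image (hmeas hB)

lemma tendsto_mul_measure_ball (hg : IsProfile g δ)
    (hu : IsNormalising μ (fun x => g (dist x ζ)) u) (hκ : 0 < κ)
    (hball : Tendsto (fun s : ℝ => μ.real (Metric.ball ζ s) / s ^ d) (𝓝[>] 0) (𝓝 κ)) {τ : ℝ}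
    (hτ : 0 < τ) {c : ℝ} (hc : 0 < c) :
    Tendsto (fun n : ℕ => n * μ.real (Metric.ball ζ (c * profileInv g δ (u n τ)))) atTop
      (𝓝 (τ * c ^ d)) := by
  have hr := tendsto_levelRadius hg hu hκ hball hτ
  have hcr : Tendsto (fun n => c * profileInv g δ (u n τ)) atTop (𝓝[>] 0) := by
    rw [tendsto_nhdsWithin_iff] at hr ⊢
    refine ⟨by simpa using hr.1.const_mul c, ?_⟩
    filter_upwards [hr.2] with n hn using mul_pos hc hn
  have h1 := (((tendsto_level hg hu hκ hball hτ).mul (hball.comp hcr)).mul_const (c ^ d)).div_const κ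
  rw [show τ * κ * c ^ d / κ = τ * c ^ d by field_simp] at h1
  refine h1.congr' ?_
  filter_upwards [hr self_mem_nhdsWithin] with n hn
  have hn' : 0 < profileInv g δ (u n τ) := hn
  simp only [Function.comp_apply]
  generalize μ.real _ = m
  rw [mul_pow]
  field_simp

/-- The image of a small Euclidean ball is a tame set close to a ball around `ζ`. -/
lemma eventually_level_decSet (hd : 1 ≤ d) (hΦ : IsAlmostIsometric ζ Φ) (hg : IsProfile g δ)
    (hu : IsNormalising μ (fun x => g (dist x ζ)) u) (hκ : 0 < κ)
    (hball : Tendsto (fun s : ℝ => μ.real (Metric.ball ζ s) / s ^ d) (𝓝[>] 0) (𝓝 κ))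
    (hdec : ∀ K : ℕ, ∃ C : ℝ, ∀ B : Set X, MeasurableSet B → IsTameSet d K B → DecSet μ T ρ C B)
    {c : ℝ} (hc : 0 < c) :
    ∃ C : ℝ, ∀ τ : ℝ, 0 < τ → ∀ᶠ n in atTop,
      DecSet μ T ρ C (Φ '' Metric.ball 0 (c * profileInv g δ (u n τ))) := by
  obtain ⟨C, r, hr, hC⟩ := hΦ.exists_decSet hdec (isTameModel_ball hd)
  refine ⟨C, fun τ hτ => ?_⟩
  filter_upwards [eventually_level hg hu hκ hball hτ (div_pos hr hc)] with n hn
  have h1 : 0 < c * profileInv g δ (u n τ) := mul_pos hc hn.1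
  have h2 : c * profileInv g δ (u n τ) ≤ r := by
    have := (lt_div_iff₀ hc).1 hn.2.1
    linarith
  rw [← ball_eq_smul h1]
  exact (hC _ h1 h2).2

lemma exists_pow_sub_pow_lt {τ ε : ℝ} (hε : 0 < ε) :
    ∃ t : ℝ, 0 < t ∧ t < 1 ∧ 2 * (τ * (1 + t) ^ d - τ * (1 - t) ^ d) < ε := by
  have h1 : Tendsto (fun t : ℝ => 2 * (τ * (1 + t) ^ d - τ * (1 - t) ^ d)) (𝓝[>] 0) (𝓝 0) := by
    have : Continuous fun t : ℝ => 2 * (τ * (1 + t) ^ d - τ * (1 - t) ^ d) := by fun_prop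
    simpa using (this.tendsto 0).mono_left nhdsWithin_le_nhds
  obtain ⟨t, ht, ht0, ht1⟩ := ((h1.eventually (gt_mem_nhds hε)).and (Ioo_mem_nhdsGT one_pos)).exists
  exact ⟨t, ht0, ht1, ht⟩

/-- A metric ball around ζ need not be tame, but the image of the Euclidean ball of the same radius
r is. Both lie between the balls of radii (1-t)r and (1+t)r, and n times the measure of that annulus
tends to τ((1+t)^d - (1-t)^d); each of the two differences contributes once. -/
lemma eventually_level_symmDiff (hΦ : IsAlmostIsometric ζ Φ) (hg : IsProfile g δ)
    (hu : IsNormalising μ (fun x => g (dist x ζ)) u) (hκ : 0 < κ)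
    (hball : Tendsto (fun s : ℝ => μ.real (Metric.ball ζ s) / s ^ d) (𝓝[>] 0) (𝓝 κ)) {τ : ℝ}
    (hτ : 0 < τ) {ε : ℝ} (hε : 0 < ε) :
    ∀ᶠ n : ℕ in atTop, (n : ℝ) *
      (μ.real (Φ '' Metric.ball 0 (profileInv g δ (u n τ)) \ {x | (u n τ : EReal) < g (dist x ζ)}) +
        μ.real ({x | (u n τ : EReal) < g (dist x ζ)} \
          Φ '' Metric.ball 0 (profileInv g δ (u n τ)))) ≤ ε := by
  obtain ⟨t, ht0, ht1, ht⟩ := exists_pow_sub_pow_lt (d := d) (τ := τ) hε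
  obtain ⟨s₀, hs₀, -, hs⟩ := hΦ.exists_ball ht0 ht1
  have hlim := ((tendsto_mul_measure_ball hg hu hκ hball hτ (show 0 < 1 + t by linarith)).sub
    (tendsto_mul_measure_ball hg hu hκ hball hτ (show 0 < 1 - t by linarith))).const_mul 2
  filter_upwards [hlim.eventually (gt_mem_nhds ht), eventually_level hg hu hκ hball hτ hs₀]
    with n h1 h2
  obtain ⟨hr0, hrs, hE⟩ := h2
  rw [hE]
  obtain ⟨hup, hlow⟩ := hs _ hr0 hrs.le
  set r := profileInv g δ (u n τ)
  have hsub : Metric.ball ζ ((1 - t) * r) ⊆ Metric.ball ζ ((1 + t) * r) :=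
    Metric.ball_subset_ball (by nlinarith)
  have hdiff := measureReal_sdiff (μ := μ) hsub Metric.isOpen_ball.measurableSet
  have e1 : μ.real (Φ '' Metric.ball 0 r \ Metric.ball ζ r) ≤
      μ.real (Metric.ball ζ ((1 + t) * r) \ Metric.ball ζ ((1 - t) * r)) :=
    measureReal_mono (sdiff_subset_sdiff hup (Metric.ball_subset_ball (by nlinarith)))
  have e2 : μ.real (Metric.ball ζ r \ Φ '' Metric.ball 0 r) ≤
      μ.real (Metric.ball ζ ((1 + t) * r) \ Metric.ball ζ ((1 - t) * r)) :=
    measureReal_mono (sdiff_subset_sdiff (Metric.ball_subset_ball (by nlinarith)) hlow)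
  rw [hdiff] at e1 e2
  have := mul_le_mul_of_nonneg_left (add_le_add e1 e2) (Nat.cast_nonneg (α := ℝ) n)
  linarith

lemma eventually_levelRadius_lt (hg : IsProfile g δ)
    (hu : IsNormalising μ (fun x => g (dist x ζ)) u) (hκ : 0 < κ)
    (hball : Tendsto (fun s : ℝ => μ.real (Metric.ball ζ s) / s ^ d) (𝓝[>] 0) (𝓝 κ)) {a b : ℝ}
    (ha : 0 < a) (hab : a < b) :
    ∀ᶠ n in atTop, profileInv g δ (u n a) < profileInv g δ (u n b) := by
  have hb : 0 < b := ha.trans hab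
  filter_upwards [(tendsto_level hg hu hκ hball ha).eventually_lt (tendsto_level hg hu hκ hball hb)
    hab, eventually_level hg hu hκ hball hb one_pos, eventually_ge_atTop 1] with n h1 h2 h3
  have hn : (0 : ℝ) < n * κ := by positivity
  exact lt_of_pow_lt_pow_left₀ d h2.1.le (lt_of_mul_lt_mul_left h1 hn.le)

lemma halfLineMeasure_real_Ico {a b : ℝ≥0} (hab : a ≤ b) :
    halfLineMeasure.real (Ico a b) = b - a := by
  have h1 : halfLineMeasure (Ico a b) = ENNReal.ofReal (b - a) := by
    rw [halfLineMeasure_apply measurableSet_Ico, ← Real.volume_Ico]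
    refine measure_congr ?_
    have h0 : ∀ᵐ x : ℝ, x ≠ 0 := by simp [ae_iff]
    filter_upwards [h0] with x hx
    refine propext ?_
    change (0 < x ∧ a ≤ x.toNNReal ∧ x.toNNReal < b) ↔ ((a : ℝ) ≤ x ∧ x < b)
    constructor
    · rintro ⟨hx0, h1, h2⟩
      rw [← Real.coe_toNNReal x hx0.le]
      exact ⟨by exact_mod_cast h1, by exact_mod_cast h2⟩
    · rintro ⟨h1, h2⟩
      have hx0 : 0 ≤ x := a.2.trans h1
      refine ⟨lt_of_le_of_ne hx0 hx.symm, ?_⟩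
      rw [← Real.coe_toNNReal x hx0] at h1 h2
      exact ⟨by exact_mod_cast h1, by exact_mod_cast h2⟩
  rw [Measure.real, h1, ENNReal.toReal_ofReal (sub_nonneg.2 (by exact_mod_cast hab))]

/-- The event that the mark lies in [a, b) is a difference of two superlevel sets. It is
approximated by the difference of the corresponding tame images, for which the decay constants add.
-/
lemma level_goodCell (hd : 1 ≤ d) (hT : MeasurePreserving T μ μ) (hΦ : IsAlmostIsometric ζ Φ)
    (hg : IsProfile g δ) (hgm : Measurable fun x : X => g (dist x ζ))
    (hu : IsNormalising μ (fun x => g (dist x ζ)) u) (hκ : 0 < κ)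
    (hball : Tendsto (fun s : ℝ => μ.real (Metric.ball ζ s) / s ^ d) (𝓝[>] 0) (𝓝 κ))
    (hdec : ∀ K : ℕ, ∃ C : ℝ, ∀ B : Set X, MeasurableSet B → IsTameSet d K B → DecSet μ T ρ C B)
    {a b : ℝ≥0} (hab : a < b) :
    GoodCell μ T ρ halfLineMeasure (levelDom g u ζ) (levelMark g u ζ) (Ico a b) := by
  have hb : 0 < b := lt_of_le_of_lt a.2 hab
  have hb' : (0 : ℝ) < b := hb
  have hfin : halfLineMeasure (Ico a b) ≠ ∞ :=
    ((measure_mono (Ico_subset_Iio_self.trans Iio_subset_Iic_self)).trans_lt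
      (halfLineMeasure_Iic_lt_top b)).ne
  obtain ⟨C, hC⟩ := eventually_level_decSet (μ := μ) (T := T) (ρ := ρ) hd hΦ hg hu hκ hball hdec
    one_pos
  simp only [one_mul] at hC
  -- For a = 0 the cell is a full superlevel set; there is no level at frequency 0 to subtract.
  rcases eq_zero_or_pos a with rfl | ha
  · have hE : ∀ n, levelDom g u ζ n ∩ levelMark g u ζ n ⁻¹' Ico 0 b =
        {x | (u n b : EReal) < g (dist x ζ)} := fun n => by
      rw [← levelDom_inter_Iio hu hb]
      congr 1
      ext x
      simp
    refine ⟨measurableSet_Ico, hfin, ?_, fun ε hε => ⟨C, ?_⟩⟩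
    · rw [halfLineMeasure_real_Ico hab.le, NNReal.coe_zero, sub_zero]
      simp only [hE]
      exact hu.tendsto b hb'
    · filter_upwards [hC b hb', eventually_level_symmDiff hΦ hg hu hκ hball hb' hε] with n h1 h2
      rw [hE]
      exact ⟨_, h1, h2⟩
  · have ha' : (0 : ℝ) < a := ha
    have hab' : (a : ℝ) < b := hab
    have hE : ∀ n, levelDom g u ζ n ∩ levelMark g u ζ n ⁻¹' Ico a b =
        {x | (u n b : EReal) < g (dist x ζ)} \ {x | (u n a : EReal) < g (dist x ζ)} := fun n => by
      rw [← levelDom_inter_Iio hu hb, ← levelDom_inter_Iio hu ha]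
      ext x
      simp only [mem_inter_iff, mem_preimage, mem_Ico, Set.mem_sdiff, mem_Iio, not_and, not_lt]
      tauto
    have hsub : ∀ n, {x | (u n a : EReal) < g (dist x ζ)} ⊆ {x | (u n b : EReal) < g (dist x ζ)} :=
      fun n x hx => (EReal.coe_lt_coe_iff.2 (hu.strictAnti n ha' hb' hab')).trans hx
    refine ⟨measurableSet_Ico, hfin, ?_, fun ε hε => ⟨C + C, ?_⟩⟩
    · rw [halfLineMeasure_real_Ico hab.le]
      refine ((hu.tendsto b hb').sub (hu.tendsto a ha')).congr fun n => ?_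
      rw [hE, measureReal_sdiff (hsub n) (hgm measurableSet_Ioi), mul_sub]
    · filter_upwards [hC b hb', eventually_level_symmDiff hΦ hg hu hκ hball hb' (half_pos hε),
        hC a ha', eventually_level_symmDiff hΦ hg hu hκ hball ha' (half_pos hε),
        eventually_levelRadius_lt hg hu hκ hball ha' hab'] with n h1 h2 h3 h4 h5
      refine ⟨_, h1.diff hT h3 (image_mono (Metric.ball_subset_ball h5.le)), ?_⟩
      rw [hE]
      generalize Φ '' Metric.ball 0 (profileInv g δ (u n b)) = Db at *
      generalize Φ '' Metric.ball 0 (profileInv g δ (u n a)) = Da at *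
      generalize {x | (u n b : EReal) < g (dist x ζ)} = Eb at *
      generalize {x | (u n a : EReal) < g (dist x ζ)} = Ea at *
      have e1 : μ.real ((Db \ Da) \ (Eb \ Ea)) ≤ μ.real (Db \ Eb) + μ.real (Ea \ Da) := by
        refine (measureReal_mono fun x hx => ?_).trans (measureReal_union_le _ _)
        simp only [Set.mem_sdiff, mem_union] at hx ⊢
        tauto
      have e2 : μ.real ((Eb \ Ea) \ (Db \ Da)) ≤ μ.real (Eb \ Db) + μ.real (Da \ Ea) := by
        refine (measureReal_mono fun x hx => ?_).trans (measureReal_union_le _ _)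
        simp only [Set.mem_sdiff, mem_union] at hx ⊢
        tauto
      have := mul_le_mul_of_nonneg_left (add_le_add e1 e2) (Nat.cast_nonneg (α := ℝ) n)
      linarith

lemma level_cells (hd : 1 ≤ d) (hT : MeasurePreserving T μ μ) (hΦ : IsAlmostIsometric ζ Φ)
    (hg : IsProfile g δ) (hgm : Measurable fun x : X => g (dist x ζ))
    (hu : IsNormalising μ (fun x => g (dist x ζ)) u) (hκ : 0 < κ)
    (hball : Tendsto (fun s : ℝ => μ.real (Metric.ball ζ s) / s ^ d) (𝓝[>] 0) (𝓝 κ))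
    (hdec : ∀ K : ℕ, ∃ C : ℝ, ∀ B : Set X, MeasurableSet B → IsTameSet d K B → DecSet μ T ρ C B)
    {K : Set ℝ≥0} (hK : IsCompact K) :
    ∃ V : ℝ, ∀ η : ℝ, 0 < η → ∃ (N : ℕ) (Q : Fin N → Set ℝ≥0) (y : Fin N → ℝ≥0),
      Pairwise (Function.onFun Disjoint Q) ∧ K ⊆ ⋃ i, Q i ∧ (∀ i, ∀ z ∈ Q i, dist z (y i) ≤ η) ∧
      (∀ i, GoodCell μ T ρ halfLineMeasure (levelDom g u ζ) (levelMark g u ζ) (Q i)) ∧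
      ∑ i, halfLineMeasure.real (Q i) ≤ V := by
  obtain ⟨B, hB0, hKB⟩ : ∃ B : ℝ≥0, 0 < B ∧ K ⊆ Iio B := by
    obtain ⟨B, hB⟩ := hK.bddAbove
    exact ⟨B + 1, by positivity, fun x hx => (hB hx).trans_lt (lt_add_one B)⟩
  refine ⟨B, fun η hη => ?_⟩
  lift η to ℝ≥0 using hη.le
  have hη' : 0 < η := hη
  obtain ⟨m, hm⟩ := exists_nat_gt (B / η)
  have hm0 : (0 : ℝ≥0) < m := lt_of_le_of_lt (by positivity) hm
  set s : ℝ≥0 := B / m with hs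
  have hs0 : 0 < s := by positivity
  have hms : m * s = B := by rw [hs]; field_simp
  have hsη : s ≤ η := by
    rw [div_lt_iff₀ hη'] at hm
    rw [hs, div_le_iff₀ hm0, mul_comm]
    exact hm.le
  have hlt : ∀ k : ℕ, k * s < (k + 1) * s := fun k => by
    have : (k : ℝ≥0) < k + 1 := lt_add_one _
    gcongr
  have hfl : ∀ k : ℕ, ∀ z ∈ Ico (k * s) ((k + 1) * s), ⌊z / s⌋₊ = k := fun k z hz => by
    rw [Nat.floor_eq_iff (by positivity), le_div_iff₀ hs0, div_lt_iff₀ hs0]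
    exact hz
  refine ⟨m, fun k => Ico ((k : ℕ) * s) (((k : ℕ) + 1) * s), fun k => (k : ℕ) * s,
    fun k k' hk => ?_, fun z hz => ?_, fun k z hz => ?_,
    fun k => level_goodCell hd hT hΦ hg hgm hu hκ hball hdec (hlt k), ?_⟩
  · rw [Function.onFun, Set.disjoint_left]
    intro z hz hz'
    exact hk (Fin.ext (by rw [← hfl _ z hz, ← hfl _ z hz']))
  · have hlt' : ⌊z / s⌋₊ < m := by
      rw [Nat.floor_lt (by positivity), div_lt_iff₀ hs0, hms]
      exact hKB hz
    refine mem_iUnion.2 ⟨⟨_, hlt'⟩, ?_, ?_⟩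
    · exact (le_div_iff₀ hs0).1 (Nat.floor_le (by positivity))
    · exact (div_lt_iff₀ hs0).1 (Nat.lt_floor_add_one _)
  · have h1 : ((k : ℕ) : ℝ) * s ≤ z := by exact_mod_cast hz.1
    have h2 : (z : ℝ) < (((k : ℕ) : ℝ) + 1) * s := by exact_mod_cast hz.2
    have h3 : (s : ℝ) ≤ η := by exact_mod_cast hsη
    rw [NNReal.dist_eq, abs_of_nonneg (by push_cast; linarith)]
    push_cast
    linarith
  · have : ∀ k : Fin m, halfLineMeasure.real (Ico ((k : ℕ) * s) (((k : ℕ) + 1) * s)) = (s : ℝ) :=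
      fun k => by
        rw [halfLineMeasure_real_Ico (hlt k).le]
        push_cast
        ring
    simp only [this, Finset.sum_const, Finset.card_univ, Fintype.card_fin, nsmul_eq_mul]
    exact_mod_cast hms.le

lemma exists_nnreal_bound {K : Set ℝ≥0} (hK : IsCompact K) :
    ∃ B : ℝ, 0 < B ∧ ∀ y ∈ K, (y : ℝ) < B := by
  obtain ⟨B, hB⟩ := hK.bddAbove
  exact ⟨B + 1, by positivity, fun x hx => by exact_mod_cast (hB hx).trans_lt (lt_add_one B)⟩

/-- With distortion 1/2, the image of the Euclidean ball of radius 2r contains the ball of radius r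
around ζ and lies in the one of radius 3r, hence the constant B 3^d. -/
lemma level_cover (hd : 1 ≤ d) (hΦ : IsAlmostIsometric ζ Φ) (hg : IsProfile g δ)
    (hu : IsNormalising μ (fun x => g (dist x ζ)) u) (hκ : 0 < κ)
    (hball : Tendsto (fun s : ℝ => μ.real (Metric.ball ζ s) / s ^ d) (𝓝[>] 0) (𝓝 κ))
    (hρ : ∀ n, 0 ≤ ρ n)
    (hdec : ∀ K : ℕ, ∃ C : ℝ, ∀ B : Set X, MeasurableSet B → IsTameSet d K B → DecSet μ T ρ C B)
    {K : Set ℝ≥0} (hK : IsCompact K) :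
    ∃ C : ℝ, ∀ᶠ n : ℕ in atTop, ∃ D, DecSet μ T ρ C D ∧
      levelDom g u ζ n ∩ levelMark g u ζ n ⁻¹' K ⊆ D ∧ (n : ℝ) * μ.real D ≤ C := by
  obtain ⟨B, hB, hKB⟩ := exists_nnreal_bound hK
  obtain ⟨C, hC⟩ := eventually_level_decSet (μ := μ) (T := T) (ρ := ρ) hd hΦ hg hu hκ hball hdec
    two_pos
  obtain ⟨s₀, hs₀, -, hs⟩ := hΦ.exists_ball (ε := 1 / 2) (by norm_num) (by norm_num)
  have hlim := tendsto_mul_measure_ball hg hu hκ hball hB three_pos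
  refine ⟨max C (B * 3 ^ d + 1), ?_⟩
  filter_upwards [hC B hB, eventually_level hg hu hκ hball hB (half_pos hs₀),
    hlim.eventually (gt_mem_nhds (lt_add_one _))] with n h1 h2 h3
  obtain ⟨hr0, hrs, hE⟩ := h2
  obtain ⟨hup, hlow⟩ := hs (2 * profileInv g δ (u n B)) (by positivity) (by linarith)
  refine ⟨_, h1.mono (le_max_left _ _) hρ, fun x hx => hlow ?_, le_trans ?_ (le_max_right _ _)⟩
  · have := (mem_levelDom_lt_iff hu hB n x).1 ⟨hx.1, hKB _ hx.2⟩
    change x ∈ {x | (u n B : EReal) < g (dist x ζ)} at this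
    rw [hE] at this
    convert this using 1
    ring_nf
  · refine le_trans ?_ h3.le
    refine mul_le_mul_of_nonneg_left (measureReal_mono (hup.trans ?_)) (Nat.cast_nonneg n)
    exact Metric.ball_subset_ball (by linarith)

lemma level_marksShrink (hg : IsProfile g δ) (hu : IsNormalising μ (fun x => g (dist x ζ)) u)
    (hκ : 0 < κ)
    (hball : Tendsto (fun s : ℝ => μ.real (Metric.ball ζ s) / s ^ d) (𝓝[>] 0) (𝓝 κ)) :
    MarksShrink ζ (levelDom g u ζ) (levelMark g u ζ) := by
  intro K hK ε hε
  obtain ⟨B, hB, hKB⟩ := exists_nnreal_bound hK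
  filter_upwards [eventually_level hg hu hκ hball hB hε] with n hn x hx hxK
  have : x ∈ {x | (u n B : EReal) < g (dist x ζ)} :=
    (mem_levelDom_lt_iff hu hB n x).1 ⟨hx, hKB _ hxK⟩
  rw [hn.2.2] at this
  exact (Metric.mem_ball.1 this).trans hn.2.1

/-- The frequency of a point is asymptotically `n` times the measure of the ball it determines. -/
lemma eventually_abs_levelMark_sub_le (hg : IsProfile g δ)
    (hu : IsNormalising μ (fun x => g (dist x ζ)) u) (hκ : 0 < κ)
    (hball : Tendsto (fun s : ℝ => μ.real (Metric.ball ζ s) / s ^ d) (𝓝[>] 0) (𝓝 κ)) {B η : ℝ}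
    (hη : 0 < η) :
    ∀ᶠ n : ℕ in atTop, ∀ x ∈ levelDom g u ζ n, (levelMark g u ζ n x : ℝ) < B →
      |levelMark g u ζ n x - n * κ * dist x ζ ^ d| ≤ 2 * η := by
  obtain ⟨N, hN⟩ := exists_nat_gt (B / η)
  -- Marks below B fall between consecutive multiples kη with k ≤ N, so finitely many levels have to
  -- be controlled. The grid and the asymptotics of each level cost η apiece.
  have hev : ∀ᶠ n : ℕ in atTop, ∀ k ∈ Finset.Icc 1 (N + 1), 0 < profileInv g δ (u n (k * η)) ∧
      {x | (u n (k * η) : EReal) < g (dist x ζ)} =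
        Metric.ball ζ (profileInv g δ (u n (k * η))) ∧
      |n * κ * profileInv g δ (u n (k * η)) ^ d - k * η| < η := by
    rw [Filter.eventually_all_finset]
    intro k hk
    have hk0 : (0 : ℝ) < k := by exact_mod_cast (Finset.mem_Icc.1 hk).1
    have hkη : 0 < k * η := mul_pos hk0 hη
    filter_upwards [eventually_level hg hu hκ hball hkη one_pos,
      (Metric.tendsto_nhds.1 (tendsto_level hg hu hκ hball hkη)) η hη] with n h1 h2
    exact ⟨h1.1, h1.2.2, h2⟩
  filter_upwards [hev] with n hn x hx hxB
  have hnκ : 0 ≤ n * κ := by positivity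
  set y : ℝ := (levelMark g u ζ n x : ℝ) with hy
  have hy0 : 0 ≤ y := NNReal.coe_nonneg _
  set k := ⌊y / η⌋₊ with hk
  have hk1 : k * η ≤ y := (le_div_iff₀ hη).1 (Nat.floor_le (by positivity))
  have hk2 : y < ((k + 1 : ℕ) : ℝ) * η := by
    push_cast
    exact (div_lt_iff₀ hη).1 (Nat.lt_floor_add_one _)
  have hkN : k < N := by
    rw [hk, Nat.floor_lt (by positivity)]
    exact (div_lt_div_of_pos_right hxB hη).trans hN
  have hup : n * κ * dist x ζ ^ d ≤ (k + 2) * η := by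
    obtain ⟨h1, h2, h3⟩ := hn (k + 1) (Finset.mem_Icc.2 ⟨by omega, by omega⟩)
    have hmem : x ∈ {x | (u n ((k + 1 : ℕ) * η) : EReal) < g (dist x ζ)} :=
      (mem_levelDom_lt_iff hu (by positivity) n x).1 ⟨hx, hk2⟩
    rw [h2, Metric.mem_ball] at hmem
    have h4 : n * κ * dist x ζ ^ d ≤ n * κ * profileInv g δ (u n ((k + 1 : ℕ) * η)) ^ d := by
      gcongr
    have h5 := (abs_lt.1 h3).2
    push_cast at h4 h5
    linarith
  have hlow : (k - 1) * η ≤ n * κ * dist x ζ ^ d := by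
    rcases Nat.eq_zero_or_pos k with h0 | h0
    · rw [h0]
      have : 0 ≤ n * κ * dist x ζ ^ d := by positivity
      push_cast
      linarith
    · obtain ⟨h1, h2, h3⟩ := hn k (Finset.mem_Icc.2 ⟨h0, by omega⟩)
      have hk0 : (0 : ℝ) < k := by exact_mod_cast h0
      have hmem : x ∉ {x | (u n (k * η) : EReal) < g (dist x ζ)} := fun h =>
        absurd ((mem_levelDom_lt_iff hu (by positivity) n x).2 h).2 (not_lt.2 hk1)
      rw [h2, Metric.mem_ball, not_lt] at hmem
      have h4 : n * κ * profileInv g δ (u n (k * η)) ^ d ≤ n * κ * dist x ζ ^ d := by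
        gcongr
      have h5 := (abs_lt.1 h3).1
      linarith
  push_cast at hk2
  rw [abs_le]
  constructor <;> linarith

/-- Being close to ζ on the scale of the levels forces a finite, bounded frequency. This is what
makes a return visible to the mark process. -/
lemma eventually_mem_levelDom (hg : IsProfile g δ)
    (hu : IsNormalising μ (fun x => g (dist x ζ)) u) (hκ : 0 < κ)
    (hball : Tendsto (fun s : ℝ => μ.real (Metric.ball ζ s) / s ^ d) (𝓝[>] 0) (𝓝 κ)) {B : ℝ}
    (hB : 0 < B) :
    ∀ᶠ n : ℕ in atTop, ∀ x : X, n * κ * dist x ζ ^ d ≤ B →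
      x ∈ levelDom g u ζ n ∧ (levelMark g u ζ n x : ℝ) < B + 1 := by
  have hB1 : 0 < B + 1 := by linarith
  filter_upwards [eventually_level hg hu hκ hball hB1 one_pos,
    (tendsto_level hg hu hκ hball hB1).eventually (lt_mem_nhds (lt_add_one B)),
    eventually_ge_atTop 1] with n h1 h2 h3 x hx
  have hn : (0 : ℝ) < n * κ := by positivity
  refine (mem_levelDom_lt_iff hu hB1 n x).2 ?_
  have : x ∈ Metric.ball ζ (profileInv g δ (u n (B + 1))) :=
    lt_of_pow_lt_pow_left₀ d h1.1.le (lt_of_mul_lt_mul_left (hx.trans_lt h2) hn.le)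
  rw [← h1.2.2] at this
  exact this

/-! ### Conformal returns multiply the frequency -/

section Return

variable {p : ℕ} {L : EuclideanSpace ℝ (Fin d) →L[ℝ] EuclideanSpace ℝ (Fin d)} {α : ℝ}

lemma IsAlmostIsometric.eventually_symm_ne_zero (hΦ : IsAlmostIsometric ζ Φ) :
    ∀ᶠ x in 𝓝[≠] ζ, x ∈ Φ.target ∧ Φ.symm x ≠ 0 := by
  have h1 : ∀ᶠ x in 𝓝[≠] ζ, x ∈ Φ.target :=
    mem_nhdsWithin_of_mem_nhds (Φ.open_target.mem_nhds hΦ.mem_target)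
  filter_upwards [h1, self_mem_nhdsWithin] with x hx hne
  refine ⟨hx, fun h0 => hne ?_⟩
  rw [mem_singleton_iff, ← Φ.right_inv hx, h0, hΦ.map_zero]

lemma IsAlmostIsometric.tendsto_symm (hΦ : IsAlmostIsometric ζ Φ) :
    Tendsto Φ.symm (𝓝 ζ) (𝓝 0) := by
  have := Φ.continuousAt_symm hΦ.mem_target
  rwa [ContinuousAt, hΦ.symm_apply] at this

lemma IsAlmostIsometric.tendsto_dist_div_norm (hΦ : IsAlmostIsometric ζ Φ) :
    Tendsto (fun x => dist x ζ / ‖Φ.symm x‖) (𝓝[≠] ζ) (𝓝 1) := by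
  rw [Metric.tendsto_nhds]
  intro ε hε
  set ε' := min (ε / 2) (1 / 2) with hε'
  have hε0 : 0 < ε' := by positivity
  have hε1 : ε' < 1 := lt_of_le_of_lt (min_le_right _ _) (by norm_num)
  have hεε : ε' < ε := lt_of_le_of_lt (min_le_left _ _) (by linarith)
  obtain ⟨r, hr, -, hrd⟩ := hΦ.exists_dist_bound hε0 hε1
  have h2 : ∀ᶠ x in 𝓝[≠] ζ, Φ.symm x ∈ Metric.ball 0 r :=
    (hΦ.tendsto_symm.eventually (Metric.ball_mem_nhds 0 hr)).filter_mono nhdsWithin_le_nhds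
  filter_upwards [hΦ.eventually_symm_ne_zero, h2] with x hx hxr
  have h3 := hrd _ hxr
  rw [Φ.right_inv hx.1] at h3
  have hpos : 0 < ‖Φ.symm x‖ := norm_pos_iff.2 hx.2
  refine lt_of_le_of_lt ?_ hεε
  rw [Real.dist_eq, abs_le]
  constructor
  · have := (le_div_iff₀ hpos).2 h3.1
    linarith
  · have := (div_le_iff₀ hpos).2 h3.2
    linarith

lemma IsAlmostIsometric.tendsto_norm_return (hΦ : IsAlmostIsometric ζ Φ) (hp : T^[p] ζ = ζ)
    (hL : HasFDerivAt (Φ.symm ∘ T^[p] ∘ Φ) L 0) (hα : ∀ v, ‖L v‖ = α * ‖v‖) :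
    Tendsto (fun x => ‖Φ.symm (T^[p] x)‖ / ‖Φ.symm x‖) (𝓝[≠] ζ) (𝓝 α) := by
  rw [Metric.tendsto_nhds]
  intro ε hε
  have hder := (hasFDerivAt_iff_isLittleO_nhds_zero.1 hL).def (half_pos hε)
  have h2 := (hΦ.tendsto_symm.eventually hder).filter_mono (nhdsWithin_le_nhds (s := {ζ}ᶜ))
  filter_upwards [hΦ.eventually_symm_ne_zero, h2] with x hx h3
  simp only [zero_add, Function.comp_apply, Φ.right_inv hx.1, hΦ.map_zero, hp, hΦ.symm_apply,
    sub_zero] at h3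
  have hpos : 0 < ‖Φ.symm x‖ := norm_pos_iff.2 hx.2
  have h4 := (abs_norm_sub_norm_le _ _).trans h3
  rw [hα] at h4
  refine lt_of_le_of_lt ?_ (half_lt_self hε)
  rw [Real.dist_eq, show ‖Φ.symm (T^[p] x)‖ / ‖Φ.symm x‖ - α =
    (‖Φ.symm (T^[p] x)‖ - α * ‖Φ.symm x‖) / ‖Φ.symm x‖ by field_simp, abs_div,
    abs_of_pos hpos, div_le_iff₀ hpos]
  exact h4

/-- The ratio of distances factors through the norms of the coordinates: at x and at T^p x the
distance is asymptotic to the norm, and the ratio of norms tends to α by differentiability. -/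
lemma IsAlmostIsometric.tendsto_dist_return (hΦ : IsAlmostIsometric ζ Φ)
    (hcont : ContinuousAt T^[p] ζ) (hp : T^[p] ζ = ζ)
    (hL : HasFDerivAt (Φ.symm ∘ T^[p] ∘ Φ) L 0) (hα0 : 0 < α) (hα : ∀ v, ‖L v‖ = α * ‖v‖) :
    Tendsto (fun x => dist (T^[p] x) ζ / dist x ζ) (𝓝[≠] ζ) (𝓝 α) := by
  have hB := hΦ.tendsto_norm_return hp hL hα
  -- Since the ratio of norms tends to α > 0, points near ζ other than ζ are not mapped to ζ.
  have hTp : Tendsto T^[p] (𝓝[≠] ζ) (𝓝[≠] ζ) := by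
    refine tendsto_nhdsWithin_iff.2 ⟨?_, ?_⟩
    · have := hcont.tendsto
      rw [hp] at this
      exact this.mono_left nhdsWithin_le_nhds
    · filter_upwards [hB.eventually (lt_mem_nhds hα0)] with x hx h0
      rw [mem_singleton_iff.1 h0, hΦ.symm_apply, norm_zero, zero_div] at hx
      exact lt_irrefl _ hx
  have h1 := ((hΦ.tendsto_dist_div_norm.comp hTp).mul hB).div hΦ.tendsto_dist_div_norm one_ne_zero
  rw [one_mul, div_one] at h1
  refine h1.congr' ?_
  filter_upwards [hΦ.eventually_symm_ne_zero, hTp.eventually hΦ.eventually_symm_ne_zero,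
    self_mem_nhdsWithin] with x h2 h3 h4
  have e1 : ‖Φ.symm x‖ ≠ 0 := norm_ne_zero_iff.2 h2.2
  have e2 : ‖Φ.symm (T^[p] x)‖ ≠ 0 := norm_ne_zero_iff.2 h3.2
  have e3 : dist x ζ ≠ 0 := dist_ne_zero.2 h4
  simp only [Function.comp_apply, Pi.div_apply]
  field_simp

lemma IsAlmostIsometric.exists_dist_return_pow (hd : 1 ≤ d) (hΦ : IsAlmostIsometric ζ Φ)
    (hcont : ContinuousAt T^[p] ζ) (hp : T^[p] ζ = ζ)
    (hL : HasFDerivAt (Φ.symm ∘ T^[p] ∘ Φ) L 0) (hα0 : 0 < α) (hα : ∀ v, ‖L v‖ = α * ‖v‖)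
    {η : ℝ} (hη : 0 < η) :
    ∃ r : ℝ, 0 < r ∧ ∀ x, dist x ζ < r →
      |dist (T^[p] x) ζ ^ d - α ^ d * dist x ζ ^ d| ≤ η * dist x ζ ^ d := by
  have h1 := (hΦ.tendsto_dist_return hcont hp hL hα0 hα).pow d
  have h2 := (Metric.tendsto_nhds.1 h1) η hη
  rw [eventually_nhdsWithin_iff] at h2
  obtain ⟨r, hr, h3⟩ := Metric.eventually_nhds_iff.1 h2
  refine ⟨r, hr, fun x hx => ?_⟩
  by_cases hxζ : x = ζ
  · rw [hxζ, hp, dist_self, zero_pow (by omega)]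
    simp
  · have h4 := (h3 hx hxζ).le
    have hpos : 0 < dist x ζ ^ d := pow_pos (dist_pos.2 hxζ) d
    rw [Real.dist_eq, div_pow] at h4
    rw [← div_le_iff₀ hpos, ← abs_of_pos hpos, ← abs_div, abs_of_pos hpos, sub_div,
      mul_div_cancel_right₀ _ hpos.ne']
    exact h4

/-- The frequency of x is close to nκ dist(x,ζ)^d, and T^p multiplies the d-th power of the distance
by α^d up to a small relative error. -/
lemma level_step (hd : 1 ≤ d) (hΦ : IsAlmostIsometric ζ Φ) (hg : IsProfile g δ)
    (hu : IsNormalising μ (fun x => g (dist x ζ)) u) (hκ : 0 < κ)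
    (hball : Tendsto (fun s : ℝ => μ.real (Metric.ball ζ s) / s ^ d) (𝓝[>] 0) (𝓝 κ))
    (hcont : ContinuousAt T^[p] ζ) (hp : T^[p] ζ = ζ)
    (hL : HasFDerivAt (Φ.symm ∘ T^[p] ∘ Φ) L 0) (hα0 : 0 < α) (hα : ∀ v, ‖L v‖ = α * ‖v‖)
    (K : Set ℝ≥0) (hK : IsCompact K) (η : ℝ) (hη : 0 < η) :
    ∀ᶠ n in atTop, ∀ x ∈ levelDom g u ζ n, levelMark g u ζ n x ∈ K →
      T^[p] x ∈ levelDom g u ζ n ∧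
        dist (levelMark g u ζ n (T^[p] x)) ((α ^ d).toNNReal * levelMark g u ζ n x) ≤ η := by
  obtain ⟨B, hB, hKB⟩ := exists_nnreal_bound hK
  set a := α ^ d with ha
  have ha0 : 0 < a := pow_pos hα0 d
  -- Three errors: η/3 for the frequency of T^p x, η/6 for the expansion of the distance, and η/6
  -- for α^d times the error of the frequency of x. The minimum with 1 also gives nκ dist(x,ζ)^d ≤ B
  -- + 1.
  set η₁ := min 1 (η / (6 * a)) / 2 with hη₁
  have hη₁0 : 0 < η₁ := by positivity
  have h2η₁ : 2 * η₁ = min 1 (η / (6 * a)) := by rw [hη₁]; ring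
  have hη₁1 : 2 * η₁ ≤ 1 := h2η₁ ▸ min_le_left _ _
  have hη₁a : a * (2 * η₁) ≤ η / 6 := by
    have : 2 * η₁ ≤ η / (6 * a) := h2η₁ ▸ min_le_right _ _
    calc a * (2 * η₁) ≤ a * (η / (6 * a)) := by gcongr
      _ = η / 6 := by field_simp
  set η₂ := η / (6 * (B + 1)) with hη₂
  have hη₂0 : 0 < η₂ := by positivity
  have hη₂B : η₂ * (B + 1) = η / 6 := by rw [hη₂]; field_simp
  set B' := a * (B + 1) + η with hB'
  have hB'0 : 0 < B' := by positivity
  obtain ⟨r, hr, hrd⟩ := hΦ.exists_dist_return_pow hd hcont hp hL hα0 hα hη₂0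
  filter_upwards [eventually_abs_levelMark_sub_le (B := B) hg hu hκ hball hη₁0,
    eventually_abs_levelMark_sub_le (B := B' + 1) hg hu hκ hball (show 0 < η / 6 by positivity),
    eventually_mem_levelDom hg hu hκ hball hB'0, level_marksShrink hg hu hκ hball K hK r hr]
    with n h1 h2 h3 h4 x hx hxK
  have e1 := abs_le.1 (h1 x hx (hKB _ hxK))
  have hyB := hKB _ hxK
  have hnκ : 0 ≤ n * κ := by positivity
  have e2 := mul_le_mul_of_nonneg_left (hrd x (h4 x hx hxK)) hnκ
  set y : ℝ := (levelMark g u ζ n x : ℝ) with hy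
  rw [← abs_of_nonneg hnκ, ← abs_mul, abs_of_nonneg hnκ] at e2
  set D := dist x ζ ^ d
  set D' := dist (T^[p] x) ζ ^ d
  have e3 : n * κ * D ≤ B + 1 := by linarith [e1.1]
  have e4 : n * κ * (η₂ * D) ≤ η / 6 := by
    calc n * κ * (η₂ * D) = η₂ * (n * κ * D) := by ring
      _ ≤ η₂ * (B + 1) := by gcongr
      _ = η / 6 := hη₂B
  have e5 := abs_le.1 (e2.trans e4)
  have e6 : n * κ * (D' - a * D) = n * κ * D' - a * (n * κ * D) := by ring
  rw [e6] at e5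
  have e7 : a * (n * κ * D) ≤ a * (B + 1) := by gcongr
  obtain ⟨h5, h6⟩ := h3 (T^[p] x) (by linarith [e5.2])
  refine ⟨h5, ?_⟩
  have e8 := abs_le.1 (h2 _ h5 h6)
  have e9 : |a * (y - n * κ * D)| ≤ η / 6 := by
    rw [abs_mul, abs_of_pos ha0]
    exact (mul_le_mul_of_nonneg_left (abs_le.2 e1) ha0.le).trans hη₁a
  have e10 := abs_le.1 e9
  rw [mul_sub] at e10
  rw [NNReal.dist_eq, NNReal.coe_mul, Real.coe_toNNReal _ ha0.le, abs_le]
  constructor <;> linarith [e8.1, e8.2, e5.1, e5.2, e10.1, e10.2]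

end Return

/-- The frequencies of the visits to a neighbourhood of a non-periodic point. -/
lemma rareMarks_level (hd : 1 ≤ d) (hT : MeasurePreserving T μ μ) (hΦ : IsAlmostIsometric ζ Φ)
    (hg : IsProfile g δ) (hgm : Measurable fun x : X => g (dist x ζ))
    (hu : IsNormalising μ (fun x => g (dist x ζ)) u) (hκ : 0 < κ)
    (hball : Tendsto (fun s : ℝ => μ.real (Metric.ball ζ s) / s ^ d) (𝓝[>] 0) (𝓝 κ))
    (hρ : ∀ n, 0 ≤ ρ n)
    (hdec : ∀ K : ℕ, ∃ C : ℝ, ∀ B : Set X, MeasurableSet B → IsTameSet d K B → DecSet μ T ρ C B)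
    (hcont : ∀ j : ℕ, ContinuousAt T (T^[j] ζ)) (hζ : ζ ∉ Function.periodicPts T) :
    RareMarks μ T ρ halfLineMeasure (levelDom g u ζ) (levelMark g u ζ) ∅ fun _ y => y where
  meas n _ hB := measurableSet_levelDom_inter hgm hu n hB
  cells _ hK := level_cells hd hT hΦ hg hgm hu hκ hball hdec hK
  cover _ hK := level_cover hd hΦ hg hu hκ hball hρ hdec hK
  noReturn _ hK j hj _ := (level_marksShrink hg hu hκ hball).noReturn (continuousAt_iterate hcont j)
    (fun h => hζ (Function.mk_mem_periodicPts hj h)) hK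
  return_ _ _ _ _ hj := absurd hj (notMem_empty _)
  continuous _ hj := absurd hj (notMem_empty _)

/-- The frequencies of the visits to a neighbourhood of a periodic point. -/
lemma rareMarks_level_periodic (hd : 1 ≤ d) (hT : MeasurePreserving T μ μ)
    (hΦ : IsAlmostIsometric ζ Φ) (hg : IsProfile g δ) (hgm : Measurable fun x : X => g (dist x ζ))
    (hu : IsNormalising μ (fun x => g (dist x ζ)) u) (hκ : 0 < κ)
    (hball : Tendsto (fun s : ℝ => μ.real (Metric.ball ζ s) / s ^ d) (𝓝[>] 0) (𝓝 κ))
    (hρ : ∀ n, 0 ≤ ρ n)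
    (hdec : ∀ K : ℕ, ∃ C : ℝ, ∀ B : Set X, MeasurableSet B → IsTameSet d K B → DecSet μ T ρ C B)
    (hcont : ∀ j : ℕ, ContinuousAt T (T^[j] ζ)) {p : ℕ} (hp0 : 0 < p)
    (hp : Function.minimalPeriod T ζ = p)
    {L : EuclideanSpace ℝ (Fin d) →L[ℝ] EuclideanSpace ℝ (Fin d)}
    (hL : HasFDerivAt (Φ.symm ∘ T^[p] ∘ Φ) L 0) {α : ℝ} (hα0 : 0 < α)
    (hα : ∀ v, ‖L v‖ = α * ‖v‖) :
    RareMarks μ T ρ halfLineMeasure (levelDom g u ζ) (levelMark g u ζ) {j | p ∣ j}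
      fun j => (fun y => (α ^ d).toNNReal * y)^[j / p] where
  meas n _ hB := measurableSet_levelDom_inter hgm hu n hB
  cells _ hK := level_cells hd hT hΦ hg hgm hu hκ hball hdec hK
  cover _ hK := level_cover hd hΦ hg hu hκ hball hρ hdec hK
  noReturn _ hK j _ hj := (level_marksShrink hg hu hκ hball).noReturn (continuousAt_iterate hcont j)
    (fun h => hj (hp ▸ Function.IsPeriodicPt.minimalPeriod_dvd h)) hK
  return_ K hK j _ hj η hη := by
    obtain ⟨l, rfl⟩ := hj
    rw [Nat.mul_div_cancel_left _ hp0]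
    have hpζ : T^[p] ζ = ζ := hp ▸ Function.isPeriodicPt_minimalPeriod T ζ
    exact return_of_step (continuous_const_mul _)
      (level_step hd hΦ hg hu hκ hball (continuousAt_iterate hcont p) hpζ hL hα0 hα) l hK hη
  continuous j _ := (continuous_const_mul _).iterate _

end Level

end Charts

lemma IsTangentChart.isAlmostIsometric {d : ℕ} {H : Type*} [TopologicalSpace H]
    {I : ModelWithCorners ℝ (EuclideanSpace ℝ (Fin d)) H} {X : Type*} [MetricSpace X]
    [ChartedSpace H X] [IsManifold I 1 X] [RiemannianBundle (fun x : X => TangentSpace I x)]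
    [IsContinuousRiemannianBundle (EuclideanSpace ℝ (Fin d)) (fun x : X => TangentSpace I x)]
    [IsRiemannianManifold I X] {ζ : X} {e : EuclideanSpace ℝ (Fin d) ≃ₗᵢ[ℝ] TangentSpace I ζ}
    {Φ : OpenPartialHomeomorph (EuclideanSpace ℝ (Fin d)) X} (hΦ : IsTangentChart I ζ e Φ) :
    IsAlmostIsometric ζ Φ :=
  ⟨hΦ.zero_mem, hΦ.map_zero, fun _ h0 h1 => hΦ.exists_biLipschitz h0 h1⟩

/-! ### The rescaling radius of the coordinates -/

section Radius

variable {d : ℕ} {X : Type*} [MetricSpace X] [MeasurableSpace X] [BorelSpace X] {μ : Measure X}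
  [IsProbabilityMeasure μ] {ζ : X} {h : X → ℝ≥0} {g : ℝ → EReal} {δ : ℝ} {u : ℕ → ℝ → ℝ}

lemma volume_real_unitBall_pos :
    0 < volume.real (Metric.ball (0 : EuclideanSpace ℝ (Fin d)) 1) :=
  ENNReal.toReal_pos (Metric.measure_ball_pos _ _ one_pos).ne' measure_ball_lt_top.ne

/-- The rescaling radius tends to zero. -/
lemma tendsto_rescaling (hpos : 0 < h ζ) (hg : IsProfile g δ)
    (hu : IsNormalising μ (fun x => g (dist x ζ)) u)
    (hball : Tendsto (fun s : ℝ => μ.real (Metric.ball ζ s) / s ^ d) (𝓝[>] 0)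
      (𝓝 (ballConstant d h ζ))) :
    Tendsto (fun n => profileInv g δ (u n 1) *
      volume.real (Metric.ball (0 : EuclideanSpace ℝ (Fin d)) 1) ^ (1 / (d : ℝ))) atTop (𝓝[>] 0) := by
  have hr := tendsto_levelRadius hg hu (ballConstant_pos hpos) hball one_pos
  have hv := Real.rpow_pos_of_pos (volume_real_unitBall_pos (d := d)) (1 / (d : ℝ))
  rw [tendsto_nhdsWithin_iff] at hr ⊢
  refine ⟨by simpa using hr.1.mul_const _, ?_⟩
  filter_upwards [hr.2] with n hn using mul_pos hn hv

/-- The d-th power of |B₁|^{1/d} supplies the factor |B₁| in κ = h(ζ)|B₁|. This is why the rescaled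
marks have unit Lebesgue intensity. -/
lemma tendsto_mul_rescaling_pow (hd : 1 ≤ d) (hpos : 0 < h ζ) (hg : IsProfile g δ)
    (hu : IsNormalising μ (fun x => g (dist x ζ)) u)
    (hball : Tendsto (fun s : ℝ => μ.real (Metric.ball ζ s) / s ^ d) (𝓝[>] 0)
      (𝓝 (ballConstant d h ζ))) :
    Tendsto (fun n : ℕ => n * (h ζ : ℝ) * (profileInv g δ (u n 1) *
      volume.real (Metric.ball (0 : EuclideanSpace ℝ (Fin d)) 1) ^ (1 / (d : ℝ))) ^ d) atTop
      (𝓝 1) := by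
  refine (tendsto_level hg hu (ballConstant_pos hpos) hball one_pos).congr fun n => ?_
  rw [mul_pow, ← Real.rpow_mul_natCast volume_real_unitBall_pos.le,
    one_div_mul_cancel (by positivity), Real.rpow_one, ballConstant]
  ring

end Radius

end

theorem mainTheorem2
    {d : ℕ} (hd : 1 ≤ d) {H : Type*} [TopologicalSpace H]
    (I : ModelWithCorners ℝ (EuclideanSpace ℝ (Fin d)) H)
    -- a compact Riemannian manifold, possibly with boundary
    {X : Type*} [MetricSpace X] [CompactSpace X] [ChartedSpace H X] [IsManifold I 1 X]
    [RiemannianBundle (fun x : X => TangentSpace I x)]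
    [IsContinuousRiemannianBundle (EuclideanSpace ℝ (Fin d)) (fun x : X => TangentSpace I x)]
    [IsRiemannianManifold I X] [MeasurableSpace X] [BorelSpace X]
    -- the system and the absolutely continuous invariant probability
    (T : X → X) (μ : Measure X) [IsProbabilityMeasure μ] (hT : MeasurePreserving T μ μ)
    (h : X → ℝ≥0) (hh : Measurable h)
    (hμ : μ = (riemannianLeb d X).withDensity (fun x => (h x : ℝ≥0∞)))
    -- summable decay of correlations against `L¹`
    {C₁ : Type*} [NormedAddCommGroup C₁] [NormedSpace ℝ C₁] [CompleteSpace C₁]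
    (ι : C₁ →ₗ[ℝ] (X →ₘ[μ] ℝ)) (hdecay : SummableDecayAgainstL1 d μ T ι)
    -- the point `ζ`, and the regularity of the density there
    (ζ : X) (hζ : I.IsInteriorPoint ζ) (hcont : ∀ j : ℕ, ContinuousAt T (T^[j] ζ))
    (hpos : 0 < h ζ)
    (hdens : Tendsto (fun ε : ℝ => μ.real (Metric.ball ζ ε) /
      (riemannianLeb d X).real (Metric.ball ζ ε)) (𝓝[>] 0) (𝓝 (h ζ : ℝ)))
    -- the observable and the normalising levels
    (g : ℝ → EReal) (δ : ℝ) (hg : IsProfile g δ) (hgm : Measurable fun x : X => g (dist x ζ))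
    (u : ℕ → ℝ → ℝ) (hu : IsNormalising μ (fun x => g (dist x ζ)) u)
    -- the coordinates around `ζ`
    (e : EuclideanSpace ℝ (Fin d) ≃ₗᵢ[ℝ] TangentSpace I ζ)
    (Φ : OpenPartialHomeomorph (EuclideanSpace ℝ (Fin d)) X) (hΦ : IsTangentChart I ζ e Φ)
    -- the probability space carrying the limiting processes
    {Ω : Type*} [MeasurableSpace Ω] (P : Measure Ω) [IsProbabilityMeasure P] :
    -- `ζ` non-periodic
    (ζ ∉ Function.periodicPts T →
      (∀ Tbar U, IsPoissonArray P unitInterval2d 1 Tbar U →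
        ConvergesWeakly μ (empirical2d T (fun x => g (dist x ζ)) u) P (poisson2d Tbar U)) ∧
      (IsLebesguePoint d h ζ →
        ∀ Tbar U, IsPoissonArray P (unitShell d) 1 Tbar U →
          ConvergesWeakly μ (empiricalMulti T Φ fun n => profileInv g δ (u n 1)) P
            (poissonMulti Tbar U))) ∧
    -- `ζ` periodic of prime period `p`
    (∀ p : ℕ, 0 < p → Function.minimalPeriod T ζ = p → MDifferentiableAt I I T^[p] ζ →
      (IsRepelling (periodDeriv I T p ζ e) →
        IsLebesguePoint d h ζ →
        ∀ θ : ℝ, θ = 1 - |(periodDeriv I T p ζ e).det|⁻¹ →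
          ∀ Tbar U, IsPoissonArray P (unitShell d) θ Tbar U →
            ConvergesWeakly μ (empiricalMulti T Φ fun n => profileInv g δ (u n 1)) P
              (clusterMulti (periodDeriv I T p ζ e) Tbar U)) ∧
      (∀ α : ℝ, 1 < α → (∀ v, ‖periodDeriv I T p ζ e v‖ = α * ‖v‖) →
        ∀ θ : ℝ, θ = 1 - (α ^ d)⁻¹ →
          ∀ Tbar U, IsPoissonArray P unitInterval2d θ Tbar U →
            ConvergesWeakly μ (empirical2d T (fun x => g (dist x ζ)) u) P
              (cluster2d d α Tbar U))) := by
  have hd0 : 0 < d := hd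
  have hA : IsAlmostIsometric ζ Φ := hΦ.isAlmostIsometric
  have hball := tendsto_measure_ball (μ := μ) hA hdens
  have hκ : 0 < ballConstant d h ζ := ballConstant_pos hpos
  obtain ⟨ρ, hρs, hρ, hdec⟩ := hdecay.exists_decSet hT
  have hs := tendsto_rescaling hpos hg hu hball
  have hns := tendsto_mul_rescaling_pow hd hpos hg hu hball
  refine ⟨fun hnp => ⟨fun Tbar U hU => ?_, fun hleb Tbar U hU => ?_⟩,
    fun p hp0 hp hdiff => ⟨fun hrep hleb θ hθ Tbar U hU => ?_, fun α hα hL θ hθ Tbar U hU => ?_⟩⟩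
  -- By definition `empirical2d` is `empiricalMarks` for `levelDom` and `levelMark`; likewise
  -- `empiricalMulti` is the one for the rescaled coordinates.
  · exact (rareMarks_level hd hT hA hg hgm hu hκ hball hρ hdec hcont hnp).convergesWeakly_poisson2d
      hT hρs hρ hU
  · exact RareMarks.convergesWeakly_poissonMulti hd hT hρs hρ
      (rareMarks_multi hd hA hh hμ hpos hleb hs hns hρ hdec hcont hnp) hU
  · have hpζ : T^[p] ζ = ζ := hp ▸ Function.isPeriodicPt_minimalPeriod T ζ
    have hder := hΦ.hasFDerivAt_return hpζ hdiff
    have hθ0 : 0 < θ := by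
      rw [hθ, sub_pos]
      exact inv_lt_one_of_one_lt₀ (hrep.one_lt_abs_det hd)
    refine RareMarks.convergesWeakly_clusterMulti hd hp0 hT hρs hρ hθ0 ?_
      (rareMarks_multi_periodic hd hA hh hμ hpos hleb hs hns hρ hdec hcont hp0 hp hder) hU
    rw [hθ, sub_sub_cancel]
    exact hrep.expandingMap hd
  · have hpζ : T^[p] ζ = ζ := hp ▸ Function.isPeriodicPt_minimalPeriod T ζ
    have hder := hΦ.hasFDerivAt_return hpζ hdiff
    have hα0 : 0 < α := one_pos.trans hα
    have hαd : 1 < α ^ d := one_lt_pow₀ hα hd0.ne'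
    have hθ0 : 0 < θ := by
      rw [hθ, sub_pos]
      exact inv_lt_one_of_one_lt₀ hαd
    refine RareMarks.convergesWeakly_cluster2d hα0 hp0 hT hρs hρ hθ0 ?_
      (rareMarks_level_periodic hd hT hA hg hgm hu hκ hball hρ hdec hcont hp0 hp hder hα0 hL) hU
    rw [hθ, sub_sub_cancel]
    exact expandingMap_halfLine hαd
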